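/- **Conventions.** A $W^*$-probability space $(\mathcal A,\varphi)$ is a von Neumann algebra $\mathcal A$ of bounded operators on a (complex) Hilbert space with a linear functional $\varphi$ that is unital, positive, faithful, tracial and weakly continuous on bounded sets (normal). For a pairing $\pi$ of $\{1,\dots,r\}$ (a partition into two-element sets), $\mathrm{Cr}(\pi)$ is the number of crossings, i.e. of couples of pairs $\{x_1,y_1\},\{x_2,y_2\}\in\pi$ with $x_1<x_2<y_1<y_2$; for $\pi',\pi''\subset\pi$, $\mathrm{Cr}(\pi',\pi'')$ is the number of crossings between a pair of $\pi'$ and a pair of $\pi''$. A $q$-Brownian motion on $(\mathcal A,\varphi)$ is a family $X=(X_t)_{t\ge0}$ of self-adjoint elements of $\mathcal A$ with $\varphi(X_{t_1}\cdots X_{t_r})=\sum_{\pi}q^{\mathrm{Cr}(\pi)}\prod_{\{a,b\}\in\pi}(t_a\wedge t_b)$ for all $r\ge 1$ and all $t_1,\dots,t_r\ge0$, the sum being over all pairings of $\{1,\dots,r\}$ (and $0^0=1$). Kernels are real-valued. The multiple integral $I_n(f)$ of $f\in L^2(\mathbb R_+^n)$ is defined by $I_n(f)=(X_{b_1}-X_{a_1})\cdots(X_{b_n}-X_{a_n})$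 when $f=\mathbf 1_{(a_1,b_1)}\otimes\cdots\otimes\mathbf 1_{(a_n,b_n)}$ with pairwise disjoint intervals $(a_i,b_i)\subset\mathbb R_+$, extended by linearity to the linear combinations of such $f$, and then by continuity from $L^2(\mathbb R_+^n)$ to $L^2(\mathcal A,\varphi)$. For $f,g\in L^2(\mathbb R_+^n)$, $$\langle f,g\rangle_q=\sum_{\sigma\in\mathfrak S_n}q^{\mathrm{inv}(\sigma)}\int_{\mathbb R_+^n}f(t_{\sigma(1)},\dots,t_{\sigma(n)})\,g(t_1,\dots,t_n)\,dt,$$ where $\mathrm{inv}(\sigma)$ is the number of inversions of $\sigma$, and for $1\le p\le n$ $$(f\otimes_p f)(t_1,\dots,t_{2n-2p})=\int_{\mathbb R_+^p}f(t_1,\dots,t_{n-p},s_p,\dots,s_1)\,f(s_1,\dots,s_p,t_{n-p+1},\dots,t_{2n-2p})\,ds.$$ For $0\le Q<1$ and $v\ge 0$, $\mathcal G_Q(0,v)$ is the compactly supported probability measure on $\mathbb R$ whose odd moments vanish and whose moment of order $2k$ is $v^k\sum_{\pi}Q^{\mathrm{Cr}(\pi)}$, the sum being over all pairings of $\{1,\dots,2k\}$.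 Convergence in law of a sequence $Y_k\in\mathcal A$ to such a measure $\nu$ means $\varphi(Y_k^r)\to\int x^r\,d\nu$ for every $r\ge1$. **Theorem.** Let $q\in[0,1)$, let $X$ be a $q$-Brownian motion on a $W^*$-probability space $(\mathcal A,\varphi)$, let $d\ge1$ and $n_1,\dots,n_d\ge1$, and for each $i\in\{1,\dots,d\}$ let $(f_k^i)_{k\ge1}$ be a sequence of (almost everywhere) symmetric functions in $L^2(\mathbb R_+^{n_i})$. Assume that there are real numbers $c(i,j)$ with $$\lim_{k\to\infty}\langle f_k^i,f_k^j\rangle_q=c(i,j)\qquad\text{for all } i,j \text{ with } n_i=n_j .$$ Then all the multiple integrals $I_{n_i}(f_k^i)$ exist as elements of $\mathcal A$, and the following four assertions are equivalent: (i) for every $i$, $\varphi\big(I_{n_i}(f_k^i)^4\big)\to(2+q^{n_i^2})\,c(i,i)^2$ as $k\to\infty$; (ii) for every $i$ and every $p\in\{1,\dots,n_i-1\}$, $\|f_k^i\otimes_p f_k^i\|_{L^2(\mathbb R_+^{2n_i-2p})}\to0$ as $k\to\infty$; (iii) for every $i$, $I_{n_i}(f_k^i)$ converges in law to $\mathcal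 G_{q^{n_i^2}}(0,c(i,i))$ as $k\to\infty$; (iv) for every $r\ge1$ and all $i_1,\dots,i_r\in\{1,\dots,d\}$, as $k\to\infty$, $$\varphi\big(I_{n_{i_1}}(f_k^{i_1})\cdots I_{n_{i_r}}(f_k^{i_r})\big)\to\sum_{\pi}\ \prod_{1\le a\le b\le K}q^{\mathrm{Cr}(\pi_a,\pi_b)N_aN_b}\prod_{\{l,m\}\in\pi}c(i_l,i_m),$$ where the sum is over the pairings $\pi$ of $\{1,\dots,r\}$ such that $n_{i_l}=n_{i_m}$ for every $\{l,m\}\in\pi$, where $N_1<\dots<N_K$ are the distinct values among $n_{i_1},\dots,n_{i_r}$, and where $\pi_a$ is the set of the pairs $\{l,m\}\in\pi$ with $n_{i_l}=n_{i_m}=N_a$. -/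

import Mathlib

open MeasureTheory Filter Topology
open scoped ENNReal NNReal

noncomputable section

namespace QChaos

/-! ### Pairings and crossings -/

/-- A pairing of `{1, …, r}`, i.e. a partition into two-element sets, encoded as the
fixed-point-free involution that exchanges the two elements of each pair. -/
abbrev Pairing (r : ℕ) : Type :=
  {σ : Equiv.Perm (Fin r) // ∀ x, σ (σ x) = x ∧ σ x ≠ x}

/-- The pairs `{x, y}` of a pairing, each listed once, as `(x, y)` with `x < y`. -/
def Pairing.pairs {r : ℕ} (π : Pairing r) : Finset (Fin r × Fin r) :=
  Finset.univ.filter fun e => e.1 < e.2 ∧ π.1 e.1 = e.2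

/-- `x₁ < x₂ < y₁ < y₂` for the pairs `e = (x₁, y₁)` and `e' = (x₂, y₂)`. -/
def Crosses {r : ℕ} (e e' : Fin r × Fin r) : Prop :=
  e.1 < e'.1 ∧ e'.1 < e.2 ∧ e.2 < e'.2

instance {r : ℕ} (e e' : Fin r × Fin r) : Decidable (Crosses e e') := by
  unfold Crosses; infer_instance

/-- `Cr(π)`, the number of crossings of `π`. -/
def Pairing.cr {r : ℕ} (π : Pairing r) : ℕ :=
  ((π.pairs ×ˢ π.pairs).filter fun e => Crosses e.1 e.2).card

/-- `Cr(S, T)`, the number of crossings in `π` between a pair of `S` and a pair of `T`. -/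
def Pairing.crBetween {r : ℕ} (π : Pairing r) (S T : Finset (Fin r × Fin r)) : ℕ :=
  ((π.pairs ×ˢ π.pairs).filter fun e =>
    Crosses e.1 e.2 ∧ ((e.1 ∈ S ∧ e.2 ∈ T) ∨ (e.1 ∈ T ∧ e.2 ∈ S))).card

/-- The pairing respects the colouring `m` of its points: paired points have the same colour. -/
def Pairing.RespectsColours {r : ℕ} (π : Pairing r) (m : Fin r → ℕ) : Prop :=
  ∀ e ∈ π.pairs, m e.1 = m e.2

instance {r : ℕ} (π : Pairing r) (m : Fin r → ℕ) : Decidable (π.RespectsColours m) := by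
  unfold Pairing.RespectsColours; infer_instance

/-- The pairs of `π` both of whose points have colour `N`. -/
def Pairing.pairsOfColour {r : ℕ} (π : Pairing r) (m : Fin r → ℕ) (N : ℕ) :
    Finset (Fin r × Fin r) :=
  π.pairs.filter fun e => m e.1 = N ∧ m e.2 = N

/-- The product over unordered pairs of colours `{N, M}` (with `N = M` allowed) of
`q ^ (Cr(π_N, π_M) N M)`, where `π_N` is the set of pairs of colour `N`. -/
def Pairing.colourWeight {r : ℕ} (π : Pairing r) (m : Fin r → ℕ) (q : ℝ) : ℝ :=
  ∏ N ∈ Finset.univ.image m, ∏ M ∈ (Finset.univ.image m).filter (fun M => N ≤ M),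
    q ^ (π.crBetween (π.pairsOfColour m N) (π.pairsOfColour m M) * N * M)

/-- The limit of the joint moments: the sum over the colour-respecting pairings of `{1, …, r}`. -/
def colouredMoment {r : ℕ} (q : ℝ) (m : Fin r → ℕ) (c : Fin r → Fin r → ℝ) : ℝ :=
  ∑ π ∈ (Finset.univ : Finset (Pairing r)).filter (fun π => π.RespectsColours m),
    π.colourWeight m q * ∏ e ∈ π.pairs, c e.1 e.2

/-! ### `W*`-probability spaces -/

/-- A `W*`-probability space: a von Neumann algebra on `H` with a trace. The weak continuity of
the trace is required on norm-bounded sets only, i.e. the trace is normal. -/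
structure WStarProbabilitySpace (H : Type*) [NormedAddCommGroup H] [InnerProductSpace ℂ H]
    [CompleteSpace H] where
  /-- the von Neumann algebra -/
  algebra : VonNeumannAlgebra H
  /-- the trace -/
  trace : algebra.toStarSubalgebra →ₗ[ℂ] ℂ
  trace_one : trace 1 = 1
  trace_nonneg : ∀ Y, 0 ≤ (trace (Y * star Y)).re ∧ (trace (Y * star Y)).im = 0
  trace_faithful : ∀ Y, trace (Y * star Y) = 0 → Y = 0
  trace_comm : ∀ Y Z, trace (Y * Z) = trace (Z * Y)
  trace_continuous : ∀ (R : ℝ) (l : Filter algebra.toStarSubalgebra)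
    (Y : algebra.toStarSubalgebra), (∀ᶠ Z : algebra.toStarSubalgebra in l, ‖(Z : H →L[ℂ] H)‖ ≤ R) →
    Tendsto (fun Z : algebra.toStarSubalgebra =>
        (ContinuousLinearMapWOT.ofCLM (Z : H →L[ℂ] H) : H →WOT[ℂ] H)) l
      (𝓝 (ContinuousLinearMapWOT.ofCLM (Y : H →L[ℂ] H))) →
    Tendsto trace l (𝓝 (trace Y))

variable {H : Type*} [NormedAddCommGroup H] [InnerProductSpace ℂ H] [CompleteSpace H]

/-- The elements of the von Neumann algebra. -/
abbrev WStarProbabilitySpace.Elem (W : WStarProbabilitySpace H) : Type _ :=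
  W.algebra.toStarSubalgebra

/-- A `q`-Brownian motion: self-adjoint elements `X t`, `t ≥ 0`, whose joint moments are given by
the `q`-Wick formula. -/
structure IsQBrownianMotion (W : WStarProbabilitySpace H) (q : ℝ) (X : ℝ≥0 → W.Elem) : Prop where
  selfAdjoint : ∀ t, IsSelfAdjoint (X t)
  moments : ∀ (r : ℕ) (t : Fin r → ℝ≥0), 1 ≤ r →
    W.trace (List.ofFn fun i => X (t i)).prod =
      ((∑ π : Pairing r, q ^ π.cr * ∏ e ∈ π.pairs, ((min (t e.1) (t e.2) : ℝ≥0) : ℝ) : ℝ) : ℂ)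

/-- `ν` is the centred `q`-Gaussian law `𝒢_q(0, v)` of variance `v`. -/
structure IsQGaussian (q v : ℝ) (ν : Measure ℝ) : Prop where
  isProbabilityMeasure : IsProbabilityMeasure ν
  compactSupport : ∃ R : ℝ, ν (Set.Icc (-R) R)ᶜ = 0
  odd_moments : ∀ k : ℕ, ∫ x, x ^ (2 * k + 1) ∂ν = 0
  even_moments : ∀ k : ℕ, ∫ x, x ^ (2 * k) ∂ν = v ^ k * ∑ π : Pairing (2 * k), q ^ π.cr

/-- Convergence in law of a sequence in `(𝒜, φ)` to the compactly supported law `ν`, which means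
convergence of all moments. -/
def ConvergesInLaw (W : WStarProbabilitySpace H) (Y : ℕ → W.Elem) (ν : Measure ℝ) : Prop :=
  ∀ r : ℕ, 1 ≤ r →
    Tendsto (fun k => W.trace (Y k ^ r)) atTop (𝓝 ((∫ x, x ^ r ∂ν : ℝ) : ℂ))

/-! ### Kernels in `L²(ℝ₊ⁿ)` -/

/-- Lebesgue measure on `ℝ₊ⁿ`, seen as a measure on `ℝⁿ` carried by `ℝ₊ⁿ`. -/
def orthant (n : ℕ) : Measure (Fin n → ℝ) :=
  Measure.pi fun _ => (volume : Measure ℝ).restrict (Set.Ici 0)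

/-- Symmetric kernels: invariant (almost everywhere) under permutations of the variables. -/
def IsSymmetricKernel {n : ℕ} (f : (Fin n → ℝ) → ℝ) : Prop :=
  ∀ σ : Equiv.Perm (Fin n), (fun t => f (t ∘ σ)) =ᵐ[orthant n] f

/-- The number of inversions of a permutation. -/
def inv {n : ℕ} (σ : Equiv.Perm (Fin n)) : ℕ :=
  ((Finset.univ : Finset (Fin n × Fin n)).filter fun p => p.1 < p.2 ∧ σ p.2 < σ p.1).card

/-- The form `⟨f, g⟩_q = ∑_σ q^{inv σ} ∫ f(t_{σ(1)}, …, t_{σ(n)}) g(t_1, …, t_n) dt`. -/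
def qInner {n : ℕ} (q : ℝ) (f g : (Fin n → ℝ) → ℝ) : ℝ :=
  ∑ σ : Equiv.Perm (Fin n), q ^ inv σ * ∫ t, f (t ∘ σ) * g t ∂(orthant n)

/-- The contraction of order `p` of `f` and `g`,
`∫ f(t_1, …, t_{n-p}, s_p, …, s_1) g(s_1, …, s_p, t_{n-p+1}, …, t_{n+m-2p}) ds`. -/
def contraction {n m : ℕ} (p : ℕ) (hn : p ≤ n) (hm : p ≤ m)
    (f : (Fin n → ℝ) → ℝ) (g : (Fin m → ℝ) → ℝ) (t : Fin ((n - p) + (m - p)) → ℝ) : ℝ :=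
  ∫ s, f (Fin.append (fun i => t (Fin.castAdd (m - p) i)) (fun i => s (Fin.rev i)) ∘
          Fin.cast (Nat.sub_add_cancel hn).symm) *
       g (Fin.append s (fun i => t (Fin.natAdd (n - p) i)) ∘
          Fin.cast (Nat.add_sub_of_le hm).symm) ∂(orthant p)

/-! ### Multiple integrals -/

/-- A product of `n` pairwise disjoint open intervals `(a_i, b_i)` of `ℝ₊`. -/
structure Box (n : ℕ) where
  lower : Fin n → ℝ≥0
  upper : Fin n → ℝ≥0
  le : ∀ i, lower i ≤ upper i
  disjoint : ∀ i j, i ≠ j →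
    Disjoint (Set.Ioo (lower i) (upper i)) (Set.Ioo (lower j) (upper j))

/-- The indicator function `1_{(a_1, b_1)}(t_1) ⋯ 1_{(a_n, b_n)}(t_n)`. -/
def Box.kernel {n : ℕ} (B : Box n) (t : Fin n → ℝ) : ℝ :=
  ∏ i, (Set.Ioo (B.lower i : ℝ) (B.upper i : ℝ)).indicator (fun _ => (1 : ℝ)) (t i)

/-- The product `(X_{b_1} - X_{a_1}) ⋯ (X_{b_n} - X_{a_n})`, in this order. -/
def Box.integral {W : WStarProbabilitySpace H} (X : ℝ≥0 → W.Elem) {n : ℕ} (B : Box n) : W.Elem :=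
  (List.ofFn fun i => X (B.upper i) - X (B.lower i)).prod

/-- The simple function vanishing on diagonals given by a formal linear combination of boxes. -/
def simpleKernel {n : ℕ} (F : Box n →₀ ℝ) (t : Fin n → ℝ) : ℝ :=
  F.sum fun B a => a * B.kernel t

/-- Its multiple integral, defined by linearity. -/
def simpleIntegral {W : WStarProbabilitySpace H} (X : ℝ≥0 → W.Elem) {n : ℕ} (F : Box n →₀ ℝ) :
    W.Elem :=
  F.sum fun B a => (a : ℂ) • B.integral X

/-- `Y` is the multiple integral of `f` with respect to `X`: it is the limit in `L²(𝒜, φ)` of the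
multiple integrals of simple functions (vanishing on diagonals) that converge to `f` in `L²`. -/
def IsMultipleIntegral {W : WStarProbabilitySpace H} (X : ℝ≥0 → W.Elem) {n : ℕ}
    (f : (Fin n → ℝ) → ℝ) (Y : W.Elem) : Prop :=
  ∃ F : ℕ → (Box n →₀ ℝ),
    Tendsto (fun m => eLpNorm (fun t => f t - simpleKernel (F m) t) 2 (orthant n)) atTop (𝓝 0) ∧
    Tendsto (fun m => W.trace (star (Y - simpleIntegral X (F m)) * (Y - simpleIntegral X (F m))))
      atTop (𝓝 0)

open Classical in
/-- The multiple integral `I_n^X(f)`, for `f` in `L²(ℝ₊ⁿ)`. -/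
def multipleIntegral {W : WStarProbabilitySpace H} (X : ℝ≥0 → W.Elem) {n : ℕ}
    (f : (Fin n → ℝ) → ℝ) : W.Elem :=
  if h : ∃ Y, IsMultipleIntegral X f Y then h.choose else 0

end QChaos

end

noncomputable section

set_option linter.unusedSectionVars false

/-! The problem is reduced to finite tensors. A symmetric kernel is approximated in `L²` by step
functions on a grid of mesh `1 / M`, with coefficients forming a symmetric tensor that vanishes on
the diagonals. The normalized increments of `X` over the cells satisfy the `q`-Wick formula with
Kronecker covariance (`IsQBrownianMotion.isWick_grid`). A joint moment of tensor integrals is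
therefore a sum, over the pairings of all the points of all the blocks of variables, of `q ^
crossings` times a `network`, the contraction of the tensors along the pairing (`IsWick.tensors`). A
pair inside one block contributes nothing, because of the diagonals.

Networks are controlled by Finner's inequality: each summation variable is shared by two tensors, so
Cauchy–Schwarz, one variable at a time, bounds a network by the product of the `L²` norms. The
remaining sum of `q ^ crossings` is itself a moment of `X 1`, whence an operator norm bound `‖X 1‖ ^
n * ‖f‖₂` for the integrals of tensors (`norm_tensorIntegral_le`). So the approximations converge in
the norm of the algebra: the multiple integral exists there, and all moments, scalar products and
contractions may be computed on tensors (`exists_multipleIntegral`, `tendsto_trace_sub`,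
`tendsto_tensorInner`, `tendsto_contraction_iff`).

From contractions to joint moments: the pairings that match whole blocks with whole blocks give a
product of `q`-scalar products with weight `q ^ blockCrossings`, and their sum converges to the
coloured moment. In every other pairing with a nonzero network, some block is connected to at least
two others; summing first over the variables it shares with one of them brings out the norm of a
contraction of intermediate order (`abs_sum_prod_le_contr`), which tends to zero. Joint moments
contain the moments of each sequence, and a limit law exists by the Riesz–Markov theorem; the law
gives back the fourth moment.

From the fourth moment to contractions, for `0 < q`: the square of the integral of `f` is projected
onto the constants and onto the chaos of order `2n`. The norm of the second projection is, up to a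
diagonal error, a sum over the permutations of `2n` points of `q ^ inv` times squared norms of
contractions of `f` with itself. All terms are nonnegative. The permutations that preserve or
exchange the two halves produce `(1 + q ^ n²)` times the squared variance, and each intermediate
contraction occurs at least once more with positive weight (`tensorInner_tensorSq_ge`,
`trace_fourth_ge`). At `q = 0` this weight may vanish. There only noncrossing pairings of four
blocks remain, the network of each is zero or the squared norm of a contraction, and each
intermediate order is reached (`jointMoment_zero_ge`). -/

namespace QChaos

/-! ### Pairings of finite linear orders -/

/-- Pairings of a type, as fixed-point-free involutions. -/
abbrev PairingOn (T : Type*) : Type _ :=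
  {σ : Equiv.Perm T // ∀ x, σ (σ x) = x ∧ σ x ≠ x}

section PairingOn

variable {S T : Type*} [LinearOrder T] [Fintype T] [LinearOrder S] [Fintype S]

/-- The left endpoints of the pairs. -/
def opens (π : PairingOn T) : Finset T := Finset.univ.filter fun p => p < π.1 p

/-- The number of crossings. -/
def crossings (π : PairingOn T) : ℕ :=
  ((Finset.univ : Finset (T × T)).filter fun p =>
    p.1 < p.2 ∧ p.2 < π.1 p.1 ∧ π.1 p.1 < π.1 p.2).card

@[simp] lemma mem_opens {π : PairingOn T} {p : T} : p ∈ opens π ↔ p < π.1 p := by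
  simp [opens]

lemma not_lt_iff_lt_partner (π : PairingOn T) (p : T) : ¬ p < π.1 p ↔ π.1 p < p := by
  rw [not_lt, le_iff_lt_or_eq, or_iff_left (π.2 p).2]

lemma Pairing.mem_pairs {r : ℕ} (π : Pairing r) (e : Fin r × Fin r) :
    e ∈ π.pairs ↔ e.1 < e.2 ∧ π.1 e.1 = e.2 := by
  simp [Pairing.pairs]

lemma Pairing.prod_pairs {r : ℕ} (π : Pairing r) (w : Fin r → Fin r → ℝ) :
    ∏ e ∈ π.pairs, w e.1 e.2 = ∏ p ∈ opens (T := Fin r) π, w p (π.1 p) := by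
  symm
  refine Finset.prod_bij (fun p _ => (p, π.1 p)) ?_ ?_ ?_ ?_
  · intro a ha
    exact (π.mem_pairs _).2 ⟨mem_opens.1 ha, rfl⟩
  · intro a _ b _ h
    exact (Prod.ext_iff.1 h).1
  · intro e he
    obtain ⟨h1, h2⟩ := (π.mem_pairs e).1 he
    exact ⟨e.1, mem_opens.2 (h2 ▸ h1), Prod.ext rfl h2⟩
  · intro a _; rfl

/-- A pair is determined by its left endpoint, so crossings may be counted on points. This form
makes sense on every finite linear order, in particular on points arranged in blocks. -/
lemma Pairing.cr_eq_crossings {r : ℕ} (π : Pairing r) :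
    π.cr = crossings (T := Fin r) π := by
  unfold Pairing.cr crossings
  symm
  refine Finset.card_bij (fun p _ => ((p.1, π.1 p.1), (p.2, π.1 p.2))) ?_ ?_ ?_
  · intro p h
    obtain ⟨h1, h2, h3⟩ := (Finset.mem_filter.1 h).2
    exact Finset.mem_filter.2 ⟨Finset.mem_product.2 ⟨(π.mem_pairs _).2 ⟨h1.trans h2, rfl⟩,
      (π.mem_pairs _).2 ⟨h2.trans h3, rfl⟩⟩, h1, h2, h3⟩
  · intro p _ p' _ h
    exact Prod.ext (congrArg (fun x => x.1.1) h) (congrArg (fun x => x.2.1) h)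
  · intro e he
    obtain ⟨h1, h2⟩ := Finset.mem_filter.1 he
    obtain ⟨h3, h4⟩ := Finset.mem_product.1 h1
    have h5 := ((π.mem_pairs _).1 h3).2
    have h6 := ((π.mem_pairs _).1 h4).2
    unfold Crosses at h2
    rw [← h5, ← h6] at h2
    exact ⟨(e.1.1, e.2.1), Finset.mem_filter.2 ⟨Finset.mem_univ _, h2⟩,
      Prod.ext (Prod.ext rfl h5) (Prod.ext rfl h6)⟩

/-- Transport of pairings along a bijection. -/
def pairingCongr (e : S ≃ T) : PairingOn S ≃ PairingOn T :=
  (Equiv.permCongr e).subtypeEquiv fun σ => by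
    constructor
    · intro h x
      have := h (e.symm x)
      simp only [Equiv.permCongr_apply, Equiv.symm_apply_apply, this.1, Equiv.apply_symm_apply, ne_eq,
        true_and]
      intro h'
      exact this.2 (by conv_rhs => rw [← h']
                       simp)
    · intro h x
      have := h (e x)
      simp only [Equiv.permCongr_apply, Equiv.symm_apply_apply, EmbeddingLike.apply_eq_iff_eq, ne_eq]
        at this
      exact this

@[simp] lemma pairingCongr_apply (e : S ≃ T) (π : PairingOn S) (x : S) :
    (pairingCongr e π).1 (e x) = e (π.1 x) := by
  simp [pairingCongr, Equiv.permCongr_apply]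

lemma prod_opens_congr (e : S ≃o T) (π : PairingOn S) (w : T → T → ℝ) :
    ∏ p ∈ opens (pairingCongr e.toEquiv π), w p ((pairingCongr e.toEquiv π).1 p) =
      ∏ p ∈ opens π, w (e p) (e (π.1 p)) := by
  symm
  refine Finset.prod_equiv e.toEquiv (fun p => ?_) (fun p _ => ?_)
  · simp only [mem_opens, pairingCongr_apply]
    exact e.lt_iff_lt.symm
  · simp only [pairingCongr_apply]
    rfl

lemma crossings_congr (e : S ≃o T) (π : PairingOn S) :
    crossings (pairingCongr e.toEquiv π) = crossings π := by
  symm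
  refine Finset.card_equiv (e.toEquiv.prodCongr e.toEquiv) (fun p => ?_)
  simp only [Finset.mem_filter, Finset.mem_univ, true_and, Equiv.prodCongr_apply, Prod.map_fst,
    Prod.map_snd, pairingCongr_apply]
  have h := fun a b => (e.lt_iff_lt (x := a) (y := b))
  exact (and_congr (h _ _) (and_congr (h _ _) (h _ _))).symm

/-- Sums over `Fin N` and over an isomorphic linear order agree. -/
lemma sum_pairing_congr {N : ℕ} (e : Fin N ≃o T) (q : ℝ) (w : T → T → ℝ) :
    ∑ π : Pairing N, q ^ π.cr * ∏ x ∈ π.pairs, w (e x.1) (e x.2) =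
      ∑ π : PairingOn T, q ^ crossings π * ∏ p ∈ opens π, w p (π.1 p) := by
  refine Fintype.sum_equiv (pairingCongr e.toEquiv) _ _ fun π => ?_
  rw [crossings_congr, prod_opens_congr, Pairing.cr_eq_crossings,
    Pairing.prod_pairs π (fun a b => w (e a) (e b))]

/-- The left endpoint of the pair of `p`. -/
def edge (π : PairingOn T) (p : T) : {p : T // p < π.1 p} :=
  if h : p < π.1 p then ⟨p, h⟩ else
    ⟨π.1 p, by rw [(π.2 p).1]; exact (not_lt_iff_lt_partner π p).1 h⟩

lemma edge_of_lt {π : PairingOn T} {p : T} (h : p < π.1 p) : edge π p = ⟨p, h⟩ := by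
  simp [edge, h]

lemma edge_partner (π : PairingOn T) (p : T) : edge π (π.1 p) = edge π p := by
  unfold edge
  by_cases h : p < π.1 p
  · have h' : ¬ π.1 p < π.1 (π.1 p) := by rw [(π.2 p).1]; exact h.not_gt
    simp only [h, h', dite_true, dite_false]
    exact Subtype.ext (π.2 p).1
  · have h' : π.1 p < π.1 (π.1 p) := by
      rw [(π.2 p).1]; exact (not_lt_iff_lt_partner π p).1 h
    simp only [h, h', dite_true, dite_false]

lemma edge_eq_iff (π : PairingOn T) (p : T) (e : {p : T // p < π.1 p}) :
    edge π p = e ↔ p = e.1 ∨ p = π.1 e.1 := by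
  obtain ⟨e, he⟩ := e
  constructor
  · intro h
    unfold edge at h
    split_ifs at h with h1
    · exact Or.inl (congrArg Subtype.val h)
    · right
      have := congrArg Subtype.val h
      simp only at this
      simp only [← this, (π.2 p).1]
  · rintro (rfl | rfl)
    · exact edge_of_lt he
    · rw [edge_partner, edge_of_lt he]

lemma edge_eq_edge_iff (π : PairingOn T) (p p' : T) :
    edge π p = edge π p' ↔ p = p' ∨ p = π.1 p' := by
  constructor
  · intro h
    rcases (edge_eq_iff π p _).1 h with h1 | h1 <;> rcases (edge_eq_iff π p' _).1 rfl with h2 | h2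
    · exact Or.inl (h1.trans h2.symm)
    · right; rw [h1]; conv_rhs => rw [h2]
      rw [(π.2 _).1]
    · right; rw [h1, ← h2]
    · left; rw [h1, ← h2]
  · rintro (rfl | rfl)
    · rfl
    · exact edge_partner _ _

/-- A sum over functions on the points, of a product over the pairs, factorizes. -/
lemma sum_prod_opens (π : PairingOn T) {X : T → Type*} [∀ t, Fintype (X t)] {R : Type*}
    [CommSemiring R]
    (h : ∀ p : T, X p → X (π.1 p) → R) :
    ∑ s : ∀ t, X t, ∏ p ∈ opens π, h p (s p) (s (π.1 p)) =
      ∏ p ∈ opens π, ∑ x, ∑ y, h p x y := by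
  classical
  have key : Function.Bijective (fun (s : ∀ t, X t) (p : {p : T // p < π.1 p}) =>
      ((s p.1, s (π.1 p.1)) : X p.1 × X (π.1 p.1))) := by
    constructor
    · intro s s' hs
      funext t
      by_cases ht : t < π.1 t
      · exact congrArg Prod.fst (congrFun hs ⟨t, ht⟩)
      · have ht' : π.1 t < π.1 (π.1 t) := by
          rw [(π.2 t).1]; exact (not_lt_iff_lt_partner π t).1 ht
        have := congrArg Prod.snd (congrFun hs ⟨π.1 t, ht'⟩)
        simp only at this
        rw [(π.2 t).1] at this
        exact this
    · intro y
      -- The types `X t` depend on `t`. The preimage is therefore characterized by its values at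
      -- left and right endpoints, with a transport in the second case, and only then chosen.
      have ex : ∀ t, ∃ x : X t, (∀ ht : t < π.1 t, x = (y ⟨t, ht⟩).1) ∧
          (∀ p : {p : T // p < π.1 p}, ∀ h : t = π.1 p.1, x = h ▸ (y p).2) := by
        intro t
        by_cases ht : t < π.1 t
        · refine ⟨(y ⟨t, ht⟩).1, fun _ => rfl, ?_⟩
          rintro ⟨p, hp⟩ h
          exfalso
          simp only at h
          subst h
          rw [(π.2 p).1] at ht
          exact absurd ht hp.not_gt
        · have ht' : π.1 t < π.1 (π.1 t) := by
            rw [(π.2 t).1]; exact (not_lt_iff_lt_partner π t).1 ht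
          obtain ⟨p, hp, hpt⟩ : ∃ p, ∃ hp : p < π.1 p, t = π.1 p :=
            ⟨π.1 t, ht', (π.2 t).1.symm⟩
          subst hpt
          refine ⟨(y ⟨p, hp⟩).2, fun h => absurd h ht, ?_⟩
          rintro ⟨p', hp'⟩ h
          have : p = p' := π.1.injective h
          subst this
          rfl
      choose s hs1 hs2 using ex
      refine ⟨s, ?_⟩
      funext p
      refine Prod.ext ?_ ?_
      · exact hs1 p.1 p.2
      · exact hs2 (π.1 p.1) p rfl
  have h1 : ∀ g : T → R, ∏ p ∈ opens π, g p = ∏ p : {p : T // p < π.1 p}, g p.1 := by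
    intro g
    exact Finset.prod_subtype (opens π) (fun x => by simp) g
  rw [h1]
  simp_rw [h1]
  rw [Fintype.sum_bijective _ key _
    (fun y : ∀ p : {p : T // p < π.1 p}, X p.1 × X (π.1 p.1) => ∏ p, h p.1 (y p).1 (y p).2)
    (fun s => rfl)]
  have h2 := Finset.prod_univ_sum
    (fun p : {p : T // p < π.1 p} => (Finset.univ : Finset (X p.1 × X (π.1 p.1))))
    (fun p y => h p.1 y.1 y.2)
  rw [Fintype.piFinset_univ] at h2
  rw [← h2]
  refine Finset.prod_congr rfl fun p _ => ?_
  rw [Fintype.sum_prod_type]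

/-- Every point is the left or the right endpoint of exactly one pair, and the partner map exchanges
the two kinds. -/
lemma prod_univ_eq_prod_opens (π : PairingOn T) {R : Type*} [CommMonoid R] (g : T → R) :
    ∏ t, g t = ∏ p ∈ opens π, g p * g (π.1 p) := by
  classical
  rw [Finset.prod_mul_distrib,
    ← Finset.prod_filter_mul_prod_filter_not Finset.univ (fun p => p < π.1 p)]
  congr 1
  refine Finset.prod_nbij' π.1 π.1 ?_ ?_ ?_ ?_ ?_
  · intro a ha
    simp only [Finset.mem_filter, Finset.mem_univ, true_and, mem_opens] at ha ⊢
    rw [(π.2 a).1]; exact (not_lt_iff_lt_partner π a).1 ha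
  · intro a ha
    simp only [Finset.mem_filter, Finset.mem_univ, true_and, mem_opens] at ha ⊢
    rw [(π.2 a).1]; exact ha.not_gt
  · intro a _; exact (π.2 a).1
  · intro a _; exact (π.2 a).1
  · intro a _; rw [(π.2 a).1]

end PairingOn

/-! ### Points arranged in blocks -/

/-- The points of `r` consecutive blocks of sizes `n l`. -/
def Pts {r : ℕ} (n : Fin r → ℕ) : Type := (l : Fin r) × Fin (n l)

/-- The `x`-th point of the block `l`. -/
@[reducible] def Pts.mk {r : ℕ} {n : Fin r → ℕ} (l : Fin r) (x : Fin (n l)) : Pts n := ⟨l, x⟩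

instance {r : ℕ} (n : Fin r → ℕ) : Fintype (Pts n) :=
  inferInstanceAs (Fintype ((l : Fin r) × Fin (n l)))

/-- The lexicographic order. -/
instance {r : ℕ} (n : Fin r → ℕ) : LinearOrder (Pts n) :=
  LinearOrder.lift' (fun p : Pts n => toLex (p.1, (p.2 : ℕ))) (by
    rintro ⟨l, x⟩ ⟨m, y⟩ h
    have := toLex.injective h
    simp only [Prod.mk.injEq] at this
    obtain ⟨rfl, h2⟩ := this
    exact congrArg (Sigma.mk l) (Fin.ext h2))

lemma Pts.lt_iff {r : ℕ} {n : Fin r → ℕ} (p p' : Pts n) :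
    p < p' ↔ p.1 < p'.1 ∨ (p.1 = p'.1 ∧ (p.2 : ℕ) < p'.2) := by
  change toLex (p.1, (p.2 : ℕ)) < toLex (p'.1, (p'.2 : ℕ)) ↔ _
  rw [Prod.Lex.toLex_lt_toLex]

lemma Pts.mk_lt_mk {r : ℕ} {n : Fin r → ℕ} (l : Fin r) (x y : Fin (n l)) :
    (Pts.mk l x : Pts n) < Pts.mk l y ↔ x < y := by
  refine (Pts.lt_iff _ _).trans ?_
  simp

lemma Pts.lt_of_fst_lt {r : ℕ} {n : Fin r → ℕ} {p p' : Pts n} (h : p.1 < p'.1) : p < p' :=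
  (Pts.lt_iff _ _).2 (Or.inl h)

lemma Pts.fst_le_of_lt {r : ℕ} {n : Fin r → ℕ} {p p' : Pts n} (h : p < p') : p.1 ≤ p'.1 := by
  rcases (Pts.lt_iff _ _).1 h with h | h
  · exact h.le
  · exact h.1.le

lemma Pts.lt_iff_of_ne {r : ℕ} {n : Fin r → ℕ} {p p' : Pts n} (h : p.1 ≠ p'.1) :
    p < p' ↔ p.1 < p'.1 := by
  rw [Pts.lt_iff]; simp [h]

/-- The number of pairs whose order is preserved. -/
def noninv {a b : ℕ} (σ : Fin a ≃ Fin b) : ℕ :=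
  ((Finset.univ : Finset (Fin a × Fin a)).filter fun p => p.1 < p.2 ∧ σ p.1 < σ p.2).card

/-- `π` matches the block `l` with the block `ρ l`. -/
def Over {r : ℕ} {n : Fin r → ℕ} (π : PairingOn (Pts n)) (ρ : Pairing r) : Prop :=
  ∀ p, (π.1 p).1 = ρ.1 p.1

instance {r : ℕ} {n : Fin r → ℕ} (π : PairingOn (Pts n)) (ρ : Pairing r) :
    Decidable (Over π ρ) := by unfold Over; infer_instance

/-! ### Pairings of points that match whole blocks -/

section Over

variable {r : ℕ} {n : Fin r → ℕ}

lemma Pts.mk_injective (l : Fin r) : Function.Injective (Pts.mk (n := n) l) := by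
  intro x y h
  exact eq_of_heq (Sigma.mk.inj h).2

lemma Pts.sum_univ {R : Type*} [AddCommMonoid R] (g : Pts n → R) :
    ∑ p, g p = ∑ l, ∑ x, g (Pts.mk l x) := Fintype.sum_sigma g

lemma Pts.prod_univ {R : Type*} [CommMonoid R] (g : Pts n → R) :
    ∏ p, g p = ∏ l, ∏ x, g (Pts.mk l x) := Fintype.prod_sigma g

/-- The involution of the points that matches blocks according to `ρ`, and points inside the
matched blocks according to `σ`. -/
def matchFun (ρ : Pairing r) (σ : ∀ l : {l // l < ρ.1 l}, Fin (n l.1) ≃ Fin (n (ρ.1 l.1))) :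
    Pts n → Pts n := fun p =>
  if h : p.1 < ρ.1 p.1 then Pts.mk (ρ.1 p.1) (σ ⟨p.1, h⟩ p.2)
  else Pts.mk (ρ.1 p.1) ((σ ⟨ρ.1 p.1, by
      rw [(ρ.2 p.1).1]; exact (not_lt_iff_lt_partner (T := Fin r) ρ p.1).1 h⟩).symm
        (Fin.cast (by rw [(ρ.2 p.1).1]) p.2))

lemma matchFun_of_lt (ρ : Pairing r)
    (σ : ∀ l : {l // l < ρ.1 l}, Fin (n l.1) ≃ Fin (n (ρ.1 l.1))) (l : {l // l < ρ.1 l})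
    (x : Fin (n l.1)) : matchFun ρ σ (Pts.mk l.1 x) = Pts.mk (ρ.1 l.1) (σ l x) := by
  unfold matchFun
  rw [dif_pos (show (Pts.mk l.1 x : Pts n).1 < ρ.1 (Pts.mk l.1 x : Pts n).1 from l.2)]

lemma matchFun_partner (ρ : Pairing r)
    (σ : ∀ l : {l // l < ρ.1 l}, Fin (n l.1) ≃ Fin (n (ρ.1 l.1))) (l : {l // l < ρ.1 l})
    (y : Fin (n (ρ.1 l.1))) :
    matchFun ρ σ (Pts.mk (ρ.1 l.1) y) = Pts.mk l.1 ((σ l).symm y) := by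
  unfold matchFun
  have h0 : ¬ (ρ.1 l.1) < ρ.1 (ρ.1 l.1) := by rw [(ρ.2 l.1).1]; exact l.2.not_gt
  rw [dif_neg (show ¬ (Pts.mk (ρ.1 l.1) y : Pts n).1 < ρ.1 (Pts.mk (ρ.1 l.1) y : Pts n).1 from h0)]
  -- The block `ρ (ρ l)` equals `l` only propositionally; generalizing it to `l'` allows the
  -- substitution in the dependent types.
  have key : ∀ (l' : {l // l < ρ.1 l}) (h : l'.1 = l.1) (y' : Fin (n (ρ.1 l'.1))),
      (y' : ℕ) = y → (Pts.mk l'.1 ((σ l').symm y') : Pts n) = Pts.mk l.1 ((σ l).symm y) := by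
    intro l' h y' hy
    have : l' = l := Subtype.ext h
    subst this
    rw [Fin.ext hy]
  exact key ⟨ρ.1 (ρ.1 l.1), _⟩ (ρ.2 l.1).1 _ rfl

lemma exists_point (ρ : Pairing r) (p : Pts n) :
    (∃ (l : {l // l < ρ.1 l}) (x : Fin (n l.1)), p = Pts.mk l.1 x) ∨
      (∃ (l : {l // l < ρ.1 l}) (y : Fin (n (ρ.1 l.1))), p = Pts.mk (ρ.1 l.1) y) := by
  obtain ⟨l, x⟩ := p
  by_cases h : l < ρ.1 l
  · exact Or.inl ⟨⟨l, h⟩, x, rfl⟩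
  · right
    have h' := (not_lt_iff_lt_partner (T := Fin r) ρ l).1 h
    obtain ⟨m, rfl⟩ := ρ.1.surjective l
    rw [(ρ.2 m).1] at h'
    exact ⟨⟨m, h'⟩, x, rfl⟩

/-- The pairing of the points defined by `matchFun`. -/
def matchPairing (ρ : Pairing r)
    (σ : ∀ l : {l // l < ρ.1 l}, Fin (n l.1) ≃ Fin (n (ρ.1 l.1))) : PairingOn (Pts n) :=
  ⟨Function.Involutive.toPerm (matchFun ρ σ) (fun p => by
    rcases exists_point ρ p with ⟨l, x, rfl⟩ | ⟨l, x, rfl⟩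
    · rw [matchFun_of_lt, matchFun_partner, Equiv.symm_apply_apply]
    · rw [matchFun_partner, matchFun_of_lt, Equiv.apply_symm_apply]), fun p => by
    constructor
    · rcases exists_point ρ p with ⟨l, x, rfl⟩ | ⟨l, x, rfl⟩
      · change matchFun ρ σ (matchFun ρ σ _) = _
        rw [matchFun_of_lt, matchFun_partner, Equiv.symm_apply_apply]
      · change matchFun ρ σ (matchFun ρ σ _) = _
        rw [matchFun_partner, matchFun_of_lt, Equiv.apply_symm_apply]
    · intro h
      have h1 : (matchFun ρ σ p).1 = p.1 := congrArg Sigma.fst h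
      have h2 : (matchFun ρ σ p).1 = ρ.1 p.1 := by
        unfold matchFun; split_ifs <;> rfl
      exact (ρ.2 p.1).2 (h2.symm.trans h1)⟩

lemma matchPairing_of_lt (ρ : Pairing r)
    (σ : ∀ l : {l // l < ρ.1 l}, Fin (n l.1) ≃ Fin (n (ρ.1 l.1))) (l : {l // l < ρ.1 l})
    (x : Fin (n l.1)) : (matchPairing ρ σ).1 (Pts.mk l.1 x) = Pts.mk (ρ.1 l.1) (σ l x) :=
  matchFun_of_lt ρ σ l x

lemma matchPairing_over (ρ : Pairing r)
    (σ : ∀ l : {l // l < ρ.1 l}, Fin (n l.1) ≃ Fin (n (ρ.1 l.1))) :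
    Over (matchPairing ρ σ) ρ := by
  intro p
  change (matchFun ρ σ p).1 = _
  unfold matchFun; split_ifs <;> rfl

lemma matchPairing_injective (ρ : Pairing r) :
    Function.Injective (matchPairing (n := n) ρ) := by
  intro σ σ' h
  funext l
  ext x : 1
  have := congrArg (fun π : PairingOn (Pts n) => π.1 (Pts.mk l.1 x)) h
  simp only [matchPairing_of_lt] at this
  exact Pts.mk_injective _ this

/-- On each block `π` restricts to an injection into the partner block, and it is onto because `π`
sends the partner block back. Hence the pairings over `ρ` are parametrized exactly by one bijection
for each pair of `ρ`. -/
lemma exists_matchPairing (ρ : Pairing r) (π : PairingOn (Pts n)) (h : Over π ρ) :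
    ∃ σ, matchPairing ρ σ = π := by
  have ex : ∀ l (x : Fin (n l)), ∃ y : Fin (n (ρ.1 l)), π.1 (Pts.mk l x) = Pts.mk (ρ.1 l) y := by
    intro l x
    have h1 := h (Pts.mk l x)
    generalize π.1 (Pts.mk l x) = z at h1
    obtain ⟨m, y⟩ := z
    simp only at h1
    subst h1
    exact ⟨y, rfl⟩
  choose s hs using ex
  have hb : ∀ l, Function.Bijective (s l) := by
    intro l
    constructor
    · intro x y hxy
      have : π.1 (Pts.mk l x) = π.1 (Pts.mk l y) := by rw [hs, hs, hxy]
      exact Pts.mk_injective _ (π.1.injective this)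
    · intro y
      have h1 := h (Pts.mk (ρ.1 l) y)
      have h3 := (π.2 (Pts.mk (ρ.1 l) y)).1
      generalize π.1 (Pts.mk (ρ.1 l) y) = z at h1 h3
      obtain ⟨m, x⟩ := z
      simp only [(ρ.2 l).1] at h1
      subst h1
      exact ⟨x, Pts.mk_injective _ ((hs m x).symm.trans h3)⟩
  refine ⟨fun l => Equiv.ofBijective (s l.1) (hb l.1), ?_⟩
  refine Subtype.ext (Equiv.ext fun p => ?_)
  rcases exists_point ρ p with ⟨l, x, rfl⟩ | ⟨l, y, rfl⟩
  · rw [matchPairing_of_lt, hs]; rfl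
  · obtain ⟨x, rfl⟩ := (hb l.1).2 y
    have h1 := matchPairing_of_lt ρ (fun l => Equiv.ofBijective (s l.1) (hb l.1)) l x
    rw [Equiv.ofBijective_apply] at h1
    rw [← h1, ((matchPairing ρ _).2 _).1, h1, ← hs, (π.2 _).1]

/-- The number of crossings between points forced by the crossings between blocks. -/
def blockCrossings (n : Fin r → ℕ) (ρ : Pairing r) : ℕ :=
  ∑ l, ∑ m, if l < m ∧ m < ρ.1 l ∧ ρ.1 l < ρ.1 m then n l * n m else 0

/-- Pairs of points over two distinct pairs of blocks cross exactly when the pairs of blocks do, and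
each crossing of blocks yields `n l * n m` crossings of points. Two pairs of points over the same
pair of blocks cross exactly when the bijection preserves their order, since nested pairs correspond
to a reversal; this is why `noninv` occurs and not the number of inversions. -/
lemma crossings_matchPairing (ρ : Pairing r)
    (σ : ∀ l : {l // l < ρ.1 l}, Fin (n l.1) ≃ Fin (n (ρ.1 l.1))) :
    crossings (matchPairing ρ σ) = blockCrossings n ρ + ∑ l, noninv (σ l) := by
  set π := matchPairing ρ σ with hπ
  have hov : Over π ρ := matchPairing_over ρ σ
  have h1 : crossings π = ∑ l, ∑ m, ∑ x, ∑ y,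
      if (Pts.mk l x : Pts n) < Pts.mk m y ∧ Pts.mk m y < π.1 (Pts.mk l x) ∧
        π.1 (Pts.mk l x) < π.1 (Pts.mk m y) then 1 else 0 := by
    unfold crossings
    rw [Finset.card_filter, Fintype.sum_prod_type, Pts.sum_univ]
    refine Finset.sum_congr rfl fun l _ => ?_
    simp_rw [Pts.sum_univ]
    rw [Finset.sum_comm]
  -- The contribution of a single pair of blocks is placed on the diagonal `l = m` of a double sum,
  -- so that the identity can be checked for each `(l, m)`.
  have h2 : ∑ l, noninv (σ l) = ∑ l, ∑ m, if h : l = m ∧ l < ρ.1 l then noninv (σ ⟨l, h.2⟩) else 0 := by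
    rw [← Finset.sum_filter_add_sum_filter_not Finset.univ (fun l => l < ρ.1 l)
      (fun l => ∑ m, if h : l = m ∧ l < ρ.1 l then noninv (σ ⟨l, h.2⟩) else 0)]
    rw [Finset.sum_eq_zero (s := Finset.univ.filter fun l => ¬ l < ρ.1 l), add_zero]
    · rw [Finset.sum_subtype (Finset.univ.filter fun l => l < ρ.1 l) (p := fun l => l < ρ.1 l)
        (by simp)]
      refine Finset.sum_congr rfl fun l _ => ?_
      rw [Finset.sum_eq_single l.1]
      · rw [dif_pos ⟨rfl, l.2⟩]
      · intro b _ hb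
        rw [dif_neg (fun h => hb h.1.symm)]
      · simp
    · intro l hl
      refine Finset.sum_eq_zero fun m _ => ?_
      rw [dif_neg (fun h => (Finset.mem_filter.1 hl).2 h.2)]
  rw [h1, h2, blockCrossings, ← Finset.sum_add_distrib]
  refine Finset.sum_congr rfl fun l _ => ?_
  rw [← Finset.sum_add_distrib]
  refine Finset.sum_congr rfl fun m _ => ?_
  by_cases hlm : l = m
  · subst hlm
    rw [if_neg (fun h => lt_irrefl _ h.1), zero_add]
    by_cases hl : l < ρ.1 l
    · rw [dif_pos ⟨rfl, hl⟩]
      unfold noninv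
      rw [Finset.card_filter, Fintype.sum_prod_type]
      refine Finset.sum_congr rfl fun x _ => Finset.sum_congr rfl fun y _ => ?_
      refine if_congr ?_ rfl rfl
      have e1 := matchPairing_of_lt ρ σ ⟨l, hl⟩ x
      have e2 := matchPairing_of_lt ρ σ ⟨l, hl⟩ y
      rw [← hπ] at e1 e2
      simp only at e1 e2
      rw [e1, e2, Pts.mk_lt_mk, Pts.mk_lt_mk]
      have : (Pts.mk l y : Pts n) < Pts.mk (ρ.1 l) (σ ⟨l, hl⟩ x) := Pts.lt_of_fst_lt hl
      simp [this]
    · rw [dif_neg (fun h => hl h.2)]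
      refine Finset.sum_eq_zero fun x _ => Finset.sum_eq_zero fun y _ => ?_
      rw [if_neg]
      rintro ⟨-, h, -⟩
      have := Pts.fst_le_of_lt h
      rw [hov] at this
      exact hl (lt_of_le_of_ne this (ρ.2 l).2.symm)
  · rw [dif_neg (fun h => hlm h.1), add_zero]
    have hc : ∀ x y, ((Pts.mk l x : Pts n) < Pts.mk m y ∧ Pts.mk m y < π.1 (Pts.mk l x) ∧
        π.1 (Pts.mk l x) < π.1 (Pts.mk m y)) ↔ (l < m ∧ m < ρ.1 l ∧ ρ.1 l < ρ.1 m) := by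
      intro x y
      have o1 := hov (Pts.mk l x)
      have o2 := hov (Pts.mk m y)
      constructor
      · rintro ⟨a1, a2, a3⟩
        have b1 := lt_of_le_of_ne (Pts.fst_le_of_lt a1) hlm
        have b2 := Pts.fst_le_of_lt a2
        have b3 := Pts.fst_le_of_lt a3
        rw [o1] at b2 b3
        rw [o2] at b3
        have b3' := lt_of_le_of_ne b3 (fun h => hlm (ρ.1.injective h))
        refine ⟨b1, lt_of_le_of_ne b2 ?_, b3'⟩
        intro h
        have h' : m = ρ.1 l := h
        have b4 : ρ.1 l < ρ.1 m := b3'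
        rw [h', (ρ.2 l).1] at b4
        have : l < ρ.1 l := h' ▸ b1
        exact absurd b4 this.not_gt
      · rintro ⟨a1, a2, a3⟩
        exact ⟨Pts.lt_of_fst_lt a1, Pts.lt_of_fst_lt (by rw [o1]; exact a2),
          Pts.lt_of_fst_lt (by rw [o1, o2]; exact a3)⟩
    simp_rw [hc]
    split_ifs <;> simp

lemma prod_opens_matchPairing (ρ : Pairing r)
    (σ : ∀ l : {l // l < ρ.1 l}, Fin (n l.1) ≃ Fin (n (ρ.1 l.1))) (w : Pts n → Pts n → ℝ) :
    ∏ p ∈ opens (matchPairing ρ σ), w p ((matchPairing ρ σ).1 p) =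
      ∏ l, ∏ x, w (Pts.mk l.1 x) (Pts.mk (ρ.1 l.1) (σ l x)) := by
  set π := matchPairing ρ σ with hπ
  have hov : Over π ρ := matchPairing_over ρ σ
  have hlt : ∀ p, p < π.1 p ↔ p.1 < ρ.1 p.1 := by
    intro p
    rw [← hov p]
    exact Pts.lt_iff_of_ne (by rw [hov p]; exact (ρ.2 p.1).2.symm)
  unfold opens
  rw [Finset.prod_filter, Pts.prod_univ]
  rw [← Finset.prod_filter_mul_prod_filter_not Finset.univ (fun l => l < ρ.1 l)]
  rw [Finset.prod_eq_one (s := Finset.univ.filter fun l => ¬ l < ρ.1 l), mul_one]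
  · rw [Finset.prod_subtype (Finset.univ.filter fun l => l < ρ.1 l) (p := fun l => l < ρ.1 l)
        (by simp)]
    refine Finset.prod_congr rfl fun l _ => Finset.prod_congr rfl fun x _ => ?_
    rw [if_pos ((hlt _).2 l.2), hπ, matchPairing_of_lt]
  · intro l hl
    refine Finset.prod_eq_one fun x _ => ?_
    rw [if_neg (fun h => (Finset.mem_filter.1 hl).2 ((hlt _).1 h))]

/-- The contribution of the pairings that match the blocks according to `ρ`. -/
lemma sum_over (q : ℝ) (w : Pts n → Pts n → ℝ) (ρ : Pairing r) :
    ∑ π : PairingOn (Pts n) with Over π ρ, q ^ crossings π * ∏ p ∈ opens π, w p (π.1 p) =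
      q ^ blockCrossings n ρ * ∏ l ∈ opens (T := Fin r) ρ, ∑ σ : Fin (n l) ≃ Fin (n (ρ.1 l)),
        q ^ noninv σ * ∏ x, w (Pts.mk l x) (Pts.mk (ρ.1 l) (σ x)) := by
  classical
  have h1 : ∑ π : PairingOn (Pts n) with Over π ρ,
      q ^ crossings π * ∏ p ∈ opens π, w p (π.1 p) =
      ∑ σ : ∀ l : {l // l < ρ.1 l}, Fin (n l.1) ≃ Fin (n (ρ.1 l.1)),
        q ^ crossings (matchPairing ρ σ) *
          ∏ p ∈ opens (matchPairing ρ σ), w p ((matchPairing ρ σ).1 p) := by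
    symm
    refine Finset.sum_bij (fun σ _ => matchPairing ρ σ) ?_ ?_ ?_ ?_
    · intro σ _
      exact Finset.mem_filter.2 ⟨Finset.mem_univ _, matchPairing_over ρ σ⟩
    · intro σ _ σ' _ h
      exact matchPairing_injective ρ h
    · intro π hπ
      obtain ⟨σ, hσ⟩ := exists_matchPairing ρ π (Finset.mem_filter.1 hπ).2
      exact ⟨σ, Finset.mem_univ _, hσ⟩
    · intro σ _; rfl
  rw [h1]
  simp_rw [crossings_matchPairing, prod_opens_matchPairing, pow_add, mul_assoc,
    ← Finset.prod_pow_eq_pow_sum, ← Finset.prod_mul_distrib]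
  rw [← Finset.mul_sum]
  congr 1
  have h2 := Finset.prod_univ_sum
    (fun l : {l // l < ρ.1 l} => (Finset.univ : Finset (Fin (n l.1) ≃ Fin (n (ρ.1 l.1)))))
    (fun l σ => q ^ noninv σ * ∏ x, w (Pts.mk l.1 x) (Pts.mk (ρ.1 l.1) (σ x)))
  rw [Fintype.piFinset_univ] at h2
  rw [← h2]
  exact (Finset.prod_subtype (opens (T := Fin r) ρ) (fun x => by simp)
    (fun l => ∑ σ : Fin (n l) ≃ Fin (n (ρ.1 l)),
        q ^ noninv σ * ∏ x, w (Pts.mk l x) (Pts.mk (ρ.1 l) (σ x)))).symm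

end Over

/-! ### The Wick formula for linear combinations, blocks and tensors -/

section Wick

variable {A : Type*} [Ring A] [Algebra ℂ A] {κ ι : Type*}

/-- The joint moments of the family `Y` are given by the `q`-Wick formula with covariance `C`. -/
def IsWick (φ : A →ₗ[ℂ] ℂ) (q : ℝ) (Y : κ → A) (C : κ → κ → ℝ) : Prop :=
  ∀ (r : ℕ) (k : Fin r → κ), φ (List.ofFn fun i => Y (k i)).prod =
    ((∑ π : Pairing r, q ^ π.cr * ∏ e ∈ π.pairs, C (k e.1) (k e.2) : ℝ) : ℂ)

/-- The moments of families of linear combinations. -/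
lemma IsWick.linearCombination {φ : A →ₗ[ℂ] ℂ} {q : ℝ} {Y : κ → A} {C : κ → κ → ℝ}
    (h : IsWick φ q Y C) {S : Type*} [Fintype S] (α : ι → S → ℝ) (k : ι → S → κ) :
    IsWick φ q (fun i => ∑ s, (α i s : ℂ) • Y (k i s))
      (fun i i' => ∑ s, ∑ s', α i s * α i' s' * C (k i s) (k i' s')) := by
  classical
  intro r i
  have e1 := (MultilinearMap.mkPiAlgebraFin ℂ r A).map_sum
    (fun (p : Fin r) (s : S) => (α (i p) s : ℂ) • Y (k (i p) s))
  simp only [MultilinearMap.mkPiAlgebraFin_apply, MultilinearMap.map_smul_univ] at e1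
  rw [e1, map_sum]
  simp_rw [map_smul, h r, smul_eq_mul]
  norm_cast
  simp_rw [Finset.mul_sum]
  rw [Finset.sum_comm]
  refine Finset.sum_congr rfl fun π _ => ?_
  simp_rw [mul_left_comm _ (q ^ _)]
  rw [← Finset.mul_sum]
  congr 1
  rw [Pairing.prod_pairs π
    (fun a b => ∑ s, ∑ s', α (i a) s * α (i b) s' * C (k (i a) s) (k (i b) s'))]
  rw [← sum_prod_opens (T := Fin r) π (X := fun _ => S)
    (fun p s s' => α (i p) s * α (i (π.1 p)) s' * C (k (i p) s) (k (i (π.1 p)) s'))]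
  refine Finset.sum_congr rfl fun s _ => ?_
  rw [prod_univ_eq_prod_opens (T := Fin r) π,
    Pairing.prod_pairs π (fun a b => C (k (i a) (s a)) (k (i b) (s b))), ← Finset.prod_mul_distrib]

/-- The points of the blocks, listed in increasing order. -/
lemma list_points {r : ℕ} (n : Fin r → ℕ) {N : ℕ} (e : Fin N ≃o Pts n) :
    List.ofFn e = (List.ofFn fun l => List.ofFn fun x => (Pts.mk l x : Pts n)).flatten := by
  have s1 : (List.ofFn e).Pairwise (· < ·) := by
    rw [List.pairwise_ofFn]
    intro i j hij
    exact e.lt_iff_lt.2 hij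
  have s2 : (List.ofFn fun l => List.ofFn fun x => (Pts.mk l x : Pts n)).flatten.Pairwise
      (· < ·) := by
    rw [List.pairwise_flatten]
    constructor
    · intro L hL
      rw [List.mem_ofFn] at hL
      obtain ⟨l, rfl⟩ := hL
      rw [List.pairwise_ofFn]
      intro x y hxy
      exact (Pts.mk_lt_mk l x y).2 hxy
    · rw [List.pairwise_ofFn]
      intro l m hlm a ha b hb
      rw [List.mem_ofFn] at ha hb
      obtain ⟨x, rfl⟩ := ha
      obtain ⟨y, rfl⟩ := hb
      exact Pts.lt_of_fst_lt hlm
  -- Two strictly increasing lists with the same members coincide.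
  refine List.Perm.eq_of_pairwise (le := (· < ·)) ?_ s1 s2 ?_
  · intro a b _ _ h1 h2
    exact absurd h1 h2.not_gt
  · rw [List.perm_ext_iff_of_nodup]
    · intro p
      constructor
      · intro _
        obtain ⟨l, x⟩ := p
        exact List.mem_flatten.2 ⟨_, (List.mem_ofFn).2 ⟨l, rfl⟩, (List.mem_ofFn).2 ⟨x, rfl⟩⟩
      · intro _
        exact (List.mem_ofFn).2 (e.surjective p)
    · exact s1.imp (fun h => ne_of_lt h)
    · exact s2.imp (fun h => ne_of_lt h)

/-- The `q`-Wick formula for a product of blocks. -/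
lemma IsWick.blocks {φ : A →ₗ[ℂ] ℂ} {q : ℝ} {Y : κ → A} {C : κ → κ → ℝ}
    (h : IsWick φ q Y C) {r : ℕ} (n : Fin r → ℕ) (k : ∀ l, Fin (n l) → κ) :
    φ (List.ofFn fun l => (List.ofFn fun x => Y (k l x)).prod).prod =
      ((∑ π : PairingOn (Pts n), q ^ crossings π *
        ∏ p ∈ opens π, C (k p.1 p.2) (k (π.1 p).1 (π.1 p).2) : ℝ) : ℂ) := by
  let e : Fin (Fintype.card (Pts n)) ≃o Pts n := Fintype.orderIsoFinOfCardEq _ rfl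
  have h1 := h _ (fun i => k (e i).1 (e i).2)
  rw [sum_pairing_congr e q (fun p p' => C (k p.1 p.2) (k p'.1 p'.2))] at h1
  rw [← h1]
  have h2 : (List.ofFn fun i => Y (k (e i).1 (e i).2)) =
      (List.ofFn e).map (fun p => Y (k p.1 p.2)) := by
    rw [List.map_ofFn]; rfl
  rw [h2, list_points, List.map_flatten, List.prod_flatten]
  simp only [List.map_ofFn]
  congr 3
  funext l
  simp only [Function.comp_apply, List.map_ofFn]
  rfl

/-- The element of the algebra associated with a tensor. -/
def tensorIntegral [Fintype ι] (Y : ι → A) {n : ℕ} (a : (Fin n → ι) → ℝ) : A :=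
  ∑ j, (a j : ℂ) • (List.ofFn fun x => Y (j x)).prod

/-- The contraction of tensors along a pairing. -/
def network [Fintype ι] (C : ι → ι → ℝ) {r : ℕ} {n : Fin r → ℕ} (a : ∀ l, (Fin (n l) → ι) → ℝ)
    (π : PairingOn (Pts n)) : ℝ :=
  ∑ J : ∀ l, Fin (n l) → ι, (∏ l, a l (J l)) *
    ∏ p ∈ opens π, C (J p.1 p.2) (J (π.1 p).1 (π.1 p).2)

/-- Multilinear expansion gives a sum over families of indices of Wick sums. Exchanging the two
sums, the indices are summed first and each pairing carries one network. -/
lemma IsWick.tensors [Fintype ι] {φ : A →ₗ[ℂ] ℂ} {q : ℝ} {Y : ι → A} {C : ι → ι → ℝ}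
    (h : IsWick φ q Y C) {r : ℕ} (n : Fin r → ℕ) (a : ∀ l, (Fin (n l) → ι) → ℝ) :
    φ (List.ofFn fun l => tensorIntegral Y (a l)).prod =
      ((∑ π : PairingOn (Pts n), q ^ crossings π * network C a π : ℝ) : ℂ) := by
  classical
  have e1 := (MultilinearMap.mkPiAlgebraFin ℂ r A).map_sum
    (fun (l : Fin r) (j : Fin (n l) → ι) => (a l j : ℂ) • (List.ofFn fun x => Y (j x)).prod)
  simp only [MultilinearMap.mkPiAlgebraFin_apply, MultilinearMap.map_smul_univ] at e1
  unfold tensorIntegral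
  rw [e1, map_sum]
  simp_rw [map_smul, h.blocks, smul_eq_mul]
  norm_cast
  simp_rw [network, Finset.mul_sum]
  rw [Finset.sum_comm]
  refine Finset.sum_congr rfl fun π _ => Finset.sum_congr rfl fun J _ => ?_
  ring

/-- The `q`-deformed pairing of two tensors, read in the same direction. -/
def crossForm [Fintype ι] (q : ℝ) (C : ι → ι → ℝ) {n m : ℕ} (a : (Fin n → ι) → ℝ)
    (b : (Fin m → ι) → ℝ) : ℝ :=
  ∑ j, ∑ j', a j * b j' * ∑ σ : Fin n ≃ Fin m, q ^ noninv σ * ∏ x, C (j x) (j' (σ x))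

/-- The contribution of the pairings that match whole blocks. -/
lemma sum_network_over [Fintype ι] (q : ℝ) (C : ι → ι → ℝ) {r : ℕ} {n : Fin r → ℕ}
    (a : ∀ l, (Fin (n l) → ι) → ℝ) (ρ : Pairing r) :
    ∑ π : PairingOn (Pts n) with Over π ρ, q ^ crossings π * network C a π =
      q ^ blockCrossings n ρ *
        ∏ l ∈ opens (T := Fin r) ρ, crossForm q C (a l) (a (ρ.1 l)) := by
  classical
  unfold network crossForm
  rw [← sum_prod_opens (T := Fin r) ρ (X := fun l => Fin (n l) → ι) (fun l j j' =>
    a l j * a (ρ.1 l) j' * ∑ σ : Fin (n l) ≃ Fin (n (ρ.1 l)),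
      q ^ noninv σ * ∏ x, C (j x) (j' (σ x)))]
  simp_rw [Finset.mul_sum (s := (Finset.univ : Finset (∀ l, Fin (n l) → ι)))]
  rw [Finset.sum_comm]
  refine Finset.sum_congr rfl fun J _ => ?_
  simp_rw [mul_left_comm _ (∏ l, a l (J l))]
  rw [← Finset.mul_sum, sum_over q (fun p p' => C (J p.1 p.2) (J p'.1 p'.2)) ρ,
    prod_univ_eq_prod_opens (T := Fin r) ρ, mul_left_comm]
  congr 1
  rw [← Finset.prod_mul_distrib]

end Wick

/-! ### Covariance of two words or tensors of the same length -/

section TwoBlocks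

/-- The pairing of `{1, 2}`. -/
def pairingTwo : Pairing 2 := ⟨Equiv.swap 0 1, by decide⟩

lemma opens_pairingTwo : opens (T := Fin 2) pairingTwo = {0} := by
  unfold opens pairingTwo; decide

lemma blockCrossings_pairingTwo (n : Fin 2 → ℕ) : blockCrossings n pairingTwo = 0 := by
  simp [blockCrossings, Fin.sum_univ_two, pairingTwo]

/-- Without a pair inside block `0`, the pairing injects block `0` into block `1`. The two have the
same size, so block `1` is exhausted and has no inner pair either. -/
lemma over_pairingTwo_of_forall {N : ℕ} (π : PairingOn (Pts fun _ : Fin 2 => N))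
    (h : ∀ x, (π.1 (Pts.mk 0 x)).1 ≠ 0) : Over π pairingTwo := by
  have ex : ∀ x : Fin N, ∃ y : Fin N, π.1 (Pts.mk 0 x) = Pts.mk 1 y := by
    intro x
    have h1 := h x
    generalize π.1 (Pts.mk 0 x) = z at h1
    obtain ⟨m, y⟩ := z
    have : m = 1 := by
      have h1' : m ≠ 0 := h1
      omega
    subst this
    exact ⟨y, rfl⟩
  choose f hf using ex
  have hinj : Function.Injective f := by
    intro x y hxy
    have : π.1 (Pts.mk 0 x) = π.1 (Pts.mk 0 y) := by rw [hf, hf, hxy]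
    exact Pts.mk_injective (n := fun _ : Fin 2 => N) 0 (π.1.injective this)
  have hsurj := Finite.surjective_of_injective hinj
  have key : ∀ (l : Fin 2) (x : Fin N), (π.1 (Pts.mk l x)).1 = pairingTwo.1 l := by
    intro l x
    match l with
    | 0 => rw [hf]; rfl
    | 1 =>
      obtain ⟨y, rfl⟩ := hsurj x
      rw [← hf, (π.2 _).1]; rfl
  rintro ⟨l, x⟩
  exact key l x

variable {A : Type*} [Ring A] [Algebra ℂ A] {κ ι : Type*}

/-- The covariance of two words of the same length, the first one without inner covariances. -/
lemma IsWick.two_words {φ : A →ₗ[ℂ] ℂ} {q : ℝ} {Y : κ → A} {C : κ → κ → ℝ}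
    (h : IsWick φ q Y C) {N : ℕ} (k k' : Fin N → κ) (hk : ∀ x y, x < y → C (k x) (k y) = 0) :
    φ ((List.ofFn fun x => Y (k x)).prod * (List.ofFn fun x => Y (k' x)).prod) =
      ((∑ σ : Fin N ≃ Fin N, q ^ noninv σ * ∏ x, C (k x) (k' (σ x)) : ℝ) : ℂ) := by
  classical
  let K : ∀ l : Fin 2, Fin ((fun _ : Fin 2 => N) l) → κ := fun l => if l = 0 then k else k'
  have h1 := h.blocks (fun _ : Fin 2 => N) K
  simp only [List.ofFn_succ, List.ofFn_zero, List.prod_cons, List.prod_nil, mul_one] at h1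
  have h2 : φ ((List.ofFn fun x => Y (k x)).prod * (List.ofFn fun x => Y (k' x)).prod) = _ := h1
  rw [h2]
  norm_cast
  have s1 := sum_over (n := fun _ : Fin 2 => N) q
    (fun p p' => C (K p.1 p.2) (K p'.1 p'.2)) pairingTwo
  rw [blockCrossings_pairingTwo, opens_pairingTwo, Finset.prod_singleton, pow_zero, one_mul] at s1
  refine (Finset.sum_filter_add_sum_filter_not Finset.univ (fun π => Over π pairingTwo)
    _).symm.trans ((congrArg₂ (· + ·) s1 (Finset.sum_eq_zero ?_)).trans (add_zero _))
  · intro π hπ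
    have hno := (Finset.mem_filter.1 hπ).2
    -- A pairing that does not match the two blocks has a pair inside the first one, and its inner
    -- covariance vanishes by `hk`.
    have : ∃ x, (π.1 (Pts.mk 0 x)).1 = 0 := by
      by_contra hc
      push Not at hc
      exact hno (over_pairingTwo_of_forall π hc)
    obtain ⟨x, hx⟩ := this
    obtain ⟨y, hy⟩ : ∃ y, π.1 (Pts.mk 0 x) = Pts.mk 0 y := by
      generalize π.1 (Pts.mk 0 x) = z at hx
      obtain ⟨m, y⟩ := z
      have hx' : m = 0 := hx
      subst hx'
      exact ⟨y, rfl⟩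
    have hy' : π.1 (Pts.mk 0 y) = Pts.mk 0 x := by rw [← hy, (π.2 _).1]
    have hxy : x ≠ y := by
      rintro rfl
      exact (π.2 _).2 hy
    have key : ∀ x y : Fin N, x < y → π.1 (Pts.mk 0 x) = Pts.mk 0 y →
        ∏ p ∈ opens π, C (K p.1 p.2) (K (π.1 p).1 (π.1 p).2) = 0 := by
      intro x y hxy hy
      refine Finset.prod_eq_zero (i := Pts.mk 0 x) ?_ ?_
      · rw [mem_opens, hy]
        exact (Pts.mk_lt_mk (n := fun _ : Fin 2 => N) 0 x y).2 hxy
      · rw [hy]; exact hk x y hxy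
    rcases lt_or_gt_of_ne hxy with hl | hl
    · rw [key x y hl hy, mul_zero]
    · rw [key y x hl hy', mul_zero]

/-- The covariance of two tensors. -/
lemma IsWick.two_tensors [Fintype ι] {φ : A →ₗ[ℂ] ℂ} {q : ℝ} {Y : ι → A} {C : ι → ι → ℝ}
    (h : IsWick φ q Y C) {N : ℕ} (b w : (Fin N → ι) → ℝ)
    (hb : ∀ j, b j ≠ 0 → ∀ x y, x < y → C (j x) (j y) = 0) :
    φ (tensorIntegral Y b * tensorIntegral Y w) = (crossForm q C b w : ℂ) := by
  unfold tensorIntegral crossForm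
  rw [Finset.sum_mul, map_sum]
  push_cast
  refine Finset.sum_congr rfl fun j _ => ?_
  rw [Finset.mul_sum, map_sum]
  refine Finset.sum_congr rfl fun j' _ => ?_
  rw [smul_mul_smul_comm, map_smul, smul_eq_mul]
  by_cases hj : b j = 0
  · simp [hj]
  · rw [h.two_words j j' (hb j hj)]
    push_cast
    rfl

/-- Taking the adjoint reverses the first word. The reversal turns preserved orders into inversions,
which reconciles the Wick formula, read from left to right, with the weights of the form `qInner`.
-/
lemma noninv_revPerm_trans {N : ℕ} (σ : Equiv.Perm (Fin N)) :
    noninv ((Fin.revPerm : Equiv.Perm (Fin N)).trans σ) = inv σ := by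
  unfold noninv inv
  refine Finset.card_equiv ((Equiv.prodComm _ _).trans (Fin.revPerm.prodCongr Fin.revPerm))
    (fun p => ?_)
  simp [Fin.revPerm_apply, Fin.rev_lt_rev]

lemma star_prod_ofFn [StarRing A] {N : ℕ} (g : Fin N → A) :
    star (List.ofFn g).prod = (List.ofFn fun x => star (g x.rev)).prod := by
  induction N with
  | zero => simp
  | succ N ih =>
    rw [List.ofFn_succ, List.prod_cons, star_mul, ih, List.ofFn_succ']
    simp [List.concat_eq_append, Fin.rev_castSucc, Fin.rev_last]

end TwoBlocks

/-! ### Increments of the Brownian motion -/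

section Brownian

variable {H : Type*} [NormedAddCommGroup H] [InnerProductSpace ℂ H] [CompleteSpace H]
  {W : WStarProbabilitySpace H} {q : ℝ} {X : ℝ≥0 → W.Elem}

lemma IsQBrownianMotion.isWick (hX : IsQBrownianMotion W q X) :
    IsWick W.trace q X (fun s t => ((min s t : ℝ≥0) : ℝ)) := by
  intro r k
  rcases Nat.eq_zero_or_pos r with rfl | hr
  -- The moments of `X` are prescribed for nonempty words only. For the empty word both sides are
  -- `1`: the trace is normalized and there is one empty pairing.
  · have : Unique (Pairing 0) :=
      { default := ⟨1, fun x => x.elim0⟩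
        uniq := fun π => Subtype.ext (Equiv.ext fun x => x.elim0) }
    rw [List.ofFn_zero, List.prod_nil, W.trace_one, Fintype.sum_unique]
    have hp : (default : Pairing 0).pairs = ∅ := by
      ext e; exact e.1.elim0
    simp [Pairing.cr, hp]
  · exact hX.moments r k hr

/-- The covariance of the increments over `(I.1, I.2)` and `(J.1, J.2)`. -/
def incrCov (I J : ℝ≥0 × ℝ≥0) : ℝ :=
  (min (I.2 : ℝ) J.2) - min (I.2 : ℝ) J.1 - min (I.1 : ℝ) J.2 + min (I.1 : ℝ) J.1

lemma IsQBrownianMotion.isWick_incr (hX : IsQBrownianMotion W q X) :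
    IsWick W.trace q (fun I : ℝ≥0 × ℝ≥0 => X I.2 - X I.1) incrCov := by
  have h := hX.isWick.linearCombination (ι := ℝ≥0 × ℝ≥0) (S := Bool)
    (fun _ b => if b then 1 else -1) (fun I b => if b then I.2 else I.1)
  convert h using 2 with I I
  · simp [sub_eq_add_neg]
  · funext J
    simp only [incrCov, Fintype.sum_bool, NNReal.coe_min]
    simp
    ring

/-- The covariance of two increments is the length of the intersection of their intervals, and the
maximum with `0` covers the case of an empty intersection. -/
lemma incrCov_eq_max {I J : ℝ≥0 × ℝ≥0} (hI : I.1 ≤ I.2) (hJ : J.1 ≤ J.2) :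
    incrCov I J = max 0 (min (I.2 : ℝ) J.2 - max (I.1 : ℝ) J.1) := by
  have h1 : (I.1 : ℝ) ≤ I.2 := hI
  have h2 : (J.1 : ℝ) ≤ J.2 := hJ
  unfold incrCov
  simp only [min_def, max_def]
  split_ifs <;> linarith

/-- The normalized increments over the cells of the grid of mesh `1 / M`. -/
def gridFamily (X : ℝ≥0 → W.Elem) (M N : ℕ) (j : Fin N) : W.Elem :=
  ((Real.sqrt M : ℝ) : ℂ) • (X ((j + 1 : ℕ) / M : ℝ≥0) - X ((j : ℕ) / M : ℝ≥0))

/-- The Kronecker symbol. -/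
def kronecker {ι : Type*} [DecidableEq ι] (i j : ι) : ℝ := if i = j then 1 else 0

/-- Distinct cells do not overlap and each has length `1 / M`, which the two factors `√M`
compensate. -/
lemma IsQBrownianMotion.isWick_grid (hX : IsQBrownianMotion W q X) {M : ℕ} (hM : 0 < M) (N : ℕ) :
    IsWick W.trace q (gridFamily X M N) kronecker := by
  have h := hX.isWick_incr.linearCombination (ι := Fin N) (S := Unit)
    (fun _ _ => Real.sqrt M)
    (fun j _ => (((j : ℕ) / M : ℝ≥0), ((j + 1 : ℕ) / M : ℝ≥0)))
  convert h using 2 with j j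
  · simp [gridFamily]
  · funext j'
    have hM' : (0 : ℝ) < M := by exact_mod_cast hM
    simp only [Finset.univ_unique, Finset.sum_const, Finset.card_singleton, one_smul]
    rw [Real.mul_self_sqrt hM'.le]
    have e : ∀ j : Fin N, ((j : ℕ) / M : ℝ≥0) ≤ ((j + 1 : ℕ) / M : ℝ≥0) := by
      intro j; gcongr; omega
    rw [incrCov_eq_max (I := (_, _)) (J := (_, _)) (e _) (e _)]
    simp only [NNReal.coe_div, NNReal.coe_natCast]
    rw [max_div_div_right hM'.le, min_div_div_right hM'.le, ← sub_div,
      mul_max_of_nonneg _ _ hM'.le, mul_zero, mul_div_cancel₀ _ hM'.ne']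
    unfold kronecker
    split_ifs with hj
    · subst hj; simp
    · have : (j : ℕ) ≠ j' := fun h => hj (Fin.ext h)
      symm
      apply max_eq_left
      rcases lt_or_gt_of_ne this with h | h
      · have h' : ((j : ℕ) + 1 : ℝ) ≤ (j' : ℕ) := by exact_mod_cast h
        have := min_le_left ((((j : ℕ) + 1 : ℕ)) : ℝ) (((j' : ℕ) + 1 : ℕ))
        have := le_max_right ((j : ℕ) : ℝ) (j' : ℕ)
        push_cast at *
        linarith
      · have h' : ((j' : ℕ) + 1 : ℝ) ≤ (j : ℕ) := by exact_mod_cast h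
        have := min_le_right ((((j : ℕ) + 1 : ℕ)) : ℝ) (((j' : ℕ) + 1 : ℕ))
        have := le_max_left ((j : ℕ) : ℝ) (j' : ℕ)
        push_cast at *
        linarith

lemma gridFamily_isSelfAdjoint (hX : IsQBrownianMotion W q X) (M N : ℕ) (j : Fin N) :
    star (gridFamily X M N j) = gridFamily X M N j := by
  unfold gridFamily
  rw [star_smul, star_sub, (hX.selfAdjoint _).star_eq, (hX.selfAdjoint _).star_eq]
  congr 1
  exact Complex.conj_ofReal _

end Brownian

/-! ### Faithful states: norms and moments of self-adjoint elements -/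

section State

variable {A : Type*} [CStarAlgebra A]

/-- A faithful state. -/
structure IsFaithfulState (φ : A →ₗ[ℂ] ℂ) : Prop where
  map_one : φ 1 = 1
  nonneg : ∀ Y, 0 ≤ (φ (Y * star Y)).re ∧ (φ (Y * star Y)).im = 0
  faithful : ∀ Y, φ (Y * star Y) = 0 → Y = 0

attribute [local instance] CStarAlgebra.spectralOrder CStarAlgebra.spectralOrderedRing

namespace IsFaithfulState

variable {φ : A →ₗ[ℂ] ℂ}

lemma map_real_smul (φ : A →ₗ[ℂ] ℂ) (c : ℝ) (Z : A) : φ (c • Z) = c * φ Z := by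
  rw [← Complex.coe_smul, map_smul, smul_eq_mul]

/-- Polarization: that `φ (Y * star Y)` is real for `Y = 1 + Z` compares the imaginary parts of `φ
Z` and `φ (star Z)`, and for `Y = 1 + i Z` their real parts. -/
lemma map_star (h : IsFaithfulState φ) (Z : A) : φ (star Z) = starRingEnd ℂ (φ Z) := by
  have h1 := (h.nonneg (1 + Z)).2
  have h2 := (h.nonneg (1 + Complex.I • Z)).2
  have h3 := (h.nonneg Z).2
  have e1 : (1 + Z) * star (1 + Z) = 1 + star Z + Z + Z * star Z := by
    simp only [star_add, star_one]; noncomm_ring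
  have e2 : (1 + Complex.I • Z) * star (1 + Complex.I • Z) =
      1 - Complex.I • star Z + Complex.I • Z + Z * star Z := by
    simp only [star_add, star_one, star_smul, mul_add, add_mul, one_mul, mul_one,
      smul_mul_smul_comm]
    simp
    abel
  rw [e1] at h1
  rw [e2] at h2
  simp only [map_add, map_sub, map_smul, h.map_one, Complex.add_im, Complex.sub_im, smul_eq_mul,
    Complex.mul_im, Complex.I_re, Complex.I_im, Complex.one_im, h3] at h1 h2
  apply Complex.ext
  · simp only [Complex.conj_re]; linarith
  · simp only [Complex.conj_im]; linarith

lemma re_nonneg (h : IsFaithfulState φ) {Z : A} (hZ : 0 ≤ Z) : 0 ≤ (φ Z).re := by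
  obtain ⟨b, rfl⟩ := CStarAlgebra.nonneg_iff_eq_star_mul_self.1 hZ
  have := (h.nonneg (star b)).1
  rwa [star_star] at this

lemma re_mono (h : IsFaithfulState φ) {Z Z' : A} (hZ : Z ≤ Z') : (φ Z).re ≤ (φ Z').re := by
  have := h.re_nonneg (sub_nonneg.2 hZ)
  rw [map_sub, Complex.sub_re] at this
  linarith

/-- This is the nonnegativity of the variance of `Z`. -/
lemma normSq_le (h : IsFaithfulState φ) (Z : A) :
    ‖φ Z‖ ^ 2 ≤ (φ (Z * star Z)).re := by
  have h1 := (h.nonneg (Z - φ Z • 1)).1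
  have e : (Z - φ Z • (1 : A)) * star (Z - φ Z • (1 : A)) = Z * star Z
      - (starRingEnd ℂ (φ Z)) • Z - φ Z • star Z + (φ Z * starRingEnd ℂ (φ Z)) • (1 : A) := by
    simp only [star_sub, star_smul, star_one, sub_mul, mul_sub, smul_mul_assoc, mul_smul_comm,
      one_mul, mul_one]
    simp only [Complex.star_def]
    abel_nf
    simp [smul_smul, mul_comm]
  rw [e] at h1
  simp only [map_add, map_sub, map_smul, h.map_one, h.map_star, smul_eq_mul, mul_one] at h1
  rw [mul_comm (starRingEnd ℂ (φ Z)) (φ Z), sub_add_cancel, Complex.mul_conj, Complex.sub_re,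
    Complex.ofReal_re, Complex.normSq_eq_norm_sq] at h1
  linarith

lemma norm_le (h : IsFaithfulState φ) (Z : A) : ‖φ Z‖ ≤ ‖Z‖ := by
  have h1 := h.normSq_le Z
  have h2 : Z * star Z ≤ algebraMap ℝ A (‖Z‖ ^ 2) := by
    have := CStarAlgebra.star_mul_le_algebraMap_norm_sq (a := star Z)
    rwa [star_star, norm_star] at this
  have h3 := h.re_mono h2
  rw [Algebra.algebraMap_eq_smul_one, map_real_smul, h.map_one, mul_one, Complex.ofReal_re] at h3
  exact abs_le_of_sq_le_sq' (h1.trans h3) (norm_nonneg _) |>.2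

/-- The norm of a self-adjoint element is bounded by the growth of its even moments. -/
lemma norm_le_of_moments (h : IsFaithfulState φ) {Z : A} (hZ : IsSelfAdjoint Z) {C : ℝ}
    (hC : 0 ≤ C) (hm : ∀ p : ℕ, 1 ≤ p → (φ (Z ^ (2 * p))).re ≤ C ^ (2 * p)) : ‖Z‖ ≤ C := by
  by_contra hlt
  push Not at hlt
  obtain ⟨c, hc1, hc2⟩ := exists_between hlt
  have hc0 : 0 < c := hC.trans_lt hc1
  -- This function vanishes exactly on `[-c, c]`. Since the norm of `Z` exceeds `c`, it is not zero
  -- on the spectrum, and by faithfulness `g(Z)²` has positive trace.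
  let g : ℝ → ℝ := fun x => max 0 (|x| - c)
  have hg : Continuous g := by fun_prop
  have hspec : ∀ x ∈ spectrum ℝ Z, |x| ≤ ‖Z‖ := fun x hx => by
    simpa using IsometricContinuousFunctionalCalculus.norm_spectrum_le (𝕜 := ℝ) Z hx hZ
  let V := cfc g Z
  have hV : star V = V := (cfc_predicate g Z : IsSelfAdjoint V)
  have hV0 : V ≠ 0 := by
    intro h0
    have h1 : (spectrum ℝ Z).EqOn g (fun _ => 0) := by
      rw [← cfc_eq_cfc_iff_eqOn (a := Z) (ha := hZ) (hf := hg.continuousOn)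
        (hg := continuousOn_const), cfc_const_zero]
      exact h0
    have h2 : ∀ x ∈ spectrum ℝ Z, ‖x‖ ≤ c := by
      intro x hx
      have h3 : max 0 (|x| - c) = 0 := h1 hx
      have := le_max_right 0 (|x| - c)
      rw [Real.norm_eq_abs]; linarith
    have h3 := norm_cfc_le (f := fun x : ℝ => x) (a := Z) hc0.le h2
    rw [cfc_id' ℝ Z] at h3
    linarith
  have hδ : 0 < (φ (V * V)).re := by
    have h1 := h.nonneg V
    rw [hV] at h1
    refine lt_of_le_of_ne h1.1 fun h2 => hV0 (h.faithful V ?_)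
    rw [hV]
    exact Complex.ext h2.symm h1.2
  -- On the spectrum `c ^ (2p) g(x)² ≤ ‖Z‖² x ^ (2p)`, since `g` is zero for `|x| ≤ c`. As `C < c`,
  -- the trace of `g(Z)²` would then be at most a geometric sequence tending to zero.
  have key : ∀ p : ℕ, 1 ≤ p → c ^ (2 * p) * (φ (V * V)).re ≤ ‖Z‖ ^ 2 * C ^ (2 * p) := by
    intro p hp
    have h1 : c ^ (2 * p) • (V * V) ≤ ‖Z‖ ^ 2 • Z ^ (2 * p) := by
      have e1 : c ^ (2 * p) • (V * V) = cfc (fun x => c ^ (2 * p) • (g x * g x)) Z := by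
        rw [cfc_smul (c ^ (2 * p)) (fun x => g x * g x) Z (by fun_prop),
          cfc_mul g g Z hg.continuousOn hg.continuousOn]
      have e2 : ‖Z‖ ^ 2 • Z ^ (2 * p) = cfc (fun x : ℝ => ‖Z‖ ^ 2 • x ^ (2 * p)) Z := by
        rw [cfc_smul (‖Z‖ ^ 2) (fun x : ℝ => x ^ (2 * p)) Z (by fun_prop), cfc_pow_id Z (2 * p) hZ]
      rw [e1, e2]
      refine cfc_mono (fun x hx => ?_) (by fun_prop) (by fun_prop)
      have hx' := hspec x hx
      simp only [smul_eq_mul, g]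
      rw [pow_mul, pow_mul, ← sq_abs x, ← pow_mul, ← pow_mul]
      rcases le_total (|x|) c with hxc | hxc
      · rw [max_eq_left (by linarith)]
        simp only [mul_zero]
        positivity
      · rw [max_eq_right (by linarith), mul_comm]
        have h2 : c ^ (2 * p) ≤ |x| ^ (2 * p) := by gcongr
        have h3 : (|x| - c) * (|x| - c) ≤ ‖Z‖ ^ 2 := by
          rw [sq]
          have : |x| - c ≤ ‖Z‖ := by linarith
          exact mul_le_mul this this (by linarith) (norm_nonneg _)
        exact mul_le_mul h3 h2 (by positivity) (by positivity)
    have h2 := h.re_mono h1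
    rw [map_real_smul, map_real_smul, Complex.re_ofReal_mul, Complex.re_ofReal_mul] at h2
    exact h2.trans (mul_le_mul_of_nonneg_left (hm p hp) (by positivity))
  have hlim : Tendsto (fun p : ℕ => ‖Z‖ ^ 2 * ((C / c) ^ 2) ^ p) atTop (𝓝 (‖Z‖ ^ 2 * 0)) := by
    refine (tendsto_pow_atTop_nhds_zero_of_lt_one (by positivity) ?_).const_mul _
    have : C / c < 1 := (div_lt_one hc0).2 hc1
    have h0 : 0 ≤ C / c := by positivity
    nlinarith
  rw [mul_zero] at hlim
  obtain ⟨p, hp, hp1⟩ := ((hlim.eventually_lt_const hδ).and (eventually_ge_atTop 1)).exists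
  have := key p hp1
  rw [← pow_mul, div_pow] at hp
  have hcp : 0 < c ^ (2 * p) := by positivity
  rw [← mul_div_assoc, div_lt_iff₀ hcp] at hp
  linarith

/-- Limits of moments of a bounded sequence of self-adjoint elements are the moments of a compactly
supported probability measure. -/
lemma exists_measure_of_tendsto_moments (h : IsFaithfulState φ) {Y : ℕ → A}
    (hY : ∀ k, IsSelfAdjoint (Y k)) {R : ℝ} (hR : ∀ k, ‖Y k‖ ≤ R) {m : ℕ → ℝ}
    (hm : ∀ r, Tendsto (fun k => (φ (Y k ^ r)).re) atTop (𝓝 (m r))) :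
    ∃ ν : Measure ℝ, IsProbabilityMeasure ν ∧ ν (Set.Icc (-R) R)ᶜ = 0 ∧
      ∀ r, ∫ x, x ^ r ∂ν = m r := by
  have hR0 : 0 ≤ R := (norm_nonneg _).trans (hR 0)
  have hRR : -R ≤ R := by linarith
  have hspec : ∀ k, ∀ x ∈ spectrum ℝ (Y k), x ∈ Set.Icc (-R) R := fun k x hx => by
    have : |x| ≤ ‖Y k‖ := by
      simpa using IsometricContinuousFunctionalCalculus.norm_spectrum_le (𝕜 := ℝ) (Y k) hx (hY k)
    exact abs_le.1 (this.trans (hR k))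
  -- Functions on `[-R, R]` are extended constantly to the line, so that one domain serves the
  -- functional calculus of all the `Y k`, whose spectra lie in that interval.
  let E : C(Set.Icc (-R) R, ℝ) → ℝ → ℝ := fun g => Set.IccExtend hRR g
  have hE : ∀ g, Continuous (E g) := fun g => g.continuous.Icc_extend'
  have hEx : ∀ (g : C(Set.Icc (-R) R, ℝ)) (x : ℝ) (hx : x ∈ Set.Icc (-R) R), E g x = g ⟨x, hx⟩ :=
    fun g x hx => Set.IccExtend_of_mem hRR g hx
  let L : ℕ → C(Set.Icc (-R) R, ℝ) → ℝ := fun k g => (φ (cfc (E g) (Y k))).re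
  have hLadd : ∀ k g g', L k (g + g') = L k g + L k g' := by
    intro k g g'
    simp only [L]
    rw [← Complex.add_re, ← map_add, ← cfc_add (Y k) (E g) (E g') (hE g).continuousOn (hE g').continuousOn]
    rfl
  have hLsmul : ∀ k (c : ℝ) g, L k (c • g) = c * L k g := by
    intro k c g
    simp only [L]
    rw [← Complex.re_ofReal_mul, ← map_real_smul, ← cfc_smul c (E g) (Y k) (hE g).continuousOn]
    rfl
  have hLnorm : ∀ k g, |L k g| ≤ ‖g‖ := by
    intro k g
    refine (Complex.abs_re_le_norm _).trans ((h.norm_le _).trans ?_)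
    refine norm_cfc_le (norm_nonneg _) fun x hx => ?_
    rw [hEx g x (hspec k x hx)]
    exact g.norm_coe_le_norm _
  have hLnonneg : ∀ k g, 0 ≤ g → 0 ≤ L k g := by
    intro k g hg
    refine h.re_nonneg (cfc_nonneg fun x hx => ?_)
    rw [hEx g x (hspec k x hx)]
    exact hg _
  have hLpoly : ∀ k (p : Polynomial ℝ), L k (p.toContinuousMapOn _) =
      p.sum fun i c => c * (φ (Y k ^ i)).re := by
    intro k p
    have e1 : cfc (E (p.toContinuousMapOn _)) (Y k) = Polynomial.aeval (Y k) p := by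
      rw [← cfc_polynomial p (Y k) (hY k)]
      refine cfc_congr fun x hx => ?_
      rw [hEx _ x (hspec k x hx)]
      rfl
    simp only [L]
    rw [e1, Polynomial.aeval_eq_sum_range, Polynomial.sum_over_range _ (by simp), map_sum,
      Complex.re_sum]
    refine Finset.sum_congr rfl fun i _ => ?_
    rw [map_real_smul, Complex.re_ofReal_mul]
  have hLsub : ∀ k g g', L k (g - g') = L k g - L k g' := by
    intro k g g'
    have := hLadd k (g - g') g'
    rw [sub_add_cancel] at this
    linarith
  -- The functionals converge on polynomials by `hm` and are contractions for the uniform norm. By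
  -- the Weierstrass theorem they converge on all continuous functions.
  have hconv : ∀ g, ∃ l, Tendsto (fun k => L k g) atTop (𝓝 l) := by
    intro g
    refine cauchySeq_tendsto_of_complete ?_
    rw [Metric.cauchySeq_iff]
    intro ε hε
    obtain ⟨p, hp⟩ := exists_polynomial_near_continuousMap (-R) R g (ε / 3) (by positivity)
    have hpc : CauchySeq fun k => L k (p.toContinuousMapOn _) := by
      refine Tendsto.cauchySeq (x := p.sum fun i c => c * m i) ?_
      simp_rw [hLpoly]
      unfold Polynomial.sum
      exact tendsto_finsetSum _ fun i _ => (hm i).const_mul _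
    obtain ⟨N, hN⟩ := Metric.cauchySeq_iff.1 hpc (ε / 3) (by positivity)
    refine ⟨N, fun i hi j hj => ?_⟩
    have h1 := hN i hi j hj
    have h2 := hLnorm i (p.toContinuousMapOn _ - g)
    have h3 := hLnorm j (p.toContinuousMapOn _ - g)
    rw [hLsub] at h2 h3
    rw [Real.dist_eq] at h1 ⊢
    have h2' := abs_le.1 (h2.trans hp.le)
    have h3' := abs_le.1 (h3.trans hp.le)
    have h1' := abs_lt.1 h1
    rw [abs_lt]
    constructor <;> linarith [h2'.1, h2'.2, h3'.1, h3'.2, h1'.1, h1'.2]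
  choose Λ₀ hΛ using hconv
  let Λ₁ : CompactlySupportedContinuousMap (Set.Icc (-R) R) ℝ →ₗ[ℝ] ℝ :=
    { toFun := fun g => Λ₀ g.toContinuousMap
      map_add' := fun g g' => by
        refine tendsto_nhds_unique (hΛ _) ?_
        have := (hΛ g.toContinuousMap).add (hΛ g'.toContinuousMap)
        simp_rw [← hLadd] at this
        exact this
      map_smul' := fun c g => by
        refine tendsto_nhds_unique (hΛ _) ?_
        have := (hΛ g.toContinuousMap).const_mul c
        simp_rw [← hLsmul] at this
        exact this }
  -- The limit functional is positive, so the Riesz–Markov theorem represents it by a measure on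
  -- `[-R, R]`. Its mass is `1` because the moment of order zero is.
  let Λ : CompactlySupportedContinuousMap (Set.Icc (-R) R) ℝ →ₚ[ℝ] ℝ :=
    PositiveLinearMap.mk₀ Λ₁ fun g hg => ge_of_tendsto' (hΛ _) fun k => hLnonneg k _ hg
  let ν₀ := RealRMK.rieszMeasure Λ
  have hint : ∀ g : C(Set.Icc (-R) R, ℝ), ∫ x, g x ∂ν₀ = Λ₀ g := fun g =>
    RealRMK.integral_rieszMeasure Λ (CompactlySupportedContinuousMap.continuousMapEquiv g)
  have hmom : ∀ r : ℕ, ∫ x : Set.Icc (-R) R, (x : ℝ) ^ r ∂ν₀ = m r := by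
    intro r
    have h1 := hint ((Polynomial.X ^ r : Polynomial ℝ).toContinuousMapOn _)
    simp only [Polynomial.toContinuousMapOn_apply, Polynomial.toContinuousMap_apply,
      Polynomial.eval_pow, Polynomial.eval_X] at h1
    rw [h1]
    refine tendsto_nhds_unique (hΛ _) ?_
    simp_rw [hLpoly]
    refine (hm r).congr fun k => ?_
    rw [← Polynomial.monomial_one_right_eq_X_pow, Polynomial.sum_monomial_index _ _ (by simp),
      one_mul]
  have hfin : IsProbabilityMeasure ν₀ := by
    have h1 := hmom 0
    have h2 : m 0 = 1 := by
      refine tendsto_nhds_unique (hm 0) ?_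
      simp [h.map_one]
    rw [h2] at h1
    simp only [pow_zero, integral_const, smul_eq_mul, mul_one] at h1
    have h3 : ν₀ Set.univ = 1 := by
      rw [Measure.real] at h1
      exact (ENNReal.toReal_eq_one_iff _).1 h1
    exact ⟨h3⟩
  have hmeas : Measurable (Subtype.val : Set.Icc (-R) R → ℝ) := measurable_subtype_coe
  refine ⟨ν₀.map Subtype.val, Measure.isProbabilityMeasure_map hmeas.aemeasurable, ?_, fun r => ?_⟩
  · rw [Measure.map_apply hmeas measurableSet_Icc.compl]
    have : (Subtype.val : Set.Icc (-R) R → ℝ) ⁻¹' (Set.Icc (-R) R)ᶜ = ∅ := by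
      ext x; simp
    rw [this, measure_empty]
  · rw [integral_map hmeas.aemeasurable (by fun_prop)]
    exact hmom r

end IsFaithfulState

end State

/-! ### Averages over finite products and Finner's inequality -/

section Average

variable {α β ι E K V : Type*} [Fintype α] [Fintype β] [Fintype ι] [Fintype E] [Fintype K]
  [Fintype V]

/-- The average of a function on a finite type. -/
def avg (g : α → ℝ) : ℝ := (∑ x, g x) / Fintype.card α

lemma avg_nonneg {g : α → ℝ} (h : ∀ x, 0 ≤ g x) : 0 ≤ avg g :=
  div_nonneg (Finset.sum_nonneg fun x _ => h x) (Nat.cast_nonneg _)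

lemma avg_mono {g h : α → ℝ} (hgh : ∀ x, g x ≤ h x) : avg g ≤ avg h := by
  unfold avg; gcongr; exact hgh _

lemma abs_avg_le (g : α → ℝ) : |avg g| ≤ avg fun x => |g x| := by
  unfold avg
  rw [abs_div, Nat.abs_cast]
  gcongr
  exact Finset.abs_sum_le_sum_abs _ _

lemma avg_const [Nonempty α] (c : ℝ) : avg (fun _ : α => c) = c := by
  unfold avg
  rw [Finset.sum_const, Finset.card_univ, nsmul_eq_mul, mul_div_assoc, mul_div_cancel₀]
  exact_mod_cast Fintype.card_ne_zero

lemma avg_mul_left (c : ℝ) (g : α → ℝ) : avg (fun x => c * g x) = c * avg g := by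
  unfold avg; rw [← Finset.mul_sum, mul_div_assoc]

lemma avg_mul_right (c : ℝ) (g : α → ℝ) : avg (fun x => g x * c) = avg g * c := by
  simp_rw [mul_comm _ c]; exact avg_mul_left c g

lemma avg_comm (g : α → β → ℝ) : avg (fun x => avg (g x)) = avg fun y => avg fun x => g x y := by
  unfold avg
  rw [← Finset.sum_div, ← Finset.sum_div, Finset.sum_comm, div_right_comm]

lemma avg_prod (g : α × β → ℝ) : avg g = avg fun x => avg fun y => g (x, y) := by
  unfold avg
  rw [← Finset.sum_div, Fintype.sum_prod_type, Fintype.card_prod, Nat.cast_mul, div_div,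
    mul_comm (Fintype.card α : ℝ)]

lemma avg_equiv (e : α ≃ β) (g : β → ℝ) : avg (fun x => g (e x)) = avg g := by
  unfold avg
  rw [Fintype.card_congr e, e.sum_comp]

lemma avg_mul_sq_le (g h : α → ℝ) :
    avg (fun x => g x * h x) ^ 2 ≤ avg (fun x => g x ^ 2) * avg fun x => h x ^ 2 := by
  unfold avg
  rw [div_pow, div_mul_div_comm, ← sq]
  gcongr
  exact Finset.sum_mul_sq_le_sq_mul_sq _ _ _

lemma avg_mul_le (g h : α → ℝ) :
    avg (fun x => g x * h x) ≤
      Real.sqrt (avg fun x => g x ^ 2) * Real.sqrt (avg fun x => h x ^ 2) := by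
  rw [← Real.sqrt_mul (avg_nonneg fun x => sq_nonneg _)]
  exact Real.le_sqrt_of_sq_le (avg_mul_sq_le g h)

/-- One step of Finner's inequality. -/
lemma avg_prod_le_of_const [Nonempty α] {N : V → α → ℝ} (hN : ∀ v x, 0 ≤ N v x) {l m : V}
    (hlm : l ≠ m) (hc : ∀ v, v ≠ l → v ≠ m → ∀ x y, N v x = N v y) :
    avg (fun x => ∏ v, N v x) ≤ ∏ v, Real.sqrt (avg fun x => N v x ^ 2) := by
  classical
  obtain ⟨x₀⟩ := ‹Nonempty α›
  have split : ∀ F : V → ℝ, ∏ v, F v = F l * (F m * ∏ v ∈ (Finset.univ.erase l).erase m, F v) := by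
    intro F
    rw [← Finset.mul_prod_erase Finset.univ F (Finset.mem_univ l),
      ← Finset.mul_prod_erase (Finset.univ.erase l) F
        (Finset.mem_erase.2 ⟨hlm.symm, Finset.mem_univ m⟩)]
  have hv : ∀ v ∈ (Finset.univ.erase l).erase m, ∀ x, N v x = N v x₀ := fun v hv x =>
    hc v (Finset.ne_of_mem_erase (Finset.mem_of_mem_erase hv)) (Finset.ne_of_mem_erase hv) _ _
  simp_rw [split]
  have e1 : ∀ x, N l x * (N m x * ∏ v ∈ (Finset.univ.erase l).erase m, N v x) =
      (N l x * N m x) * ∏ v ∈ (Finset.univ.erase l).erase m, N v x₀ := by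
    intro x
    rw [Finset.prod_congr rfl fun v h => hv v h x, mul_assoc]
  have e2 : ∏ v ∈ (Finset.univ.erase l).erase m, Real.sqrt (avg fun x => N v x ^ 2) =
      ∏ v ∈ (Finset.univ.erase l).erase m, N v x₀ := by
    refine Finset.prod_congr rfl fun v h => ?_
    have : (fun x => N v x ^ 2) = fun _ => N v x₀ ^ 2 := by
      funext x; rw [hv v h x]
    have : Nonempty α := ⟨x₀⟩
    rw [‹(fun x => N v x ^ 2) = _›, avg_const, Real.sqrt_sq (hN _ _)]
  simp_rw [e1]
  rw [avg_mul_right, e2, ← mul_assoc]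
  exact mul_le_mul_of_nonneg_right (avg_mul_le _ _) (Finset.prod_nonneg fun v _ => hN _ _)

lemma avg_fin_succ {N : ℕ} (g : (Fin (N + 1) → ι) → ℝ) :
    avg g = avg fun i => avg fun x => g (Fin.cons i x) := by
  rw [← avg_prod (fun p : ι × (Fin N → ι) => g (Fin.cons p.1 p.2)),
    ← avg_equiv (Fin.consEquiv fun _ => ι) g]
  rfl

/-- Induction on the number of variables. With the first variable frozen, the inductive hypothesis
produces partial `L²` norms. These are functions of the first variable, all constant but two, so one
Cauchy–Schwarz inequality finishes. Normalized averages are used since a constant factor then costs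
nothing. -/
lemma finner_fin [Nonempty ι] {N : ℕ} {f : V → (Fin N → ι) → ℝ} (hf : ∀ v x, 0 ≤ f v x)
    (hdep : ∀ e, ∃ l m, l ≠ m ∧ ∀ v, v ≠ l → v ≠ m → ∀ x i, f v (Function.update x e i) = f v x) :
    avg (fun x => ∏ v, f v x) ≤ ∏ v, Real.sqrt (avg fun x => f v x ^ 2) := by
  induction N with
  | zero =>
    apply le_of_eq
    have e : ∀ g : (Fin 0 → ι) → ℝ, avg g = g Fin.elim0 := by
      intro g
      have : g = fun _ => g Fin.elim0 := by
        funext x; rw [Subsingleton.elim x Fin.elim0]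
      rw [this, avg_const]
    simp_rw [e]
    exact Finset.prod_congr rfl fun v _ => (Real.sqrt_sq (hf _ _)).symm
  | succ N ih =>
    have h1 : ∀ i, avg (fun x => ∏ v, f v (Fin.cons i x)) ≤
        ∏ v, Real.sqrt (avg fun x => f v (Fin.cons i x) ^ 2) := by
      intro i
      refine ih (f := fun v x => f v (Fin.cons i x)) (fun v x => hf _ _) fun e => ?_
      obtain ⟨l, m, hlm, h⟩ := hdep e.succ
      refine ⟨l, m, hlm, fun v hl hm x i' => ?_⟩
      rw [Fin.cons_update]
      exact h v hl hm _ _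
    rw [avg_fin_succ]
    refine (avg_mono h1).trans ?_
    obtain ⟨l, m, hlm, h⟩ := hdep 0
    refine (avg_prod_le_of_const (fun v x => Real.sqrt_nonneg _) hlm ?_).trans ?_
    · intro v hl hm i j
      congr 2
      funext x
      have := h v hl hm (Fin.cons j x) i
      rw [Fin.update_cons_zero] at this
      rw [this]
    · refine le_of_eq (Finset.prod_congr rfl fun v _ => ?_)
      rw [avg_fin_succ (fun x => f v x ^ 2)]
      congr 2
      funext i
      exact Real.sq_sqrt (avg_nonneg fun x => sq_nonneg _)

/-- Finner's inequality, when each variable occurs in at most two of the functions. -/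
lemma finner [Nonempty ι] [DecidableEq E] {f : V → (E → ι) → ℝ} (hf : ∀ v x, 0 ≤ f v x)
    (hdep : ∀ e, ∃ l m, l ≠ m ∧ ∀ v, v ≠ l → v ≠ m → ∀ x i, f v (Function.update x e i) = f v x) :
    avg (fun x => ∏ v, f v x) ≤ ∏ v, Real.sqrt (avg fun x => f v x ^ 2) := by
  classical
  let e := Fintype.equivFin E
  have h := finner_fin (ι := ι) (f := fun v (x : Fin (Fintype.card E) → ι) => f v (x ∘ e))
    (fun v x => hf _ _) (fun k => by
      obtain ⟨l, m, hlm, h⟩ := hdep (e.symm k)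
      refine ⟨l, m, hlm, fun v hl hm x i => ?_⟩
      have : Function.update x k i ∘ e = Function.update (x ∘ e) (e.symm k) i := by
        have := Function.update_comp_equiv x e k i
        exact this
      rw [this]
      exact h v hl hm _ _)
  let e' : (Fin (Fintype.card E) → ι) ≃ (E → ι) := e.symm.arrowCongr (Equiv.refl ι)
  have he' : ∀ x, e' x = x ∘ e := fun x => rfl
  simp_rw [← he'] at h
  rw [avg_equiv e' (fun x => ∏ v, f v x)] at h
  simp_rw [fun v => avg_equiv e' (fun x => f v x ^ 2)] at h
  exact h

/-- The function equal to `w` on `S` and to `x` off `S`. -/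
def mix [DecidableEq E] (S : Finset E) (w x : E → ι) : E → ι := fun e => if e ∈ S then w e else x e

/-- Exchanging the coordinates in `S` of two independent copies is an involution of pairs, hence
preserves the average. -/
lemma avg_mix [Nonempty ι] [DecidableEq E] (S : Finset E) (h : (E → ι) → ℝ) :
    avg (fun x => avg fun w => h (mix S w x)) = avg h := by
  let Φ : (E → ι) × (E → ι) → (E → ι) × (E → ι) := fun p => (mix S p.2 p.1, mix S p.1 p.2)
  have hΦ : Function.Involutive Φ := by
    rintro ⟨x, w⟩
    refine Prod.ext ?_ ?_ <;>
    · funext e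
      simp only [Φ, mix]
      split_ifs <;> rfl
  rw [← avg_prod (fun p : (E → ι) × (E → ι) => h (mix S p.2 p.1))]
  have h1 := avg_equiv hΦ.toPerm (fun p : (E → ι) × (E → ι) => h p.1)
  have h2 : avg (fun p : (E → ι) × (E → ι) => h p.1) = avg h := by
    rw [avg_prod]
    simp_rw [avg_const]
  rw [← h2, ← h1]
  rfl

/-- Independence of functions of disjoint sets of variables. -/
lemma avg_mul_of_disjoint [Nonempty ι] [DecidableEq E] (S : Finset E) (g h : (E → ι) → ℝ)
    (hg : ∀ w x, g (mix S w x) = g w) (hh : ∀ w x, h (mix S w x) = h x) :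
    avg (fun x => g x * h x) = avg g * avg h := by
  rw [← avg_mix S]
  simp_rw [hg, hh, avg_mul_right, avg_mul_left]

/-- The coordinates off the range of `ε` are free and average out. -/
lemma avg_comp_injective [Nonempty ι] [DecidableEq E] [DecidableEq K] (ε : K → E) (hε : Function.Injective ε)
    (g : (K → ι) → ℝ) : avg (fun x : E → ι => g (x ∘ ε)) = avg g := by
  classical
  let e1 := Equiv.piEquivPiSubtypeProd (fun e => e ∈ Set.range ε) (fun _ => ι)
  let e2 : ({e // e ∈ Set.range ε} → ι) ≃ (K → ι) :=
    (Equiv.ofInjective ε hε).symm.arrowCongr (Equiv.refl ι)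
  have h1 := avg_equiv (e1.trans (e2.prodCongr (Equiv.refl _)))
    (fun p : (K → ι) × ({e // ¬ e ∈ Set.range ε} → ι) => g p.1)
  rw [avg_prod] at h1
  simp_rw [avg_const] at h1
  rw [← h1]
  rfl

lemma avg_map [Nonempty ι] [DecidableEq E] (S : Finset E) {k : ℕ} (hk : S.card = k) (G : Multiset ι → ℝ) :
    avg (fun x : E → ι => G (S.val.map x)) =
      avg fun y : Fin k → ι => G ((Finset.univ : Finset (Fin k)).val.map y) := by
  let e : Fin k ≃ S := (S.equivFinOfCardEq hk).symm
  rw [← avg_comp_injective (fun i => (e i : E)) (Subtype.val_injective.comp e.injective)]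
  congr 1
  funext x
  congr 1
  have h1 : S.val = (Finset.univ : Finset (Fin k)).val.map (fun i => (e i : E)) := by
    have h2 : S = Finset.univ.map (e.toEmbedding.trans (Function.Embedding.subtype _)) := by
      ext a
      simp only [Finset.mem_map, Finset.mem_univ, true_and, Function.Embedding.trans_apply,
        Equiv.coe_toEmbedding, Function.Embedding.coe_subtype]
      constructor
      · intro ha
        exact ⟨e.symm ⟨a, ha⟩, by simp⟩
      · rintro ⟨i, rfl⟩
        exact (e i).2
    conv_lhs => rw [h2]
    rfl
  rw [h1, Multiset.map_map]

end Average

/-! ### Contractions of symmetric tensors along graphs -/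

section MultisetTensor

variable {ι E V : Type*} [Fintype ι] [Fintype E] [Fintype V] [DecidableEq E] [DecidableEq V]

/-- The symmetric tensor of order `n` given by a function of multisets. -/
def symTensor (A : Multiset ι → ℝ) (n : ℕ) (j : Fin n → ι) : ℝ :=
  A ((Finset.univ : Finset (Fin n)).val.map j)

/-- The squared norm of a symmetric tensor. -/
def nrmSq (A : Multiset ι → ℝ) (n : ℕ) : ℝ := ∑ j, symTensor A n j ^ 2

/-- The squared norm of the contraction over `s` variables of a symmetric tensor of order `s + p`
with itself. -/
def contrSq (A : Multiset ι → ℝ) (s p : ℕ) : ℝ :=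
  ∑ w : Fin p → ι, ∑ w' : Fin p → ι, (∑ y : Fin s → ι,
    A ((Finset.univ : Finset (Fin p)).val.map w + (Finset.univ : Finset (Fin s)).val.map y) *
    A ((Finset.univ : Finset (Fin p)).val.map w' + (Finset.univ : Finset (Fin s)).val.map y)) ^ 2

lemma nrmSq_nonneg (A : Multiset ι → ℝ) (n : ℕ) : 0 ≤ nrmSq A n :=
  Finset.sum_nonneg fun _ _ => sq_nonneg _

lemma contrSq_nonneg (A : Multiset ι → ℝ) (s p : ℕ) : 0 ≤ contrSq A s p :=
  Finset.sum_nonneg fun _ _ => Finset.sum_nonneg fun _ _ => sq_nonneg _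

lemma avg_symTensor_sq [Nonempty ι] (A : Multiset ι → ℝ) (S : Finset E) :
    avg (fun x : E → ι => A (S.val.map x) ^ 2) =
      nrmSq A S.card / (Fintype.card ι : ℝ) ^ S.card := by
  rw [avg_map S rfl (fun s => A s ^ 2)]
  unfold avg nrmSq symTensor
  simp

lemma avg_contr_sq [Nonempty ι] (A : Multiset ι → ℝ) (S D : Finset E) :
    avg (fun w : E → ι => avg fun w' : E → ι =>
      (avg fun x : E → ι => A (S.val.map w + D.val.map x) * A (S.val.map w' + D.val.map x)) ^ 2) =
      contrSq A D.card S.card / (Fintype.card ι : ℝ) ^ (2 * (S.card + D.card)) := by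
  simp_rw [fun w w' : E → ι => avg_map D rfl (fun s => A (S.val.map w + s) * A (S.val.map w' + s))]
  simp_rw [fun w : E → ι => avg_map S rfl (fun s => (avg fun y : Fin D.card → ι =>
    A (S.val.map w + (Finset.univ : Finset (Fin D.card)).val.map y) *
    A (s + (Finset.univ : Finset (Fin D.card)).val.map y)) ^ 2)]
  rw [avg_map S rfl (fun s => avg fun w' : Fin S.card → ι => (avg fun y : Fin D.card → ι =>
    A (s + (Finset.univ : Finset (Fin D.card)).val.map y) *
    A ((Finset.univ : Finset (Fin S.card)).val.map w' +
      (Finset.univ : Finset (Fin D.card)).val.map y)) ^ 2)]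
  unfold avg contrSq
  simp only [div_pow, Fintype.card_fun, Fintype.card_fin, Nat.cast_pow]
  rw [← Finset.sum_div]
  simp_rw [← Finset.sum_div]
  rw [div_div, div_div]
  congr 1
  ring

variable {inc : V → Finset E}

lemma sum_card_inc (hinc : ∀ e, ∃ l m, l ≠ m ∧ ∀ v, e ∈ inc v ↔ v = l ∨ v = m) :
    ∑ v, (inc v).card = 2 * Fintype.card E := by
  have h1 : ∀ v, (inc v).card = ∑ e, if e ∈ inc v then 1 else 0 := by
    intro v; simp
  simp_rw [h1]
  rw [Finset.sum_comm]
  have h2 : ∀ e, (∑ v, if e ∈ inc v then 1 else 0) = 2 := by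
    intro e
    obtain ⟨l, m, hlm, h⟩ := hinc e
    rw [← Finset.card_filter]
    have : (Finset.univ.filter fun v => e ∈ inc v) = {l, m} := by
      ext v; simp [h]
    rw [this, Finset.card_pair hlm]
  simp [h2, mul_comm]

lemma map_val_congr {S : Finset E} {x y : E → ι} (h : ∀ e ∈ S, x e = y e) :
    S.val.map x = S.val.map y := Multiset.map_congr rfl h

/-- Each edge has two endpoints, so the degrees add up to twice the number of edges. Hence the
powers of `card ι` that separate sums from averages cancel: one power for each edge on the left,
half a power for each incidence on the right. -/
lemma card_pow_mul_prod [Nonempty ι]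
    (hinc : ∀ e, ∃ l m, l ≠ m ∧ ∀ v, e ∈ inc v ↔ v = l ∨ v = m) (c : V → ℝ) :
    ((Fintype.card ι : ℝ) ^ Fintype.card E) *
      ∏ v, Real.sqrt (c v / (Fintype.card ι : ℝ) ^ (inc v).card) = ∏ v, Real.sqrt (c v) := by
  have hpos : (0 : ℝ) < Fintype.card ι := by exact_mod_cast Fintype.card_pos
  have h1 : ∀ v, Real.sqrt (c v / (Fintype.card ι : ℝ) ^ (inc v).card) =
      Real.sqrt (c v) / Real.sqrt (Fintype.card ι : ℝ) ^ (inc v).card := by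
    intro v
    rw [Real.sqrt_div' _ (by positivity)]
    congr 1
    rw [Real.sqrt_eq_iff_mul_self_eq (by positivity) (by positivity), ← mul_pow,
      Real.mul_self_sqrt hpos.le]
  simp_rw [h1]
  rw [Finset.prod_div_distrib, Finset.prod_pow_eq_pow_sum, sum_card_inc hinc, pow_mul,
    Real.sq_sqrt hpos.le, mul_div_cancel₀]
  positivity

lemma sum_eq_card_mul_avg [Nonempty ι] (g : (E → ι) → ℝ) :
    ∑ x, g x = (Fintype.card ι : ℝ) ^ Fintype.card E * avg g := by
  unfold avg
  rw [Fintype.card_fun, Nat.cast_pow, mul_div_cancel₀]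
  have hpos : (0 : ℝ) < Fintype.card ι := by exact_mod_cast Fintype.card_pos
  positivity

/-- The contraction of symmetric tensors along a graph is bounded by the product of the norms. -/
lemma abs_sum_prod_le (hinc : ∀ e, ∃ l m, l ≠ m ∧ ∀ v, e ∈ inc v ↔ v = l ∨ v = m)
    (A : V → Multiset ι → ℝ) [Nonempty ι] :
    |∑ x : E → ι, ∏ v, A v ((inc v).val.map x)| ≤ ∏ v, Real.sqrt (nrmSq (A v) (inc v).card) := by
  rw [sum_eq_card_mul_avg, abs_mul, abs_of_nonneg (by positivity),
    ← card_pow_mul_prod (ι := ι) hinc (fun v => nrmSq (A v) (inc v).card)]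
  refine mul_le_mul_of_nonneg_left ((abs_avg_le _).trans ?_) (by positivity)
  simp_rw [Finset.abs_prod]
  refine (finner (f := fun v (x : E → ι) => |A v ((inc v).val.map x)|) (fun v x => abs_nonneg _)
    fun e => ?_).trans ?_
  · obtain ⟨l, m, hlm, h⟩ := hinc e
    refine ⟨l, m, hlm, fun v hl hm x i => ?_⟩
    rw [map_val_congr (y := x)]
    intro e' he'
    rw [Function.update_of_ne]
    rintro rfl
    rcases (h v).1 he' with h | h
    · exact hl h
    · exact hm h
  · simp_rw [sq_abs, avg_symTensor_sq]
    exact le_rfl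

/-- An improved bound, involving the contraction of one of the tensors with itself. -/
lemma abs_sum_prod_le_contr (hinc : ∀ e, ∃ l m, l ≠ m ∧ ∀ v, e ∈ inc v ↔ v = l ∨ v = m)
    (A : V → Multiset ι → ℝ) [Nonempty ι] {l m : V} (hlm : l ≠ m) :
    |∑ x : E → ι, ∏ v, A v ((inc v).val.map x)| ≤
      Real.sqrt (Real.sqrt (contrSq (A l) (inc l \ inc m).card (inc l ∩ inc m).card)) *
        ∏ v ∈ Finset.univ.erase l, Real.sqrt (nrmSq (A v) (inc v).card) := by
  set S := inc l ∩ inc m with hS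
  set N : ℝ := (Fintype.card ι : ℝ) with hN
  have hpos : (0 : ℝ) < N := Nat.cast_pos.2 Fintype.card_pos
  have hcard : S.card + (inc l \ inc m).card = (inc l).card :=
    Finset.card_inter_add_card_sdiff _ _
  let a : V → (E → ι) → ℝ := fun v x => A v ((inc v).val.map x)
  have hSv : ∀ v, v ≠ l → v ≠ m → ∀ e ∈ S, e ∉ inc v := by
    intro v hl hm e he hv
    obtain ⟨l', m', hlm', h⟩ := hinc e
    have h1 := (h l).1 (Finset.mem_inter.1 he).1
    have h2 := (h m).1 (Finset.mem_inter.1 he).2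
    have h3 := (h v).1 hv
    rcases h1 with rfl | rfl <;> rcases h2 with rfl | rfl <;> rcases h3 with rfl | rfl <;>
      simp_all
  have hother : ∀ v, v ≠ l → v ≠ m → ∀ w x, a v (mix S w x) = a v x := by
    intro v hl hm w x
    simp only [a]
    rw [map_val_congr (y := x)]
    intro e he
    simp only [mix]
    rw [if_neg fun h => hSv v hl hm e h he]
  -- The edges of `S` join `l` to `m` and meet no other vertex, so their labels can be averaged out
  -- first. What remains is one function `G` attached to the merged vertex.
  let G : (E → ι) → ℝ := fun x => avg fun w => a l (mix S w x) * a m (mix S w x)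
  -- The merged vertex is placed at `l`, and `m` receives the constant `1`. Every edge label still
  -- occurs in at most two factors, so Finner's inequality applies again.
  let f : V → (E → ι) → ℝ := fun v => if v = l then fun x => |G x| else
    if v = m then fun _ => 1 else fun x => |a v x|
  have split : ∀ F : V → ℝ, ∏ v, F v = F l * (F m * ∏ v ∈ (Finset.univ.erase l).erase m, F v) := by
    intro F
    rw [← Finset.mul_prod_erase Finset.univ F (Finset.mem_univ l),
      ← Finset.mul_prod_erase (Finset.univ.erase l) F
        (Finset.mem_erase.2 ⟨hlm.symm, Finset.mem_univ m⟩)]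
  have hfl : f l = fun x => |G x| := by simp [f]
  have hfm : f m = fun _ => 1 := by simp [f, hlm.symm]
  have hfv : ∀ v ∈ (Finset.univ.erase l).erase m, f v = fun x => |a v x| := by
    intro v hv
    have h1 := Finset.ne_of_mem_erase hv
    have h2 := Finset.ne_of_mem_erase (Finset.mem_of_mem_erase hv)
    simp [f, h1, h2]
  have step1 : |avg fun x => ∏ v, a v x| ≤ avg fun x => ∏ v, f v x := by
    rw [← avg_mix S]
    have e1 : ∀ x, avg (fun w => ∏ v, a v (mix S w x)) =
        G x * ∏ v ∈ (Finset.univ.erase l).erase m, a v x := by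
      intro x
      simp only [G]
      rw [← avg_mul_right]
      congr 1
      funext w
      rw [split, mul_assoc]
      congr 2
      refine Finset.prod_congr rfl fun v hv => ?_
      exact hother v (Finset.ne_of_mem_erase (Finset.mem_of_mem_erase hv))
        (Finset.ne_of_mem_erase hv) w x
    simp_rw [e1]
    refine (abs_avg_le _).trans (le_of_eq ?_)
    congr 1
    funext x
    rw [split, hfl, hfm, abs_mul, Finset.abs_prod, one_mul]
    congr 1
    exact Finset.prod_congr rfl fun v hv => by rw [hfv v hv]
  have hGdep : ∀ e, (e ∈ S ∨ (e ∉ inc l ∧ e ∉ inc m)) → ∀ x i, G (Function.update x e i) = G x := by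
    intro e he x i
    simp only [G]
    congr 1
    funext w
    have : ∀ v, (v = l ∨ v = m) →
        a v (mix S w (Function.update x e i)) = a v (mix S w x) := by
      intro v hv
      simp only [a]
      rw [map_val_congr]
      intro e' he'
      simp only [mix]
      split_ifs with h1
      · rfl
      · rw [Function.update_of_ne]
        rintro rfl
        rcases he with he | he
        · exact h1 he
        · rcases hv with rfl | rfl
          · exact he.1 he'
          · exact he.2 he'
    rw [this l (Or.inl rfl), this m (Or.inr rfl)]
  have step2 : avg (fun x => ∏ v, f v x) ≤ ∏ v, Real.sqrt (avg fun x => f v x ^ 2) := by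
    refine finner (fun v x => ?_) fun e => ?_
    · simp only [f]; split_ifs <;> positivity
    · have hav : ∀ v, e ∉ inc v → ∀ x i, |a v (Function.update x e i)| = |a v x| := by
        intro v hv x i
        simp only [a]
        rw [map_val_congr (y := x)]
        intro e' he'
        rw [Function.update_of_ne]
        rintro rfl
        exact hv he'
      obtain ⟨l', m', hlm', h⟩ := hinc e
      have fdep : ∀ v, v ≠ l → (v ≠ m → e ∉ inc v) → ∀ x i,
          f v (Function.update x e i) = f v x := by
        intro v hl hv x i
        by_cases hm : v = m
        · subst hm; rw [hfm]
        · rw [hfv v (by simp [hl, hm])]; exact hav v (hv hm) x i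
      have flS : (e ∈ S ∨ (e ∉ inc l ∧ e ∉ inc m)) → ∀ x i,
          f l (Function.update x e i) = f l x := by
        intro he x i
        rw [hfl]
        simp only
        rw [hGdep e he]
      by_cases h1 : e ∈ inc l ∨ e ∈ inc m
      · by_cases h2 : e ∈ S
        · refine ⟨l, m, hlm, fun v hl hm x i => fdep v hl (fun _ => hSv v hl hm e h2) x i⟩
        · -- exactly one of the two endpoints of `e` is `l` or `m`
          obtain ⟨b, hbl, hb⟩ : ∃ b, l ≠ b ∧ ∀ v, v ≠ l → v ≠ b → v ≠ m → e ∉ inc v := by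
            rcases h1 with h1 | h1
            · rcases (h l).1 h1 with rfl | rfl
              · exact ⟨m', hlm', fun v h3 h4 _ h5 => ((h v).1 h5).elim h3 h4⟩
              · exact ⟨l', hlm'.symm, fun v h3 h4 _ h5 => ((h v).1 h5).elim h4 h3⟩
            · rcases (h m).1 h1 with rfl | rfl
              · refine ⟨m', ?_, fun v h3 h4 h6 h5 => ((h v).1 h5).elim h6 h4⟩
                rintro rfl
                exact h2 (Finset.mem_inter.2 ⟨(h l).2 (Or.inr rfl), h1⟩)
              · refine ⟨l', ?_, fun v h3 h4 h6 h5 => ((h v).1 h5).elim h4 h6⟩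
                rintro rfl
                exact h2 (Finset.mem_inter.2 ⟨(h l).2 (Or.inl rfl), h1⟩)
          exact ⟨l, b, hbl, fun v hl hb' x i => fdep v hl (hb v hl hb') x i⟩
      · push Not at h1
        refine ⟨l', m', hlm', fun v hl hm x i => ?_⟩
        by_cases hvl : v = l
        · subst hvl; exact flS (Or.inr h1) x i
        · exact fdep v hvl (fun _ h5 => ((h v).1 h5).elim hl hm) x i
  have hamix : ∀ v, (v = l ∨ v = m) → ∀ w x,
      a v (mix S w x) = A v (S.val.map w + (inc v \ S).val.map x) := by
    intro v hv w x
    simp only [a]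
    have hSv' : S ⊆ inc v := by
      rcases hv with rfl | rfl
      · exact Finset.inter_subset_left
      · exact Finset.inter_subset_right
    congr 1
    have h1 : (inc v).val = S.val + (inc v \ S).val := by
      rw [← Finset.union_sdiff_of_subset hSv', ← Finset.disjUnion_eq_union _ _
        Finset.disjoint_sdiff, Finset.disjUnion_val,
        Finset.disjUnion_eq_union, Finset.union_sdiff_of_subset hSv']
    rw [h1, Multiset.map_add]
    congr 1
    · exact map_val_congr fun e he => by simp [mix, he]
    · exact map_val_congr fun e he => by simp [mix, (Finset.mem_sdiff.1 he).2]
  let Γ : V → (E → ι) → (E → ι) → ℝ := fun v w w' =>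
    avg fun x => a v (mix S w x) * a v (mix S w' x)
  have step3 : avg (fun x => f l x ^ 2) ≤
      Real.sqrt (contrSq (A l) (inc l \ inc m).card S.card) / N ^ (inc l).card *
        (nrmSq (A m) (inc m).card / N ^ (inc m).card) := by
    -- Squaring `G` doubles the labels of `S` into `w` and `w'`. For fixed `w, w'`, the factors of
    -- `l` and of `m` involve disjoint sets of remaining labels and are therefore independent.
    have e1 : avg (fun x => f l x ^ 2) = avg fun w => avg fun w' => Γ l w w' * Γ m w w' := by
      have e2 : ∀ x, f l x ^ 2 = avg fun w => avg fun w' =>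
          (a l (mix S w x) * a l (mix S w' x)) * (a m (mix S w x) * a m (mix S w' x)) := by
        intro x
        rw [hfl]
        simp only [sq_abs, G]
        rw [sq, ← avg_mul_right]
        congr 1
        funext w
        rw [← avg_mul_left]
        congr 1
        funext w'
        ring
      simp_rw [e2]
      rw [avg_comm]
      congr 1
      funext w
      rw [avg_comm]
      congr 1
      funext w'
      refine avg_mul_of_disjoint (inc l \ inc m) _ _ (fun u x => ?_) (fun u x => ?_)
      · simp only [hamix l (Or.inl rfl)]
        rw [map_val_congr (S := inc l \ S) (y := u)]
        intro e he
        have : e ∈ inc l \ inc m := by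
          rw [Finset.mem_sdiff] at he ⊢
          exact ⟨he.1, fun h => he.2 (Finset.mem_inter.2 ⟨he.1, h⟩)⟩
        simp [mix, Finset.mem_sdiff.1 this]
      · simp only [hamix m (Or.inr rfl)]
        rw [map_val_congr (S := inc m \ S) (y := x)]
        intro e he
        have : e ∉ inc l \ inc m := by
          rw [Finset.mem_sdiff] at he ⊢
          exact fun h => h.2 he.1
        simp only [mix]
        rw [if_neg this]
    rw [e1, ← avg_prod (fun p : (E → ι) × (E → ι) => Γ l p.1 p.2 * Γ m p.1 p.2)]
    -- Cauchy–Schwarz in `(w, w')` separates the two vertices. The factor of `l` is the norm of its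
    -- contraction over the edges not going to `m`; the factor of `m` is bounded below by its
    -- squared norm alone.
    refine (avg_mul_le _ _).trans ?_
    rw [avg_prod, avg_prod]
    have e3 : avg (fun w => avg fun w' => Γ l w w' ^ 2) =
        contrSq (A l) (inc l \ inc m).card S.card / N ^ (2 * (inc l).card) := by
      have := avg_contr_sq (A l) S (inc l \ inc m)
      rw [hcard] at this
      rw [← this]
      have hD : inc l \ S = inc l \ inc m := Finset.sdiff_inter_self_left _ _
      simp only [Γ, hamix l (Or.inl rfl), hD]
    have e4 : avg (fun w => avg fun w' => Γ m w w' ^ 2) ≤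
        (nrmSq (A m) (inc m).card / N ^ (inc m).card) ^ 2 := by
      have e5 : ∀ w w', Γ m w w' ^ 2 ≤
          (avg fun x => a m (mix S w x) ^ 2) * avg fun x => a m (mix S w' x) ^ 2 := fun w w' =>
        avg_mul_sq_le _ _
      refine (avg_mono fun w => avg_mono fun w' => e5 w w').trans (le_of_eq ?_)
      simp_rw [avg_mul_left]
      rw [avg_mul_right, avg_comm, avg_mix S (fun x => a m x ^ 2), ← sq, avg_symTensor_sq]
    have e6 : Real.sqrt (avg fun w => avg fun w' => Γ l w w' ^ 2) =
        Real.sqrt (contrSq (A l) (inc l \ inc m).card S.card) / N ^ (inc l).card := by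
      rw [e3, mul_comm 2, pow_mul, Real.sqrt_div' _ (by positivity), Real.sqrt_sq (by positivity)]
    rw [e6]
    refine mul_le_mul_of_nonneg_left ?_ (by positivity)
    refine (Real.sqrt_le_sqrt e4).trans (le_of_eq ?_)
    exact Real.sqrt_sq (div_nonneg (nrmSq_nonneg _ _) (by positivity))
  let c : V → ℝ := fun v => if v = l then Real.sqrt (contrSq (A l) (inc l \ inc m).card S.card)
    else nrmSq (A v) (inc v).card
  have hcl : c l = Real.sqrt (contrSq (A l) (inc l \ inc m).card S.card) := by simp [c]
  have hcv : ∀ v, v ≠ l → c v = nrmSq (A v) (inc v).card := fun v hv => by simp [c, hv]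
  have step4 : ∏ v, Real.sqrt (avg fun x => f v x ^ 2) ≤
      ∏ v, Real.sqrt (c v / N ^ (inc v).card) := by
    rw [split, split, ← mul_assoc, ← mul_assoc]
    refine mul_le_mul ?_ (le_of_eq (Finset.prod_congr rfl fun v hv => ?_))
      (Finset.prod_nonneg fun v _ => Real.sqrt_nonneg _) (by positivity)
    · have e7 : Real.sqrt (avg fun x => f m x ^ 2) = 1 := by
        rw [hfm]; simp only [one_pow]; rw [avg_const, Real.sqrt_one]
      rw [e7, mul_one, hcl, hcv m hlm.symm, ← Real.sqrt_mul (by positivity)]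
      exact Real.sqrt_le_sqrt step3
    · rw [hfv v hv, hcv v (Finset.ne_of_mem_erase (Finset.mem_of_mem_erase hv))]
      simp only [sq_abs, a]
      rw [avg_symTensor_sq]
  rw [sum_eq_card_mul_avg, abs_mul, abs_of_nonneg (by positivity)]
  have fin : ∏ v, Real.sqrt (c v) =
      Real.sqrt (Real.sqrt (contrSq (A l) (inc l \ inc m).card S.card)) *
        ∏ v ∈ Finset.univ.erase l, Real.sqrt (nrmSq (A v) (inc v).card) := by
    rw [← Finset.mul_prod_erase Finset.univ _ (Finset.mem_univ l), hcl]
    congr 1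
    exact Finset.prod_congr rfl fun v hv => by rw [hcv v (Finset.ne_of_mem_erase hv)]
  rw [← fin, ← card_pow_mul_prod (ι := ι) hinc c]
  exact mul_le_mul_of_nonneg_left (step1.trans (step2.trans step4)) (by positivity)

end MultisetTensor

/-! ### Networks as graph sums: blocks are vertices, pairs are edges -/

section Network

variable {ι : Type*} [Fintype ι] [DecidableEq ι]

/-- Functions on the points that are constant on the pairs are functions on the pairs. -/
lemma sum_mul_prod_kronecker {T : Type*} [LinearOrder T] [Fintype T] (π : PairingOn T)
    (G : (T → ι) → ℝ) :
    ∑ J : T → ι, G J * ∏ p ∈ opens π, kronecker (J p) (J (π.1 p)) =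
      ∑ x : {p : T // p < π.1 p} → ι, G (x ∘ edge π) := by
  symm
  -- A labelling of the points that is not constant on some pair has weight zero; the others come
  -- from labellings of the pairs.
  refine Fintype.sum_of_injective (fun x : {p : T // p < π.1 p} → ι => x ∘ edge π) ?_ _ _ ?_ ?_
  · intro x y h
    funext e
    have := congrFun h e.1
    simpa [edge_of_lt e.2] using this
  · intro J hJ
    by_contra hne
    have hp : ∀ p ∈ opens π, J p = J (π.1 p) := by
      intro p hp
      by_contra hne'
      refine hne ?_
      rw [Finset.prod_eq_zero hp, mul_zero]
      simp [kronecker, hne']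
    refine hJ ⟨fun e => J e.1, ?_⟩
    funext p
    simp only [Function.comp_apply]
    rcases (edge_eq_iff π p _).1 rfl with h | h
    · rw [← h]
    · conv_rhs => rw [h]
      exact hp _ (mem_opens.2 (edge π p).2)
  · intro x
    rw [Finset.prod_eq_one, mul_one]
    intro p hp
    simp [kronecker, edge_partner]

variable {r : ℕ} {n : Fin r → ℕ}

/-- Functions on the points are families of functions on the blocks. -/
def blockCurry (n : Fin r → ℕ) (ι : Type*) : (Pts n → ι) ≃ (∀ l, Fin (n l) → ι) where
  toFun J l i := J (Pts.mk l i)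
  invFun K p := K p.1 p.2
  left_inv _ := rfl
  right_inv _ := rfl

lemma network_kronecker (a : ∀ l, (Fin (n l) → ι) → ℝ) (π : PairingOn (Pts n)) :
    network kronecker a π = ∑ x : {p : Pts n // p < π.1 p} → ι,
      ∏ l, a l (fun i => x (edge π (Pts.mk l i))) := by
  refine Eq.trans ?_ (sum_mul_prod_kronecker π (fun J => ∏ l, a l (fun i => J (Pts.mk l i))))
  unfold network
  rw [← (blockCurry n ι).sum_comp]
  rfl

lemma nodup_map_univ_iff {k : ℕ} (j : Fin k → ι) :
    ((Finset.univ : Finset (Fin k)).val.map j).Nodup ↔ Function.Injective j := by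
  constructor
  · intro h x y hxy
    exact Multiset.inj_on_of_nodup_map h x (Finset.mem_univ x) y (Finset.mem_univ y) hxy
  · intro h
    exact Multiset.Nodup.map h (Finset.nodup _)

/-- A pair inside a block forces two equal labels in one tensor, which vanishes on the diagonals. -/
lemma network_eq_zero_of_inner {a : ∀ l, (Fin (n l) → ι) → ℝ}
    (ha : ∀ l j, a l j ≠ 0 → Function.Injective j) {π : PairingOn (Pts n)} {p : Pts n}
    (hp : (π.1 p).1 = p.1) : network kronecker a π = 0 := by
  rw [network_kronecker]
  refine Finset.sum_eq_zero fun x _ => ?_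
  obtain ⟨l, i⟩ := p
  obtain ⟨k, hk⟩ : ∃ k, π.1 (Pts.mk l i) = Pts.mk l k := by
    change (π.1 (Pts.mk l i)).1 = l at hp
    generalize π.1 (Pts.mk l i) = z at hp
    obtain ⟨m, k⟩ := z
    change m = l at hp
    subst hp
    exact ⟨k, rfl⟩
  refine Finset.prod_eq_zero (Finset.mem_univ l) ?_
  by_contra hne
  have h1 := ha l _ hne
  have h2 : i = k := by
    apply h1
    simp only
    rw [← hk, edge_partner]
  subst h2
  exact (π.2 _).2 hk

/-- The pairs that meet the block `l`. -/
def incident (π : PairingOn (Pts n)) (l : Fin r) : Finset {p : Pts n // p < π.1 p} :=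
  Finset.univ.image fun i => edge π (Pts.mk l i)

lemma edge_injective {π : PairingOn (Pts n)} (h : ∀ p, (π.1 p).1 ≠ p.1) (l : Fin r) :
    Function.Injective fun i : Fin (n l) => edge π (Pts.mk l i) := by
  intro i k hik
  rcases (edge_eq_edge_iff π _ _).1 hik with h1 | h1
  · exact Pts.mk_injective _ h1
  · exact absurd (congrArg Sigma.fst h1).symm (h (Pts.mk l k))

lemma card_incident {π : PairingOn (Pts n)} (h : ∀ p, (π.1 p).1 ≠ p.1) (l : Fin r) :
    (incident π l).card = n l := by
  unfold incident
  rw [Finset.card_image_of_injective _ (edge_injective h l), Finset.card_univ, Fintype.card_fin]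

lemma mem_incident {π : PairingOn (Pts n)} (e : {p : Pts n // p < π.1 p}) (v : Fin r) :
    e ∈ incident π v ↔ v = e.1.1 ∨ v = (π.1 e.1).1 := by
  unfold incident
  simp only [Finset.mem_image, Finset.mem_univ, true_and, edge_eq_iff]
  constructor
  · rintro ⟨i, h | h⟩
    · exact Or.inl (congrArg Sigma.fst h)
    · exact Or.inr (congrArg Sigma.fst h)
  · rintro (rfl | rfl)
    · exact ⟨e.1.2, Or.inl rfl⟩
    · exact ⟨(π.1 e.1).2, Or.inr rfl⟩

lemma incident_spec {π : PairingOn (Pts n)} (h : ∀ p, (π.1 p).1 ≠ p.1) :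
    ∀ e, ∃ l m, l ≠ m ∧ ∀ v, e ∈ incident π v ↔ v = l ∨ v = m := fun e =>
  ⟨e.1.1, (π.1 e.1).1, (h e.1).symm, fun v => mem_incident e v⟩

/-- A symmetric tensor sees only the multiset of the labels of the edges at its vertex. This brings
networks into the form to which the graph inequalities apply. -/
lemma network_symTensor {π : PairingOn (Pts n)} (h : ∀ p, (π.1 p).1 ≠ p.1)
    (A : Fin r → Multiset ι → ℝ) :
    network kronecker (fun l => symTensor (A l) (n l)) π =
      ∑ x : {p : Pts n // p < π.1 p} → ι, ∏ l, A l ((incident π l).val.map x) := by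
  rw [network_kronecker]
  refine Finset.sum_congr rfl fun x _ => Finset.prod_congr rfl fun l _ => ?_
  unfold symTensor incident
  rw [Finset.image_val_of_injOn (edge_injective h l).injOn, Multiset.map_map]
  rfl

lemma symTensor_injective_of_ne_zero {A : Multiset ι → ℝ} (hA : ∀ s, A s ≠ 0 → s.Nodup) (k : ℕ)
    (j : Fin k → ι) (hj : symTensor A k j ≠ 0) : Function.Injective j :=
  (nodup_map_univ_iff j).1 (hA _ hj)

/-- All contractions along pairings are bounded by the product of the norms. -/
lemma abs_network_le [Nonempty ι] (A : Fin r → Multiset ι → ℝ)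
    (hA : ∀ l s, A l s ≠ 0 → s.Nodup) (π : PairingOn (Pts n)) :
    |network kronecker (fun l => symTensor (A l) (n l)) π| ≤
      ∏ l, Real.sqrt (nrmSq (A l) (n l)) := by
  by_cases h : ∀ p, (π.1 p).1 ≠ p.1
  · rw [network_symTensor h]
    have := abs_sum_prod_le (ι := ι) (incident_spec h) A
    simp_rw [card_incident h] at this
    exact this
  · push Not at h
    obtain ⟨p, hp⟩ := h
    rw [network_eq_zero_of_inner (fun l => symTensor_injective_of_ne_zero (hA l) _) hp, abs_zero]
    exact Finset.prod_nonneg fun _ _ => Real.sqrt_nonneg _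

/-- The improved bound for pairings that do not match whole blocks. -/
lemma abs_network_le_contr (π : PairingOn (Pts n)) (h : ∀ p, (π.1 p).1 ≠ p.1)
    (hn : ∀ l, 1 ≤ n l) (hρ : ∀ ρ : Pairing r, ¬ Over π ρ) :
    ∃ l p, 1 ≤ p ∧ p < n l ∧ ∀ (κ : Type) [Fintype κ] [DecidableEq κ] [Nonempty κ]
      (A : Fin r → Multiset κ → ℝ),
      |network kronecker (fun l => symTensor (A l) (n l)) π| ≤
        Real.sqrt (Real.sqrt (contrSq (A l) (n l - p) p)) *
          ∏ v ∈ Finset.univ.erase l, Real.sqrt (nrmSq (A v) (n v)) := by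
  -- If every block were sent into a single block, the induced map of the blocks would be a pairing
  -- over which `π` lies. So some block `l` is connected to two others.
  obtain ⟨l, x, y, hxy⟩ : ∃ l, ∃ x y, (π.1 (Pts.mk l x)).1 ≠ (π.1 (Pts.mk l y)).1 := by
    by_contra hc
    push Not at hc
    let s : Fin r → Fin r := fun l => (π.1 (Pts.mk l ⟨0, hn l⟩)).1
    have hs : ∀ p : Pts n, (π.1 p).1 = s p.1 := fun p => hc p.1 p.2 _
    have hss : ∀ l, s (s l) = l := by
      intro l
      have h1 := hs (π.1 (Pts.mk l ⟨0, hn l⟩))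
      rw [(π.2 _).1, hs] at h1
      exact h1.symm
    refine hρ ⟨Function.Involutive.toPerm s hss, fun l => ⟨hss l, ?_⟩⟩ hs
    exact h (Pts.mk l ⟨0, hn l⟩)
  set m := (π.1 (Pts.mk l x)).1 with hm
  have hlm : l ≠ m := (h (Pts.mk l x)).symm
  have hc : (incident π l \ incident π m).card = n l - (incident π l ∩ incident π m).card := by
    rw [← card_incident h l, ← Finset.card_inter_add_card_sdiff (incident π l) (incident π m)]
    omega
  -- The witness is the number of edges between `l` and one neighbour `m`: positive because of `x`,
  -- smaller than `n l` because of `y`. It depends on `π` only, not on the tensors, which allows the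
  -- tensors to vary along a sequence.
  refine ⟨l, (incident π l ∩ incident π m).card, ?_, ?_, fun κ _ _ _ A => ?_⟩
  · refine Finset.card_pos.2 ⟨edge π (Pts.mk l x), Finset.mem_inter.2 ⟨?_, ?_⟩⟩
    · exact Finset.mem_image.2 ⟨x, Finset.mem_univ _, rfl⟩
    · rw [← edge_partner]
      exact Finset.mem_image.2 ⟨(π.1 (Pts.mk l x)).2, Finset.mem_univ _, rfl⟩
  · rw [← card_incident h l]
    refine Finset.card_lt_card (Finset.ssubset_iff_subset_ne.2 ⟨Finset.inter_subset_left, ?_⟩)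
    intro heq
    have h1 : edge π (Pts.mk l y) ∈ incident π l := Finset.mem_image.2 ⟨y, Finset.mem_univ _, rfl⟩
    rw [← heq] at h1
    have h2 := (mem_incident _ _).1 (Finset.mem_inter.1 h1).2
    rcases (edge_eq_iff π (Pts.mk l y) _).1 rfl with h3 | h3
    · rw [← h3] at h2
      rcases h2 with h2 | h2
      · exact hlm h2.symm
      · exact hxy h2
    · have h4 : π.1 (Pts.mk l y) = (edge π (Pts.mk l y)).1 := by
        rw [← (π.2 (edge π (Pts.mk l y)).1).1, ← h3]
      rw [← h4, (π.2 _).1] at h2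
      rcases h2 with h2 | h2
      · exact hxy h2
      · exact hlm h2.symm
  · rw [network_symTensor h]
    have := abs_sum_prod_le_contr (ι := κ) (incident_spec h) A hlm
    rw [hc] at this
    simp_rw [card_incident h] at this
    exact this

end Network

/-! ### Operator norm of the integrals of tensors -/

section OperatorNorm

variable {H : Type*} [NormedAddCommGroup H] [InnerProductSpace ℂ H] [CompleteSpace H]
  {W : WStarProbabilitySpace H} {q : ℝ} {X : ℝ≥0 → W.Elem}

/-- The algebra equals its bicommutant, and centralizers are closed in norm. This makes it a
`C*`-algebra, with continuous functional calculus and complete norm. -/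
lemma WStarProbabilitySpace.isClosed_algebra (W : WStarProbabilitySpace H) :
    IsClosed (W.algebra.toStarSubalgebra : Set (H →L[ℂ] H)) := by
  have h : (W.algebra.toStarSubalgebra : Set (H →L[ℂ] H)) =
      Set.centralizer (Set.centralizer (W.algebra : Set (H →L[ℂ] H))) :=
    W.algebra.centralizer_centralizer.symm
  rw [h]
  exact Set.isClosed_centralizer _

instance (W : WStarProbabilitySpace H) : CStarAlgebra W.Elem :=
  StarSubalgebra.cstarAlgebra (h_closed := W.isClosed_algebra) W.algebra.toStarSubalgebra

lemma WStarProbabilitySpace.isFaithfulState (W : WStarProbabilitySpace H) :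
    IsFaithfulState W.trace where
  map_one := W.trace_one
  nonneg := W.trace_nonneg
  faithful := W.trace_faithful

/-- The adjoint reverses each word, and the symmetry of the tensor absorbs the reversal. -/
lemma tensorIntegral_isSelfAdjoint {ι : Type*} [Fintype ι] {Y : ι → W.Elem}
    (hY : ∀ j, star (Y j) = Y j) (A : Multiset ι → ℝ) (n : ℕ) :
    IsSelfAdjoint (tensorIntegral Y (symTensor A n)) := by
  unfold IsSelfAdjoint tensorIntegral
  rw [star_sum]
  refine Fintype.sum_equiv (Fin.revPerm.arrowCongr (Equiv.refl ι)) _ _ fun j => ?_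
  rw [star_smul, star_prod_ofFn]
  simp_rw [hY]
  have h1 : symTensor A n (Fin.revPerm.arrowCongr (Equiv.refl ι) j) = symTensor A n j := by
    unfold symTensor
    congr 1
    have : (Fin.revPerm.arrowCongr (Equiv.refl ι) j) = j ∘ Fin.revPerm := rfl
    rw [this, ← Multiset.map_map]
    congr 1
    exact congrArg Finset.val (Finset.map_univ_equiv (Fin.revPerm (n := n)))
  rw [h1]
  congr 1
  exact Complex.conj_ofReal _

/-- The generating sum of crossings is a moment of `X 1`. -/
lemma IsQBrownianMotion.sum_crossings_le (hX : IsQBrownianMotion W q X) {T : Type*} [LinearOrder T]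
    [Fintype T] : ∑ π : PairingOn T, q ^ crossings π ≤ ‖X 1‖ ^ Fintype.card T := by
  let e : Fin (Fintype.card T) ≃o T := Fintype.orderIsoFinOfCardEq _ rfl
  have h1 := sum_pairing_congr e q (fun _ _ => 1)
  have h2 := hX.isWick (Fintype.card T) (fun _ => 1)
  simp only [min_self, NNReal.coe_one, Finset.prod_const_one, mul_one, List.ofFn_const,
    List.prod_replicate] at h1 h2
  rw [← h1]
  have h3 : ‖W.trace (X 1 ^ Fintype.card T)‖ ≤ ‖X 1‖ ^ Fintype.card T := by
    rcases Nat.eq_zero_or_pos (Fintype.card T) with h0 | h0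
    · simp [h0, W.trace_one]
    · exact (W.isFaithfulState.norm_le _).trans (norm_pow_le' _ h0)
  rw [h2, Complex.norm_real] at h3
  exact (le_abs_self _).trans h3

lemma card_pts {r : ℕ} (n : Fin r → ℕ) : Fintype.card (Pts n) = ∑ l, n l := by
  have : Fintype.card (Pts n) = Fintype.card ((l : Fin r) × Fin (n l)) := rfl
  rw [this, Fintype.card_sigma]
  simp

/-- The operator norm of a multiple integral is controlled by the norm of its kernel. -/
lemma IsQBrownianMotion.norm_tensorIntegral_le (hX : IsQBrownianMotion W q X) (hq : 0 ≤ q)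
    {M N : ℕ} (hM : 0 < M) (hN : 0 < N) {A : Multiset (Fin N) → ℝ} (hA : ∀ s, A s ≠ 0 → s.Nodup)
    (n : ℕ) :
    ‖tensorIntegral (gridFamily X M N) (symTensor A n)‖ ≤ ‖X 1‖ ^ n * Real.sqrt (nrmSq A n) := by
  have : Nonempty (Fin N) := ⟨⟨0, hN⟩⟩
  refine W.isFaithfulState.norm_le_of_moments
    (tensorIntegral_isSelfAdjoint (gridFamily_isSelfAdjoint hX M N) A n) (by positivity)
    fun p _ => ?_
  have h1 := (hX.isWick_grid hM N).tensors (fun _ : Fin (2 * p) => n) (fun _ => symTensor A n)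
  rw [List.ofFn_const, List.prod_replicate] at h1
  rw [h1, Complex.ofReal_re]
  -- The signs of the networks are unknown; nonnegativity of `q` is what allows each to be replaced
  -- by its absolute value without touching the weights.
  have h2 : ∀ π : PairingOn (Pts fun _ : Fin (2 * p) => n),
      q ^ crossings π * network kronecker (fun _ => symTensor A n) π ≤
        q ^ crossings π * Real.sqrt (nrmSq A n) ^ (2 * p) := by
    intro π
    refine mul_le_mul_of_nonneg_left ((le_abs_self _).trans ?_) (by positivity)
    have := abs_network_le (n := fun _ : Fin (2 * p) => n) (fun _ => A) (fun _ => hA) π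
    simpa using this
  refine (Finset.sum_le_sum fun π _ => h2 π).trans ?_
  rw [← Finset.sum_mul, mul_pow]
  refine mul_le_mul_of_nonneg_right ?_ (by positivity)
  -- The sum of `q ^ crossings` over the pairings of `2pn` points is the moment of order `2pn` of `X
  -- 1`. Being at most `‖X 1‖ ^ (2pn)`, it has exactly the growth that the moment criterion for
  -- norms requires.
  have h3 := hX.sum_crossings_le (T := Pts fun _ : Fin (2 * p) => n)
  rw [card_pts] at h3
  simpa [← pow_mul, mul_comm] using h3

end OperatorNorm

/-! ### Square-integrable kernels -/

section Glue

variable {α β γ Y : Type*}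

/-- The function on `γ ≃ α ⊕ β` with given restrictions. -/
def glue (e : α ⊕ β ≃ γ) (u : α → Y) (s : β → Y) : γ → Y := fun i => Sum.elim u s (e.symm i)

/-- Functions on `γ ≃ α ⊕ β` are pairs of functions. -/
def glueEquiv (e : α ⊕ β ≃ γ) : (α → Y) × (β → Y) ≃ (γ → Y) where
  toFun p := glue e p.1 p.2
  invFun t := (fun i => t (e (Sum.inl i)), fun i => t (e (Sum.inr i)))
  left_inv p := by simp [glue]
  right_inv t := by
    funext i
    simp only [glue]
    obtain ⟨x, rfl⟩ := e.surjective i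
    rcases x with x | x <;> simp

lemma prod_glue [Fintype α] [Fintype β] [Fintype γ] {R Z : Type*} [CommMonoid R]
    (e : α ⊕ β ≃ γ) (g : Y → Z → R) (u : α → Y) (s : β → Y) (u' : α → Z) (s' : β → Z) :
    ∏ i, g (glue e u s i) (glue e u' s' i) = (∏ i, g (u i) (u' i)) * ∏ i, g (s i) (s' i) := by
  rw [← e.prod_comp, Fintype.prod_sum_type]
  simp [glue]

lemma map_glue {a b n : ℕ} (e : Fin a ⊕ Fin b ≃ Fin n) (u : Fin a → Y) (s : Fin b → Y) :
    (Finset.univ : Finset (Fin n)).val.map (glue e u s) =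
      (Finset.univ : Finset (Fin a)).val.map u + (Finset.univ : Finset (Fin b)).val.map s := by
  have h1 : (Finset.univ : Finset (Fin n)).val =
      (Finset.univ : Finset (Fin a ⊕ Fin b)).val.map e :=
    (congrArg Finset.val (Finset.map_univ_equiv e)).symm
  rw [h1, Multiset.map_map]
  have h2 : (Finset.univ : Finset (Fin a ⊕ Fin b)).val =
      (Finset.univ : Finset (Fin a)).val.map Sum.inl +
        (Finset.univ : Finset (Fin b)).val.map Sum.inr := rfl
  rw [h2, Multiset.map_add, Multiset.map_map, Multiset.map_map]
  congr 1 <;>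
  · refine Multiset.map_congr rfl fun i _ => ?_
    simp [glue]

end Glue

/-! ### The space of kernels and continuity of the `q`-deformed form -/

section Kernels

instance (n : ℕ) : SigmaFinite (orthant n) := by unfold orthant; infer_instance

lemma measurePreserving_glue {a b n : ℕ} (e : Fin a ⊕ Fin b ≃ Fin n) :
    MeasurePreserving (fun p : (Fin a → ℝ) × (Fin b → ℝ) => glue e p.1 p.2)
      ((orthant a).prod (orthant b)) (orthant n) := by
  have h1 := measurePreserving_sumPiEquivProdPi_symm (X := fun _ : Fin a ⊕ Fin b => ℝ)
    (fun _ => (volume : Measure ℝ).restrict (Set.Ici 0))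
  have h2 := measurePreserving_piCongrLeft (α := fun _ : Fin n => ℝ)
    (fun _ => (volume : Measure ℝ).restrict (Set.Ici 0)) e
  have h3 := h2.comp h1
  have h4 : (MeasurableEquiv.piCongrLeft (fun _ : Fin n => ℝ) e ∘
      (MeasurableEquiv.sumPiEquivProdPi fun _ : Fin a ⊕ Fin b => ℝ).symm :
        (Fin a → ℝ) × (Fin b → ℝ) → Fin n → ℝ) = fun p => glue e p.1 p.2 := by
    funext p i
    obtain ⟨x, rfl⟩ := e.surjective i
    rcases x with x | x
    · refine (Equiv.piCongrLeft_sumInl (fun _ : Fin n => ℝ) e p.1 p.2 x).trans ?_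
      simp [glue]
    · refine (Equiv.piCongrLeft_sumInr (fun _ : Fin n => ℝ) e p.1 p.2 x).trans ?_
      simp [glue]
  rw [← h4]
  exact h3

lemma measurePreserving_perm {n : ℕ} (σ : Equiv.Perm (Fin n)) :
    MeasurePreserving (fun t : Fin n → ℝ => t ∘ σ) (orthant n) (orthant n) := by
  have h2 := measurePreserving_piCongrLeft (α := fun _ : Fin n => ℝ)
    (fun _ => (volume : Measure ℝ).restrict (Set.Ici 0)) σ.symm
  have : (MeasurableEquiv.piCongrLeft (fun _ : Fin n => ℝ) σ.symm : (Fin n → ℝ) → (Fin n → ℝ)) =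
      fun t => t ∘ σ := by
    funext t i
    have := MeasurableEquiv.piCongrLeft_apply_apply (β := fun _ : Fin n => ℝ) σ.symm t (σ i)
    rwa [Equiv.symm_apply_apply] at this
  rw [this] at h2
  exact h2

/-- The norm of a kernel. -/
def l2norm {α : Type*} [MeasurableSpace α] (μ : Measure α) (f : α → ℝ) : ℝ :=
  (eLpNorm f 2 μ).toReal

section General

variable {α : Type*} [MeasurableSpace α] {μ : Measure α} {f g : α → ℝ}

lemma l2norm_nonneg (f : α → ℝ) : 0 ≤ l2norm μ f := ENNReal.toReal_nonneg

lemma l2norm_sq (hf : MemLp f 2 μ) : l2norm μ f ^ 2 = ∫ x, f x ^ 2 ∂μ := by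
  have h := hf.eLpNorm_eq_integral_rpow_norm (by norm_num) (by norm_num)
  unfold l2norm
  rw [h]
  have hn : 0 ≤ ∫ x, f x ^ 2 ∂μ := integral_nonneg fun x => sq_nonneg _
  simp only [ENNReal.toReal_ofNat, Real.norm_eq_abs, Real.rpow_two, sq_abs]
  rw [ENNReal.toReal_ofReal (by positivity), ← Real.rpow_two, ← Real.rpow_mul hn]
  norm_num

lemma integrable_mul_of_memLp (hf : MemLp f 2 μ) (hg : MemLp g 2 μ) :
    Integrable (fun x => f x * g x) μ := hf.integrable_mul hg

lemma abs_integral_mul_le (hf : MemLp f 2 μ) (hg : MemLp g 2 μ) :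
    |∫ x, f x * g x ∂μ| ≤ l2norm μ f * l2norm μ g := by
  have h1 : eLpNorm (fun x => f x * g x) 1 μ ≤ eLpNorm f 2 μ * eLpNorm g 2 μ :=
    by
    have := eLpNorm_le_eLpNorm_mul_eLpNorm_of_nnnorm (p := 2) (q := 2) (r := 1) hf.1 hg.1
      (fun x y => x * y) 1 (.of_forall fun x => by rw [nnnorm_mul, one_mul])
    rwa [ENNReal.coe_one, one_mul] at this
  rw [← Real.norm_eq_abs]
  refine (norm_integral_le_integral_norm _).trans ?_
  rw [integral_norm_eq_lintegral_enorm (integrable_mul_of_memLp hf hg).1,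
    ← eLpNorm_one_eq_lintegral_enorm]
  unfold l2norm
  rw [← ENNReal.toReal_mul]
  exact ENNReal.toReal_mono (ENNReal.mul_ne_top hf.2.ne hg.2.ne) h1

lemma l2norm_add_le (hf : MemLp f 2 μ) (hg : MemLp g 2 μ) :
    l2norm μ (fun x => f x + g x) ≤ l2norm μ f + l2norm μ g := by
  unfold l2norm
  rw [← ENNReal.toReal_add hf.2.ne hg.2.ne]
  exact ENNReal.toReal_mono (ENNReal.add_ne_top.2 ⟨hf.2.ne, hg.2.ne⟩)
    (eLpNorm_add_le hf.1 hg.1 (by norm_num))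

lemma l2norm_sub_le (hf : MemLp f 2 μ) (hg : MemLp g 2 μ) :
    l2norm μ (fun x => f x - g x) ≤ l2norm μ f + l2norm μ g := by
  unfold l2norm
  rw [← ENNReal.toReal_add hf.2.ne hg.2.ne]
  exact ENNReal.toReal_mono (ENNReal.add_ne_top.2 ⟨hf.2.ne, hg.2.ne⟩)
    (eLpNorm_sub_le hf.1 hg.1 (by norm_num))

lemma l2norm_sub_comm (f g : α → ℝ) :
    l2norm μ (fun x => f x - g x) = l2norm μ (fun x => g x - f x) := by
  unfold l2norm
  have := eLpNorm_sub_comm f g 2 μ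
  exact congrArg ENNReal.toReal this

lemma l2norm_le_of_sub (hf : MemLp f 2 μ) (hg : MemLp g 2 μ) :
    l2norm μ f ≤ l2norm μ g + l2norm μ (fun x => f x - g x) := by
  have h := l2norm_add_le (g := fun x => f x - g x) hg (hf.sub hg)
  simp only [add_sub_cancel] at h
  exact h

end General

lemma l2norm_comp {α β : Type*} [MeasurableSpace α] [MeasurableSpace β] {μ : Measure α}
    {ν : Measure β} {φ : α → β} (hφ : MeasurePreserving φ μ ν) {f : β → ℝ}
    (hf : AEStronglyMeasurable f ν) : l2norm μ (fun x => f (φ x)) = l2norm ν f := by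
  unfold l2norm
  rw [← eLpNorm_comp_measurePreserving hf hφ]
  rfl

lemma factorial_bound_sum {n : ℕ} {q : ℝ} (hq0 : 0 ≤ q) (hq1 : q ≤ 1) :
    ∑ σ : Equiv.Perm (Fin n), q ^ inv σ ≤ n.factorial := by
  calc ∑ σ : Equiv.Perm (Fin n), q ^ inv σ ≤ ∑ σ : Equiv.Perm (Fin n), (1 : ℝ) :=
        Finset.sum_le_sum fun σ _ => pow_le_one₀ hq0 hq1
    _ = n.factorial := by simp [Fintype.card_perm]

lemma abs_qInner_le {n : ℕ} {q : ℝ} (hq0 : 0 ≤ q) (hq1 : q ≤ 1) {f g : (Fin n → ℝ) → ℝ}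
    (hf : MemLp f 2 (orthant n)) (hg : MemLp g 2 (orthant n)) :
    |qInner q f g| ≤ n.factorial * (l2norm (orthant n) f * l2norm (orthant n) g) := by
  unfold qInner
  refine (Finset.abs_sum_le_sum_abs _ _).trans ?_
  have h1 : ∀ σ : Equiv.Perm (Fin n), |q ^ inv σ * ∫ t, f (t ∘ σ) * g t ∂(orthant n)| ≤
      q ^ inv σ * (l2norm (orthant n) f * l2norm (orthant n) g) := by
    intro σ
    rw [abs_mul, abs_of_nonneg (pow_nonneg hq0 _)]
    refine mul_le_mul_of_nonneg_left ?_ (pow_nonneg hq0 _)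
    have := abs_integral_mul_le (hf.comp_measurePreserving (measurePreserving_perm σ)) hg
    rwa [show l2norm (orthant n) (f ∘ fun t => t ∘ σ) = l2norm (orthant n) f from
      l2norm_comp (measurePreserving_perm σ) hf.1] at this
  refine (Finset.sum_le_sum fun σ _ => h1 σ).trans ?_
  rw [← Finset.sum_mul]
  exact mul_le_mul_of_nonneg_right (factorial_bound_sum hq0 hq1)
    (mul_nonneg (l2norm_nonneg _) (l2norm_nonneg _))

lemma qInner_sub_left {n : ℕ} {q : ℝ} {f f' g : (Fin n → ℝ) → ℝ}
    (hf : MemLp f 2 (orthant n)) (hf' : MemLp f' 2 (orthant n)) (hg : MemLp g 2 (orthant n)) :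
    qInner q (fun t => f t - f' t) g = qInner q f g - qInner q f' g := by
  unfold qInner
  rw [← Finset.sum_sub_distrib]
  refine Finset.sum_congr rfl fun σ _ => ?_
  have h1 : Integrable (fun t => f (t ∘ σ) * g t) (orthant n) :=
    integrable_mul_of_memLp (hf.comp_measurePreserving (measurePreserving_perm σ)) hg
  have h2 : Integrable (fun t => f' (t ∘ σ) * g t) (orthant n) :=
    integrable_mul_of_memLp (hf'.comp_measurePreserving (measurePreserving_perm σ)) hg
  rw [← mul_sub, ← integral_sub h1 h2]
  simp only [sub_mul]

lemma qInner_sub_right {n : ℕ} {q : ℝ} {f g g' : (Fin n → ℝ) → ℝ}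
    (hf : MemLp f 2 (orthant n)) (hg : MemLp g 2 (orthant n)) (hg' : MemLp g' 2 (orthant n)) :
    qInner q f (fun t => g t - g' t) = qInner q f g - qInner q f g' := by
  unfold qInner
  rw [← Finset.sum_sub_distrib]
  refine Finset.sum_congr rfl fun σ _ => ?_
  have h1 : Integrable (fun t => f (t ∘ σ) * g t) (orthant n) :=
    integrable_mul_of_memLp (hf.comp_measurePreserving (measurePreserving_perm σ)) hg
  have h2 : Integrable (fun t => f (t ∘ σ) * g' t) (orthant n) :=
    integrable_mul_of_memLp (hf.comp_measurePreserving (measurePreserving_perm σ)) hg'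
  rw [← mul_sub, ← integral_sub h1 h2]
  simp only [mul_sub]

lemma abs_qInner_sub_le {n : ℕ} {q : ℝ} (hq0 : 0 ≤ q) (hq1 : q ≤ 1)
    {f f' g g' : (Fin n → ℝ) → ℝ}
    (hf : MemLp f 2 (orthant n)) (hf' : MemLp f' 2 (orthant n))
    (hg : MemLp g 2 (orthant n)) (hg' : MemLp g' 2 (orthant n)) :
    |qInner q f g - qInner q f' g'| ≤ n.factorial *
      (l2norm (orthant n) (fun t => f t - f' t) * l2norm (orthant n) g +
        l2norm (orthant n) f' * l2norm (orthant n) (fun t => g t - g' t)) := by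
  have e : qInner q f g - qInner q f' g' =
      qInner q (fun t => f t - f' t) g + qInner q f' (fun t => g t - g' t) := by
    rw [qInner_sub_left hf hf' hg, qInner_sub_right hf' hg hg']; ring
  rw [e, mul_add]
  exact (abs_add_le _ _).trans (add_le_add (abs_qInner_le hq0 hq1 (hf.sub hf') hg)
    (abs_qInner_le hq0 hq1 hf' (hg.sub hg')))

end Kernels

/-! ### Step functions on a grid -/

section Steps

/-- The normalized indicator function of a cell of the grid. -/
def cell (M j : ℕ) (x : ℝ) : ℝ :=
  Real.sqrt M * (Set.Ioo ((j : ℝ) / M) ((j + 1 : ℕ) / M : ℝ)).indicator (fun _ => (1 : ℝ)) x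

lemma measurable_cell (M j : ℕ) : Measurable (cell M j) :=
  (measurable_const.indicator measurableSet_Ioo).const_mul _

lemma cell_mul_cell_of_ne {M i j : ℕ} (hij : i ≠ j) (x : ℝ) : cell M i x * cell M j x = 0 := by
  rcases Nat.eq_zero_or_pos M with rfl | hM
  · simp [cell]
  have hM' : (0 : ℝ) < M := by exact_mod_cast hM
  unfold cell
  by_cases h1 : x ∈ Set.Ioo ((i : ℝ) / M) ((i + 1 : ℕ) / M : ℝ)
  · by_cases h2 : x ∈ Set.Ioo ((j : ℝ) / M) ((j + 1 : ℕ) / M : ℝ)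
    · exfalso
      rw [Set.mem_Ioo, div_lt_iff₀ hM', lt_div_iff₀ hM'] at h1 h2
      have a1 : (i : ℝ) < (j + 1 : ℕ) := h1.1.trans h2.2
      have a2 : (j : ℝ) < (i + 1 : ℕ) := h2.1.trans h1.2
      have a1' : i < j + 1 := by exact_mod_cast a1
      have a2' : j < i + 1 := by exact_mod_cast a2
      omega
    · rw [Set.indicator_of_notMem h2, mul_zero, mul_zero]
  · rw [Set.indicator_of_notMem h1, mul_zero, zero_mul]

lemma integral_cell_mul_cell {M : ℕ} (hM : 0 < M) {N : ℕ} (i j : Fin N) :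
    ∫ x in Set.Ici (0 : ℝ), cell M i x * cell M j x = kronecker i j := by
  have hM' : (0 : ℝ) < M := by exact_mod_cast hM
  unfold kronecker
  split_ifs with h
  · subst h
    have e : ∀ x, cell M i x * cell M i x =
        (Set.Ioo (((i : ℕ) : ℝ) / M) (((i : ℕ) + 1 : ℕ) / M : ℝ)).indicator (fun _ => (M : ℝ)) x := by
      intro x
      unfold cell
      by_cases h1 : x ∈ Set.Ioo (((i : ℕ) : ℝ) / M) (((i : ℕ) + 1 : ℕ) / M : ℝ)
      · simp only [Set.indicator_of_mem h1, mul_one]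
        exact Real.mul_self_sqrt hM'.le
      · rw [Set.indicator_of_notMem h1, Set.indicator_of_notMem h1, mul_zero, mul_zero]
    simp_rw [e]
    rw [integral_indicator measurableSet_Ioo, setIntegral_const, Measure.real,
      Measure.restrict_apply measurableSet_Ioo, Set.inter_eq_left.2, Real.volume_Ioo, ← sub_div]
    · rw [ENNReal.toReal_ofReal]
      · push_cast
        rw [smul_eq_mul]
        field_simp
        ring
      · push_cast
        have : (((i : ℕ) : ℝ) + 1 - (i : ℕ)) = 1 := by ring
        rw [this]; positivity
    · intro x hx
      exact (div_nonneg (Nat.cast_nonneg _) hM'.le).trans hx.1.le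
  · have h' : (i : ℕ) ≠ j := fun h' => h (Fin.ext h')
    simp [cell_mul_cell_of_ne h']

variable {M N : ℕ}

/-- The step function of a tensor. -/
def stepFun (M : ℕ) {n : ℕ} (a : (Fin n → Fin N) → ℝ) (t : Fin n → ℝ) : ℝ :=
  ∑ j, a j * ∏ i, cell M (j i) (t i)

lemma measurable_stepFun {n : ℕ} (a : (Fin n → Fin N) → ℝ) : Measurable (stepFun M a) := by
  unfold stepFun
  refine Finset.measurable_sum _ fun j _ => Measurable.const_mul ?_ _
  exact Finset.measurable_prod _ fun i _ => (measurable_cell M (j i)).comp (measurable_pi_apply i)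

lemma memLp_cell (hM : 0 < M) {N : ℕ} (j : Fin N) :
    MemLp (cell M j) 2 ((volume : Measure ℝ).restrict (Set.Ici 0)) := by
  unfold cell
  refine MemLp.const_mul ?_ _
  refine memLp_indicator_const 2 measurableSet_Ioo 1 (Or.inr ?_)
  refine ((Measure.restrict_apply_le _ _).trans_lt ?_).ne
  rw [Real.volume_Ioo]
  exact ENNReal.ofReal_lt_top

lemma integrable_prod_cell (hM : 0 < M) {n : ℕ} (j k : Fin n → Fin N) :
    Integrable (fun t : Fin n → ℝ => ∏ i, cell M (j i) (t i) * cell M (k i) (t i))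
      (orthant n) := by
  unfold orthant
  exact Integrable.fintype_prod (f := fun i x => cell M (j i) x * cell M (k i) x)
    (fun i => integrable_mul_of_memLp (memLp_cell hM _) (memLp_cell hM _))

/-- The normalized cells are orthonormal, hence so are their tensor products. Passing from tensors
to step functions is isometric. -/
lemma integral_stepFun_mul (hM : 0 < M) {n : ℕ} (a b : (Fin n → Fin N) → ℝ) :
    ∫ t, stepFun M a t * stepFun M b t ∂(orthant n) = ∑ j, a j * b j := by
  have e : ∀ t, stepFun M a t * stepFun M b t =
      ∑ j, ∑ k, a j * b k * ∏ i, cell M (j i) (t i) * cell M (k i) (t i) := by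
    intro t
    unfold stepFun
    rw [Finset.sum_mul_sum]
    refine Finset.sum_congr rfl fun j _ => Finset.sum_congr rfl fun k _ => ?_
    rw [Finset.prod_mul_distrib]; ring
  simp_rw [e]
  rw [integral_finsetSum _ fun j _ => integrable_finsetSum _ fun k _ =>
    (integrable_prod_cell hM j k).const_mul _]
  refine Finset.sum_congr rfl fun j _ => ?_
  rw [integral_finsetSum _ fun k _ => (integrable_prod_cell hM j k).const_mul _]
  have e2 : ∀ k : Fin n → Fin N, ∫ t, a j * b k * ∏ i, cell M (j i) (t i) * cell M (k i) (t i)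
      ∂(orthant n) = a j * b k * if j = k then 1 else 0 := by
    intro k
    rw [integral_const_mul]
    congr 1
    unfold orthant
    rw [integral_fintype_prod_eq_prod (fun i x => cell M (j i) x * cell M (k i) x)]
    simp_rw [integral_cell_mul_cell hM]
    split_ifs with h
    · subst h; simp [kronecker]
    · obtain ⟨i, hi⟩ := Function.ne_iff.1 h
      exact Finset.prod_eq_zero (Finset.mem_univ i) (by simp [kronecker, hi])
  simp_rw [e2]
  simp

lemma memLp_stepFun (hM : 0 < M) {n : ℕ} (a : (Fin n → Fin N) → ℝ) :
    MemLp (stepFun M a) 2 (orthant n) := by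
  rw [memLp_two_iff_integrable_sq (measurable_stepFun a).aestronglyMeasurable]
  have e : ∀ t, stepFun M a t ^ 2 =
      ∑ j, ∑ k, a j * a k * ∏ i, cell M (j i) (t i) * cell M (k i) (t i) := by
    intro t
    unfold stepFun
    rw [sq, Finset.sum_mul_sum]
    refine Finset.sum_congr rfl fun j _ => Finset.sum_congr rfl fun k _ => ?_
    rw [Finset.prod_mul_distrib]; ring
  simp_rw [e]
  exact integrable_finsetSum _ fun j _ => integrable_finsetSum _ fun k _ =>
    (integrable_prod_cell hM j k).const_mul _

lemma l2norm_stepFun_sq (hM : 0 < M) {n : ℕ} (a : (Fin n → Fin N) → ℝ) :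
    l2norm (orthant n) (stepFun M a) ^ 2 = ∑ j, a j ^ 2 := by
  rw [l2norm_sq (memLp_stepFun hM a)]
  simp_rw [sq]
  exact integral_stepFun_mul hM a a

lemma l2norm_stepFun (hM : 0 < M) {n : ℕ} (a : (Fin n → Fin N) → ℝ) :
    l2norm (orthant n) (stepFun M a) = Real.sqrt (∑ j, a j ^ 2) := by
  rw [← l2norm_stepFun_sq hM, Real.sqrt_sq (l2norm_nonneg _)]

lemma stepFun_sub {n : ℕ} (a b : (Fin n → Fin N) → ℝ) (t : Fin n → ℝ) :
    stepFun M (fun j => a j - b j) t = stepFun M a t - stepFun M b t := by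
  unfold stepFun
  rw [← Finset.sum_sub_distrib]
  simp_rw [sub_mul]

lemma stepFun_comp_perm {n : ℕ} (a : (Fin n → Fin N) → ℝ) (σ : Equiv.Perm (Fin n))
    (t : Fin n → ℝ) : stepFun M a (t ∘ σ) = stepFun M (fun j => a (j ∘ σ)) t := by
  unfold stepFun
  refine (Fintype.sum_equiv (σ.arrowCongr (Equiv.refl (Fin N))) _ _ fun j => ?_)
  have h1 : (σ.arrowCongr (Equiv.refl (Fin N)) j) ∘ σ = j := by
    funext i; simp [Equiv.arrowCongr]
  beta_reduce
  rw [h1]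
  congr 1
  refine Eq.trans ?_ (Equiv.prod_comp σ _)
  refine Finset.prod_congr rfl fun i _ => ?_
  have h2 : (σ.arrowCongr (Equiv.refl (Fin N)) j) (σ i) = j i := congrFun h1 i
  rw [h2]; rfl

/-- The `q`-deformed inner product of tensors. -/
def tensorInner {ι : Type*} [Fintype ι] (q : ℝ) {n : ℕ} (a b : (Fin n → ι) → ℝ) : ℝ :=
  ∑ σ : Equiv.Perm (Fin n), q ^ inv σ * ∑ j, a (j ∘ σ) * b j

lemma qInner_stepFun (hM : 0 < M) {n : ℕ} (q : ℝ) (a b : (Fin n → Fin N) → ℝ) :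
    qInner q (stepFun M a) (stepFun M b) = tensorInner q a b := by
  unfold qInner tensorInner
  refine Finset.sum_congr rfl fun σ _ => ?_
  simp_rw [stepFun_comp_perm]
  rw [integral_stepFun_mul hM]

lemma stepFun_glue {a b n : ℕ} (e : Fin a ⊕ Fin b ≃ Fin n) (c : (Fin n → Fin N) → ℝ)
    (u : Fin a → ℝ) (s : Fin b → ℝ) :
    stepFun M c (glue e u s) = ∑ j, ∑ k, c (glue e j k) *
      ((∏ i, cell M (j i) (u i)) * ∏ i, cell M (k i) (s i)) := by
  unfold stepFun
  rw [← (glueEquiv e).sum_comp, Fintype.sum_prod_type]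
  refine Finset.sum_congr rfl fun j _ => Finset.sum_congr rfl fun k _ => ?_
  change c (glue e j k) * ∏ i, cell M (glue e j k i : Fin N) (glue e u s i) = _
  congr 1
  exact prod_glue e (fun (y : Fin N) (z : ℝ) => cell M y z) j k u s

end Steps

/-! ### Composition of square-integrable kernels -/

section Conv

variable {α β γ : Type*} [MeasurableSpace α] [MeasurableSpace β] [MeasurableSpace γ]
  {μ : Measure α} {ν : Measure β} {ξ : Measure γ} [SigmaFinite μ] [SigmaFinite ν] [SigmaFinite ξ]

/-- The composition of two kernels. -/
def kernelComp (ν : Measure β) (f : α × β → ℝ) (g : β × γ → ℝ) (p : α × γ) : ℝ :=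
  ∫ s, f (p.1, s) * g (s, p.2) ∂ν

lemma aestronglyMeasurable_kernelComp {f : α × β → ℝ} {g : β × γ → ℝ}
    (hf : AEStronglyMeasurable f (μ.prod ν)) (hg : AEStronglyMeasurable g (ν.prod ξ)) :
    AEStronglyMeasurable (kernelComp ν f g) (μ.prod ξ) := by
  have h1 : Measure.QuasiMeasurePreserving (Prod.map (Prod.fst : α × γ → α) (id : β → β))
      ((μ.prod ξ).prod ν) (μ.prod ν) :=
    QuasiMeasurePreserving.prodMap Measure.quasiMeasurePreserving_fst (Measure.QuasiMeasurePreserving.id ν)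
  have h2 : Measure.QuasiMeasurePreserving (Prod.map (Prod.snd : α × γ → γ) (id : β → β))
      ((μ.prod ξ).prod ν) (ξ.prod ν) :=
    QuasiMeasurePreserving.prodMap Measure.quasiMeasurePreserving_snd (Measure.QuasiMeasurePreserving.id ν)
  have h3 := (Measure.measurePreserving_swap (μ := ξ) (ν := ν)).quasiMeasurePreserving.comp h2
  exact ((hf.comp_quasiMeasurePreserving h1).mul
    (hg.comp_quasiMeasurePreserving h3)).integral_prod_right'

lemma ae_memLp_slice {f : α × β → ℝ} (hf : MemLp f 2 (μ.prod ν)) :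
    ∀ᵐ u ∂μ, MemLp (fun s => f (u, s)) 2 ν := by
  have h1 := ((memLp_two_iff_integrable_sq hf.1).1 hf).prod_right_ae
  filter_upwards [h1, hf.1.prodMk_left] with u hu hu'
  exact (memLp_two_iff_integrable_sq hu').2 hu

lemma memLp_swap {g : β × γ → ℝ} (hg : MemLp g 2 (ν.prod ξ)) :
    MemLp (fun p : γ × β => g (p.2, p.1)) 2 (ξ.prod ν) :=
  hg.comp_measurePreserving (Measure.measurePreserving_swap (μ := ξ) (ν := ν))

lemma integrable_slice_sq {f : α × β → ℝ} (hf : MemLp f 2 (μ.prod ν)) :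
    Integrable (fun u => ∫ s, f (u, s) ^ 2 ∂ν) μ :=
  ((memLp_two_iff_integrable_sq hf.1).1 hf).integral_prod_left

lemma integral_slice_sq {f : α × β → ℝ} (hf : MemLp f 2 (μ.prod ν)) :
    ∫ u, ∫ s, f (u, s) ^ 2 ∂ν ∂μ = l2norm (μ.prod ν) f ^ 2 := by
  rw [l2norm_sq hf]
  exact (integral_prod _ ((memLp_two_iff_integrable_sq hf.1).1 hf)).symm

lemma ae_kernelComp_sq_le {f : α × β → ℝ} {g : β × γ → ℝ}
    (hf : MemLp f 2 (μ.prod ν)) (hg : MemLp g 2 (ν.prod ξ)) :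
    ∀ᵐ p ∂(μ.prod ξ), kernelComp ν f g p ^ 2 ≤
      (∫ s, f (p.1, s) ^ 2 ∂ν) * ∫ s, g (s, p.2) ^ 2 ∂ν := by
  have h1 := Measure.quasiMeasurePreserving_fst (μ := μ) (ν := ξ) |>.ae (ae_memLp_slice hf)
  have h2 := Measure.quasiMeasurePreserving_snd (μ := μ) (ν := ξ) |>.ae
    (ae_memLp_slice (memLp_swap hg))
  filter_upwards [h1, h2] with p hp1 hp2
  rw [← l2norm_sq hp1, ← l2norm_sq hp2, ← mul_pow]
  exact sq_le_sq' (by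
    have := abs_le.1 (abs_integral_mul_le hp1 hp2)
    exact this.1) (abs_le.1 (abs_integral_mul_le hp1 hp2)).2

lemma memLp_kernelComp {f : α × β → ℝ} {g : β × γ → ℝ}
    (hf : MemLp f 2 (μ.prod ν)) (hg : MemLp g 2 (ν.prod ξ)) :
    MemLp (kernelComp ν f g) 2 (μ.prod ξ) := by
  have hm := aestronglyMeasurable_kernelComp (ξ := ξ) hf.1 hg.1
  rw [memLp_two_iff_integrable_sq hm]
  refine ((integrable_slice_sq hf).mul_prod (integrable_slice_sq (memLp_swap hg))).mono' (hm.pow 2) ?_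
  filter_upwards [ae_kernelComp_sq_le hf hg] with p hp
  rw [Real.norm_of_nonneg (sq_nonneg _)]
  exact hp

/-- Submultiplicativity of the Hilbert–Schmidt norm: Cauchy–Schwarz on the slices bounds the square
of the composition by a product of functions of separate variables, which is then integrated. -/
lemma l2norm_kernelComp_le {f : α × β → ℝ} {g : β × γ → ℝ}
    (hf : MemLp f 2 (μ.prod ν)) (hg : MemLp g 2 (ν.prod ξ)) :
    l2norm (μ.prod ξ) (kernelComp ν f g) ≤ l2norm (μ.prod ν) f * l2norm (ν.prod ξ) g := by
  refine le_of_sq_le_sq ?_ (mul_nonneg (l2norm_nonneg _) (l2norm_nonneg _))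
  have hm := memLp_kernelComp hf hg
  have hsw : l2norm (ξ.prod ν) (fun p : γ × β => g (p.2, p.1)) = l2norm (ν.prod ξ) g :=
    l2norm_comp (Measure.measurePreserving_swap (μ := ξ) (ν := ν)) hg.1
  rw [l2norm_sq hm, mul_pow, ← hsw, ← integral_slice_sq hf, ← integral_slice_sq (memLp_swap hg),
    ← integral_prod_mul (fun u => ∫ s, f (u, s) ^ 2 ∂ν) (fun v => ∫ s, g (s, v) ^ 2 ∂ν)]
  exact integral_mono_ae ((memLp_two_iff_integrable_sq hm.1).1 hm)
    ((integrable_slice_sq hf).mul_prod (integrable_slice_sq (memLp_swap hg)))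
    (ae_kernelComp_sq_le hf hg)

/-- The identity holds only almost everywhere, since the slices are square-integrable only for
almost all values of the outer variables. -/
lemma kernelComp_sub {f f' : α × β → ℝ} {g g' : β × γ → ℝ}
    (hf : MemLp f 2 (μ.prod ν)) (hf' : MemLp f' 2 (μ.prod ν))
    (hg : MemLp g 2 (ν.prod ξ)) (hg' : MemLp g' 2 (ν.prod ξ)) :
    (fun p => kernelComp ν f g p - kernelComp ν f' g' p) =ᵐ[μ.prod ξ]
      fun p => kernelComp ν (fun x => f x - f' x) g p + kernelComp ν f' (fun x => g x - g' x) p := by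
  have h1 := Measure.quasiMeasurePreserving_fst (μ := μ) (ν := ξ) |>.ae (ae_memLp_slice hf)
  have h1' := Measure.quasiMeasurePreserving_fst (μ := μ) (ν := ξ) |>.ae (ae_memLp_slice hf')
  have h2 := Measure.quasiMeasurePreserving_snd (μ := μ) (ν := ξ) |>.ae
    (ae_memLp_slice (memLp_swap hg))
  have h2' := Measure.quasiMeasurePreserving_snd (μ := μ) (ν := ξ) |>.ae
    (ae_memLp_slice (memLp_swap hg'))
  filter_upwards [h1, h1', h2, h2'] with p a1 a2 a3 a4
  unfold kernelComp
  simp only [sub_mul, mul_sub]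
  rw [integral_sub (integrable_mul_of_memLp a1 a3) (integrable_mul_of_memLp a2 a3),
    integral_sub (integrable_mul_of_memLp a2 a3) (integrable_mul_of_memLp a2 a4)]
  ring

lemma l2norm_kernelComp_sub_le {f f' : α × β → ℝ} {g g' : β × γ → ℝ}
    (hf : MemLp f 2 (μ.prod ν)) (hf' : MemLp f' 2 (μ.prod ν))
    (hg : MemLp g 2 (ν.prod ξ)) (hg' : MemLp g' 2 (ν.prod ξ)) :
    l2norm (μ.prod ξ) (fun p => kernelComp ν f g p - kernelComp ν f' g' p) ≤
      l2norm (μ.prod ν) (fun x => f x - f' x) * l2norm (ν.prod ξ) g +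
        l2norm (μ.prod ν) f' * l2norm (ν.prod ξ) (fun x => g x - g' x) := by
  have e : l2norm (μ.prod ξ) (fun p => kernelComp ν f g p - kernelComp ν f' g' p) =
      l2norm (μ.prod ξ) (fun p => kernelComp ν (fun x => f x - f' x) g p +
        kernelComp ν f' (fun x => g x - g' x) p) :=
    congrArg ENNReal.toReal (eLpNorm_congr_ae (kernelComp_sub hf hf' hg hg'))
  rw [e]
  have a1 : MemLp (fun x => f x - f' x) 2 (μ.prod ν) := hf.sub hf'
  have a2 : MemLp (fun x => g x - g' x) 2 (ν.prod ξ) := hg.sub hg'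
  exact (l2norm_add_le (memLp_kernelComp a1 hg) (memLp_kernelComp hf' a2)).trans
    (add_le_add (l2norm_kernelComp_le a1 hg) (l2norm_kernelComp_le hf' a2))

end Conv

/-! ### Contractions of kernels and of step functions -/

section Contraction

/-- The splitting of the variables of the left factor of a contraction. -/
def leftSplit {n p : ℕ} (hp : p ≤ n) : Fin (n - p) ⊕ Fin p ≃ Fin n :=
  ((Equiv.refl _).sumCongr Fin.revPerm).trans
    (finSumFinEquiv.trans (finCongr (Nat.sub_add_cancel hp)))

/-- The splitting of the variables of the right factor of a contraction. -/
def rightSplit {n p : ℕ} (hp : p ≤ n) : Fin p ⊕ Fin (n - p) ≃ Fin n :=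
  finSumFinEquiv.trans (finCongr (Nat.add_sub_of_le hp))

lemma glue_finSumFinEquiv {Y : Type*} {a b : ℕ} (u : Fin a → Y) (s : Fin b → Y) :
    glue finSumFinEquiv u s = Fin.append u s := by
  funext i
  obtain ⟨x, rfl⟩ := finSumFinEquiv.surjective i
  rcases x with x | x <;> simp [glue]

lemma glue_leftSplit {Y : Type*} {n p : ℕ} (hp : p ≤ n) (u : Fin (n - p) → Y) (s : Fin p → Y) :
    glue (leftSplit hp) u s =
      Fin.append u (fun i => s (Fin.rev i)) ∘ Fin.cast (Nat.sub_add_cancel hp).symm := by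
  funext i
  obtain ⟨x, rfl⟩ := (leftSplit hp).surjective i
  rcases x with x | x
  · simp [glue, leftSplit]
  · simp [glue, leftSplit]

lemma glue_rightSplit {Y : Type*} {n p : ℕ} (hp : p ≤ n) (s : Fin p → Y) (v : Fin (n - p) → Y) :
    glue (rightSplit hp) s v = Fin.append s v ∘ Fin.cast (Nat.add_sub_of_le hp).symm := by
  funext i
  obtain ⟨x, rfl⟩ := (rightSplit hp).surjective i
  rcases x with x | x
  · simp [glue, rightSplit]
  · simp [glue, rightSplit]

/-- Once the variables are split into free and contracted ones, a contraction is a composition of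
kernels, so the Hilbert–Schmidt bounds apply. The reversed order of the contracted variables in the
left factor is built into `leftSplit`. -/
lemma contraction_glue {n m p : ℕ} (hn : p ≤ n) (hm : p ≤ m) (f : (Fin n → ℝ) → ℝ)
    (g : (Fin m → ℝ) → ℝ) (z : (Fin (n - p) → ℝ) × (Fin (m - p) → ℝ)) :
    contraction p hn hm f g (glue finSumFinEquiv z.1 z.2) =
      kernelComp (orthant p) (fun x => f (glue (leftSplit hn) x.1 x.2))
        (fun x => g (glue (rightSplit hm) x.1 x.2)) z := by
  unfold contraction kernelComp
  simp only [glue_finSumFinEquiv, glue_leftSplit, glue_rightSplit, Fin.append_left,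
    Fin.append_right]

lemma measurableEmbedding_glue {a b n : ℕ} (e : Fin a ⊕ Fin b ≃ Fin n) :
    MeasurableEmbedding (fun p : (Fin a → ℝ) × (Fin b → ℝ) => glue e p.1 p.2) := by
  let E : (Fin a → ℝ) × (Fin b → ℝ) ≃ᵐ (Fin n → ℝ) :=
    { toEquiv := glueEquiv e
      measurable_toFun := (measurePreserving_glue e).measurable
      measurable_invFun := by
        refine Measurable.prodMk ?_ ?_ <;>
        exact measurable_pi_lambda _ fun i => measurable_pi_apply _ }
  exact E.measurableEmbedding

lemma memLp_glue {a b n : ℕ} (e : Fin a ⊕ Fin b ≃ Fin n) {f : (Fin n → ℝ) → ℝ}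
    (hf : MemLp f 2 (orthant n)) :
    MemLp (fun x : (Fin a → ℝ) × (Fin b → ℝ) => f (glue e x.1 x.2)) 2
      ((orthant a).prod (orthant b)) :=
  hf.comp_measurePreserving (measurePreserving_glue e)

lemma memLp_contraction {n m p : ℕ} (hn : p ≤ n) (hm : p ≤ m) {f : (Fin n → ℝ) → ℝ}
    {g : (Fin m → ℝ) → ℝ} (hf : MemLp f 2 (orthant n)) (hg : MemLp g 2 (orthant m)) :
    MemLp (contraction p hn hm f g) 2 (orthant ((n - p) + (m - p))) := by
  have h1 := memLp_kernelComp (memLp_glue (leftSplit hn) hf) (memLp_glue (rightSplit hm) hg)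
  have h2 : kernelComp (orthant p) (fun x => f (glue (leftSplit hn) x.1 x.2))
      (fun x => g (glue (rightSplit hm) x.1 x.2)) = contraction p hn hm f g ∘
        fun z : (Fin (n - p) → ℝ) × (Fin (m - p) → ℝ) => glue finSumFinEquiv z.1 z.2 := by
    funext z; exact (contraction_glue hn hm f g z).symm
  rw [h2] at h1
  have h3 := measurePreserving_glue (finSumFinEquiv (m := n - p) (n := m - p))
  have h4 : AEStronglyMeasurable (contraction p hn hm f g) (orthant ((n - p) + (m - p))) :=
    (h3.aestronglyMeasurable_comp_iff (measurableEmbedding_glue _)).1 h1.1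
  refine ⟨h4, ?_⟩
  rw [← eLpNorm_comp_measurePreserving h4 h3]
  exact h1.2

lemma l2norm_glue {a b n : ℕ} (e : Fin a ⊕ Fin b ≃ Fin n) {f : (Fin n → ℝ) → ℝ}
    (hf : AEStronglyMeasurable f (orthant n)) :
    l2norm ((orthant a).prod (orthant b)) (fun x => f (glue e x.1 x.2)) = l2norm (orthant n) f :=
  l2norm_comp (measurePreserving_glue e) hf

lemma l2norm_contraction_sub_le {n p : ℕ} (hp : p ≤ n) {f g : (Fin n → ℝ) → ℝ}
    (hf : MemLp f 2 (orthant n)) (hg : MemLp g 2 (orthant n)) :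
    l2norm (orthant ((n - p) + (n - p)))
        (fun t => contraction p hp hp f f t - contraction p hp hp g g t) ≤
      l2norm (orthant n) (fun t => f t - g t) *
        (l2norm (orthant n) f + l2norm (orthant n) g) := by
  have h1 := l2norm_kernelComp_sub_le (memLp_glue (leftSplit hp) hf) (memLp_glue (leftSplit hp) hg)
    (memLp_glue (rightSplit hp) hf) (memLp_glue (rightSplit hp) hg)
  have hs : MemLp (fun t => f t - g t) 2 (orthant n) := hf.sub hg
  rw [l2norm_glue (rightSplit hp) hf.1, l2norm_glue (leftSplit hp) hg.1,
    l2norm_glue (f := fun t => f t - g t) (leftSplit hp) hs.1,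
    l2norm_glue (f := fun t => f t - g t) (rightSplit hp) hs.1] at h1
  simp_rw [← contraction_glue] at h1
  rw [l2norm_glue (f := fun t => contraction p hp hp f f t - contraction p hp hp g g t)
    finSumFinEquiv ((memLp_contraction hp hp hf hf).sub (memLp_contraction hp hp hg hg)).1] at h1
  linarith

variable {M N : ℕ}

/-- By orthonormality of the cells, the contraction of step functions is the step function of the
contracted tensor `c`. The order in which the contracted variables are listed is invisible on
symmetric tensors. -/
lemma l2norm_contraction_stepFun_sq (hM : 0 < M) {n p : ℕ} (hp : p ≤ n)
    (A : Multiset (Fin N) → ℝ) :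
    l2norm (orthant ((n - p) + (n - p))) (contraction p hp hp
      (stepFun M (symTensor A n)) (stepFun M (symTensor A n))) ^ 2 = contrSq A p (n - p) := by
  have hmap : ∀ (w : Fin (n - p) → Fin N) (y : Fin p → Fin N),
      symTensor A n (glue (leftSplit hp) w y) = A ((Finset.univ : Finset (Fin (n - p))).val.map w +
        (Finset.univ : Finset (Fin p)).val.map y) := fun w y => by
    unfold symTensor; rw [map_glue]
  have hmap' : ∀ (w : Fin (n - p) → Fin N) (y : Fin p → Fin N),
      symTensor A n (glue (rightSplit hp) y w) = A ((Finset.univ : Finset (Fin (n - p))).val.map w +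
        (Finset.univ : Finset (Fin p)).val.map y) := fun w y => by
    unfold symTensor; rw [map_glue, add_comm]
  let c : (Fin ((n - p) + (n - p)) → Fin N) → ℝ := fun J =>
    ∑ y : Fin p → Fin N, A ((Finset.univ : Finset (Fin (n - p))).val.map
        ((glueEquiv finSumFinEquiv).symm J).1 + (Finset.univ : Finset (Fin p)).val.map y) *
      A ((Finset.univ : Finset (Fin (n - p))).val.map
        ((glueEquiv finSumFinEquiv).symm J).2 + (Finset.univ : Finset (Fin p)).val.map y)
  have hc : ∀ w w' : Fin (n - p) → Fin N, c (glue finSumFinEquiv w w') =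
      ∑ y : Fin p → Fin N, A ((Finset.univ : Finset (Fin (n - p))).val.map w +
        (Finset.univ : Finset (Fin p)).val.map y) *
      A ((Finset.univ : Finset (Fin (n - p))).val.map w' +
        (Finset.univ : Finset (Fin p)).val.map y) := by
    intro w w'
    have : (glueEquiv finSumFinEquiv).symm (glue finSumFinEquiv w w') = (w, w') :=
      (glueEquiv finSumFinEquiv).symm_apply_apply (w, w')
    simp only [c, this]
  have key : contraction p hp hp (stepFun M (symTensor A n)) (stepFun M (symTensor A n)) =
      stepFun M c := by
    funext t
    obtain ⟨⟨u, v⟩, rfl⟩ := (glueEquiv finSumFinEquiv).surjective t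
    refine (contraction_glue hp hp _ _ (u, v)).trans ?_
    unfold kernelComp
    change ∫ s, stepFun M _ (glue (leftSplit hp) u s) * stepFun M _ (glue (rightSplit hp) s v)
      ∂(orthant p) = stepFun M c (glue finSumFinEquiv u v)
    have e1 : ∀ s, stepFun M (symTensor A n) (glue (leftSplit hp) u s) =
        stepFun M (fun y : Fin p → Fin N => ∑ w : Fin (n - p) → Fin N,
          A ((Finset.univ : Finset (Fin (n - p))).val.map w +
            (Finset.univ : Finset (Fin p)).val.map y) * ∏ i, cell M (w i) (u i)) s := by
      intro s
      rw [stepFun_glue, Finset.sum_comm]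
      unfold stepFun
      refine Finset.sum_congr rfl fun y _ => ?_
      rw [Finset.sum_mul]
      refine Finset.sum_congr rfl fun w _ => ?_
      rw [hmap]; ring
    have e2 : ∀ s, stepFun M (symTensor A n) (glue (rightSplit hp) s v) =
        stepFun M (fun y : Fin p → Fin N => ∑ w : Fin (n - p) → Fin N,
          A ((Finset.univ : Finset (Fin (n - p))).val.map w +
            (Finset.univ : Finset (Fin p)).val.map y) * ∏ i, cell M (w i) (v i)) s := by
      intro s
      rw [stepFun_glue]
      unfold stepFun
      refine Finset.sum_congr rfl fun y _ => ?_
      rw [Finset.sum_mul]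
      refine Finset.sum_congr rfl fun w _ => ?_
      rw [hmap']; ring
    simp_rw [e1, e2]
    rw [integral_stepFun_mul hM, stepFun_glue]
    simp_rw [hc, Finset.sum_mul_sum, Finset.sum_mul]
    rw [Finset.sum_comm]
    refine Finset.sum_congr rfl fun w _ => ?_
    rw [Finset.sum_comm]
    refine Finset.sum_congr rfl fun w' _ => Finset.sum_congr rfl fun y _ => ?_
    ring
  rw [key, l2norm_stepFun_sq hM, ← (glueEquiv finSumFinEquiv).sum_comp, Fintype.sum_prod_type]
  unfold contrSq
  refine Finset.sum_congr rfl fun w _ => Finset.sum_congr rfl fun w' _ => ?_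
  rw [← hc]
  rfl

end Contraction

/-! ### Density of symmetric grid tensors off the diagonals -/

section Density

lemma orthant_eq_restrict (n : ℕ) : orthant n =
    (volume : Measure (Fin n → ℝ)).restrict (Set.univ.pi fun _ => Set.Ici 0) := by
  unfold orthant
  rw [volume_pi, Measure.restrict_pi_pi]

instance (n : ℕ) : IsLocallyFiniteMeasure (orthant n) := by
  rw [orthant_eq_restrict]; infer_instance

lemma ae_nonneg (n : ℕ) : ∀ᵐ t ∂(orthant n), ∀ i, 0 ≤ t i := by
  rw [orthant_eq_restrict]
  filter_upwards [ae_restrict_mem (MeasurableSet.univ_pi fun _ => measurableSet_Ici)] with t ht i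
  exact ht i (Set.mem_univ i)

/-- The boundaries of the cells are rational for every mesh, so almost every point avoids all of
them at once. -/
lemma ae_irrational (n : ℕ) : ∀ᵐ t ∂(orthant n), ∀ i, Irrational (t i) := by
  rw [ae_all_iff]
  intro i
  refine Measure.tendsto_eval_ae_ae.eventually (p := fun x : ℝ => Irrational x) ?_
  refine ae_restrict_of_ae ?_
  rw [ae_iff]
  refine measure_mono_null ?_ ((Set.countable_range ((↑) : ℚ → ℝ)).measure_zero volume)
  intro x hx
  exact not_not.1 hx

/-- Each diagonal is a proper subspace, hence null; deleting the diagonal cells costs nothing in the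
limit. -/
lemma ae_injective (n : ℕ) : ∀ᵐ t ∂(orthant n), Function.Injective t := by
  have h : ∀ᵐ t ∂(orthant n), ∀ i j, i ≠ j → t i ≠ t j := by
    rw [ae_all_iff]; intro i
    rw [ae_all_iff]; intro j
    by_cases hij : i = j
    · simp [hij]
    rw [orthant_eq_restrict]
    refine ae_restrict_of_ae ?_
    rw [ae_iff]
    let S : Submodule ℝ (Fin n → ℝ) := LinearMap.ker
      ((LinearMap.proj i : (Fin n → ℝ) →ₗ[ℝ] ℝ) - LinearMap.proj j)
    have hS : S ≠ ⊤ := by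
      intro h
      have : Pi.single i (1 : ℝ) ∈ S := by rw [h]; trivial
      simp [S, LinearMap.mem_ker, Ne.symm hij] at this
    refine measure_mono_null ?_ (Measure.addHaar_submodule volume S hS)
    intro t ht
    have : t i = t j := by
      by_contra h'
      exact ht fun _ => h'
    simp [S, LinearMap.mem_ker, this]
  filter_upwards [h] with t ht i j hij
  by_contra hne
  exact ht i j hne hij

open Classical in
/-- The discretization of a kernel on the grid of mesh `1 / M`, off the diagonals. -/
def disc (M : ℕ) {n : ℕ} (g : (Fin n → ℝ) → ℝ) (j : Fin n → Fin (M * M)) : ℝ :=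
  if Function.Injective j then (Real.sqrt M)⁻¹ ^ n * g fun i => ((j i : ℕ) : ℝ) / M else 0

/-- Irrationality excludes the endpoints, for which the open cell and the half-open cell selected by
the floor function differ. -/
lemma cell_eq_ite {M : ℕ} (hM : 0 < M) {x : ℝ} (hx : 0 ≤ x) (hx' : Irrational x) (j : ℕ) :
    cell M j x = if j = ⌊(M : ℝ) * x⌋₊ then Real.sqrt M else 0 := by
  have hM' : (0 : ℝ) < M := by exact_mod_cast hM
  have h0 : (0 : ℝ) ≤ M * x := mul_nonneg hM'.le hx
  unfold cell
  by_cases h : j = ⌊(M : ℝ) * x⌋₊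
  · rw [if_pos h, Set.indicator_of_mem, mul_one]
    have h1 := (Nat.floor_eq_iff h0).1 h.symm
    rw [Set.mem_Ioo, div_lt_iff₀ hM', lt_div_iff₀ hM', mul_comm x]
    refine ⟨lt_of_le_of_ne h1.1 fun h2 => hx' ?_, by push_cast; exact h1.2⟩
    refine ⟨(j : ℚ) / M, ?_⟩
    push_cast
    rw [h2]; field_simp
  · rw [if_neg h, Set.indicator_of_notMem, mul_zero]
    intro h1
    rw [Set.mem_Ioo, div_lt_iff₀ hM', lt_div_iff₀ hM', mul_comm x] at h1
    refine h (((Nat.floor_eq_iff h0).2 ⟨h1.1.le, ?_⟩).symm)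
    have := h1.2
    push_cast at this
    exact this

open Classical in
lemma stepFun_disc {M : ℕ} (hM : 0 < M) {n : ℕ} (g : (Fin n → ℝ) → ℝ) {t : Fin n → ℝ}
    (ht : ∀ i, 0 ≤ t i) (ht' : ∀ i, Irrational (t i)) :
    stepFun M (disc M g) t =
      if (∀ i, ⌊(M : ℝ) * t i⌋₊ < M * M) ∧ Function.Injective (fun i => ⌊(M : ℝ) * t i⌋₊)
      then g fun i => (⌊(M : ℝ) * t i⌋₊ : ℝ) / M else 0 := by
  have hs : 0 < Real.sqrt M := Real.sqrt_pos.2 (by exact_mod_cast hM)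
  unfold stepFun
  have e : ∀ j : Fin n → Fin (M * M), ∏ i, cell M (j i) (t i) =
      if ∀ i, (j i : ℕ) = ⌊(M : ℝ) * t i⌋₊ then Real.sqrt M ^ n else 0 := by
    intro j
    simp_rw [fun i => cell_eq_ite hM (ht i) (ht' i) (j i)]
    rw [Finset.prod_ite_zero]
    simp
  simp_rw [e]
  by_cases h1 : ∀ i, ⌊(M : ℝ) * t i⌋₊ < M * M
  · let j₀ : Fin n → Fin (M * M) := fun i => ⟨⌊(M : ℝ) * t i⌋₊, h1 i⟩
    rw [Finset.sum_eq_single j₀]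
    · rw [if_pos fun i => rfl]
      unfold disc
      have hinj : Function.Injective j₀ ↔ Function.Injective (fun i => ⌊(M : ℝ) * t i⌋₊) := by
        constructor
        · intro h x y hxy; exact h (Fin.ext hxy)
        · intro h x y hxy; exact h (congrArg Fin.val hxy)
      by_cases h2 : Function.Injective j₀
      · rw [if_pos h2, if_pos ⟨h1, hinj.1 h2⟩]
        have : (Real.sqrt M)⁻¹ ^ n * Real.sqrt M ^ n = 1 := by
          rw [← mul_pow, inv_mul_cancel₀ hs.ne', one_pow]
        rw [mul_right_comm, this, one_mul]
      · rw [if_neg h2, if_neg fun h => h2 (hinj.2 h.2), zero_mul]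
    · intro j _ hj
      rw [if_neg, mul_zero]
      intro h
      exact hj (funext fun i => Fin.ext (h i))
    · intro h; exact absurd (Finset.mem_univ _) h
  · rw [if_neg fun h => h1 h.1]
    refine Finset.sum_eq_zero fun j _ => ?_
    rw [if_neg, mul_zero]
    intro h
    exact h1 fun i => by rw [← h i]; exact (j i).2

lemma floor_tendsto {x : ℝ} (hx : 0 ≤ x) :
    Tendsto (fun M : ℕ => (⌊(M : ℝ) * x⌋₊ : ℝ) / M) atTop (𝓝 x) := by
  have := (tendsto_nat_floor_mul_div_atTop hx).comp tendsto_natCast_atTop_atTop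
  refine this.congr fun M => ?_
  simp only [Function.comp_apply, mul_comm x]

lemma abs_floor_div_sub_le {M : ℕ} (hM : 0 < M) {x : ℝ} (hx : 0 ≤ x) :
    x ≤ (⌊(M : ℝ) * x⌋₊ : ℝ) / M + 1 := by
  have hM' : (1 : ℝ) ≤ M := by exact_mod_cast hM
  have h := Nat.lt_floor_add_one ((M : ℝ) * x)
  rw [div_add_one (by positivity), le_div_iff₀ (by positivity)]
  nlinarith

lemma tendsto_stepFun_disc {n : ℕ} {g : (Fin n → ℝ) → ℝ} (hg : Continuous g) {t : Fin n → ℝ}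
    (ht : ∀ i, 0 ≤ t i) (ht' : ∀ i, Irrational (t i)) (hinj : Function.Injective t) :
    Tendsto (fun M => stepFun M (disc M g) t) atTop (𝓝 (g t)) := by
  have h1 : Tendsto (fun M : ℕ => g fun i => (⌊(M : ℝ) * t i⌋₊ : ℝ) / M) atTop (𝓝 (g t)) :=
    (hg.tendsto t).comp (tendsto_pi_nhds.2 fun i => floor_tendsto (ht i))
  refine h1.congr' ?_
  -- The grid has `M * M` cells of length `1 / M`. It covers `[0, M]` up to endpoints and so reaches
  -- every fixed point eventually.
  have h2 : ∀ᶠ M : ℕ in atTop, ∀ i, ⌊(M : ℝ) * t i⌋₊ < M * M := by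
    rw [eventually_all]
    intro i
    obtain ⟨K, hK⟩ := exists_nat_gt (t i)
    filter_upwards [eventually_ge_atTop K, eventually_gt_atTop 0] with M hM hM0
    have hM' : (0 : ℝ) < M := by exact_mod_cast hM0
    rw [Nat.floor_lt (mul_nonneg hM'.le (ht i))]
    push_cast
    refine mul_lt_mul_of_pos_left (hK.trans_le (by exact_mod_cast hM)) hM'
  have h3 : ∀ᶠ M : ℕ in atTop, ∀ i j, i ≠ j → ⌊(M : ℝ) * t i⌋₊ ≠ ⌊(M : ℝ) * t j⌋₊ := by
    rw [eventually_all]; intro i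
    rw [eventually_all]; intro j
    by_cases hij : i = j
    · simp [hij]
    have h4 := (floor_tendsto (ht i)).sub (floor_tendsto (ht j))
    have h5 : t i - t j ≠ 0 := sub_ne_zero.2 fun h => hij (hinj h)
    filter_upwards [h4.eventually_ne h5] with M hM _ h
    rw [h] at hM
    exact hM (sub_self _)
  filter_upwards [h2, h3, eventually_gt_atTop 0] with M hM2 hM3 hM0
  rw [stepFun_disc hM0 g ht ht', if_pos]
  refine ⟨hM2, fun x y hxy => ?_⟩
  by_contra hne
  exact hM3 x y hne hxy

/-- Dominated convergence: the discretization converges at every nonnegative irrational point with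
distinct coordinates. It is bounded like `g` and supported in a fixed box. -/
lemma tendsto_l2norm_disc {n : ℕ} {g : (Fin n → ℝ) → ℝ} (hg : Continuous g)
    (hc : HasCompactSupport g) :
    Tendsto (fun M => l2norm (orthant n) (fun t => g t - stepFun M (disc M g) t)) atTop (𝓝 0) := by
  have hgm : MemLp g 2 (orthant n) := hg.memLp_of_hasCompactSupport hc
  have hstep : ∀ M, Measurable (stepFun M (disc M g)) := fun M => measurable_stepFun _
  obtain ⟨B, hB⟩ := hc.exists_bound_of_continuous hg
  have hB0 : 0 ≤ B := (norm_nonneg _).trans (hB 0)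
  obtain ⟨R, hR⟩ := hc.isCompact.isBounded.exists_norm_le
  have hsupp : ∀ t, g t ≠ 0 → ∀ i, |t i| ≤ R := by
    intro t ht i
    exact (norm_le_pi_norm t i).trans (hR t (subset_tsupport g ht))
  -- The margin `1` covers the distance between a point and the corner of its cell, where `g` is
  -- sampled.
  let K : Set (Fin n → ℝ) := Set.univ.pi fun _ => Set.Icc (-(R + 1)) (R + 1)
  have hKm : MeasurableSet K := MeasurableSet.univ_pi fun _ => measurableSet_Icc
  have hKc : IsCompact K := isCompact_univ_pi fun _ => isCompact_Icc
  have hlim : Tendsto (fun M => ∫ t, (g t - stepFun M (disc M g) t) ^ 2 ∂(orthant n)) atTop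
      (𝓝 (∫ t, (0 : ℝ) ∂(orthant n))) := by
    -- The shift avoids `M = 0`, for which the domination argument is not available.
    rw [← tendsto_add_atTop_iff_nat 1]
    refine tendsto_integral_of_dominated_convergence
      (K.indicator fun _ => (2 * B) ^ 2) ?_ ?_ ?_ ?_
    · intro M
      exact ((hg.measurable.sub (hstep _)).pow_const 2).aestronglyMeasurable
    · rw [integrable_indicator_iff hKm]
      exact integrableOn_const hKc.measure_lt_top.ne
    · intro M
      filter_upwards [ae_nonneg n, ae_irrational n] with t ht ht'
      have hM : 0 < M + 1 := M.succ_pos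
      have hs := stepFun_disc hM g ht ht'
      rw [Real.norm_of_nonneg (sq_nonneg _)]
      by_cases htK : t ∈ K
      · rw [Set.indicator_of_mem htK]
        have h1 : |stepFun (M + 1) (disc (M + 1) g) t| ≤ B := by
          rw [hs]; split_ifs
          · exact hB _
          · simpa using hB0
        have h2 : |g t| ≤ B := hB t
        have h3 : |g t - stepFun (M + 1) (disc (M + 1) g) t| ≤ 2 * B :=
          (abs_sub _ _).trans (by linarith)
        rw [← sq_abs]
        exact pow_le_pow_left₀ (abs_nonneg _) h3 2
      · rw [Set.indicator_of_notMem htK]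
        have hex : ∃ i, R + 1 < t i := by
          by_contra hcon
          push Not at hcon
          refine htK fun i _ => ⟨?_, hcon i⟩
          have hR0 : 0 ≤ R + 1 := (ht i).trans (hcon i)
          linarith [ht i]
        obtain ⟨i, hi⟩ := hex
        have h1 : g t = 0 := by
          by_contra h0
          have := (le_abs_self _).trans (hsupp t h0 i)
          linarith
        have h2 : stepFun (M + 1) (disc (M + 1) g) t = 0 := by
          rw [hs]; split_ifs
          · by_contra h0
            have h3 := (le_abs_self _).trans (hsupp _ h0 i)
            have h4 := abs_floor_div_sub_le hM (ht i)
            linarith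
          · rfl
        rw [h1, h2]; norm_num
    · filter_upwards [ae_nonneg n, ae_irrational n, ae_injective n] with t h1 h2 h3
      have h4 := (tendsto_const_nhds (x := g t)).sub (tendsto_stepFun_disc hg h1 h2 h3)
      have h5 := (h4.pow 2).comp (tendsto_add_atTop_nat 1)
      simp only [sub_self, ne_eq, OfNat.ofNat_ne_zero, not_false_eq_true, zero_pow] at h5
      exact h5
  rw [integral_zero] at hlim
  have h6 := (Real.continuous_sqrt.tendsto 0).comp hlim
  rw [Real.sqrt_zero] at h6
  refine h6.congr' ?_
  filter_upwards [eventually_gt_atTop 0] with M hM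
  have hm : MemLp (fun t => g t - stepFun M (disc M g) t) 2 (orthant n) :=
    hgm.sub (memLp_stepFun hM _)
  rw [Function.comp_apply, ← l2norm_sq hm, Real.sqrt_sq (l2norm_nonneg _)]

lemma exists_perm_of_map_eq {ι : Type*} [Fintype ι] [DecidableEq ι] {n : ℕ} {j j' : Fin n → ι} (hj : Function.Injective j)
    (h : (Finset.univ : Finset (Fin n)).val.map j = (Finset.univ : Finset (Fin n)).val.map j') :
    ∃ σ : Equiv.Perm (Fin n), j' = j ∘ σ := by
  have hj' : Function.Injective j' := by
    rw [← nodup_map_univ_iff] at hj ⊢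
    rwa [h] at hj
  have h1 : ∀ i, ∃ k, j k = j' i := by
    intro i
    have : j' i ∈ (Finset.univ : Finset (Fin n)).val.map j := by
      rw [h]; exact Multiset.mem_map_of_mem j' (Finset.mem_univ i)
    obtain ⟨k, _, hk⟩ := Multiset.mem_map.1 this
    exact ⟨k, hk⟩
  choose s hs using h1
  have hinj : Function.Injective s := fun x y hxy => hj' (by rw [← hs, ← hs, hxy])
  exact ⟨Equiv.ofBijective s (Finite.injective_iff_bijective.1 hinj), funext fun i => (hs i).symm⟩

/-- The value on a multiset is read off any injective enumeration. Two enumerations differ by a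
permutation, so symmetry makes the choice irrelevant; every other multiset gets the value `0`. -/
lemma exists_symTensor {ι : Type*} [Fintype ι] [DecidableEq ι] {n : ℕ} (a : (Fin n → ι) → ℝ)
    (hsymm : ∀ (σ : Equiv.Perm (Fin n)) j, a (j ∘ σ) = a j)
    (hdiag : ∀ j, ¬ Function.Injective j → a j = 0) :
    ∃ A : Multiset ι → ℝ, (∀ s, A s ≠ 0 → s.Nodup) ∧ symTensor A n = a := by
  classical
  refine ⟨fun s => if h : ∃ j : Fin n → ι, Function.Injective j ∧
    (Finset.univ : Finset (Fin n)).val.map j = s then a h.choose else 0, ?_, ?_⟩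
  · intro s hs
    by_cases h : ∃ j : Fin n → ι, Function.Injective j ∧
        (Finset.univ : Finset (Fin n)).val.map j = s
    · obtain ⟨j, hj, rfl⟩ := h
      exact (nodup_map_univ_iff j).2 hj
    · exact absurd (dif_neg h) hs
  · funext j
    unfold symTensor
    by_cases hj : Function.Injective j
    · have h : ∃ j' : Fin n → ι, Function.Injective j' ∧
          (Finset.univ : Finset (Fin n)).val.map j' = (Finset.univ : Finset (Fin n)).val.map j :=
        ⟨j, hj, rfl⟩
      beta_reduce
      rw [dif_pos h]
      obtain ⟨σ, hσ⟩ := exists_perm_of_map_eq h.choose_spec.1 h.choose_spec.2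
      conv_rhs => rw [hσ]
      rw [hsymm]
    · beta_reduce
      rw [hdiag j hj, dif_neg]
      rintro ⟨j', hj', h⟩
      rw [← nodup_map_univ_iff, h, nodup_map_univ_iff] at hj'
      exact hj hj'

/-- The part of the tensor square of a tensor that is carried by the diagonals. -/
def diagMass {ι : Type*} [Fintype ι] {n : ℕ} (a : (Fin n → ι) → ℝ) : ℝ := by
  classical exact ∑ J : Fin (n + n) → ι, if Function.Injective J then 0 else
    (a (fun i => J (Fin.castAdd n i)) * a (fun i => J (Fin.natAdd n i))) ^ 2

/-- The tensor square of a kernel. -/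
def tensorSq {Y : Type*} {n : ℕ} (g : (Fin n → Y) → ℝ) (t : Fin (n + n) → Y) : ℝ :=
  g (fun i => t (Fin.castAdd n i)) * g (fun i => t (Fin.natAdd n i))

lemma tensorSq_glue {Y : Type*} {n : ℕ} (g : (Fin n → Y) → ℝ) (u v : Fin n → Y) :
    tensorSq g (glue finSumFinEquiv u v) = g u * g v := by
  unfold tensorSq
  rw [glue_finSumFinEquiv]
  simp only [Fin.append_left, Fin.append_right]

lemma sum_tensorSq_sq {ι : Type*} [Fintype ι] {n : ℕ} (a : (Fin n → ι) → ℝ) :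
    ∑ J, tensorSq a J ^ 2 = (∑ j, a j ^ 2) ^ 2 := by
  classical
  rw [← (glueEquiv finSumFinEquiv).sum_comp, Fintype.sum_prod_type, sq (∑ j, a j ^ 2),
    Finset.sum_mul_sum]
  refine Finset.sum_congr rfl fun u _ => Finset.sum_congr rfl fun v _ => ?_
  change tensorSq a (glue finSumFinEquiv u v) ^ 2 = _
  rw [tensorSq_glue]; ring

lemma l2norm_tensorSq {n : ℕ} {g : (Fin n → ℝ) → ℝ} (hg : Continuous g)
    (hc : HasCompactSupport g) :
    MemLp (tensorSq g) 2 (orthant (n + n)) ∧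
      l2norm (orthant (n + n)) (tensorSq g) ^ 2 = (l2norm (orthant n) g ^ 2) ^ 2 := by
  have hgm : MemLp g 2 (orthant n) := hg.memLp_of_hasCompactSupport hc
  have hcont : Continuous (tensorSq g) := by
    unfold tensorSq
    exact (hg.comp (continuous_pi fun i => continuous_apply _)).mul
      (hg.comp (continuous_pi fun i => continuous_apply _))
  have h1 := measurePreserving_glue (finSumFinEquiv (m := n) (n := n))
  have hi : Integrable (fun t => tensorSq g t ^ 2) (orthant (n + n)) := by
    rw [← h1.integrable_comp_emb (measurableEmbedding_glue _)]
    have h2 := hgm.integrable_sq.mul_prod hgm.integrable_sq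
    refine h2.congr (ae_of_all _ fun z => ?_)
    simp only [Function.comp_apply, tensorSq_glue]; ring
  have hm : MemLp (tensorSq g) 2 (orthant (n + n)) :=
    (memLp_two_iff_integrable_sq hcont.aestronglyMeasurable).2 hi
  refine ⟨hm, ?_⟩
  rw [l2norm_sq hm, ← h1.integral_comp (measurableEmbedding_glue _), l2norm_sq hgm,
    sq (∫ x, g x ^ 2 ∂(orthant n)),
    ← integral_prod_mul (fun u : Fin n → ℝ => g u ^ 2) (fun v : Fin n → ℝ => g v ^ 2)]
  refine integral_congr_ae (ae_of_all _ fun z => ?_)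
  simp only [tensorSq_glue]; ring

lemma hasCompactSupport_tensorSq {n : ℕ} {g : (Fin n → ℝ) → ℝ} (hc : HasCompactSupport g) :
    HasCompactSupport (tensorSq g) := by
  obtain ⟨R, hR⟩ := hc.isCompact.isBounded.exists_norm_le
  refine HasCompactSupport.of_support_subset_isCompact
    (isCompact_univ_pi fun _ : Fin (n + n) => isCompact_Icc (a := -R) (b := R)) ?_
  intro t ht i _
  have ht' : g (fun i => t (Fin.castAdd n i)) ≠ 0 ∧ g (fun i => t (Fin.natAdd n i)) ≠ 0 :=
    mul_ne_zero_iff.1 ht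
  have h1 := fun i => (norm_le_pi_norm _ i).trans (hR _ (subset_tsupport g ht'.1))
  have h2 := fun i => (norm_le_pi_norm _ i).trans (hR _ (subset_tsupport g ht'.2))
  change -R ≤ t i ∧ t i ≤ R
  rw [← abs_le]
  refine Fin.addCases (fun i => h1 i) (fun i => h2 i) i

lemma tendsto_sum_disc_sq {n : ℕ} {g : (Fin n → ℝ) → ℝ} (hg : Continuous g)
    (hc : HasCompactSupport g) :
    Tendsto (fun M => ∑ j, disc M g j ^ 2) atTop (𝓝 (l2norm (orthant n) g ^ 2)) := by
  have hgm : MemLp g 2 (orthant n) := hg.memLp_of_hasCompactSupport hc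
  have h1 : Tendsto (fun M => l2norm (orthant n) (stepFun M (disc M g))) atTop
      (𝓝 (l2norm (orthant n) g)) := by
    rw [tendsto_iff_dist_tendsto_zero]
    refine squeeze_zero' (Eventually.of_forall fun _ => dist_nonneg) ?_ (tendsto_l2norm_disc hg hc)
    filter_upwards [eventually_gt_atTop 0] with M hM
    have hs := memLp_stepFun hM (disc M g)
    rw [Real.dist_eq, abs_sub_le_iff]
    have a1 := l2norm_le_of_sub hs hgm
    have a2 := l2norm_le_of_sub hgm hs
    rw [l2norm_sub_comm] at a1
    constructor <;> linarith
  refine (h1.pow 2).congr' ?_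
  filter_upwards [eventually_gt_atTop 0] with M hM
  exact l2norm_stepFun_sq hM _

/-- The discretization of `g ⊗ g` is the tensor square of the discretization of `g` with its
diagonals removed. The squared norms of both tensors tend to the same limit `‖g‖⁴`, and their
difference is the mass on the diagonals. -/
lemma tendsto_diagMass_disc {n : ℕ} {g : (Fin n → ℝ) → ℝ} (hg : Continuous g)
    (hc : HasCompactSupport g) :
    Tendsto (fun M => diagMass (disc M g)) atTop (𝓝 0) := by
  classical
  have hcont : Continuous (tensorSq g) := by
    unfold tensorSq
    exact (hg.comp (continuous_pi fun i => continuous_apply _)).mul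
      (hg.comp (continuous_pi fun i => continuous_apply _))
  have h1 := ((tendsto_sum_disc_sq hg hc).pow 2).sub
    (tendsto_sum_disc_sq hcont (hasCompactSupport_tensorSq hc))
  rw [(l2norm_tensorSq hg hc).2, sub_self] at h1
  refine h1.congr fun M => ?_
  rw [← sum_tensorSq_sq, ← Finset.sum_sub_distrib]
  unfold diagMass
  refine Finset.sum_congr rfl fun J _ => ?_
  by_cases hJ : Function.Injective J
  · have hl : Function.Injective fun i => J (Fin.castAdd n i) :=
      fun x y h => Fin.castAdd_injective n n (hJ h)
    have hr : Function.Injective fun i => J (Fin.natAdd n i) :=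
      fun x y h => Fin.natAdd_injective n n (hJ h)
    simp only [hJ, hl, hr, tensorSq, disc, if_true]
    ring
  · simp only [hJ, disc, if_false]
    simp [tensorSq, disc]

/-- Symmetric square-integrable kernels are limits of symmetric tensors on grids, vanishing on
diagonals. -/
lemma eventually_exists_symTensor {n : ℕ} {f : (Fin n → ℝ) → ℝ} (hf : MemLp f 2 (orthant n))
    (hsymm : IsSymmetricKernel f) {ε : ℝ} (hε : 0 < ε) :
    ∀ᶠ M in atTop, ∃ A : Multiset (Fin (M * M)) → ℝ, (∀ s, A s ≠ 0 → s.Nodup) ∧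
      l2norm (orthant n) (fun t => f t - stepFun M (symTensor A n) t) ≤ ε ∧
      diagMass (symTensor A n) ≤ ε := by
  obtain ⟨g, hgc, hgε, hg, hgm⟩ := hf.exists_hasCompactSupport_eLpNorm_sub_le
    (by norm_num : (2 : ℝ≥0∞) ≠ ⊤) (ε := ENNReal.ofReal (ε / 2))
    (by simpa using half_pos hε)
  have hgε' : l2norm (orthant n) (fun t => f t - g t) ≤ ε / 2 :=
    ENNReal.toReal_le_of_le_ofReal (half_pos hε).le hgε
  let P := Fintype.card (Equiv.Perm (Fin n))
  have hP : (0 : ℝ) < P := by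
    have : 0 < P := Fintype.card_pos
    exact_mod_cast this
  -- The continuous approximation is symmetrized. As `f` is symmetric, `f - G` is the average of the
  -- permuted functions `f - g`, so the error does not increase.
  let G : (Fin n → ℝ) → ℝ := fun t => (P : ℝ)⁻¹ * ∑ σ : Equiv.Perm (Fin n), g (t ∘ σ)
  have hGcont : Continuous G := continuous_const.mul (continuous_finsetSum _ fun σ _ =>
    hg.comp (continuous_pi fun i => continuous_apply _))
  have hGsupp : HasCompactSupport G := by
    obtain ⟨R, hR⟩ := hgc.isCompact.isBounded.exists_norm_le
    refine HasCompactSupport.of_support_subset_isCompact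
      (isCompact_univ_pi fun _ : Fin n => isCompact_Icc (a := -R) (b := R)) ?_
    intro t ht i _
    obtain ⟨σ, _, hσ⟩ := Finset.exists_ne_zero_of_sum_ne_zero (right_ne_zero_of_mul ht)
    have h1 := (norm_le_pi_norm _ (σ.symm i)).trans (hR _ (subset_tsupport g hσ))
    simp only [Function.comp_apply, Equiv.apply_symm_apply] at h1
    exact abs_le.1 h1
  have hGsymm : ∀ (σ : Equiv.Perm (Fin n)) t, G (t ∘ σ) = G t := by
    intro σ t
    simp only [G]
    congr 1
    exact Fintype.sum_equiv (Equiv.mulLeft σ) _ _ fun τ => rfl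
  have hGm : MemLp G 2 (orthant n) := hGcont.memLp_of_hasCompactSupport hGsupp
  have hfG : l2norm (orthant n) (fun t => f t - G t) ≤ ε / 2 := by
    have e1 : (fun t => f t - G t) =ᵐ[orthant n]
        fun t => (P : ℝ)⁻¹ * ∑ σ : Equiv.Perm (Fin n), (f (t ∘ σ) - g (t ∘ σ)) := by
      have := ae_all_iff.2 fun σ => hsymm σ
      filter_upwards [this] with t ht
      simp only [G, Finset.sum_sub_distrib]
      rw [Finset.sum_congr rfl fun σ _ => ht σ]
      rw [Finset.sum_const, Finset.card_univ, nsmul_eq_mul]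
      rw [mul_sub, inv_mul_cancel_left₀ hP.ne']
    have hfg : MemLp (fun t => f t - g t) 2 (orthant n) := hf.sub hgm
    have hsum : ∀ s : Finset (Equiv.Perm (Fin n)),
        MemLp (fun t => ∑ σ ∈ s, (f (t ∘ σ) - g (t ∘ σ))) 2 (orthant n) ∧
        l2norm (orthant n) (fun t => ∑ σ ∈ s, (f (t ∘ σ) - g (t ∘ σ))) ≤ s.card * (ε / 2) := by
      classical
      intro s
      induction s using Finset.induction_on with
      | empty => simp [l2norm]
      | insert σ s hσ ih =>
        simp only [Finset.sum_insert hσ, Finset.card_insert_of_notMem hσ]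
        have hm : MemLp (fun t : Fin n → ℝ => f (t ∘ σ) - g (t ∘ σ)) 2 (orthant n) :=
          hfg.comp_measurePreserving (measurePreserving_perm σ)
        have hn : l2norm (orthant n) (fun t : Fin n → ℝ => f (t ∘ σ) - g (t ∘ σ)) ≤ ε / 2 := by
          refine le_trans (le_of_eq ?_) hgε'
          exact l2norm_comp (f := fun t => f t - g t) (measurePreserving_perm σ) hfg.1
        refine ⟨hm.add ih.1, (l2norm_add_le hm ih.1).trans ?_⟩
        push_cast
        linarith [ih.2]
    have e2 : l2norm (orthant n) (fun t => f t - G t) = (P : ℝ)⁻¹ *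
        l2norm (orthant n) (fun t => ∑ σ : Equiv.Perm (Fin n), (f (t ∘ σ) - g (t ∘ σ))) := by
      unfold l2norm
      rw [eLpNorm_congr_ae e1]
      have := eLpNorm_const_smul ((P : ℝ)⁻¹)
        (fun t => ∑ σ : Equiv.Perm (Fin n), (f (t ∘ σ) - g (t ∘ σ))) 2 (orthant n)
      have h := congrArg ENNReal.toReal this
      rw [ENNReal.toReal_mul, toReal_enorm, Real.norm_of_nonneg (inv_nonneg.2 hP.le)] at h
      exact h
    rw [e2, inv_mul_le_iff₀ hP]
    exact (hsum Finset.univ).2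
  filter_upwards [eventually_gt_atTop 0,
    (tendsto_l2norm_disc hGcont hGsupp).eventually (ge_mem_nhds (half_pos hε)),
    (tendsto_diagMass_disc hGcont hGsupp).eventually (ge_mem_nhds hε)] with M hM h1 h2
  obtain ⟨A, hA, hAa⟩ := exists_symTensor (disc M G) (fun σ j => by
      unfold disc
      have : Function.Injective (j ∘ σ) ↔ Function.Injective j := Equiv.injective_comp σ j
      simp only [this]
      congr 2
      exact hGsymm σ fun i => ((j i : ℕ) : ℝ) / M)
    (fun j hj => by unfold disc; rw [if_neg hj])
  refine ⟨A, hA, ?_, by rw [hAa]; exact h2⟩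
  rw [hAa]
  have hs := memLp_stepFun hM (disc M G)
  have a1 : MemLp (fun t => f t - G t) 2 (orthant n) := hf.sub hGm
  have a2 : MemLp (fun t => G t - stepFun M (disc M G) t) 2 (orthant n) := hGm.sub hs
  have e3 : (fun t => f t - stepFun M (disc M G) t) =
      fun t => (f t - G t) + (G t - stepFun M (disc M G) t) := by funext t; ring
  rw [e3]
  exact (l2norm_add_le a1 a2).trans (by linarith)

end Density

/-! ### Isometry for simple functions -/

section Boxes

variable {H : Type*} [NormedAddCommGroup H] [InnerProductSpace ℂ H] [CompleteSpace H]
  {W : WStarProbabilitySpace H} {q : ℝ} {X : ℝ≥0 → W.Elem}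

/-- The sides of a box. -/
def Box.side {n : ℕ} (B : Box n) (i : Fin n) : ℝ≥0 × ℝ≥0 := (B.lower i, B.upper i)

lemma Box.incrCov_side {n : ℕ} (B : Box n) {i j : Fin n} (hij : i ≠ j) :
    incrCov (B.side i) (B.side j) = 0 := by
  rw [incrCov_eq_max (B.le i) (B.le j), max_eq_left]
  by_contra h
  push Not at h
  have h1 : max ((B.side i).1 : ℝ) (B.side j).1 < min ((B.side i).2 : ℝ) (B.side j).2 := by
    linarith
  have h2 : max (B.lower i) (B.lower j) < min (B.upper i) (B.upper j) := by
    rw [← NNReal.coe_lt_coe]; push_cast; exact h1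
  obtain ⟨x, hx1, hx2⟩ := exists_between h2
  rw [max_lt_iff] at hx1
  rw [lt_min_iff] at hx2
  exact Set.disjoint_left.1 (B.disjoint i j hij) ⟨hx1.1, hx2.1⟩ ⟨hx1.2, hx2.2⟩

/-- The indicator function of an interval. -/
def sideFun (I : ℝ≥0 × ℝ≥0) (x : ℝ) : ℝ :=
  (Set.Ioo (I.1 : ℝ) (I.2 : ℝ)).indicator (fun _ => (1 : ℝ)) x

lemma measurable_sideFun (I : ℝ≥0 × ℝ≥0) : Measurable (sideFun I) :=
  measurable_const.indicator measurableSet_Ioo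

lemma memLp_sideFun (I : ℝ≥0 × ℝ≥0) :
    MemLp (sideFun I) 2 ((volume : Measure ℝ).restrict (Set.Ici 0)) := by
  refine memLp_indicator_const 2 measurableSet_Ioo 1 (Or.inr ?_)
  refine ((Measure.restrict_apply_le _ _).trans_lt ?_).ne
  rw [Real.volume_Ioo]
  exact ENNReal.ofReal_lt_top

lemma integral_sideFun_mul {I J : ℝ≥0 × ℝ≥0} (hI : I.1 ≤ I.2) (hJ : J.1 ≤ J.2) :
    ∫ x in Set.Ici (0 : ℝ), sideFun I x * sideFun J x = incrCov I J := by
  have e : ∀ x, sideFun I x * sideFun J x =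
      (Set.Ioo (max (I.1 : ℝ) J.1) (min (I.2 : ℝ) J.2)).indicator (fun _ => (1 : ℝ)) x := by
    intro x
    unfold sideFun
    rw [← Set.Ioo_inter_Ioo, ← Set.inter_indicator_mul (fun _ => (1 : ℝ)) (fun _ => (1 : ℝ))]
    simp only [mul_one]
  simp_rw [e]
  rw [integral_indicator measurableSet_Ioo, setIntegral_const, Measure.real,
    Measure.restrict_apply measurableSet_Ioo, Set.inter_eq_left.2, Real.volume_Ioo,
    incrCov_eq_max hI hJ, smul_eq_mul, mul_one, ENNReal.toReal_ofReal', max_comm]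
  intro x hx
  exact (le_max_of_le_left I.1.2).trans hx.1.le

lemma measurable_boxKernel {n : ℕ} (B : Box n) : Measurable B.kernel :=
  Finset.measurable_prod _ fun i _ => (measurable_sideFun (B.side i)).comp (measurable_pi_apply i)

lemma integrable_prod_side {n : ℕ} (I J : Fin n → ℝ≥0 × ℝ≥0) :
    Integrable (fun t : Fin n → ℝ => ∏ i, sideFun (I i) (t i) * sideFun (J i) (t i))
      (orthant n) := by
  unfold orthant
  exact Integrable.fintype_prod (f := fun i x => sideFun (I i) x * sideFun (J i) x)
    (fun i => integrable_mul_of_memLp (memLp_sideFun _) (memLp_sideFun _))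

lemma memLp_boxKernel {n : ℕ} (B : Box n) : MemLp B.kernel 2 (orthant n) := by
  rw [memLp_two_iff_integrable_sq (measurable_boxKernel B).aestronglyMeasurable]
  refine (integrable_prod_side B.side B.side).congr (ae_of_all _ fun t => ?_)
  beta_reduce
  rw [Finset.prod_mul_distrib, sq]
  rfl

lemma qInner_boxKernel {n : ℕ} (B B' : Box n) :
    qInner q B.kernel B'.kernel =
      ∑ σ : Equiv.Perm (Fin n), q ^ inv σ * ∏ i, incrCov (B.side i) (B'.side (σ i)) := by
  unfold qInner
  refine Finset.sum_congr rfl fun σ _ => ?_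
  congr 1
  have e : ∀ t : Fin n → ℝ, B.kernel (t ∘ σ) * B'.kernel t =
      ∏ i, sideFun (B.side (σ.symm i)) (t i) * sideFun (B'.side i) (t i) := by
    intro t
    rw [Finset.prod_mul_distrib]
    congr 1
    rw [← Equiv.prod_comp σ]
    simp only [Equiv.symm_apply_apply]
    rfl
  simp_rw [e]
  unfold orthant
  rw [integral_fintype_prod_eq_prod
    (fun i x => sideFun (B.side (σ.symm i)) x * sideFun (B'.side i) x)]
  rw [Finset.prod_congr rfl fun i _ => integral_sideFun_mul
    (I := B.side (σ.symm i)) (J := B'.side i) (B.le (σ.symm i)) (B'.le i)]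
  rw [← Equiv.prod_comp σ]
  simp only [Equiv.symm_apply_apply]

/-- The sides of one box are disjoint, so the reversed first word has no inner covariances and only
the bijections between the two words count. The reversal made by the adjoint converts `noninv` into
`inv`. -/
lemma IsQBrownianMotion.trace_box_mul (hX : IsQBrownianMotion W q X) {n : ℕ} (B B' : Box n) :
    W.trace (star (B.integral X) * B'.integral X) = (qInner q B.kernel B'.kernel : ℂ) := by
  unfold Box.integral
  rw [star_prod_ofFn]
  simp only [star_sub, (hX.selfAdjoint _).star_eq]
  have h := hX.isWick_incr.two_words (fun x => B.side (Fin.rev x)) B'.side (fun x y hxy =>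
    B.incrCov_side (Fin.rev_injective.ne hxy.ne))
  refine Eq.trans h ?_
  rw [qInner_boxKernel]
  congr 1
  symm
  refine Fintype.sum_equiv (Equiv.mulRight (Fin.revPerm : Equiv.Perm (Fin n))) _ _ fun σ => ?_
  change q ^ inv σ * ∏ i, incrCov (B.side i) (B'.side (σ i)) =
    q ^ noninv ((Fin.revPerm : Equiv.Perm (Fin n)).trans σ) *
      ∏ x : Fin n, incrCov (B.side x.rev) (B'.side (σ x.rev))
  rw [noninv_revPerm_trans]
  congr 1
  exact (Equiv.prod_comp (Fin.revPerm : Equiv.Perm (Fin n))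
    fun i => incrCov (B.side i) (B'.side (σ i))).symm

lemma simpleKernel_eq {n : ℕ} (F : Box n →₀ ℝ) :
    simpleKernel F = fun t => ∑ B ∈ F.support, F B * B.kernel t := rfl

lemma memLp_simpleKernel {n : ℕ} (F : Box n →₀ ℝ) : MemLp (simpleKernel F) 2 (orthant n) := by
  rw [simpleKernel_eq]
  exact memLp_finsetSum _ fun B _ => (memLp_boxKernel B).const_mul _

lemma simpleKernel_sub {n : ℕ} (F G : Box n →₀ ℝ) (t : Fin n → ℝ) :
    simpleKernel (F - G) t = simpleKernel F t - simpleKernel G t := by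
  unfold simpleKernel
  exact Finsupp.sum_sub_index fun B a b => sub_mul _ _ _

lemma simpleIntegral_sub {n : ℕ} (F G : Box n →₀ ℝ) :
    simpleIntegral X (F - G) = simpleIntegral X F - simpleIntegral X G := by
  unfold simpleIntegral
  refine Finsupp.sum_sub_index fun B a b => ?_
  rw [Complex.ofReal_sub, sub_smul]

lemma qInner_simpleKernel {n : ℕ} (F G : Box n →₀ ℝ) :
    qInner q (simpleKernel F) (simpleKernel G) =
      ∑ B ∈ F.support, ∑ B' ∈ G.support, F B * G B' * qInner q B.kernel B'.kernel := by
  unfold qInner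
  simp_rw [Finset.mul_sum]
  have e : ∀ B ∈ F.support, ∑ B' ∈ G.support, ∑ σ : Equiv.Perm (Fin n), F B * G B' *
      (q ^ inv σ * ∫ t, B.kernel (t ∘ σ) * B'.kernel t ∂(orthant n)) =
      ∑ σ : Equiv.Perm (Fin n), ∑ B' ∈ G.support, F B * G B' *
      (q ^ inv σ * ∫ t, B.kernel (t ∘ σ) * B'.kernel t ∂(orthant n)) :=
    fun B _ => Finset.sum_comm
  rw [Finset.sum_congr rfl e, Finset.sum_comm]
  refine Finset.sum_congr rfl fun σ _ => ?_
  have hint : ∀ B B' : Box n, Integrable (fun t => B.kernel (t ∘ σ) * B'.kernel t) (orthant n) :=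
    fun B B' => integrable_mul_of_memLp
      ((memLp_boxKernel B).comp_measurePreserving (measurePreserving_perm σ)) (memLp_boxKernel B')
  have e2 : ∀ t, simpleKernel F (t ∘ σ) * simpleKernel G t =
      ∑ B ∈ F.support, ∑ B' ∈ G.support, F B * G B' * (B.kernel (t ∘ σ) * B'.kernel t) := by
    intro t
    simp only [simpleKernel_eq]
    rw [Finset.sum_mul_sum]
    refine Finset.sum_congr rfl fun B _ => Finset.sum_congr rfl fun B' _ => ?_
    ring
  simp_rw [e2]
  rw [integral_finsetSum _ fun B _ => integrable_finsetSum _ fun B' _ => (hint B B').const_mul _,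
    Finset.mul_sum]
  refine Finset.sum_congr rfl fun B _ => ?_
  rw [integral_finsetSum _ fun B' _ => (hint B B').const_mul _, Finset.mul_sum]
  refine Finset.sum_congr rfl fun B' _ => ?_
  rw [integral_const_mul]
  ring

lemma IsQBrownianMotion.trace_simple (hX : IsQBrownianMotion W q X) {n : ℕ} (F : Box n →₀ ℝ) :
    W.trace (star (simpleIntegral X F) * simpleIntegral X F) =
      (qInner q (simpleKernel F) (simpleKernel F) : ℂ) := by
  rw [qInner_simpleKernel]
  unfold simpleIntegral Finsupp.sum
  rw [star_sum, Finset.sum_mul_sum, map_sum]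
  push_cast
  refine Finset.sum_congr rfl fun B _ => ?_
  rw [map_sum]
  refine Finset.sum_congr rfl fun B' _ => ?_
  rw [star_smul, smul_mul_smul_comm, map_smul, hX.trace_box_mul, smul_eq_mul]
  congr 2
  exact Complex.conj_ofReal _

end Boxes

/-! ### Uniqueness of the multiple integral -/

section Uniqueness

variable {H : Type*} [NormedAddCommGroup H] [InnerProductSpace ℂ H] [CompleteSpace H]
  {W : WStarProbabilitySpace H} {q : ℝ} {X : ℝ≥0 → W.Elem}

lemma WStarProbabilitySpace.star_mul_nonneg (W : WStarProbabilitySpace H) (Z : W.Elem) :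
    0 ≤ (W.trace (star Z * Z)).re := by
  rw [W.trace_comm]; exact (W.trace_nonneg Z).1

lemma WStarProbabilitySpace.add_le (W : WStarProbabilitySpace H) (Y Z : W.Elem) :
    (W.trace (star (Y + Z) * (Y + Z))).re ≤
      2 * (W.trace (star Y * Y)).re + 2 * (W.trace (star Z * Z)).re := by
  have h := W.star_mul_nonneg (Y - Z)
  have e : star (Y - Z) * (Y - Z) + star (Y + Z) * (Y + Z) =
      star Y * Y + star Y * Y + (star Z * Z + star Z * Z) := by
    rw [star_sub, star_add]; noncomm_ring
  have e2 := congrArg (fun x => (W.trace x).re) e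
  simp only [map_add, Complex.add_re] at e2
  linarith

lemma WStarProbabilitySpace.eq_zero_of_re (W : WStarProbabilitySpace H) {Z : W.Elem}
    (h : (W.trace (star Z * Z)).re ≤ 0) : Z = 0 := by
  refine W.trace_faithful Z ?_
  have h1 := W.trace_nonneg Z
  rw [W.trace_comm] at h1 ⊢
  exact Complex.ext (le_antisymm h h1.1) h1.2

lemma tendsto_l2norm_of_eLpNorm {α ι : Type*} [MeasurableSpace α] {μ : Measure α}
    {l : Filter ι} {F : ι → α → ℝ} (h : Tendsto (fun m => eLpNorm (F m) 2 μ) l (𝓝 0)) :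
    Tendsto (fun m => l2norm μ (F m)) l (𝓝 0) := by
  exact (ENNReal.tendsto_toReal ENNReal.zero_ne_top).comp h

/-- The isometry bounds the `L²` distance between simple integrals by `n!` times that of the simple
kernels, in squares. So two limits are at distance zero, and faithfulness makes them equal. This
frees the definition of `multipleIntegral` from its arbitrary choice. -/
lemma IsMultipleIntegral.unique (hX : IsQBrownianMotion W q X) (hq0 : 0 ≤ q) (hq1 : q ≤ 1)
    {n : ℕ} {f : (Fin n → ℝ) → ℝ} (hf : MemLp f 2 (orthant n)) {Y Y' : W.Elem}
    (h : IsMultipleIntegral X f Y) (h' : IsMultipleIntegral X f Y') : Y = Y' := by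
  obtain ⟨F, hF, hY⟩ := h
  obtain ⟨F', hF', hY'⟩ := h'
  have hF1 := tendsto_l2norm_of_eLpNorm hF
  have hF1' := tendsto_l2norm_of_eLpNorm hF'
  have hYr := (Complex.continuous_re.tendsto _).comp hY
  have hYr' := (Complex.continuous_re.tendsto _).comp hY'
  have hbound : ∀ m, (W.trace (star (Y - Y') * (Y - Y'))).re ≤
      2 * (W.trace (star (Y - simpleIntegral X (F m)) * (Y - simpleIntegral X (F m)))).re +
      2 * (2 * (W.trace (star (Y' - simpleIntegral X (F' m)) *
        (Y' - simpleIntegral X (F' m)))).re +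
      2 * (n.factorial * (l2norm (orthant n) (fun t => f t - simpleKernel (F m) t) +
        l2norm (orthant n) (fun t => f t - simpleKernel (F' m) t)) ^ 2)) := by
    intro m
    have h1 := W.add_le (Y - simpleIntegral X (F m)) (simpleIntegral X (F m) - Y')
    rw [sub_add_sub_cancel] at h1
    have h2 := W.add_le (simpleIntegral X (F' m) - Y')
      (simpleIntegral X (F m) - simpleIntegral X (F' m))
    rw [add_comm, sub_add_sub_cancel] at h2
    have e : star (simpleIntegral X (F' m) - Y') * (simpleIntegral X (F' m) - Y') =
        star (Y' - simpleIntegral X (F' m)) * (Y' - simpleIntegral X (F' m)) := by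
      rw [← neg_sub Y', star_neg, neg_mul_neg]
    rw [e, ← simpleIntegral_sub, hX.trace_simple, Complex.ofReal_re] at h2
    have hK := memLp_simpleKernel (F m - F' m)
    have h3 := (le_abs_self _).trans (abs_qInner_le hq0 hq1 hK hK)
    have h4 : l2norm (orthant n) (simpleKernel (F m - F' m)) ≤
        l2norm (orthant n) (fun t => f t - simpleKernel (F m) t) +
        l2norm (orthant n) (fun t => f t - simpleKernel (F' m) t) := by
      have a1 : MemLp (fun t => f t - simpleKernel (F m) t) 2 (orthant n) :=
        hf.sub (memLp_simpleKernel _)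
      have a2 : MemLp (fun t => f t - simpleKernel (F' m) t) 2 (orthant n) :=
        hf.sub (memLp_simpleKernel _)
      have e3 : simpleKernel (F m - F' m) = fun t =>
          (f t - simpleKernel (F' m) t) - (f t - simpleKernel (F m) t) := by
        funext t; rw [simpleKernel_sub]; ring
      rw [e3]
      exact (l2norm_sub_le a2 a1).trans (by rw [add_comm])
    have h5 : l2norm (orthant n) (simpleKernel (F m - F' m)) *
        l2norm (orthant n) (simpleKernel (F m - F' m)) ≤
        (l2norm (orthant n) (fun t => f t - simpleKernel (F m) t) +
        l2norm (orthant n) (fun t => f t - simpleKernel (F' m) t)) ^ 2 := by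
      rw [← sq]; exact pow_le_pow_left₀ (l2norm_nonneg _) h4 2
    have h6 := h3.trans (mul_le_mul_of_nonneg_left h5 (Nat.cast_nonneg _))
    linarith
  have hlim := (hYr.const_mul 2).add (((hYr'.const_mul 2).add
    ((((hF1.add hF1').pow 2).const_mul (n.factorial : ℝ)).const_mul 2)).const_mul 2)
  simp only [Complex.zero_re, add_zero, mul_zero, ne_eq, OfNat.ofNat_ne_zero, not_false_eq_true,
    zero_pow] at hlim
  exact sub_eq_zero.1 (W.eq_zero_of_re (ge_of_tendsto' hlim hbound))

lemma IsMultipleIntegral.eq (hX : IsQBrownianMotion W q X) (hq0 : 0 ≤ q) (hq1 : q ≤ 1)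
    {n : ℕ} {f : (Fin n → ℝ) → ℝ} (hf : MemLp f 2 (orthant n)) {Y : W.Elem}
    (h : IsMultipleIntegral X f Y) : multipleIntegral X f = Y := by
  have hex : ∃ Y, IsMultipleIntegral X f Y := ⟨Y, h⟩
  unfold multipleIntegral
  rw [dif_pos hex]
  exact IsMultipleIntegral.unique hX hq0 hq1 hf hex.choose_spec h

end Uniqueness

/-! ### Refinement of grids and comparison of two grids -/

section Refinement

/-- The coefficients of a tensor after a linear change of variables. -/
def expand {ι κ : Type*} [Fintype ι] (w : ι → κ → ℝ) {n : ℕ} (a : (Fin n → ι) → ℝ)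
    (k : Fin n → κ) : ℝ := ∑ j, a j * ∏ x, w (j x) (k x)

lemma tensorIntegral_expand {A : Type*} [Ring A] [Algebra ℂ A] {ι κ : Type*} [Fintype ι]
    [Fintype κ] {Y : ι → A} {Z : κ → A} {w : ι → κ → ℝ} (h : ∀ j, Y j = ∑ i, (w j i : ℂ) • Z i)
    {n : ℕ} (a : (Fin n → ι) → ℝ) : tensorIntegral Y a = tensorIntegral Z (expand w a) := by
  classical
  unfold tensorIntegral expand
  push_cast
  simp_rw [Finset.sum_smul]
  rw [Finset.sum_comm]
  refine Finset.sum_congr rfl fun j _ => ?_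
  have e1 := (MultilinearMap.mkPiAlgebraFin ℂ n A).map_sum
    (fun (p : Fin n) (s : κ) => (w (j p) s : ℂ) • Z s)
  simp only [MultilinearMap.mkPiAlgebraFin_apply, MultilinearMap.map_smul_univ] at e1
  simp_rw [h]
  rw [e1, Finset.smul_sum]
  simp_rw [smul_smul]

/-- A tensor that is symmetric and vanishes on the diagonals. -/
structure IsOffDiag {ι : Type*} {n : ℕ} (a : (Fin n → ι) → ℝ) : Prop where
  symm : ∀ (σ : Equiv.Perm (Fin n)) j, a (j ∘ σ) = a j
  diag : ∀ j, ¬ Function.Injective j → a j = 0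

lemma IsOffDiag.sub {ι : Type*} {n : ℕ} {a b : (Fin n → ι) → ℝ} (ha : IsOffDiag a)
    (hb : IsOffDiag b) : IsOffDiag fun j => a j - b j :=
  ⟨fun σ j => by rw [ha.symm, hb.symm], fun j hj => by rw [ha.diag j hj, hb.diag j hj, sub_zero]⟩

lemma isOffDiag_symTensor {ι : Type*} [Fintype ι] [DecidableEq ι] {A : Multiset ι → ℝ}
    (hA : ∀ s, A s ≠ 0 → s.Nodup) (n : ℕ) : IsOffDiag (symTensor A n) := by
  constructor
  · intro σ j
    unfold symTensor
    congr 1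
    rw [← Multiset.map_map]
    congr 1
    exact congrArg Finset.val (Finset.map_univ_equiv σ)
  · intro j hj
    by_contra h
    exact hj ((nodup_map_univ_iff j).1 (hA _ h))

/-- By `hw` every fine cell lies in at most one coarse cell, so distinct coarse indices force
distinct fine ones. -/
lemma IsOffDiag.expand {ι κ : Type*} [Fintype ι] {w : ι → κ → ℝ}
    (hw : ∀ j j' i, w j i ≠ 0 → w j' i ≠ 0 → j = j') {n : ℕ} {a : (Fin n → ι) → ℝ}
    (ha : IsOffDiag a) : IsOffDiag (expand w a) := by
  constructor
  · intro σ k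
    unfold QChaos.expand
    refine Fintype.sum_equiv (σ.arrowCongr (Equiv.refl ι)) _ _ fun j => ?_
    have h1 : (σ.arrowCongr (Equiv.refl ι) j) ∘ σ = j := by
      funext i; simp [Equiv.arrowCongr]
    congr 1
    · rw [← ha.symm σ (σ.arrowCongr (Equiv.refl ι) j), h1]
    · refine Eq.trans ?_ (Equiv.prod_comp σ _)
      refine Finset.prod_congr rfl fun i _ => ?_
      have h2 : (σ.arrowCongr (Equiv.refl ι) j) (σ i) = j i := congrFun h1 i
      rw [h2]; rfl
  · intro k hk
    refine Finset.sum_eq_zero fun j _ => ?_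
    by_cases hj : Function.Injective j
    · rw [mul_eq_zero]; right
      by_contra hne
      replace hne := Finset.prod_ne_zero_iff.1 hne
      refine hk fun x y hxy => hj (hw _ _ (k x) (hne x (Finset.mem_univ x)) ?_)
      rw [hxy]
      exact hne y (Finset.mem_univ y)
    · rw [ha.diag j hj, zero_mul]

/-- The matrix that expresses the cells of a grid in terms of those of a finer grid. -/
def refineCoeff (L : ℕ) {N N' : ℕ} (j : Fin N) (i : Fin N') : ℝ :=
  if (i : ℕ) / L = j then (Real.sqrt L)⁻¹ else 0

lemma refineCoeff_inj {L N N' : ℕ} (j j' : Fin N) (i : Fin N') (h : refineCoeff L j i ≠ 0)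
    (h' : refineCoeff L j' i ≠ 0) : j = j' := by
  unfold refineCoeff at h h'
  have h1 : (i : ℕ) / L = j := by by_contra hne; exact h (if_neg hne)
  have h2 : (i : ℕ) / L = j' := by by_contra hne; exact h' (if_neg hne)
  exact Fin.ext (h1.symm.trans h2)

lemma sum_div_eq {E : Type*} [AddCommMonoid E] {L : ℕ} (hL : 0 < L) {N N' : ℕ} (hN : N * L ≤ N')
    (j : Fin N) (g : ℕ → E) :
    ∑ i : Fin N', (if (i : ℕ) / L = j then g i else 0) =
      ∑ r ∈ Finset.range L, g (j * L + r) := by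
  rw [Fin.sum_univ_eq_sum_range (fun i => if i / L = (j : ℕ) then g i else 0) N',
    ← Finset.sum_filter]
  refine Finset.sum_nbij' (fun i => i % L) (fun r => j * L + r) ?_ ?_ ?_ ?_ ?_
  · intro i _
    exact Finset.mem_range.2 (Nat.mod_lt _ hL)
  · intro r hr
    rw [Finset.mem_range] at hr
    rw [Finset.mem_filter, Finset.mem_range]
    constructor
    · have : (j + 1 : ℕ) * L ≤ N * L := Nat.mul_le_mul_right L j.2
      rw [add_mul, one_mul] at this
      omega
    · rw [add_comm, Nat.add_mul_div_right _ _ hL, Nat.div_eq_of_lt hr, zero_add]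
  · intro i hi
    rw [Finset.mem_filter] at hi
    have := Nat.div_add_mod' i L
    rw [hi.2] at this
    exact this
  · intro r hr
    rw [Finset.mem_range] at hr
    rw [add_comm, Nat.add_mul_mod_self_right, Nat.mod_eq_of_lt hr]
  · intro i hi
    rw [Finset.mem_filter] at hi
    have := Nat.div_add_mod' i L
    rw [hi.2] at this
    rw [this]

variable {H : Type*} [NormedAddCommGroup H] [InnerProductSpace ℂ H] [CompleteSpace H]
  {W : WStarProbabilitySpace H} {q : ℝ} {X : ℝ≥0 → W.Elem}

/-- The increment over a coarse cell telescopes over its `L` fine cells; the coefficient `1 / √L` is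
the ratio of the normalizations `√M` and `√(M L)`. -/
lemma gridFamily_refine (X : ℝ≥0 → W.Elem) {M L : ℕ} (hM : 0 < M) (hL : 0 < L) {N N' : ℕ}
    (hN : N * L ≤ N') (j : Fin N) :
    gridFamily X M N j = ∑ i, (refineCoeff L j i : ℂ) • gridFamily X (M * L) N' i := by
  have hL' : (0 : ℝ) < L := by exact_mod_cast hL
  have hLn : (L : ℝ≥0) ≠ 0 := by exact_mod_cast hL.ne'
  have hMn : (M : ℝ≥0) ≠ 0 := by exact_mod_cast hM.ne'
  let g : ℕ → W.Elem := fun i => ((Real.sqrt M : ℝ) : ℂ) •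
    (X ((i + 1 : ℕ) / (M * L : ℕ) : ℝ≥0) - X ((i : ℕ) / (M * L : ℕ) : ℝ≥0))
  have e : ∀ i : Fin N', (refineCoeff L j i : ℂ) • gridFamily X (M * L) N' i =
      if (i : ℕ) / L = j then g i else 0 := by
    intro i
    unfold refineCoeff
    split_ifs with h
    · unfold gridFamily
      rw [smul_smul, ← Complex.ofReal_mul]
      congr 2
      push_cast
      rw [Real.sqrt_mul (Nat.cast_nonneg M), mul_comm, mul_assoc,
        mul_inv_cancel₀ (Real.sqrt_pos.2 hL').ne', mul_one]
    · simp
  rw [Finset.sum_congr rfl fun i _ => e i, sum_div_eq hL hN j g]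
  simp only [g]
  rw [← Finset.smul_sum]
  have h1 := Finset.sum_range_sub
    (fun r : ℕ => X (((j : ℕ) * L + r : ℕ) / (M * L : ℕ) : ℝ≥0)) L
  rw [show (∑ r ∈ Finset.range L, (X (((j : ℕ) * L + r + 1 : ℕ) / (M * L : ℕ) : ℝ≥0) -
    X (((j : ℕ) * L + r : ℕ) / (M * L : ℕ) : ℝ≥0))) = _ from h1]
  unfold gridFamily
  congr 3
  · push_cast; field_simp
  · push_cast; field_simp; simp

lemma cell_refine {M L : ℕ} (hM : 0 < M) (hL : 0 < L) {N N' : ℕ} (hN : N * L ≤ N') (j : Fin N)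
    {x : ℝ} (hx : 0 ≤ x) (hx' : Irrational x) :
    cell M j x = ∑ i : Fin N', refineCoeff L j i * cell (M * L) i x := by
  have hL' : (0 : ℝ) < L := by exact_mod_cast hL
  have hML : 0 < M * L := Nat.mul_pos hM hL
  have hfl : ⌊((M * L : ℕ) : ℝ) * x⌋₊ / L = ⌊(M : ℝ) * x⌋₊ := by
    rw [← Nat.floor_div_natCast]
    congr 1
    push_cast
    field_simp
  rw [cell_eq_ite hM hx hx']
  simp_rw [fun i : ℕ => cell_eq_ite hML hx hx' i]
  unfold refineCoeff
  by_cases h : (j : ℕ) = ⌊(M : ℝ) * x⌋₊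
  · rw [if_pos h]
    have hlt : ⌊((M * L : ℕ) : ℝ) * x⌋₊ < N' := by
      have h1 : ⌊((M * L : ℕ) : ℝ) * x⌋₊ < (j + 1 : ℕ) * L := by
        rw [← Nat.div_lt_iff_lt_mul hL, hfl, ← h]; omega
      have h2 : (j + 1 : ℕ) * L ≤ N * L := Nat.mul_le_mul_right L j.2
      omega
    rw [Finset.sum_eq_single (⟨_, hlt⟩ : Fin N')]
    · rw [if_pos (hfl.trans h.symm), if_pos rfl]
      push_cast
      rw [Real.sqrt_mul (Nat.cast_nonneg M), mul_comm, mul_assoc,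
        mul_inv_cancel₀ (Real.sqrt_pos.2 hL').ne', mul_one]
    · intro i _ hi
      rw [if_neg (c := (i : ℕ) = _) fun h' => hi (Fin.ext h'), mul_zero]
    · intro h'; exact absurd (Finset.mem_univ _) h'
  · rw [if_neg h]
    symm
    refine Finset.sum_eq_zero fun i _ => ?_
    by_cases h1 : (i : ℕ) = ⌊((M * L : ℕ) : ℝ) * x⌋₊
    · rw [if_neg, zero_mul]
      rw [h1, hfl]; exact Ne.symm h
    · rw [if_neg h1, mul_zero]

lemma stepFun_expand {M L : ℕ} (hM : 0 < M) (hL : 0 < L) {N N' : ℕ} (hN : N * L ≤ N') {n : ℕ}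
    (a : (Fin n → Fin N) → ℝ) {t : Fin n → ℝ} (ht : ∀ i, 0 ≤ t i) (ht' : ∀ i, Irrational (t i)) :
    stepFun (M * L) (expand (refineCoeff (N' := N') L) a) t = stepFun M a t := by
  classical
  unfold stepFun expand
  simp_rw [fun (j : Fin n → Fin N) i => cell_refine hM hL hN (j i) (ht i) (ht' i),
    Finset.prod_univ_sum, Finset.sum_mul, Finset.mul_sum]
  rw [Finset.sum_comm]
  simp only [Fintype.piFinset_univ]
  refine Finset.sum_congr rfl fun j _ => Finset.sum_congr rfl fun k _ => ?_
  rw [Finset.prod_mul_distrib]; ring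

lemma IsQBrownianMotion.norm_tensorIntegral_le' (hX : IsQBrownianMotion W q X) (hq : 0 ≤ q)
    {M N : ℕ} (hM : 0 < M) (hN : 0 < N) {n : ℕ} {a : (Fin n → Fin N) → ℝ} (ha : IsOffDiag a) :
    ‖tensorIntegral (gridFamily X M N) a‖ ≤ ‖X 1‖ ^ n * l2norm (orthant n) (stepFun M a) := by
  obtain ⟨A, hA, rfl⟩ := exists_symTensor a ha.symm ha.diag
  rw [l2norm_stepFun hM]
  exact hX.norm_tensorIntegral_le hq hM hN hA n

lemma tensorIntegral_sub {ι : Type*} [Fintype ι] (Y : ι → W.Elem) {n : ℕ}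
    (a b : (Fin n → ι) → ℝ) :
    tensorIntegral Y (fun j => a j - b j) = tensorIntegral Y a - tensorIntegral Y b := by
  unfold tensorIntegral
  rw [← Finset.sum_sub_distrib]
  refine Finset.sum_congr rfl fun j _ => ?_
  rw [Complex.ofReal_sub, sub_smul]

/-- Both tensors are expanded on the common refinement of mesh `1 / (M M')`, where their difference
is again symmetric and off the diagonals. The operator norm bound then applies to it. -/
lemma IsQBrownianMotion.norm_tensorIntegral_sub_le (hX : IsQBrownianMotion W q X) (hq : 0 ≤ q)
    {M N M' N' : ℕ} (hM : 0 < M) (hM' : 0 < M') {n : ℕ} {a : (Fin n → Fin N) → ℝ}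
    {b : (Fin n → Fin N') → ℝ} (ha : IsOffDiag a) (hb : IsOffDiag b) :
    ‖tensorIntegral (gridFamily X M N) a - tensorIntegral (gridFamily X M' N') b‖ ≤
      ‖X 1‖ ^ n * l2norm (orthant n) (fun t => stepFun M a t - stepFun M' b t) := by
  -- Enough fine cells to contain both grids; the `1` keeps the grid nonempty even if `N` and `N'`
  -- are zero.
  let K := N * M' + N' * M + 1
  have hK1 : N * M' ≤ K := by simp only [K]; omega
  have hK2 : N' * M ≤ K := by simp only [K]; omega
  have hK : 0 < K := by simp only [K]; omega
  have g2 : ∀ j, gridFamily X M' N' j =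
      ∑ i, (refineCoeff M j i : ℂ) • gridFamily X (M * M') K i := fun j => by
    rw [mul_comm M M']; exact gridFamily_refine X hM' hM hK2 j
  rw [tensorIntegral_expand (gridFamily_refine X hM hM' hK1) a, tensorIntegral_expand g2 b,
    ← tensorIntegral_sub]
  refine (hX.norm_tensorIntegral_le' hq (Nat.mul_pos hM hM') hK
    ((ha.expand refineCoeff_inj).sub (hb.expand refineCoeff_inj))).trans (le_of_eq ?_)
  congr 1
  unfold l2norm
  congr 1
  refine eLpNorm_congr_ae ?_
  filter_upwards [ae_nonneg n, ae_irrational n] with t h1 h2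
  rw [stepFun_sub, stepFun_expand hM hM' hK1 a h1 h2]
  congr 1
  have := stepFun_expand hM' hM hK2 b h1 h2
  rwa [mul_comm M' M] at this

end Refinement

/-! ### Existence of the multiple integral in the algebra -/

section Existence

variable {H : Type*} [NormedAddCommGroup H] [InnerProductSpace ℂ H] [CompleteSpace H]
  {W : WStarProbabilitySpace H} {q : ℝ} {X : ℝ≥0 → W.Elem}

/-- The box of distinct cells of a grid. -/
def cellBox {M N n : ℕ} (j : Fin n → Fin N) (hj : Function.Injective j) : Box n where
  lower i := ((j i : ℕ) : ℝ≥0) / M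
  upper i := ((j i + 1 : ℕ) : ℝ≥0) / M
  le i := by gcongr; omega
  disjoint := by
    intro i i' hii'
    have hne : (j i : ℕ) ≠ j i' := fun h => hii' (hj (Fin.ext h))
    rw [Set.disjoint_left]
    rintro x ⟨h1, h2⟩ ⟨h3, h4⟩
    rcases lt_or_gt_of_ne hne with h | h
    · have : ((j i + 1 : ℕ) : ℝ≥0) / M ≤ ((j i' : ℕ) : ℝ≥0) / M := by gcongr; omega
      exact absurd (h2.trans_le (this.trans h3.le)) (lt_irrefl _)
    · have : ((j i' + 1 : ℕ) : ℝ≥0) / M ≤ ((j i : ℕ) : ℝ≥0) / M := by gcongr; omega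
      exact absurd (h4.trans_le (this.trans h1.le)) (lt_irrefl _)

lemma simpleKernel_sum_single {n : ℕ} {S : Type*} (s : Finset S) (B : S → Box n) (c : S → ℝ)
    (t : Fin n → ℝ) :
    simpleKernel (∑ x ∈ s, Finsupp.single (B x) (c x)) t = ∑ x ∈ s, c x * (B x).kernel t := by
  unfold simpleKernel
  rw [← Finsupp.sum_finsetSum_index (h := fun B a => a * Box.kernel B t)
    (fun B => zero_mul _) (fun B a b => add_mul _ _ _)]
  refine Finset.sum_congr rfl fun x _ => ?_
  rw [Finsupp.sum_single_index (zero_mul _)]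

lemma simpleIntegral_sum_single {n : ℕ} {S : Type*} (s : Finset S) (B : S → Box n) (c : S → ℝ) :
    simpleIntegral X (∑ x ∈ s, Finsupp.single (B x) (c x)) =
      ∑ x ∈ s, (c x : ℂ) • (B x).integral X := by
  unfold simpleIntegral
  rw [← Finsupp.sum_finsetSum_index (h := fun B (a : ℝ) => (a : ℂ) • Box.integral X B)
    (fun B => by simp) (fun B a b => by rw [Complex.ofReal_add, add_smul])]
  refine Finset.sum_congr rfl fun x _ => ?_
  rw [Finsupp.sum_single_index (by simp)]

lemma sum_injective_eq {E : Type*} [AddCommMonoid E] {N n : ℕ} (g : (Fin n → Fin N) → E)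
    (hg : ∀ j, ¬ Function.Injective j → g j = 0) :
    ∑ j : {j : Fin n → Fin N // Function.Injective j}, g j.1 = ∑ j, g j := by
  classical
  rw [← Fintype.sum_subtype_add_sum_subtype (fun j : Fin n → Fin N => Function.Injective j) g,
    Fintype.sum_eq_zero (fun j : {j : Fin n → Fin N // ¬ Function.Injective j} => g j.1)
      fun j => hg j.1 j.2, add_zero]

/-- Tensors on a grid that vanish on the diagonals are combinations of boxes. -/
lemma exists_simple (X : ℝ≥0 → W.Elem) (M : ℕ) {N n : ℕ} {a : (Fin n → Fin N) → ℝ}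
    (ha : IsOffDiag a) : ∃ F : Box n →₀ ℝ, simpleKernel F = stepFun M a ∧
      simpleIntegral X F = tensorIntegral (gridFamily X M N) a := by
  classical
  let F : Box n →₀ ℝ := ∑ j : {j : Fin n → Fin N // Function.Injective j},
    Finsupp.single (cellBox (M := M) j.1 j.2) (a j.1 * Real.sqrt M ^ n)
  refine ⟨F, ?_, ?_⟩
  · funext t
    simp only [F]
    rw [simpleKernel_sum_single]
    unfold stepFun
    rw [← sum_injective_eq (fun j => a j * ∏ i, cell M (j i) (t i)) fun j hj => by rw [ha.diag j hj, zero_mul]]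
    refine Finset.sum_congr rfl fun j _ => ?_
    rw [mul_assoc]
    congr 1
    unfold cell
    rw [Finset.prod_mul_distrib]
    simp only [Finset.prod_const, Finset.card_univ, Fintype.card_fin]
    congr 1
  · simp only [F]
    rw [simpleIntegral_sum_single]
    unfold tensorIntegral
    rw [← sum_injective_eq (fun j => (a j : ℂ) • (List.ofFn fun x => gridFamily X M N (j x)).prod)
      fun j hj => by rw [ha.diag j hj, Complex.ofReal_zero, zero_smul]]
    refine Finset.sum_congr rfl fun j _ => ?_
    have e := MultilinearMap.map_smul_univ (MultilinearMap.mkPiAlgebraFin ℂ n W.Elem)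
      (fun _ => ((Real.sqrt M : ℝ) : ℂ)) (fun x => X (((j.1 x : ℕ) + 1 : ℕ) / M : ℝ≥0) -
        X (((j.1 x : ℕ) : ℕ) / M : ℝ≥0))
    simp only [MultilinearMap.mkPiAlgebraFin_apply, Finset.prod_const, Finset.card_univ,
      Fintype.card_fin] at e
    unfold gridFamily
    rw [e, smul_smul, Complex.ofReal_mul, Complex.ofReal_pow]
    rfl

/-- The integrals of approximating tensors form a Cauchy sequence in operator norm, not merely in
`L²(𝒜, φ)`. Hence the limit is an element of the algebra. The second clause is the same estimate in
the limit; it is the tool for replacing integrals by tensors inside moments. -/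
lemma IsQBrownianMotion.exists_multipleIntegral (hX : IsQBrownianMotion W q X) (hq0 : 0 ≤ q)
    (hq1 : q ≤ 1) {n : ℕ} {f : (Fin n → ℝ) → ℝ} (hf : MemLp f 2 (orthant n))
    (hsymm : IsSymmetricKernel f) :
    IsMultipleIntegral X f (multipleIntegral X f) ∧
    ∀ {M N : ℕ} (hM : 0 < M) {a : (Fin n → Fin N) → ℝ} (ha : IsOffDiag a),
      ‖multipleIntegral X f - tensorIntegral (gridFamily X M N) a‖ ≤
        ‖X 1‖ ^ n * l2norm (orthant n) (fun t => f t - stepFun M a t) := by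
  set C := ‖X 1‖ ^ n with hC
  have hC0 : 0 ≤ C := by positivity
  have hex : ∀ m : ℕ, ∃ M : ℕ, 0 < M ∧ ∃ a : (Fin n → Fin (M * M)) → ℝ, IsOffDiag a ∧
      l2norm (orthant n) (fun t => f t - stepFun M a t) ≤ 1 / (m + 1 : ℝ) := by
    intro m
    obtain ⟨M, ⟨A, hA, h1, h2⟩, hM⟩ := ((eventually_exists_symTensor hf hsymm
      (ε := 1 / (m + 1 : ℝ)) (by positivity)).and (eventually_gt_atTop 0)).exists
    exact ⟨M, hM, _, isOffDiag_symTensor hA n, h1⟩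
  choose M hM a ha hfa using hex
  let T : ℕ → W.Elem := fun m => tensorIntegral (gridFamily X (M m) (M m * M m)) (a m)
  have hdist : ∀ m {M' N' : ℕ} (hM' : 0 < M') {b : (Fin n → Fin N') → ℝ} (hb : IsOffDiag b),
      ‖T m - tensorIntegral (gridFamily X M' N') b‖ ≤
        C * (1 / (m + 1 : ℝ) + l2norm (orthant n) (fun t => f t - stepFun M' b t)) := by
    intro m M' N' hM' b hb
    refine (hX.norm_tensorIntegral_sub_le hq0 (hM m) hM' (ha m) hb).trans
      (mul_le_mul_of_nonneg_left ?_ hC0)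
    have a1 : MemLp (fun t => f t - stepFun M' b t) 2 (orthant n) := hf.sub (memLp_stepFun hM' _)
    have a2 : MemLp (fun t => f t - stepFun (M m) (a m) t) 2 (orthant n) :=
      hf.sub (memLp_stepFun (hM m) _)
    have e : (fun t => stepFun (M m) (a m) t - stepFun M' b t) = fun t =>
        (f t - stepFun M' b t) - (f t - stepFun (M m) (a m) t) := by funext t; ring
    rw [e]
    refine (l2norm_sub_le a1 a2).trans ?_
    linarith [hfa m]
  have hzero : Tendsto (fun m : ℕ => 1 / ((m : ℝ) + 1)) atTop (𝓝 0) :=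
    tendsto_one_div_add_atTop_nhds_zero_nat
  have hcauchy : CauchySeq T := by
    refine cauchySeq_of_le_tendsto_0' (fun m => 2 * C * (1 / ((m : ℝ) + 1))) (fun m k hmk => ?_)
      (by simpa using hzero.const_mul (2 * C))
    rw [dist_eq_norm]
    refine (hdist m (hM k) (ha k)).trans ?_
    have h1 : 1 / ((k : ℝ) + 1) ≤ 1 / ((m : ℝ) + 1) :=
      one_div_le_one_div_of_le (by positivity) (by simpa using hmk)
    have h2 := (hfa k).trans h1
    nlinarith
  obtain ⟨Y, hY⟩ := cauchySeq_tendsto_of_complete hcauchy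
  have hYint : IsMultipleIntegral X f Y := by
    choose F hF1 hF2 using fun m => exists_simple X (M m) (ha m)
    refine ⟨F, ?_, ?_⟩
    · have h1 : Tendsto (fun m => l2norm (orthant n) (fun t => f t - simpleKernel (F m) t)) atTop
          (𝓝 0) := by
        refine squeeze_zero (fun m => l2norm_nonneg _) (fun m => ?_) hzero
        rw [hF1]; exact hfa m
      rw [← ENNReal.tendsto_toReal_iff (fun m => ?_) ENNReal.zero_ne_top]
      · exact h1
      · exact (hf.sub (memLp_simpleKernel (F m))).2.ne
    · rw [tendsto_zero_iff_norm_tendsto_zero]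
      have h2 : Tendsto (fun m => ‖Y - T m‖ * ‖Y - T m‖) atTop (𝓝 0) := by
        have h3 : Tendsto (fun m => ‖Y - T m‖) atTop (𝓝 0) := by
          have := (tendsto_const_nhds (x := Y)).sub hY
          rw [sub_self] at this
          simpa using this.norm
        simpa using h3.mul h3
      refine squeeze_zero (fun m => norm_nonneg _) (fun m => ?_) h2
      rw [hF2]
      refine (W.isFaithfulState.norm_le _).trans ?_
      refine (norm_mul_le _ _).trans ?_
      rw [norm_star]
  have hYeq := hYint.eq hX hq0 hq1 hf
  refine ⟨by rw [hYeq]; exact hYint, ?_⟩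
  intro M' N' hM' b hb
  rw [hYeq]
  have h1 : Tendsto (fun m => ‖T m - tensorIntegral (gridFamily X M' N') b‖) atTop
      (𝓝 ‖Y - tensorIntegral (gridFamily X M' N') b‖) := (hY.sub_const _).norm
  have h2 : Tendsto (fun m : ℕ => C * (1 / (m + 1 : ℝ) +
      l2norm (orthant n) (fun t => f t - stepFun M' b t))) atTop
      (𝓝 (C * (0 + l2norm (orthant n) (fun t => f t - stepFun M' b t)))) :=
    (hzero.add_const _).const_mul C
  rw [zero_add] at h2
  exact le_of_tendsto_of_tendsto' h1 h2 fun m => hdist m hM' hb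

end Existence

/-! ### The weight of a coloured pairing -/

section ColourWeight

variable {r : ℕ}

/-- Among the pairs `N ≤ M`, only `(min x y, max x y)` contributes. -/
lemma sum_min_max (I : Finset ℕ) {x y : ℕ} (hx : x ∈ I) (hy : y ∈ I) :
    ∑ N ∈ I, ∑ M ∈ I.filter (fun M => N ≤ M),
      (if (x = N ∧ y = M) ∨ (x = M ∧ y = N) then N * M else 0) = x * y := by
  have hmin : min x y ∈ I := by rcases min_choice x y with h | h <;> rw [h] <;> assumption
  have hmax : max x y ∈ I := by rcases max_choice x y with h | h <;> rw [h] <;> assumption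
  rw [Finset.sum_eq_single (min x y), Finset.sum_eq_single (max x y), if_pos, min_mul_max]
  · rcases le_total x y with h | h <;> simp [h]
  · intro M hM hne
    rw [if_neg]
    rw [Finset.mem_filter] at hM
    rintro (⟨h1, h2⟩ | ⟨h1, h2⟩) <;> omega
  · intro h
    exact absurd (Finset.mem_filter.2 ⟨hmax, min_le_max⟩) h
  · intro N hN hne
    refine Finset.sum_eq_zero fun M hM => ?_
    rw [if_neg]
    rw [Finset.mem_filter] at hM
    rintro (⟨h1, h2⟩ | ⟨h1, h2⟩) <;> omega
  · intro h; exact absurd hmin h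

/-- When colours are respected a pair has the colour of its left endpoint. Each crossing is then
counted for exactly one unordered pair of colours and contributes their product, as a crossing of
blocks of these sizes does. -/
lemma Pairing.colourWeight_eq (π : Pairing r) {m : Fin r → ℕ} (h : π.RespectsColours m) (q : ℝ) :
    π.colourWeight m q = q ^ blockCrossings m π := by
  unfold Pairing.colourWeight
  simp_rw [Finset.prod_pow_eq_pow_sum]
  congr 1
  set I := Finset.univ.image m with hI
  have hmem : ∀ l, m l ∈ I := fun l => Finset.mem_image_of_mem m (Finset.mem_univ l)
  let P := (π.pairs ×ˢ π.pairs).filter fun e => Crosses e.1 e.2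
  have memP : ∀ {e}, e ∈ P ↔ (e.1 ∈ π.pairs ∧ e.2 ∈ π.pairs) ∧ Crosses e.1 e.2 := fun {e} => by
    rw [Finset.mem_filter, Finset.mem_product]
  have h1 : ∀ N M : ℕ, π.crBetween (π.pairsOfColour m N) (π.pairsOfColour m M) * N * M =
      ∑ e ∈ P, if (m e.1.1 = N ∧ m e.2.1 = M) ∨ (m e.1.1 = M ∧ m e.2.1 = N) then N * M else 0 := by
    intro N M
    rw [← Finset.sum_filter, Finset.sum_const, smul_eq_mul, mul_assoc]
    congr 1
    unfold Pairing.crBetween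
    rw [Finset.filter_filter]
    congr 1
    refine Finset.filter_congr fun e he => ?_
    rw [Finset.mem_product] at he
    have key : ∀ e' ∈ π.pairs, ∀ N, e' ∈ π.pairsOfColour m N ↔ m e'.1 = N := by
      intro e' he' N
      unfold Pairing.pairsOfColour
      rw [Finset.mem_filter]
      have := h e' he'
      constructor
      · exact fun h => h.2.1
      · exact fun h => ⟨he', h, this ▸ h⟩
    rw [key _ he.1, key _ he.1, key _ he.2, key _ he.2]
  simp_rw [h1]
  have h2 : ∀ N ∈ I, ∑ M ∈ I.filter (fun M => N ≤ M), ∑ e ∈ P,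
      (if (m e.1.1 = N ∧ m e.2.1 = M) ∨ (m e.1.1 = M ∧ m e.2.1 = N) then N * M else 0) =
      ∑ e ∈ P, ∑ M ∈ I.filter (fun M => N ≤ M),
      (if (m e.1.1 = N ∧ m e.2.1 = M) ∨ (m e.1.1 = M ∧ m e.2.1 = N) then N * M else 0) :=
    fun N _ => Finset.sum_comm
  rw [Finset.sum_congr rfl h2, Finset.sum_comm]
  rw [Finset.sum_congr rfl fun e _ => sum_min_max I (hmem e.1.1) (hmem e.2.1)]
  unfold blockCrossings
  rw [← Finset.sum_product', Finset.univ_product_univ, ← Finset.sum_filter]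
  refine Finset.sum_nbij' (fun e => (e.1.1, e.2.1)) (fun x => ((x.1, π.1 x.1), (x.2, π.1 x.2)))
    ?_ ?_ ?_ ?_ ?_
  · intro e he
    obtain ⟨⟨h1, h2⟩, h3⟩ := memP.1 he
    rw [Pairing.mem_pairs] at h1 h2
    refine Finset.mem_filter.2 ⟨Finset.mem_univ _, ?_⟩
    simp only [h1.2, h2.2]
    exact h3
  · intro x hx
    have h5 := (Finset.mem_filter.1 hx).2
    exact memP.2 ⟨⟨(π.mem_pairs _).2 ⟨h5.1.trans h5.2.1, rfl⟩,
      (π.mem_pairs _).2 ⟨h5.2.1.trans h5.2.2, rfl⟩⟩, h5⟩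
  · intro e he
    obtain ⟨⟨h1, h2⟩, h3⟩ := memP.1 he
    rw [Pairing.mem_pairs] at h1 h2
    simp only [h1.2, h2.2]
  · intro x hx
    rfl
  · intro e he
    rfl

end ColourWeight

/-! ### Bilinear forms on tensors -/

section Forms

variable {ι : Type*} [Fintype ι] [DecidableEq ι]

lemma sum_sum_kronecker {n m : ℕ} (a : (Fin n → ι) → ℝ) (b : (Fin m → ι) → ℝ)
    (σ : Fin n ≃ Fin m) :
    ∑ j, ∑ j', a j * b j' * ∏ x, kronecker (j x) (j' (σ x)) = ∑ j', a (j' ∘ σ) * b j' := by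
  rw [Finset.sum_comm]
  refine Finset.sum_congr rfl fun j' _ => ?_
  rw [Finset.sum_eq_single (j' ∘ σ)]
  · simp [kronecker]
  · intro j _ hj
    obtain ⟨x, hx⟩ := Function.ne_iff.1 hj
    rw [Finset.prod_eq_zero (Finset.mem_univ x), mul_zero]
    unfold kronecker
    rw [if_neg]
    exact hx
  · intro h; exact absurd (Finset.mem_univ _) h

lemma crossForm_kronecker_eq (q : ℝ) {n m : ℕ} (a : (Fin n → ι) → ℝ) (b : (Fin m → ι) → ℝ) :
    crossForm q kronecker a b = ∑ σ : Fin n ≃ Fin m, q ^ noninv σ * ∑ j', a (j' ∘ σ) * b j' := by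
  unfold crossForm
  simp_rw [← sum_sum_kronecker, Finset.mul_sum]
  rw [Finset.sum_comm' (t' := Finset.univ) (s' := fun _ => Finset.univ) (by simp)]
  rw [Finset.sum_congr rfl fun j _ => Finset.sum_comm, Finset.sum_comm]
  refine Finset.sum_congr rfl fun σ _ => ?_
  rw [Finset.sum_comm]
  refine Finset.sum_congr rfl fun j _ => Finset.sum_congr rfl fun j' _ => ?_
  ring

lemma crossForm_of_ne (q : ℝ) {n m : ℕ} (h : n ≠ m) (a : (Fin n → ι) → ℝ)
    (b : (Fin m → ι) → ℝ) : crossForm q kronecker a b = 0 := by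
  rw [crossForm_kronecker_eq]
  have : IsEmpty (Fin n ≃ Fin m) := ⟨fun σ => h (by simpa using Fintype.card_congr σ)⟩
  rw [Finset.univ_eq_empty, Finset.sum_empty]

lemma symTensor_comp_equiv (A : Multiset ι → ℝ) {n m : ℕ} (σ : Fin n ≃ Fin m) (j : Fin m → ι) :
    symTensor A n (j ∘ σ) = symTensor A m j := by
  unfold symTensor
  congr 1
  rw [← Multiset.map_map]
  congr 1
  exact congrArg Finset.val (Finset.map_univ_equiv σ)

lemma tensorInner_symTensor (q : ℝ) (A B : Multiset ι → ℝ) (n : ℕ) :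
    tensorInner q (symTensor A n) (symTensor B n) =
      (∑ σ : Equiv.Perm (Fin n), q ^ inv σ) * ∑ j, symTensor A n j * symTensor B n j := by
  unfold tensorInner
  simp_rw [symTensor_comp_equiv]
  rw [Finset.sum_mul]

/-- For symmetric tensors the direction of reading does not matter, so the reversal that separates
`noninv` from `inv` only relabels the permutations. -/
lemma crossForm_symTensor (q : ℝ) (A B : Multiset ι → ℝ) {n m : ℕ} (h : n = m) :
    crossForm q kronecker (symTensor A n) (symTensor B m) =
      tensorInner q (symTensor A n) (symTensor B n) := by
  subst h
  rw [crossForm_kronecker_eq, tensorInner_symTensor]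
  simp_rw [symTensor_comp_equiv]
  rw [← Finset.sum_mul]
  congr 1
  symm
  refine Fintype.sum_equiv (Equiv.mulRight (Fin.revPerm : Equiv.Perm (Fin n))) _ _ fun σ => ?_
  rw [← noninv_revPerm_trans]
  rfl

lemma inv_one (n : ℕ) : inv (1 : Equiv.Perm (Fin n)) = 0 := by
  unfold inv
  rw [Finset.card_eq_zero, Finset.filter_eq_empty_iff]
  intro p _ h
  exact absurd h.1 h.2.not_gt

lemma one_le_sum_pow_inv {q : ℝ} (hq : 0 ≤ q) (n : ℕ) :
    1 ≤ ∑ σ : Equiv.Perm (Fin n), q ^ inv σ := by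
  calc (1 : ℝ) = q ^ inv (1 : Equiv.Perm (Fin n)) := by rw [inv_one, pow_zero]
    _ ≤ _ := Finset.single_le_sum (f := fun σ : Equiv.Perm (Fin n) => q ^ inv σ)
      (fun σ _ => pow_nonneg hq _) (Finset.mem_univ _)

/-- The identity has weight `1` and the other permutations nonnegative weights. Thus convergent
`q`-norms give bounded `L²` norms. -/
lemma nrmSq_le_tensorInner {q : ℝ} (hq : 0 ≤ q) (A : Multiset ι → ℝ) (n : ℕ) :
    nrmSq A n ≤ tensorInner q (symTensor A n) (symTensor A n) := by
  rw [tensorInner_symTensor]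
  have h : ∑ j, symTensor A n j * symTensor A n j = nrmSq A n := by
    unfold nrmSq; simp_rw [sq]
  rw [h]
  exact le_mul_of_one_le_left (nrmSq_nonneg A n) (one_le_sum_pow_inv hq n)

end Forms

/-! ### Limits of joint moments under vanishing contractions -/

section Moments

variable {d : ℕ}

/-- The joint moments of the multiple integrals of symmetric tensors. -/
def jointMoment {ι : Type*} [Fintype ι] [DecidableEq ι] (q : ℝ) (n : Fin d → ℕ)
    (A : Fin d → Multiset ι → ℝ) {r : ℕ} (i : Fin r → Fin d) : ℝ :=
  ∑ π : PairingOn (Pts fun l => n (i l)), q ^ crossings π *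
    network kronecker (fun l => symTensor (A (i l)) (n (i l))) π

-- The pairings of points are split according to whether they match whole blocks. As the blocks are
-- nonempty, the underlying pairing of blocks is unique, so the first class is a disjoint union of
-- fibres. Fibres that pair blocks of different sizes contribute zero, for lack of a bijection.
open Classical in
lemma jointMoment_eq {ι : Type*} [Fintype ι] [DecidableEq ι] (q : ℝ) {n : Fin d → ℕ}
    (hn : ∀ i, 1 ≤ n i) (A : Fin d → Multiset ι → ℝ) {r : ℕ} (i : Fin r → Fin d) :
    jointMoment q n A i =
      ∑ ρ ∈ (Finset.univ : Finset (Pairing r)).filter (fun ρ => ρ.RespectsColours fun l => n (i l)),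
        ρ.colourWeight (fun l => n (i l)) q *
          ∏ e ∈ ρ.pairs, tensorInner q (symTensor (A (i e.1)) (n (i e.1)))
            (symTensor (A (i e.2)) (n (i e.1))) +
      ∑ π : PairingOn (Pts fun l => n (i l)) with ∀ ρ, ¬ Over π ρ, q ^ crossings π *
        network kronecker (fun l => symTensor (A (i l)) (n (i l))) π := by
  unfold jointMoment
  rw [← Finset.sum_filter_add_sum_filter_not _
    (fun π : PairingOn (Pts fun l => n (i l)) => ∃ ρ, Over π ρ)]
  congr 1
  · have hu : ∀ π : PairingOn (Pts fun l => n (i l)), ∀ ρ ρ', Over π ρ → Over π ρ' → ρ = ρ' := by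
      intro π ρ ρ' h h'
      refine Subtype.ext (Equiv.ext fun l => ?_)
      have x : Fin (n (i l)) := ⟨0, hn _⟩
      exact (h (Pts.mk l x)).symm.trans (h' (Pts.mk l x))
    have hb : (Finset.univ.filter fun π : PairingOn (Pts fun l => n (i l)) => ∃ ρ, Over π ρ) =
        (Finset.univ : Finset (Pairing r)).biUnion
          fun ρ => Finset.univ.filter fun π => Over π ρ := by
      ext π; simp
    rw [hb, Finset.sum_biUnion]
    · simp_rw [sum_network_over]
      rw [← Finset.sum_filter_add_sum_filter_not _
        (fun ρ : Pairing r => ρ.RespectsColours fun l => n (i l))]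
      rw [Finset.sum_eq_zero (s := Finset.univ.filter fun ρ : Pairing r =>
        ¬ ρ.RespectsColours fun l => n (i l)), add_zero]
      · refine Finset.sum_congr rfl fun ρ hρ => ?_
        have hρ' := (Finset.mem_filter.1 hρ).2
        rw [Pairing.colourWeight_eq ρ hρ', Pairing.prod_pairs ρ (fun a b => tensorInner q
          (symTensor (A (i a)) (n (i a))) (symTensor (A (i b)) (n (i a))))]
        congr 1
        refine Finset.prod_congr rfl fun l hl => ?_
        exact crossForm_symTensor q _ _ (hρ' (l, ρ.1 l) ((ρ.mem_pairs _).2 ⟨mem_opens.1 hl, rfl⟩))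
      · intro ρ hρ
        have hρ' := (Finset.mem_filter.1 hρ).2
        unfold Pairing.RespectsColours at hρ'
        push Not at hρ'
        obtain ⟨e, he, hne⟩ := hρ'
        have he' := (ρ.mem_pairs e).1 he
        rw [Finset.prod_eq_zero (i := e.1), mul_zero]
        · exact mem_opens.2 (by rw [he'.2]; exact he'.1)
        · refine crossForm_of_ne q ?_ _ _
          rw [he'.2]; exact hne
    · intro ρ _ ρ' _ hne
      rw [Function.onFun, Finset.disjoint_left]
      intro π h h'
      exact hne (hu π ρ ρ' (Finset.mem_filter.1 h).2 (Finset.mem_filter.1 h').2)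
  · refine Finset.sum_congr ?_ fun _ _ => rfl
    ext π
    simp

variable {ι : ℕ → Type} [∀ k, Fintype (ι k)] [∀ k, DecidableEq (ι k)] [∀ k, Nonempty (ι k)]

/-- Fourth moment theorem, from vanishing contractions to joint moments. -/
lemma tendsto_jointMoment {q : ℝ} (hq0 : 0 ≤ q) {n : Fin d → ℕ} (hn : ∀ i, 1 ≤ n i)
    (A : ∀ k, Fin d → Multiset (ι k) → ℝ) (hA : ∀ k i s, A k i s ≠ 0 → s.Nodup)
    {c : Fin d → Fin d → ℝ}
    (hc : ∀ i j, n i = n j → Tendsto (fun k => tensorInner q (symTensor (A k i) (n i))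
      (symTensor (A k j) (n i))) atTop (𝓝 (c i j)))
    (hcontr : ∀ i p, 1 ≤ p → p < n i →
      Tendsto (fun k => contrSq (A k i) p (n i - p)) atTop (𝓝 0))
    {r : ℕ} (i : Fin r → Fin d) :
    Tendsto (fun k => jointMoment q n (A k) i) atTop
      (𝓝 (colouredMoment q (fun l => n (i l)) (fun l m => c (i l) (i m)))) := by
  classical
  have hbdd : ∀ j, ∃ B, ∀ k, Real.sqrt (nrmSq (A k j) (n j)) ≤ B := by
    intro j
    obtain ⟨B, hB⟩ := (hc j j rfl).bddAbove_range
    refine ⟨Real.sqrt B, fun k => Real.sqrt_le_sqrt ?_⟩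
    exact (nrmSq_le_tensorInner hq0 _ _).trans (hB (Set.mem_range_self k))
  choose B hB using hbdd
  simp_rw [jointMoment_eq q hn]
  rw [← add_zero (colouredMoment _ _ _)]
  refine Tendsto.add ?_ ?_
  · unfold colouredMoment
    refine tendsto_finsetSum _ fun ρ hρ => Tendsto.const_mul _ (tendsto_finsetProd _ fun e he => ?_)
    exact hc _ _ ((Finset.mem_filter.1 hρ).2 e he)
  · rw [← Finset.sum_const_zero (s := Finset.univ.filter
      fun π : PairingOn (Pts fun l => n (i l)) => ∀ ρ, ¬ Over π ρ)]
    refine tendsto_finsetSum _ fun π hπ => ?_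
    have hπ' := (Finset.mem_filter.1 hπ).2
    rw [← mul_zero (q ^ crossings π)]
    refine Tendsto.const_mul _ ?_
    by_cases h : ∀ p, (π.1 p).1 ≠ p.1
    · obtain ⟨l, p, hp1, hp2, hbd⟩ := abs_network_le_contr π h (fun l => hn _) hπ'
      refine squeeze_zero_norm (fun k => (hbd (ι k) fun l => A k (i l)).trans (mul_le_mul_of_nonneg_left
        (Finset.prod_le_prod (fun v _ => Real.sqrt_nonneg _) fun v _ => hB (i v) k)
        (Real.sqrt_nonneg _))) ?_
      -- The bound counts by `p` the variables left free, so the order of the contraction is `n -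
      -- p`, which is also strictly between `0` and `n`.
      have h1 := hcontr (i l) (n (i l) - p) (by omega) (by omega)
      rw [show n (i l) - (n (i l) - p) = p by omega] at h1
      have h2 := (Real.continuous_sqrt.tendsto _).comp ((Real.continuous_sqrt.tendsto _).comp h1)
      rw [Real.sqrt_zero, Real.sqrt_zero] at h2
      simpa using h2.mul_const (∏ v ∈ Finset.univ.erase l, B (i v))
    · push Not at h
      obtain ⟨p, hp⟩ := h
      refine tendsto_const_nhds.congr fun k => ?_
      exact (network_eq_zero_of_inner
        (fun l => symTensor_injective_of_ne_zero (hA k (i l)) _) hp).symm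

end Moments

/-! ### Four tensors arranged in a cycle -/

section FourCycle

variable {ι E : Type*} [Fintype ι] [DecidableEq ι] [Fintype E] [DecidableEq E]

lemma map_univ_equivFin {S : Finset E} {k : ℕ} (h : S.card = k) (J : E → ι) :
    (Finset.univ : Finset (Fin k)).val.map (fun i => J ((S.equivFinOfCardEq h).symm i)) =
      S.val.map J := by
  have h1 : (Finset.univ : Finset (Fin k)).val.map
      (fun i => (((S.equivFinOfCardEq h).symm i : S) : E)) = S.val := by
    have e1 : (Finset.univ : Finset S).val =
        (Finset.univ : Finset (Fin k)).val.map (S.equivFinOfCardEq h).symm :=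
      (congrArg Finset.val (Finset.map_univ_equiv (S.equivFinOfCardEq h).symm)).symm
    have e2 : (Finset.univ : Finset S).val.map Subtype.val = S.val := by
      rw [Finset.univ_eq_attach, Finset.attach_val, Multiset.attach_map_val]
    rw [← e2, e1, Multiset.map_map]
    rfl
  rw [← h1, Multiset.map_map]
  rfl

lemma map_inter_add_sdiff (P R : Finset E) (J : E → ι) :
    P.val.map J = (P ∩ R).val.map J + (P \ R).val.map J := by
  rw [← Multiset.map_add]
  congr 1
  have hd : Disjoint (P ∩ R) (P \ R) := (Finset.disjoint_sdiff_inter P R).symm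
  have h : P = (P ∩ R).disjUnion (P \ R) hd := by
    rw [Finset.disjUnion_eq_union]
    ext x
    simp only [Finset.mem_union, Finset.mem_inter, Finset.mem_sdiff]
    tauto
  conv_lhs => rw [h]
  rfl

/-- The contraction of four symmetric tensors along a cycle. -/
lemma sum_four_cycle (A : Multiset ι → ℝ) {n p : ℕ} {P R : Finset E} (hP : P.card = n)
    (hR : R.card = n) (hE : Fintype.card E = 2 * n) (hp : (P ∩ R).card = p) :
    ∑ J : E → ι, A (P.val.map J) * A (Pᶜ.val.map J) * (A (R.val.map J) * A (Rᶜ.val.map J)) =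
      contrSq A (n - p) p := by
  have c2 : (P \ R).card = n - p := by
    rw [Finset.card_sdiff, Finset.inter_comm, hP, hp]
  have c3 : (R \ P).card = n - p := by
    rw [Finset.card_sdiff, hR, hp]
  have hpn : p ≤ n := by rw [← hp, ← hP]; exact Finset.card_le_card Finset.inter_subset_left
  have c4 : (Pᶜ \ R).card = p := by
    have h1 := Finset.card_inter_add_card_sdiff Pᶜ R
    have h2 : Pᶜ ∩ R = R \ P := by ext; simp [and_comm]
    rw [h2, c3, Finset.card_compl, hE, hP] at h1
    omega
  let e1 := (P ∩ R).equivFinOfCardEq hp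
  let e2 := (P \ R).equivFinOfCardEq c2
  let e3 := (R \ P).equivFinOfCardEq c3
  let e4 := (Pᶜ \ R).equivFinOfCardEq c4
  let f : (Fin p ⊕ Fin (n - p)) ⊕ (Fin (n - p) ⊕ Fin p) → E :=
    Sum.elim (Sum.elim (fun i => e1.symm i) (fun i => e2.symm i))
      (Sum.elim (fun i => e3.symm i) (fun i => e4.symm i))
  have hf : Function.Bijective f := by
    rw [Fintype.bijective_iff_surjective_and_card]
    constructor
    · intro x
      by_cases h1 : x ∈ P <;> by_cases h2 : x ∈ R
      · exact ⟨Sum.inl (Sum.inl (e1 ⟨x, Finset.mem_inter.2 ⟨h1, h2⟩⟩)), by simp [f]⟩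
      · exact ⟨Sum.inl (Sum.inr (e2 ⟨x, Finset.mem_sdiff.2 ⟨h1, h2⟩⟩)), by simp [f]⟩
      · exact ⟨Sum.inr (Sum.inl (e3 ⟨x, Finset.mem_sdiff.2 ⟨h2, h1⟩⟩)), by simp [f]⟩
      · exact ⟨Sum.inr (Sum.inr (e4 ⟨x, Finset.mem_sdiff.2 ⟨Finset.mem_compl.2 h1, h2⟩⟩)),
          by simp [f]⟩
    · simp only [Fintype.card_sum, Fintype.card_fin, hE]; omega
  let e := Equiv.ofBijective f hf
  let Φ : (E → ι) ≃ ((Fin p → ι) × (Fin (n - p) → ι)) × ((Fin (n - p) → ι) × (Fin p → ι)) :=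
    (Equiv.arrowCongr e.symm (Equiv.refl ι)).trans ((Equiv.sumArrowEquivProdArrow _ _ _).trans
      ((Equiv.sumArrowEquivProdArrow _ _ _).prodCongr (Equiv.sumArrowEquivProdArrow _ _ _)))
  -- The labels split into `w` on `P ∩ R`, `y` on `P \ R`, `z` on `R \ P` and `w'` on the rest. The
  -- product is `A(w+y) A(w'+z) A(w+z) A(w'+y)`. Summing over `y` and `z` gives the square of the
  -- contraction at `(w, w')`.
  let F : ((Fin p → ι) × (Fin (n - p) → ι)) × ((Fin (n - p) → ι) × (Fin p → ι)) → ℝ := fun z =>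
    A ((Finset.univ : Finset (Fin p)).val.map z.1.1 +
      (Finset.univ : Finset (Fin (n - p))).val.map z.1.2) *
    A ((Finset.univ : Finset (Fin p)).val.map z.2.2 +
      (Finset.univ : Finset (Fin (n - p))).val.map z.2.1) *
    (A ((Finset.univ : Finset (Fin p)).val.map z.1.1 +
      (Finset.univ : Finset (Fin (n - p))).val.map z.2.1) *
    A ((Finset.univ : Finset (Fin p)).val.map z.2.2 +
      (Finset.univ : Finset (Fin (n - p))).val.map z.1.2))
  have key : ∀ J : E → ι, A (P.val.map J) * A (Pᶜ.val.map J) *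
      (A (R.val.map J) * A (Rᶜ.val.map J)) = F (Φ J) := by
    intro J
    have m1 : (Finset.univ : Finset (Fin p)).val.map (Φ J).1.1 = (P ∩ R).val.map J :=
      map_univ_equivFin hp J
    have m2 : (Finset.univ : Finset (Fin (n - p))).val.map (Φ J).1.2 = (P \ R).val.map J :=
      map_univ_equivFin c2 J
    have m3 : (Finset.univ : Finset (Fin (n - p))).val.map (Φ J).2.1 = (R \ P).val.map J :=
      map_univ_equivFin c3 J
    have m4 : (Finset.univ : Finset (Fin p)).val.map (Φ J).2.2 = (Pᶜ \ R).val.map J :=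
      map_univ_equivFin c4 J
    simp only [F, m1, m2, m3, m4]
    rw [map_inter_add_sdiff P R, map_inter_add_sdiff Pᶜ R, map_inter_add_sdiff R P,
      map_inter_add_sdiff Rᶜ P]
    rw [show Pᶜ ∩ R = R \ P by ext; simp [and_comm], show R ∩ P = P ∩ R from Finset.inter_comm _ _,
      show Rᶜ ∩ P = P \ R by ext; simp [and_comm], show Rᶜ \ P = Pᶜ \ R by ext; simp [and_comm],
      add_comm ((R \ P).val.map J) ((Pᶜ \ R).val.map J),
      add_comm ((P \ R).val.map J) ((Pᶜ \ R).val.map J)]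
  refine (Fintype.sum_equiv Φ _ F key).trans ?_
  simp only [F]
  rw [Fintype.sum_prod_type, Fintype.sum_prod_type]
  unfold contrSq
  refine Finset.sum_congr rfl fun x _ => ?_
  simp_rw [Fintype.sum_prod_type]
  rw [Finset.sum_congr rfl fun y _ => Finset.sum_comm, Finset.sum_comm]
  refine Finset.sum_congr rfl fun w _ => ?_
  rw [sq, Finset.sum_mul_sum]
  refine Finset.sum_congr rfl fun y _ => Finset.sum_congr rfl fun z _ => ?_
  ring

lemma contrSq_zero_left (A : Multiset ι → ℝ) (n : ℕ) : contrSq A 0 n = nrmSq A n ^ 2 := by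
  unfold contrSq nrmSq symTensor
  rw [sq, Finset.sum_mul_sum]
  refine Finset.sum_congr rfl fun w _ => Finset.sum_congr rfl fun w' _ => ?_
  simp
  ring

lemma contrSq_zero_right (A : Multiset ι → ℝ) (n : ℕ) : contrSq A n 0 = nrmSq A n ^ 2 := by
  unfold contrSq nrmSq symTensor
  simp [sq]

end FourCycle

/-! ### The `q`-norm of a tensor square -/

section TensorSquare

variable {ι : Type*} [Fintype ι] [DecidableEq ι]

/-- The first half of the points. -/
def firstHalf (n : ℕ) : Finset (Fin (n + n)) := Finset.univ.map (Fin.castAddEmb n)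

lemma mem_firstHalf {n : ℕ} {x : Fin (n + n)} : x ∈ firstHalf n ↔ (x : ℕ) < n := by
  unfold firstHalf
  rw [Finset.mem_map]
  constructor
  · rintro ⟨i, _, rfl⟩; exact i.2
  · intro h; exact ⟨⟨x, h⟩, Finset.mem_univ _, rfl⟩

lemma compl_firstHalf (n : ℕ) : (firstHalf n)ᶜ = Finset.univ.map (Fin.natAddEmb n) := by
  ext x
  rw [Finset.mem_compl, mem_firstHalf, Finset.mem_map]
  constructor
  · intro h
    exact ⟨⟨x - n, by omega⟩, Finset.mem_univ _, Fin.ext (by simp; omega)⟩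
  · rintro ⟨i, _, rfl⟩; simp

lemma card_firstHalf (n : ℕ) : (firstHalf n).card = n := by simp [firstHalf]

lemma tensorSq_symTensor (A : Multiset ι → ℝ) {n : ℕ} (J : Fin (n + n) → ι) :
    tensorSq (symTensor A n) J = A ((firstHalf n).val.map J) * A ((firstHalf n)ᶜ.val.map J) := by
  rw [compl_firstHalf]
  unfold tensorSq symTensor firstHalf
  rw [Finset.map_val, Finset.map_val, Multiset.map_map, Multiset.map_map]
  rfl

lemma tensorSq_symTensor_comp (A : Multiset ι → ℝ) {n : ℕ} (J : Fin (n + n) → ι)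
    (σ : Equiv.Perm (Fin (n + n))) :
    tensorSq (symTensor A n) (J ∘ σ) = A (((firstHalf n).map σ.toEmbedding).val.map J) *
      A (((firstHalf n).map σ.toEmbedding)ᶜ.val.map J) := by
  rw [tensorSq_symTensor]
  have : ((firstHalf n).map σ.toEmbedding)ᶜ = (firstHalf n)ᶜ.map σ.toEmbedding := by
    ext x
    simp [Finset.mem_map_equiv]
  rw [this, Finset.map_val, Finset.map_val, Multiset.map_map, Multiset.map_map]
  rfl

/-- The number of points of the first half that come from the first half. -/
def halfOverlap {n : ℕ} (σ : Equiv.Perm (Fin (n + n))) : ℕ :=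
  ((firstHalf n).map σ.toEmbedding ∩ firstHalf n).card

/-- For each permutation, the two halves and their images form a four-cycle, determined by the
overlap of the first half with its image. Every term is thus a weight times the squared norm of a
contraction. -/
lemma tensorInner_tensorSq (q : ℝ) (A : Multiset ι → ℝ) (n : ℕ) :
    tensorInner q (tensorSq (symTensor A n)) (tensorSq (symTensor A n)) =
      ∑ σ : Equiv.Perm (Fin (n + n)), q ^ inv σ * contrSq A (n - halfOverlap σ) (halfOverlap σ) := by
  unfold tensorInner
  refine Finset.sum_congr rfl fun σ _ => ?_
  congr 1
  refine Eq.trans ?_ (sum_four_cycle A (P := (firstHalf n).map σ.toEmbedding) (R := firstHalf n)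
    (p := halfOverlap σ) (by rw [Finset.card_map, card_firstHalf]) (card_firstHalf n)
    (by simp [two_mul]) rfl)
  refine Finset.sum_congr rfl fun J _ => ?_
  rw [tensorSq_symTensor_comp, tensorSq_symTensor]

/-- The permutation acting by `α` and `β` on the two halves. -/
def blockPerm {n : ℕ} (α β : Equiv.Perm (Fin n)) : Equiv.Perm (Fin (n + n)) :=
  finSumFinEquiv.permCongr (α.sumCongr β)

/-- The permutation acting by `α` and `β` on the two halves and exchanging them. -/
def swapPerm {n : ℕ} (α β : Equiv.Perm (Fin n)) : Equiv.Perm (Fin (n + n)) :=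
  finSumFinEquiv.permCongr ((α.sumCongr β).trans (Equiv.sumComm _ _))

lemma blockPerm_castAdd {n : ℕ} (α β : Equiv.Perm (Fin n)) (i : Fin n) :
    blockPerm α β (Fin.castAdd n i) = Fin.castAdd n (α i) := by
  simp [blockPerm, Equiv.permCongr_apply]

lemma blockPerm_natAdd {n : ℕ} (α β : Equiv.Perm (Fin n)) (i : Fin n) :
    blockPerm α β (Fin.natAdd n i) = Fin.natAdd n (β i) := by
  unfold blockPerm
  rw [Equiv.permCongr_apply, finSumFinEquiv_symm_apply_natAdd]
  rfl

lemma swapPerm_castAdd {n : ℕ} (α β : Equiv.Perm (Fin n)) (i : Fin n) :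
    swapPerm α β (Fin.castAdd n i) = Fin.natAdd n (α i) := by
  simp [swapPerm, Equiv.permCongr_apply]

lemma swapPerm_natAdd {n : ℕ} (α β : Equiv.Perm (Fin n)) (i : Fin n) :
    swapPerm α β (Fin.natAdd n i) = Fin.castAdd n (β i) := by
  unfold swapPerm
  rw [Equiv.permCongr_apply, finSumFinEquiv_symm_apply_natAdd]
  rfl

lemma inv_eq_sum {n : ℕ} (σ : Equiv.Perm (Fin n)) :
    inv σ = ∑ x, ∑ y, if x < y ∧ σ y < σ x then 1 else 0 := by
  unfold inv
  rw [Finset.card_filter, ← Finset.univ_product_univ, Finset.sum_product]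

lemma castAdd_lt_natAdd' {n : ℕ} (i j : Fin n) : Fin.castAdd n i < Fin.natAdd n j := by
  rw [Fin.lt_def, Fin.val_castAdd, Fin.val_natAdd]; omega

lemma inv_blockPerm {n : ℕ} (α β : Equiv.Perm (Fin n)) :
    inv (blockPerm α β) = inv α + inv β := by
  have h1 : ∀ i j : Fin n, ¬ Fin.natAdd n j < Fin.castAdd n i :=
    fun i j => (castAdd_lt_natAdd' i j).not_gt
  rw [inv_eq_sum, inv_eq_sum, inv_eq_sum]
  simp only [Fin.sum_univ_add, blockPerm_castAdd, blockPerm_natAdd, h1, and_false, false_and,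
    if_false, Finset.sum_const_zero, add_zero, zero_add]
  have h2 : ∀ i j : Fin n, (Fin.natAdd n i < Fin.natAdd n j) = (i < j) := fun i j => by simp
  have h3 : ∀ i j : Fin n, (Fin.castAdd n i < Fin.castAdd n j) = (i < j) := fun i j => by
    rw [Fin.lt_def, Fin.lt_def, Fin.val_castAdd, Fin.val_castAdd]
  simp only [h2, h3]

/-- Exchanging the halves inverts all the `n ^ 2` mixed pairs; this is the origin of the exponent `n
^ 2`. -/
lemma inv_swapPerm {n : ℕ} (α β : Equiv.Perm (Fin n)) :
    inv (swapPerm α β) = n ^ 2 + (inv α + inv β) := by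
  have h1 : ∀ i j : Fin n, ¬ Fin.natAdd n j < Fin.castAdd n i :=
    fun i j => (castAdd_lt_natAdd' i j).not_gt
  rw [inv_eq_sum, inv_eq_sum, inv_eq_sum]
  simp only [Fin.sum_univ_add, swapPerm_castAdd, swapPerm_natAdd, h1, castAdd_lt_natAdd',
    and_true, false_and, if_false, if_true, Finset.sum_const_zero,
    Finset.sum_add_distrib, Finset.sum_const, Finset.card_univ, Fintype.card_fin, smul_eq_mul,
    mul_one]
  have h2 : ∀ i j : Fin n, (Fin.natAdd n i < Fin.natAdd n j) = (i < j) := fun i j => by simp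
  have h3 : ∀ i j : Fin n, (Fin.castAdd n i < Fin.castAdd n j) = (i < j) := fun i j => by
    rw [Fin.lt_def, Fin.lt_def, Fin.val_castAdd, Fin.val_castAdd]
  simp only [h2, h3]
  ring

lemma halfOverlap_blockPerm {n : ℕ} (α β : Equiv.Perm (Fin n)) :
    halfOverlap (blockPerm α β) = n := by
  unfold halfOverlap
  rw [Finset.inter_eq_left.2, Finset.card_map, card_firstHalf]
  intro x hx
  obtain ⟨y, hy, rfl⟩ := Finset.mem_map.1 hx
  obtain ⟨i, _, rfl⟩ := Finset.mem_map.1 hy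
  exact Finset.mem_map.2 ⟨α i, Finset.mem_univ _, (blockPerm_castAdd α β i).symm⟩

lemma halfOverlap_swapPerm {n : ℕ} (α β : Equiv.Perm (Fin n)) :
    halfOverlap (swapPerm α β) = 0 := by
  unfold halfOverlap
  rw [Finset.card_eq_zero, ← Finset.disjoint_iff_inter_eq_empty, Finset.disjoint_left]
  intro x hx
  obtain ⟨y, hy, rfl⟩ := Finset.mem_map.1 hx
  obtain ⟨i, _, rfl⟩ := Finset.mem_map.1 hy
  rw [mem_firstHalf]
  have := swapPerm_castAdd α β i
  change ¬ ((swapPerm α β (Fin.castAdd n i) : Fin (n + n)) : ℕ) < n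
  rw [this]; simp

lemma exists_halfOverlap {n p : ℕ} (hp : p ≤ n) :
    ∃ σ : Equiv.Perm (Fin (n + n)), halfOverlap σ = p := by
  obtain ⟨S, hS, hSc⟩ := Finset.exists_subset_card_eq (s := firstHalf n) (n := p)
    (by rw [card_firstHalf]; exact hp)
  obtain ⟨S', hS', hSc'⟩ := Finset.exists_subset_card_eq (s := (firstHalf n)ᶜ) (n := n - p)
    (by rw [Finset.card_compl, card_firstHalf, Fintype.card_fin]; omega)
  have hdisj : Disjoint S S' :=
    Finset.disjoint_of_subset_left hS (Finset.disjoint_of_subset_right hS' disjoint_compl_right)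
  have hcard : (S ∪ S').card = n := by
    rw [Finset.card_union_of_disjoint hdisj, hSc, hSc']; omega
  let e : {x // x ∈ firstHalf n} ≃ {x // x ∈ S ∪ S'} :=
    Finset.equivOfCardEq (by rw [card_firstHalf, hcard])
  refine ⟨e.extendSubtype, ?_⟩
  have hmap : (firstHalf n).map (e.extendSubtype).toEmbedding = S ∪ S' := by
    refine Finset.eq_of_subset_of_card_le ?_ (by rw [Finset.card_map, card_firstHalf, hcard])
    intro x hx
    obtain ⟨y, hy, rfl⟩ := Finset.mem_map.1 hx
    exact e.extendSubtype_mem y hy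
  unfold halfOverlap
  rw [hmap, Finset.union_inter_distrib_right, Finset.inter_eq_left.2 hS,
    Finset.disjoint_iff_inter_eq_empty.1 (Finset.disjoint_of_subset_left hS' disjoint_compl_left),
    Finset.union_empty, hSc]

lemma blockPerm_injective {n : ℕ} {α β α' β' : Equiv.Perm (Fin n)}
    (h : blockPerm α β = blockPerm α' β') : α = α' ∧ β = β' := by
  have h1 : α.sumCongr β = α'.sumCongr β' := finSumFinEquiv.permCongr.injective h
  constructor
  · ext i
    have := Equiv.congr_fun h1 (Sum.inl i)
    simpa [Fin.ext_iff] using this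
  · ext i
    have := Equiv.congr_fun h1 (Sum.inr i)
    simpa [Fin.ext_iff] using this

lemma swapPerm_injective {n : ℕ} {α β α' β' : Equiv.Perm (Fin n)}
    (h : swapPerm α β = swapPerm α' β') : α = α' ∧ β = β' := by
  have h1 := finSumFinEquiv.permCongr.injective h
  constructor
  · ext i
    have := Equiv.congr_fun h1 (Sum.inl i)
    simpa [Fin.ext_iff] using this
  · ext i
    have := Equiv.congr_fun h1 (Sum.inr i)
    simpa [Fin.ext_iff] using this

/-- All terms of the sum over permutations are nonnegative, so a part of it suffices: the
permutations that preserve the halves, those that exchange them, and one of overlap `n - p`. The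
exponent `k` is the number of inversions of the latter and does not depend on the tensor. -/
lemma tensorInner_tensorSq_ge {q : ℝ} (hq : 0 ≤ q) {n p : ℕ}
    (hp0 : 1 ≤ p) (hp : p < n) : ∃ k : ℕ, ∀ (κ : Type) [Fintype κ] [DecidableEq κ]
      (A : Multiset κ → ℝ),
    (1 + q ^ n ^ 2) * tensorInner q (symTensor A n) (symTensor A n) ^ 2 +
      q ^ k * contrSq A p (n - p) ≤
      tensorInner q (tensorSq (symTensor A n)) (tensorSq (symTensor A n)) := by
  obtain ⟨σ₀, hσ₀⟩ := exists_halfOverlap (n := n) (p := n - p) (by omega)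
  refine ⟨inv σ₀, fun κ _ _ A => ?_⟩
  rw [tensorInner_tensorSq]
  let f : Equiv.Perm (Fin (n + n)) → ℝ := fun σ =>
    q ^ inv σ * contrSq A (n - halfOverlap σ) (halfOverlap σ)
  have hf : ∀ σ, 0 ≤ f σ := fun σ => mul_nonneg (pow_nonneg hq _) (contrSq_nonneg _ _ _)
  let PP := Equiv.Perm (Fin n) × Equiv.Perm (Fin n)
  -- The three families have overlaps `n`, `0` and `n - p`, which are distinct because `0 < p < n`;
  -- hence nothing is counted twice.
  let g : PP ⊕ (PP ⊕ Unit) → Equiv.Perm (Fin (n + n)) :=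
    Sum.elim (fun z => blockPerm z.1 z.2) (Sum.elim (fun z => swapPerm z.1 z.2) fun _ => σ₀)
  have hg : Function.Injective g := by
    have hb : ∀ z : PP, halfOverlap (blockPerm z.1 z.2) = n := fun z => halfOverlap_blockPerm _ _
    have hs : ∀ z : PP, halfOverlap (swapPerm z.1 z.2) = 0 := fun z => halfOverlap_swapPerm _ _
    rintro (z | z | z) (z' | z' | z') h
    · obtain ⟨h1, h2⟩ := blockPerm_injective h
      exact congrArg Sum.inl (Prod.ext h1 h2)
    · have this : halfOverlap (blockPerm z.1 z.2) = halfOverlap (swapPerm z'.1 z'.2) :=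
        congrArg halfOverlap h
      rw [hb, hs] at this; omega
    · have this : halfOverlap (blockPerm z.1 z.2) = halfOverlap (σ₀) :=
        congrArg halfOverlap h
      rw [hb, hσ₀] at this; omega
    · have this : halfOverlap (swapPerm z.1 z.2) = halfOverlap (blockPerm z'.1 z'.2) :=
        congrArg halfOverlap h
      rw [hb, hs] at this; omega
    · obtain ⟨h1, h2⟩ := swapPerm_injective h
      exact congrArg (Sum.inr ∘ Sum.inl) (Prod.ext h1 h2)
    · have this : halfOverlap (swapPerm z.1 z.2) = halfOverlap (σ₀) :=
        congrArg halfOverlap h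
      rw [hs, hσ₀] at this; omega
    · have this : halfOverlap (σ₀) = halfOverlap (blockPerm z'.1 z'.2) :=
        congrArg halfOverlap h
      rw [hb, hσ₀] at this; omega
    · have this : halfOverlap (σ₀) = halfOverlap (swapPerm z'.1 z'.2) :=
        congrArg halfOverlap h
      rw [hs, hσ₀] at this; omega
    · rfl
  have h1 : ∑ x, f (g x) ≤ ∑ σ, f σ := by
    have := Finset.sum_le_univ_sum_of_nonneg (s := Finset.univ.map ⟨g, hg⟩) hf
    rwa [Finset.sum_map] at this
  refine le_trans (le_of_eq ?_) h1
  rw [Fintype.sum_sum_type, Fintype.sum_sum_type]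
  have e1 : ∀ z : PP, f (g (Sum.inl z)) = q ^ inv z.1 * q ^ inv z.2 * nrmSq A n ^ 2 := by
    intro z
    change q ^ inv (blockPerm z.1 z.2) * contrSq A (n - halfOverlap (blockPerm z.1 z.2))
      (halfOverlap (blockPerm z.1 z.2)) = _
    rw [inv_blockPerm, halfOverlap_blockPerm, Nat.sub_self, contrSq_zero_left, pow_add]
  have e2 : ∀ z : PP, f (g (Sum.inr (Sum.inl z))) =
      q ^ n ^ 2 * (q ^ inv z.1 * q ^ inv z.2 * nrmSq A n ^ 2) := by
    intro z
    change q ^ inv (swapPerm z.1 z.2) * contrSq A (n - halfOverlap (swapPerm z.1 z.2))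
      (halfOverlap (swapPerm z.1 z.2)) = _
    rw [inv_swapPerm, halfOverlap_swapPerm, Nat.sub_zero, contrSq_zero_right, pow_add, pow_add]
    ring
  have e3 : ∀ u : Unit, f (g (Sum.inr (Sum.inr u))) = q ^ inv σ₀ * contrSq A p (n - p) := by
    intro u
    change q ^ inv σ₀ * contrSq A (n - halfOverlap σ₀) (halfOverlap σ₀) = _
    rw [hσ₀, show n - (n - p) = p by omega]
  simp_rw [e1, e2, e3]
  rw [← Finset.mul_sum]
  have e4 : ∑ z : PP, q ^ inv z.1 * q ^ inv z.2 * nrmSq A n ^ 2 =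
      tensorInner q (symTensor A n) (symTensor A n) ^ 2 := by
    rw [tensorInner_symTensor, ← Finset.sum_mul, Fintype.sum_prod_type, mul_pow,
      sq (∑ σ : Equiv.Perm (Fin n), q ^ inv σ), Finset.sum_mul_sum]
    congr 1
    unfold nrmSq
    simp_rw [sq (symTensor A n _)]
  rw [e4]
  simp only [Finset.univ_unique, Finset.sum_const, Finset.card_singleton, one_smul]
  ring

end TensorSquare

/-! ### A single colour: moments of the `q`-Gaussian law -/

section ConstantColour

lemma card_eq_two_mul_card_opens {T : Type*} [LinearOrder T] [Fintype T] (π : PairingOn T) :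
    Fintype.card T = 2 * (opens π).card := by
  have h := prod_univ_eq_prod_opens π (R := ℕ) fun _ => 2
  rw [Finset.prod_const, Finset.prod_const, Finset.card_univ, show 2 * 2 = 2 ^ 2 from rfl,
    ← pow_mul] at h
  exact Nat.pow_right_injective le_rfl h

lemma card_edges {T : Type*} [LinearOrder T] [Fintype T] (π : PairingOn T) :
    Fintype.card {p : T // p < π.1 p} = (opens π).card := by
  rw [Fintype.card_subtype]; rfl

lemma Pairing.two_mul_card_pairs {r : ℕ} (π : Pairing r) : 2 * π.pairs.card = r := by
  have h1 := Pairing.prod_pairs π fun _ _ => (2 : ℝ)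
  rw [Finset.prod_const, Finset.prod_const] at h1
  have h2 : π.pairs.card = (opens (T := Fin r) π).card :=
    pow_right_injective₀ (by norm_num) (by norm_num) h1
  rw [h2, ← card_eq_two_mul_card_opens (T := Fin r) π, Fintype.card_fin]

lemma blockCrossings_const {r : ℕ} (N : ℕ) (π : Pairing r) :
    blockCrossings (fun _ => N) π = N ^ 2 * π.cr := by
  rw [Pairing.cr_eq_crossings]
  unfold blockCrossings crossings
  rw [Finset.card_filter, ← Finset.univ_product_univ, Finset.sum_product, Finset.mul_sum]
  refine Finset.sum_congr rfl fun l _ => ?_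
  rw [Finset.mul_sum]
  refine Finset.sum_congr rfl fun m _ => ?_
  rw [mul_ite, mul_one, mul_zero, sq]

/-- With one colour, the limit moments are those of a `q`-Gaussian law. -/
lemma colouredSum_const {r : ℕ} (q v : ℝ) (N : ℕ) :
    ∑ π ∈ (Finset.univ : Finset (Pairing r)).filter (fun π => π.RespectsColours fun _ => N),
      π.colourWeight (fun _ => N) q * ∏ e ∈ π.pairs, v =
    v ^ (r / 2) * ∑ π : Pairing r, (q ^ N ^ 2) ^ π.cr := by
  rw [Finset.filter_true_of_mem (fun π _ e _ => rfl), Finset.mul_sum]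
  refine Finset.sum_congr rfl fun π _ => ?_
  rw [Pairing.colourWeight_eq π (fun e _ => rfl), blockCrossings_const, pow_mul, Finset.prod_const,
    mul_comm]
  congr 2
  have := π.two_mul_card_pairs
  omega

lemma isEmpty_pairing_odd (k : ℕ) : IsEmpty (Pairing (2 * k + 1)) :=
  ⟨fun π => by have := π.two_mul_card_pairs; omega⟩

/-- The fourth moment of a `q`-Gaussian law. -/
lemma sum_pairing_four (Q : ℝ) : ∑ π : Pairing 4, Q ^ π.cr = 2 + Q := by
  have h0 : ((Finset.univ : Finset (Pairing 4)).filter fun π => π.cr = 0).card = 2 := by decide +kernel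
  have h1 : ((Finset.univ : Finset (Pairing 4)).filter fun π => ¬ π.cr = 0).card = 1 := by
    decide +kernel
  have h2 : ∀ π : Pairing 4, ¬ π.cr = 0 → π.cr = 1 := by decide +kernel
  rw [← Finset.sum_filter_add_sum_filter_not _ (fun π : Pairing 4 => π.cr = 0),
    Finset.sum_congr rfl (g := fun _ => (1 : ℝ)) fun π hπ => by
      rw [(Finset.mem_filter.1 hπ).2, pow_zero],
    Finset.sum_congr (s₁ := Finset.univ.filter fun π : Pairing 4 => ¬ π.cr = 0) rfl
      (g := fun _ => Q) fun π hπ => by rw [h2 π (Finset.mem_filter.1 hπ).2, pow_one],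
    Finset.sum_const, Finset.sum_const, h0, h1]
  simp

end ConstantColour

/-! ### Noncrossing pairings of four blocks -/

section Noncrossing

variable {n : ℕ}

/-- A pair joining blocks `0` and `2` would cross a pair joining `1` and `3`, so one of these two
opposite couples shares no pair. Two disjoint sets of `n` pairs among `2n` are complementary. Since
each pair has only two ends, the other couple is then disjoint too. -/
lemma incident_compl {π : PairingOn (Pts fun _ : Fin 4 => n)} (h : ∀ p, (π.1 p).1 ≠ p.1)
    (hc : crossings π = 0) :
    incident π 2 = (incident π 0)ᶜ ∧ incident π 3 = (incident π 1)ᶜ := by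
  have hcard : Fintype.card {p // p < π.1 p} = 2 * n := by
    have h1 := card_eq_two_mul_card_opens π
    rw [card_pts] at h1
    rw [card_edges]
    simp at h1
    omega
  have hc' : ∀ p p', ¬ (p < p' ∧ p' < π.1 p ∧ π.1 p < π.1 p') := by
    intro p p' hp
    unfold crossings at hc
    rw [Finset.card_eq_zero, Finset.filter_eq_empty_iff] at hc
    exact hc (Finset.mem_univ (p, p')) hp
  have hend : ∀ e : {p // p < π.1 p}, e.1.1 < (π.1 e.1).1 := fun e =>
    lt_of_le_of_ne (Pts.fst_le_of_lt e.2) (h _).symm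
  have main : ∀ a b : Fin 4, a ≠ b → (∀ e, ¬ (e ∈ incident π a ∧ e ∈ incident π b)) →
      incident π b = (incident π a)ᶜ := by
    intro a b hab hdis
    refine Finset.eq_of_subset_of_card_le ?_ ?_
    · intro e he
      rw [Finset.mem_compl]
      exact fun h' => hdis e ⟨h', he⟩
    · rw [Finset.card_compl, hcard, card_incident h, card_incident h]; omega
  have hdis : (∀ e, ¬ (e ∈ incident π 0 ∧ e ∈ incident π 2)) ∨
      (∀ e, ¬ (e ∈ incident π 1 ∧ e ∈ incident π 3)) := by
    by_contra hcon
    push Not at hcon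
    obtain ⟨⟨e, he⟩, ⟨e', he'⟩⟩ := hcon
    simp only [mem_incident] at he he'
    have h1 := hend e
    have h2 := hend e'
    have : ∀ a b a' b' : Fin 4, a < b → a' < b' → (0 = a ∨ 0 = b) ∧ (2 = a ∨ 2 = b) →
        (1 = a' ∨ 1 = b') ∧ (3 = a' ∨ 3 = b') → a < a' ∧ a' < b ∧ b < b' := by decide
    obtain ⟨k1, k2, k3⟩ := this _ _ _ _ h1 h2 he he'
    exact hc' e.1 e'.1 ⟨Pts.lt_of_fst_lt k1, Pts.lt_of_fst_lt k2, Pts.lt_of_fst_lt k3⟩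
  have htwo : ∀ e, (e ∈ incident π 0 ∨ e ∈ incident π 1 ∨ e ∈ incident π 2 ∨ e ∈ incident π 3) ∧
      ¬ (e ∈ incident π 0 ∧ e ∈ incident π 1 ∧ e ∈ incident π 3) ∧
      ¬ (e ∈ incident π 2 ∧ e ∈ incident π 1 ∧ e ∈ incident π 3) ∧
      ¬ (e ∈ incident π 1 ∧ e ∈ incident π 0 ∧ e ∈ incident π 2) ∧
      ¬ (e ∈ incident π 3 ∧ e ∈ incident π 0 ∧ e ∈ incident π 2) := by
    intro e
    simp only [mem_incident]
    have : ∀ a b : Fin 4, a < b → ((0 = a ∨ 0 = b) ∨ (1 = a ∨ 1 = b) ∨ (2 = a ∨ 2 = b) ∨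
        (3 = a ∨ 3 = b)) ∧
        ¬ ((0 = a ∨ 0 = b) ∧ (1 = a ∨ 1 = b) ∧ (3 = a ∨ 3 = b)) ∧
        ¬ ((2 = a ∨ 2 = b) ∧ (1 = a ∨ 1 = b) ∧ (3 = a ∨ 3 = b)) ∧
        ¬ ((1 = a ∨ 1 = b) ∧ (0 = a ∨ 0 = b) ∧ (2 = a ∨ 2 = b)) ∧
        ¬ ((3 = a ∨ 3 = b) ∧ (0 = a ∨ 0 = b) ∧ (2 = a ∨ 2 = b)) := by decide
    exact this _ _ (hend e)
  rcases hdis with hd | hd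
  · have h2 := main 0 2 (by decide) hd
    refine ⟨h2, main 1 3 (by decide) fun e he => ?_⟩
    obtain ⟨-, t1, t2, -, -⟩ := htwo e
    refine t2 ⟨?_, he⟩
    rw [h2, Finset.mem_compl]
    exact fun h0 => t1 ⟨h0, he⟩
  · have h2 := main 1 3 (by decide) hd
    refine ⟨main 0 2 (by decide) fun e he => ?_, h2⟩
    obtain ⟨-, -, -, t1, t2⟩ := htwo e
    refine t2 ⟨?_, he⟩
    rw [h2, Finset.mem_compl]
    exact fun h0 => t1 ⟨h0, he⟩

/-- Opposite blocks are complementary, so the graph is a four-cycle and its network is the squared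
norm of a contraction. The sign of the network is thereby known. -/
lemma network_noncrossing {ι : Type*} [Fintype ι] [DecidableEq ι] (A : Multiset ι → ℝ)
    {π : PairingOn (Pts fun _ : Fin 4 => n)} (h : ∀ p, (π.1 p).1 ≠ p.1) (hc : crossings π = 0) :
    network kronecker (fun _ => symTensor A n) π =
      contrSq A (n - (incident π 0 ∩ incident π 1).card) (incident π 0 ∩ incident π 1).card := by
  obtain ⟨h2, h3⟩ := incident_compl h hc
  rw [network_symTensor h]
  refine Eq.trans ?_ (sum_four_cycle A (P := incident π 0) (R := incident π 1) (card_incident h 0)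
    (card_incident h 1) ?_ rfl)
  · refine Finset.sum_congr rfl fun x _ => ?_
    rw [Fin.prod_univ_four, h2, h3]
    ring
  · have h1 := card_eq_two_mul_card_opens π
    rw [card_pts] at h1
    rw [card_edges]
    simp at h1
    omega

/-- The reflection of the noncrossing pairing in which consecutive blocks are joined by `α` and
`n - α` pairs alternately. -/
def cyclePartner (n α u : ℕ) : ℕ :=
  if n - α ≤ u ∧ u < n + α then 2 * n - 1 - u
  else if 3 * n - α ≤ u ∧ u < 3 * n + α then 6 * n - 1 - u
  else 4 * n - 1 - u

lemma exists_noncrossing {α : ℕ} (h1 : 1 ≤ α) (h2 : α < n) :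
    ∃ π : PairingOn (Pts fun _ : Fin 4 => n), (∀ p, (π.1 p).1 ≠ p.1) ∧ crossings π = 0 ∧
      (incident π 0 ∩ incident π 1).card = α ∧ ∀ ρ, ¬ Over π ρ := by
  let e : Fin 4 × Fin n ≃ Fin (4 * n) := finProdFinEquiv
  have hval : ∀ z : Fin 4 × Fin n, ((e z : Fin (4 * n)) : ℕ) = z.2 + n * z.1 := fun z => rfl
  have hlt : ∀ u : Fin (4 * n), cyclePartner n α u < 4 * n := by
    intro u
    have := u.2
    unfold cyclePartner
    split_ifs <;> omega
  let f : Pts (fun _ : Fin 4 => n) → Pts (fun _ : Fin 4 => n) := fun p =>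
    let z := e.symm ⟨cyclePartner n α (e (p.1, p.2)), hlt _⟩
    Pts.mk z.1 z.2
  -- The position of a point in the whole row; order, blocks and the reflection then become linear
  -- inequalities between integers.
  let ps : Pts (fun _ : Fin 4 => n) → ℕ := fun p => p.2 + n * p.1
  have hps : ∀ p, ps p < 4 * n := fun p => (e (p.1, p.2)).2
  have hinj : ∀ p p', ps p = ps p' → p = p' := by
    rintro ⟨l, x⟩ ⟨l', x'⟩ h
    have : (l, x) = (l', x') := e.injective (Fin.ext h)
    simp only [Prod.mk.injEq] at this
    obtain ⟨rfl, rfl⟩ := this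
    rfl
  have hf : ∀ p, ps (f p) = cyclePartner n α (ps p) := by
    intro p
    have : e ((f p).1, (f p).2) = ⟨cyclePartner n α (e (p.1, p.2)), hlt _⟩ :=
      e.apply_symm_apply _
    exact congrArg Fin.val this
  have hblock : ∀ p : Pts (fun _ : Fin 4 => n), ∀ l : Fin 4,
      p.1 = l ↔ n * l ≤ ps p ∧ ps p < n * l + n := by
    rintro ⟨m, x⟩ l
    have hx : (x : ℕ) < n := x.2
    change m = l ↔ n * l ≤ x + n * m ∧ x + n * m < n * l + n
    fin_cases m <;> fin_cases l <;> simp <;> omega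
  have hord : ∀ p p' : Pts (fun _ : Fin 4 => n), p < p' ↔ ps p < ps p' := by
    intro p p'
    rw [Pts.lt_iff]
    change _ ↔ (p.2 : ℕ) + n * p.1 < p'.2 + n * p'.1
    have hx : (p.2 : ℕ) < n := p.2.2
    have hx' : (p'.2 : ℕ) < n := p'.2.2
    generalize (p.2 : ℕ) = x at *
    generalize (p'.2 : ℕ) = x' at *
    generalize p.1 = l
    generalize p'.1 = l'
    fin_cases l <;> fin_cases l' <;> simp <;> omega
  have hff : ∀ p, f (f p) = p := by
    intro p
    apply hinj
    rw [hf, hf]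
    have := hps p
    unfold cyclePartner
    split_ifs <;> omega
  have hblk : ∀ p, (f p).1 ≠ p.1 := by
    intro p h
    have a := (hblock p _).1 rfl
    have b := (hblock (f p) _).1 h
    rw [hf] at b
    have := hps p
    unfold cyclePartner at b
    generalize ps p = u at *
    generalize p.1 = l at *
    fin_cases l <;> simp at a b <;> split_ifs at b <;> omega
  let π : PairingOn (Pts fun _ : Fin 4 => n) :=
    ⟨⟨f, f, hff, hff⟩, fun p => ⟨hff p, fun h => hblk p (congrArg Sigma.fst h)⟩⟩
  have hπ : ∀ p, π.1 p = f p := fun p => rfl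
  refine ⟨π, hblk, ?_, ?_, ?_⟩
  · unfold crossings
    rw [Finset.card_eq_zero, Finset.filter_eq_empty_iff]
    rintro ⟨p, p'⟩ _ h
    simp only [hπ, hord, hf] at h
    have a := hps p
    have b := hps p'
    unfold cyclePartner at h
    generalize ps p = u at *
    generalize ps p' = u' at *
    split_ifs at h <;> omega
  · rw [show α = (Finset.Ico (n - α) n).card by rw [Nat.card_Ico]; omega]
    have hmem : ∀ x : {p // p < π.1 p}, x ∈ incident π 0 ∩ incident π 1 ↔
        n - α ≤ ps x.1 ∧ ps x.1 < n := by
      intro x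
      have h0 := (hord _ _).1 x.2
      rw [hπ, hf] at h0
      rw [Finset.mem_inter, mem_incident, mem_incident, hπ, eq_comm, hblock, eq_comm, hblock,
        eq_comm (a := (1 : Fin 4)), hblock, eq_comm (a := (1 : Fin 4)), hblock, hf]
      have := hps x.1
      unfold cyclePartner at h0 ⊢
      generalize ps x.1 = u at *
      simp
      split_ifs at h0 ⊢ <;> omega
    refine Finset.card_bij (fun x _ => ps x.1) ?_ ?_ ?_
    · intro x hx
      exact Finset.mem_Ico.2 ((hmem x).1 hx)
    · intro x _ y _ hxy
      exact Subtype.ext (hinj _ _ hxy)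
    · intro u hu
      rw [Finset.mem_Ico] at hu
      let p : Pts (fun _ : Fin 4 => n) := Pts.mk 0 ⟨u, hu.2⟩
      have hp : ps p = u := by simp [ps, p]
      have hlt' : p < π.1 p := by
        rw [hord, hπ, hf, hp]
        unfold cyclePartner
        split_ifs <;> omega
      exact ⟨⟨p, hlt'⟩, (hmem _).2 (by rw [hp]; exact hu), hp⟩
  -- The last point of block `0` is sent to block `1` because `1 ≤ α`, the first one to block `3`
  -- because `α < n`.
  · intro ρ hρ
    have z : 0 < n := by omega
    have h3 := hρ (Pts.mk 0 ⟨n - 1, by omega⟩)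
    have h4 := hρ (Pts.mk 0 ⟨0, z⟩)
    have h5 := h3.trans h4.symm
    have a := (hblock (f (Pts.mk 0 ⟨n - 1, by omega⟩)) _).1 h5
    have b := (hblock (f (Pts.mk 0 ⟨0, z⟩)) _).1 rfl
    rw [hf] at a b
    have e1 : ps (Pts.mk 0 ⟨n - 1, by omega⟩) = n - 1 := by simp [ps]
    have e2 : ps (Pts.mk 0 ⟨0, z⟩) = 0 := by simp [ps]
    rw [e1] at a
    rw [e2] at b
    unfold cyclePartner at a b
    rw [if_pos (by omega)] at a
    rw [if_neg (by omega), if_neg (by omega)] at b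
    generalize ((f (Pts.mk 0 ⟨0, z⟩))).1 = l at *
    fin_cases l <;> simp at a b <;> omega

open Classical in
/-- In the free case the fourth moment dominates the norm of every contraction. -/
lemma jointMoment_zero_ge {d : ℕ} {ι : Type*} [Fintype ι] [DecidableEq ι] {n : Fin d → ℕ}
    (hn : ∀ i, 1 ≤ n i) (A : Fin d → Multiset ι → ℝ) (hA : ∀ i s, A i s ≠ 0 → s.Nodup)
    (i : Fin d) {p : ℕ} (hp1 : 1 ≤ p) (hp2 : p < n i) :
    (2 + 0 ^ n i ^ 2) * tensorInner 0 (symTensor (A i) (n i)) (symTensor (A i) (n i)) ^ 2 +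
      contrSq (A i) p (n i - p) ≤ jointMoment 0 n A (fun _ : Fin 4 => i) := by
  rw [jointMoment_eq 0 hn, colouredSum_const, sum_pairing_four, mul_comm]
  refine add_le_add le_rfl ?_
  -- At `q = 0` crossing pairings have weight zero, pairings with a pair inside a block have zero
  -- network, and the others are squared norms. One well-chosen pairing may thus be kept and the
  -- rest dropped.
  have hnonneg : ∀ π : PairingOn (Pts fun _ : Fin 4 => n i), 0 ≤ (0 : ℝ) ^ crossings π *
      network kronecker (fun _ => symTensor (A i) (n i)) π := by
    intro π
    by_cases hc : crossings π = 0
    · rw [hc, pow_zero, one_mul]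
      by_cases h : ∀ p, (π.1 p).1 ≠ p.1
      · rw [network_noncrossing (A i) h hc]; exact contrSq_nonneg _ _ _
      · push Not at h
        obtain ⟨p, hp⟩ := h
        rw [network_eq_zero_of_inner
          (fun _ => symTensor_injective_of_ne_zero (hA i) _) hp]
    · rw [zero_pow hc, zero_mul]
  obtain ⟨π, h, hc, hα, hρ⟩ := exists_noncrossing (n := n i) (α := n i - p) (by omega) (by omega)
  have h1 := network_noncrossing (A i) h hc
  rw [hα, show n i - (n i - p) = p by omega] at h1
  rw [← h1]
  refine le_trans (le_of_eq ?_) (Finset.single_le_sum (f := fun π => (0 : ℝ) ^ crossings π *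
      network kronecker (fun _ => symTensor (A i) (n i)) π) (fun π _ => hnonneg π)
      (Finset.mem_filter.2 ⟨Finset.mem_univ π, hρ⟩))
  simp only [hc, pow_zero, one_mul]

end Noncrossing

/-! ### Lower bound of the fourth moment by projection -/

section FourthMoment

variable {ι : Type*} [Fintype ι] [DecidableEq ι]

lemma tensorIntegral_mul_self {A : Type*} [Ring A] [Algebra ℂ A] (Y : ι → A) {n : ℕ}
    (a : (Fin n → ι) → ℝ) :
    tensorIntegral Y a * tensorIntegral Y a = tensorIntegral Y (tensorSq a) := by
  unfold tensorIntegral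
  rw [Finset.sum_mul_sum, ← Fintype.sum_prod_type']
  refine Fintype.sum_equiv (Fin.appendEquiv n n) _ _ fun z => ?_
  rw [smul_mul_smul_comm, ← Complex.ofReal_mul]
  have h1 : tensorSq a (Fin.appendEquiv n n z) = a z.1 * a z.2 := by
    unfold tensorSq
    simp only [Fin.appendEquiv, Equiv.coe_fn_mk, Fin.append_left, Fin.append_right]
  have h2 : (List.ofFn fun x => Y (Fin.appendEquiv n n z x)) =
      (List.ofFn fun x => Y (z.1 x)) ++ List.ofFn fun x => Y (z.2 x) := by
    rw [← List.ofFn_fin_append]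
    congr 1
    ext x
    refine Fin.addCases (fun i => ?_) (fun i => ?_) x <;>
      simp only [Fin.appendEquiv, Equiv.coe_fn_mk, Fin.append_left, Fin.append_right]
  rw [h1, h2, List.prod_append]

lemma star_tensorIntegral {A : Type*} [Ring A] [Algebra ℂ A] [StarRing A] [StarModule ℂ A]
    {Y : ι → A} (hY : ∀ j, star (Y j) = Y j) {n : ℕ} {b : (Fin n → ι) → ℝ}
    (hb : ∀ j, b (j ∘ Fin.rev) = b j) : star (tensorIntegral Y b) = tensorIntegral Y b := by
  unfold tensorIntegral
  rw [star_sum]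
  refine Fintype.sum_equiv (Fin.revPerm.arrowCongr (Equiv.refl ι)) _ _ fun j => ?_
  rw [star_smul, star_prod_ofFn]
  simp_rw [hY]
  rw [show b (Fin.revPerm.arrowCongr (Equiv.refl ι) j) = b j from hb j]
  congr 1
  exact Complex.conj_ofReal _

/-- With distinct labels every pair of every pairing has covariance zero, and there is at least one
pair. So the off-diagonal chaos is orthogonal to the constants. -/
lemma IsWick.trace_offDiag {A : Type*} [Ring A] [Algebra ℂ A] {φ : A →ₗ[ℂ] ℂ} {q : ℝ} {Y : ι → A}
    (h : IsWick φ q Y kronecker) {n : ℕ} (hn : 1 ≤ n) {b : (Fin n → ι) → ℝ}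
    (hb : ∀ j, ¬ Function.Injective j → b j = 0) : φ (tensorIntegral Y b) = 0 := by
  unfold tensorIntegral
  rw [map_sum]
  refine Finset.sum_eq_zero fun j _ => ?_
  by_cases hj : Function.Injective j
  · rw [map_smul, h n j, Finset.sum_eq_zero, Complex.ofReal_zero, smul_zero]
    intro π _
    have hcard := π.two_mul_card_pairs
    obtain ⟨e, he⟩ := Finset.card_pos.1 (show 0 < π.pairs.card by omega)
    have hlt := ((π.mem_pairs e).1 he).1
    rw [Finset.prod_eq_zero he, mul_zero]
    exact if_neg fun h' => hlt.ne (hj h')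
  · rw [hb j hj, Complex.ofReal_zero, zero_smul, map_zero]

lemma crossForm_kronecker_of_rev (q : ℝ) {n : ℕ} {b : (Fin n → ι) → ℝ}
    (hb : ∀ j, b (j ∘ Fin.rev) = b j) (w : (Fin n → ι) → ℝ) :
    crossForm q kronecker b w = tensorInner q b w := by
  rw [crossForm_kronecker_eq]
  unfold tensorInner
  symm
  refine Fintype.sum_equiv (Equiv.mulRight (Fin.revPerm : Equiv.Perm (Fin n))) _ _ fun σ => ?_
  rw [← noninv_revPerm_trans]
  congr 1
  refine Finset.sum_congr rfl fun j _ => ?_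
  rw [← hb]
  rfl

/-- The part of the tensor square of a tensor that is carried off the diagonals. -/
def offDiagSq {n : ℕ} (a : (Fin n → ι) → ℝ) (J : Fin (n + n) → ι) : ℝ := by
  classical exact if Function.Injective J then tensorSq a J else 0

lemma offDiagSq_of_injective {n : ℕ} {a : (Fin n → ι) → ℝ} {J : Fin (n + n) → ι}
    (hJ : Function.Injective J) : offDiagSq a J = tensorSq a J := if_pos hJ

lemma offDiagSq_of_not_injective {n : ℕ} {a : (Fin n → ι) → ℝ} {J : Fin (n + n) → ι}
    (hJ : ¬ Function.Injective J) : offDiagSq a J = 0 := if_neg hJ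

lemma injective_comp_perm {n : ℕ} (J : Fin n → ι) (σ : Equiv.Perm (Fin n)) :
    Function.Injective (J ∘ σ) ↔ Function.Injective J :=
  ⟨fun h => by simpa [Function.comp_assoc] using h.comp σ.symm.injective,
    fun h => h.comp σ.injective⟩

lemma offDiagSq_rev {n : ℕ} {a : (Fin n → ι) → ℝ}
    (ha : ∀ (σ : Equiv.Perm (Fin n)) j, a (j ∘ σ) = a j) (J : Fin (n + n) → ι) :
    offDiagSq a (J ∘ Fin.rev) = offDiagSq a J := by
  have hsq : tensorSq a (J ∘ Fin.rev) = tensorSq a J := by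
    unfold tensorSq
    have h1 : (fun i => (J ∘ Fin.rev) (Fin.castAdd n i)) =
        (fun i => J (Fin.natAdd n i)) ∘ Fin.revPerm := by
      ext i
      simp only [Function.comp_apply, Fin.revPerm_apply]
      congr 1
      ext
      simp [Fin.val_rev]; omega
    have h2 : (fun i => (J ∘ Fin.rev) (Fin.natAdd n i)) =
        (fun i => J (Fin.castAdd n i)) ∘ Fin.revPerm := by
      ext i
      simp only [Function.comp_apply, Fin.revPerm_apply]
      congr 1
      ext
      simp [Fin.val_rev]; omega
    rw [h1, h2, ha, ha, mul_comm]
  have hinj : Function.Injective (J ∘ Fin.rev) ↔ Function.Injective J :=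
    injective_comp_perm J Fin.revPerm
  by_cases hJ : Function.Injective J
  · rw [offDiagSq_of_injective hJ, offDiagSq_of_injective (hinj.2 hJ), hsq]
  · rw [offDiagSq_of_not_injective hJ, offDiagSq_of_not_injective fun h => hJ (hinj.1 h)]

/-- Injectivity of a labelling is invariant under permutations, so the diagonal part never meets the
off-diagonal part. This makes the integral of `offDiagSq` behave as a projection of the square. -/
lemma tensorInner_offDiagSq_left (q : ℝ) {n : ℕ} (a : (Fin n → ι) → ℝ) :
    tensorInner q (offDiagSq a) (tensorSq a) = tensorInner q (offDiagSq a) (offDiagSq a) := by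
  unfold tensorInner
  refine Finset.sum_congr rfl fun σ _ => ?_
  congr 1
  refine Finset.sum_congr rfl fun J _ => ?_
  by_cases hJ : Function.Injective J
  · rw [offDiagSq_of_injective hJ]
  · rw [offDiagSq_of_not_injective fun h => hJ ((injective_comp_perm J σ).1 h), zero_mul, zero_mul]

lemma diagMass_eq {n : ℕ} (a : (Fin n → ι) → ℝ) :
    diagMass a = ∑ J : Fin (n + n) → ι, (tensorSq a J ^ 2 - offDiagSq a J ^ 2) := by
  unfold diagMass
  refine Finset.sum_congr rfl fun J _ => ?_
  by_cases hJ : Function.Injective J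
  · rw [if_pos hJ, offDiagSq_of_injective hJ, sub_self]
  · rw [if_neg hJ, offDiagSq_of_not_injective hJ]; unfold tensorSq; ring

lemma diagMass_nonneg {n : ℕ} (a : (Fin n → ι) → ℝ) : 0 ≤ diagMass a := by
  rw [diagMass_eq]
  refine Finset.sum_nonneg fun J _ => ?_
  by_cases hJ : Function.Injective J
  · rw [offDiagSq_of_injective hJ, sub_self]
  · rw [offDiagSq_of_not_injective hJ]; nlinarith [sq_nonneg (tensorSq a J)]

/-- For each permutation the diagonal terms are bounded by `2ab ≤ a² + b²`, hence by the diagonal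
mass. There are `(2n)!` permutations, with weights at most `1`. -/
lemma sub_le_tensorInner_offDiagSq {q : ℝ} (hq0 : 0 ≤ q) (hq1 : q ≤ 1) {n : ℕ}
    (a : (Fin n → ι) → ℝ) :
    tensorInner q (tensorSq a) (tensorSq a) - (n + n).factorial * diagMass a ≤
      tensorInner q (offDiagSq a) (offDiagSq a) := by
  have hD : ∀ σ : Equiv.Perm (Fin (n + n)),
      ∑ J, tensorSq a (J ∘ σ) * tensorSq a J ≤
        ∑ J, offDiagSq a (J ∘ σ) * offDiagSq a J + diagMass a := by
    intro σ
    have h1 : diagMass a = ∑ J : Fin (n + n) → ι,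
        (tensorSq a (J ∘ σ) ^ 2 - offDiagSq a (J ∘ σ) ^ 2) := by
      rw [diagMass_eq]
      symm
      refine Fintype.sum_equiv (Equiv.arrowCongr σ.symm (Equiv.refl ι)) _ _ fun J => ?_
      rfl
    have h2 : diagMass a = ∑ J : Fin (n + n) → ι,
        ((tensorSq a (J ∘ σ) ^ 2 - offDiagSq a (J ∘ σ) ^ 2) / 2 +
          (tensorSq a J ^ 2 - offDiagSq a J ^ 2) / 2) := by
      rw [Finset.sum_add_distrib, ← Finset.sum_div, ← Finset.sum_div, ← h1, ← diagMass_eq]; ring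
    rw [h2, ← Finset.sum_add_distrib]
    refine Finset.sum_le_sum fun J _ => ?_
    by_cases hJ : Function.Injective J
    · rw [offDiagSq_of_injective hJ, offDiagSq_of_injective ((injective_comp_perm J σ).2 hJ)]
      linarith
    · rw [offDiagSq_of_not_injective hJ,
        offDiagSq_of_not_injective fun h => hJ ((injective_comp_perm J σ).1 h)]
      nlinarith [sq_nonneg (tensorSq a (J ∘ σ) - tensorSq a J)]
  have hd0 := diagMass_nonneg a
  rw [sub_le_iff_le_add]
  unfold tensorInner
  have hcard : ((n + n).factorial : ℝ) * diagMass a =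
      ∑ σ : Equiv.Perm (Fin (n + n)), diagMass a := by
    rw [Finset.sum_const, Finset.card_univ, Fintype.card_perm, Fintype.card_fin, nsmul_eq_mul]
  rw [hcard, ← Finset.sum_add_distrib]
  refine Finset.sum_le_sum fun σ _ => ?_
  calc q ^ inv σ * ∑ J, tensorSq a (J ∘ σ) * tensorSq a J
      ≤ q ^ inv σ * (∑ J, offDiagSq a (J ∘ σ) * offDiagSq a J + diagMass a) :=
        mul_le_mul_of_nonneg_left (hD σ) (pow_nonneg hq0 _)
    _ ≤ _ := by
        rw [mul_add]
        exact add_le_add le_rfl (mul_le_of_le_one_left hd0 (pow_le_one₀ hq0 hq1))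

variable {H : Type*} [NormedAddCommGroup H] [InnerProductSpace ℂ H] [CompleteSpace H]
  {W : WStarProbabilitySpace H} {q : ℝ} {X : ℝ≥0 → W.Elem}

/-- A lower bound of the fourth moment of the integral of a symmetric tensor, by projection onto
the constants and the chaos of order `2n`. -/
lemma WStarProbabilitySpace.trace_fourth_ge {Y : ι → W.Elem} (hY : ∀ j, star (Y j) = Y j)
    (h : IsWick W.trace q Y kronecker) (hq0 : 0 ≤ q) (hq1 : q ≤ 1) {n : ℕ} (hn : 1 ≤ n)
    {a : (Fin n → ι) → ℝ} (ha : IsOffDiag a) :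
    tensorInner q a a ^ 2 + tensorInner q (tensorSq a) (tensorSq a) -
      (n + n).factorial * diagMass a ≤ (W.trace (tensorIntegral Y a ^ 4)).re := by
  set T := tensorIntegral Y a with hT
  set Z := tensorIntegral Y (offDiagSq a) with hZ
  set c := tensorInner q a a with hc
  have hinj : ∀ {m : ℕ} (j : Fin m → ι), Function.Injective j →
      ∀ x y, x < y → kronecker (j x) (j y) = 0 := fun j hj x y hxy =>
    if_neg fun h' => hxy.ne (hj h')
  have hrev : ∀ j, a (j ∘ Fin.rev) = a j := fun j => ha.symm Fin.revPerm j
  have hsT : star T = T := star_tensorIntegral hY hrev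
  have hsZ : star Z = Z := star_tensorIntegral hY (offDiagSq_rev ha.symm)
  have hS : T * T = tensorIntegral Y (tensorSq a) := tensorIntegral_mul_self Y a
  have t1 : W.trace (T * T) = (c : ℂ) := by
    rw [hT, h.two_tensors a a fun j hj => hinj j (by_contra fun h' => hj (ha.diag j h')),
      crossForm_kronecker_of_rev q hrev]
  have t2 : W.trace Z = 0 := h.trace_offDiag (by omega) fun j hj => offDiagSq_of_not_injective hj
  have hbZ : ∀ j, offDiagSq a j ≠ 0 → ∀ x y, x < y → kronecker (j x) (j y) = 0 := fun j hj =>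
    hinj j (by_contra fun h' => hj (offDiagSq_of_not_injective h'))
  have t3 : W.trace (Z * (T * T)) = (tensorInner q (offDiagSq a) (offDiagSq a) : ℂ) := by
    rw [hS, hZ, h.two_tensors _ _ hbZ, crossForm_kronecker_of_rev q (offDiagSq_rev ha.symm),
      tensorInner_offDiagSq_left]
  have t4 : W.trace (Z * Z) = (tensorInner q (offDiagSq a) (offDiagSq a) : ℂ) := by
    rw [hZ, h.two_tensors _ _ hbZ, crossForm_kronecker_of_rev q (offDiagSq_rev ha.symm)]
  have t5 : W.trace (T * T * Z) = (tensorInner q (offDiagSq a) (offDiagSq a) : ℂ) := by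
    rw [W.trace_comm, t3]
  -- Here `c` and `Z` are the components of `T²` along the constants and the chaos of order `2n`.
  -- Nonnegativity of the squared norm of the remainder gives `φ(T⁴) ≥ c² + φ(Z²)`.
  have hV := W.star_mul_nonneg (T * T - Z - (c : ℂ) • 1)
  have hsV : star (T * T - Z - (c : ℂ) • (1 : W.Elem)) = T * T - Z - (c : ℂ) • 1 := by
    rw [star_sub, star_sub, star_mul, hsT, hsZ, star_smul, star_one]
    congr 2
    exact Complex.conj_ofReal c
  rw [hsV] at hV
  have hexp : (T * T - Z - (c : ℂ) • (1 : W.Elem)) * (T * T - Z - (c : ℂ) • 1) =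
      T ^ 4 - T * T * Z - Z * (T * T) + Z * Z - (2 * c : ℂ) • (T * T) + (2 * c : ℂ) • Z +
        (c * c : ℂ) • 1 := by
    simp only [sub_mul, mul_sub, smul_mul_assoc, mul_smul_comm, one_mul, mul_one, smul_smul,
      two_mul, add_smul, pow_succ, pow_zero, mul_assoc, smul_sub]
    abel
  rw [hexp] at hV
  simp only [map_add, map_sub, map_smul, t1, t2, t3, t4, t5, W.trace_one, smul_eq_mul] at hV
  have := sub_le_tensorInner_offDiagSq hq0 hq1 a
  simp only [Complex.add_re, Complex.sub_re, Complex.mul_re, Complex.mul_im, Complex.ofReal_re,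
    Complex.ofReal_im, Complex.re_ofNat, Complex.im_ofNat, Complex.one_re, Complex.one_im,
    Complex.zero_re, Complex.zero_im] at hV
  nlinarith

end FourthMoment

/-! ### The fourth moment dominates the contractions -/

section FourthMomentBound

variable {H : Type*} [NormedAddCommGroup H] [InnerProductSpace ℂ H] [CompleteSpace H]
  {W : WStarProbabilitySpace H} {q : ℝ} {X : ℝ≥0 → W.Elem}

lemma IsQBrownianMotion.trace_tensors (hX : IsQBrownianMotion W q X) {M N : ℕ} (hM : 0 < M)
    {d : ℕ} (n : Fin d → ℕ) (A : Fin d → Multiset (Fin N) → ℝ) {r : ℕ} (i : Fin r → Fin d) :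
    W.trace (List.ofFn fun l =>
      tensorIntegral (gridFamily X M N) (symTensor (A (i l)) (n (i l)))).prod =
      (jointMoment q n A i : ℂ) :=
  (hX.isWick_grid hM N).tensors (fun l => n (i l)) fun l => symTensor (A (i l)) (n (i l))

/-- The fourth moment controls the contractions. -/
lemma IsQBrownianMotion.exists_contrSq_le (hX : IsQBrownianMotion W q X) (hq0 : 0 ≤ q)
    (hq1 : q ≤ 1) {n p : ℕ} (hp1 : 1 ≤ p) (hp2 : p < n) :
    ∃ δ > 0, ∃ K : ℝ, ∀ {M N : ℕ} (hM : 0 < M) (A : Multiset (Fin N) → ℝ)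
      (hA : ∀ s, A s ≠ 0 → s.Nodup),
      δ * contrSq A p (n - p) ≤
        (W.trace (tensorIntegral (gridFamily X M N) (symTensor A n) ^ 4)).re -
        (2 + q ^ n ^ 2) * tensorInner q (symTensor A n) (symTensor A n) ^ 2 +
        K * diagMass (symTensor A n) := by
  -- For `q > 0` the weight `q ^ k` of the extra permutation is positive and serves as `δ`. At `q =
  -- 0` it may be zero, and the noncrossing pairings are used instead, without diagonal error.
  rcases hq0.eq_or_lt with h0 | hpos
  · subst h0
    refine ⟨1, one_pos, 0, fun {M N} hM A hA => ?_⟩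
    have h1 := jointMoment_zero_ge (n := fun _ : Fin 1 => n) (fun _ => by omega) (fun _ => A)
      (fun _ => hA) 0 hp1 hp2
    have h2 := hX.trace_tensors hM (fun _ : Fin 1 => n) (fun _ => A) (fun _ : Fin 4 => 0)
    rw [List.ofFn_const, List.prod_replicate] at h2
    rw [h2, Complex.ofReal_re]
    linarith
  · obtain ⟨k, hk⟩ := tensorInner_tensorSq_ge hpos.le hp1 hp2
    refine ⟨q ^ k, pow_pos hpos k, (n + n).factorial, fun {M N} hM A hA => ?_⟩
    have h1 := W.trace_fourth_ge (gridFamily_isSelfAdjoint hX M N) (hX.isWick_grid hM N) hpos.le hq1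
      (by omega) (isOffDiag_symTensor hA n)
    have h2 := hk (Fin N) A
    linarith

end FourthMomentBound

/-! ### Transfer of scalar products and contractions to tensors -/

section Approximation

lemma exists_approximation {d : ℕ} {n : Fin d → ℕ} {f : (i : Fin d) → ℕ → (Fin (n i) → ℝ) → ℝ}
    (hf : ∀ i k, MemLp (f i k) 2 (orthant (n i))) (hsymm : ∀ i k, IsSymmetricKernel (f i k)) :
    ∃ (M : ℕ → ℕ) (A : ∀ k, Fin d → Multiset (Fin (M k * M k)) → ℝ), (∀ k, 0 < M k) ∧
      (∀ k i s, A k i s ≠ 0 → s.Nodup) ∧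
      (∀ i k, l2norm (orthant (n i)) (fun t => f i k t - stepFun (M k) (symTensor (A k i) (n i)) t)
        ≤ 1 / ((k : ℝ) + 1)) ∧
      ∀ i k, diagMass (symTensor (A k i) (n i)) ≤ 1 / ((k : ℝ) + 1) := by
  have h : ∀ k : ℕ, ∃ M, 0 < M ∧ ∀ i, ∃ A : Multiset (Fin (M * M)) → ℝ, (∀ s, A s ≠ 0 → s.Nodup) ∧
      l2norm (orthant (n i)) (fun t => f i k t - stepFun M (symTensor A (n i)) t)
        ≤ 1 / ((k : ℝ) + 1) ∧ diagMass (symTensor A (n i)) ≤ 1 / ((k : ℝ) + 1) := fun k =>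
    ((eventually_gt_atTop 0).and (eventually_all.2 fun i =>
      eventually_exists_symTensor (hf i k) (hsymm i k) Nat.one_div_pos_of_nat)).exists
  choose M hM A hA using h
  exact ⟨M, A, hM, fun k i => (hA k i).1, fun i k => (hA k i).2.1, fun i k => (hA k i).2.2⟩

lemma memLp_comp_cast {m m' : ℕ} (h : m = m') {g : (Fin m' → ℝ) → ℝ}
    (hg : MemLp g 2 (orthant m')) :
    MemLp (fun t : Fin m → ℝ => g (t ∘ Fin.cast h.symm)) 2 (orthant m) := by
  subst h; exact hg

lemma l2norm_comp_cast_sub {m m' M N : ℕ} (h : m = m') (g : (Fin m' → ℝ) → ℝ)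
    (A : Multiset (Fin N) → ℝ) :
    l2norm (orthant m) (fun t => g (t ∘ Fin.cast h.symm) - stepFun M (symTensor A m) t) =
      l2norm (orthant m') (fun t => g t - stepFun M (symTensor A m') t) := by
  subst h; rfl

variable {d : ℕ} {n : Fin d → ℕ} {f : (i : Fin d) → ℕ → (Fin (n i) → ℝ) → ℝ} {q : ℝ}
  {c : Fin d → Fin d → ℝ} {M : ℕ → ℕ} {A : ∀ k, Fin d → Multiset (Fin (M k * M k)) → ℝ}

lemma l2norm_stepFun_symTensor_sq_le {M N n : ℕ} (hM : 0 < M) (hq0 : 0 ≤ q)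
    (A : Multiset (Fin N) → ℝ) :
    l2norm (orthant n) (stepFun M (symTensor A n)) ^ 2 ≤
      tensorInner q (symTensor A n) (symTensor A n) := by
  rw [l2norm_stepFun_sq hM]
  exact nrmSq_le_tensorInner hq0 A n

/-- Only the values of the form at the kernels are known to be bounded, while the bound of the `L²`
norm by the form is available for tensors. Comparing the two forms costs a term linear in the
unknown norm, so a quadratic inequality closes the estimate. -/
lemma exists_l2norm_le (hq0 : 0 ≤ q) (hq1 : q ≤ 1)
    (hf : ∀ i k, MemLp (f i k) 2 (orthant (n i)))
    (hc : ∀ i j, ∀ h : n i = n j,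
      Tendsto (fun k => qInner q (f i k) (fun t => f j k (t ∘ Fin.cast h.symm)))
        atTop (𝓝 (c i j))) (hM : ∀ k, 0 < M k)
    (hfA : ∀ i k, l2norm (orthant (n i))
      (fun t => f i k t - stepFun (M k) (symTensor (A k i) (n i)) t) ≤ 1 / ((k : ℝ) + 1))
    (i : Fin d) : ∃ B, ∀ k, l2norm (orthant (n i)) (f i k) ≤ B ∧
      l2norm (orthant (n i)) (stepFun (M k) (symTensor (A k i) (n i))) ≤ B := by
  obtain ⟨C, hC⟩ := (hc i i rfl).bddAbove_range
  set F : ℝ := ((n i).factorial : ℝ) with hF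
  have hF0 : 0 ≤ F := Nat.cast_nonneg _
  -- The inequality `G² ≤ C + F (2G + 1)` reads `(G - F)² ≤ C + F + F²`. The final `1` bounds the
  -- error between kernel and step function.
  refine ⟨F + Real.sqrt (C + F + F ^ 2) + 1, fun k => ?_⟩
  set g := stepFun (M k) (symTensor (A k i) (n i)) with hg
  have hgm : MemLp g 2 (orthant (n i)) := memLp_stepFun (hM k) _
  have hε : l2norm (orthant (n i)) (fun t => f i k t - g t) ≤ 1 :=
    (hfA i k).trans ((div_le_one (by positivity)).2 (by linarith [Nat.cast_nonneg (α := ℝ) k]))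
  have hε0 := l2norm_nonneg (μ := orthant (n i)) (fun t => f i k t - g t)
  have h1 := l2norm_le_of_sub (hf i k) hgm
  have h2 := abs_qInner_sub_le hq0 hq1 hgm (hf i k) hgm (hf i k)
  rw [l2norm_sub_comm] at h2
  have h3 : qInner q (f i k) (f i k) ≤ C := hC (Set.mem_range_self k)
  have h4 : l2norm (orthant (n i)) g ^ 2 ≤ qInner q g g := by
    rw [hg, qInner_stepFun (hM k)]
    exact l2norm_stepFun_symTensor_sq_le (hM k) hq0 _
  have hg0 := l2norm_nonneg (μ := orthant (n i)) g
  have hf0 := l2norm_nonneg (μ := orthant (n i)) (f i k)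
  have h5 := (le_abs_self _).trans h2
  generalize l2norm (orthant (n i)) g = G at *
  generalize l2norm (orthant (n i)) (f i k) = P at *
  generalize l2norm (orthant (n i)) (fun t => f i k t - g t) = ε at *
  have h6 : ε * G + P * ε ≤ 2 * G + 1 := by nlinarith
  have h7 : G ^ 2 ≤ C + F * (2 * G + 1) := by
    have := mul_le_mul_of_nonneg_left h6 hF0
    linarith
  have h8 : G ≤ F + Real.sqrt (C + F + F ^ 2) := by
    have : G - F ≤ Real.sqrt (C + F + F ^ 2) := by
      apply Real.le_sqrt_of_sq_le
      nlinarith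
    linarith
  exact ⟨by linarith, by linarith⟩

lemma tendsto_one_div_mul {B : ℝ} :
    Tendsto (fun k : ℕ => 1 / ((k : ℝ) + 1) * B) atTop (𝓝 0) := by
  simpa using tendsto_one_div_add_atTop_nhds_zero_nat.mul_const B

lemma tendsto_tensorInner (hq0 : 0 ≤ q) (hq1 : q ≤ 1)
    (hf : ∀ i k, MemLp (f i k) 2 (orthant (n i)))
    (hc : ∀ i j, ∀ h : n i = n j,
      Tendsto (fun k => qInner q (f i k) (fun t => f j k (t ∘ Fin.cast h.symm)))
        atTop (𝓝 (c i j))) (hM : ∀ k, 0 < M k)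
    (hfA : ∀ i k, l2norm (orthant (n i))
      (fun t => f i k t - stepFun (M k) (symTensor (A k i) (n i)) t) ≤ 1 / ((k : ℝ) + 1))
    (i j : Fin d) (h : n i = n j) :
    Tendsto (fun k => tensorInner q (symTensor (A k i) (n i)) (symTensor (A k j) (n i)))
      atTop (𝓝 (c i j)) := by
  obtain ⟨B, hB⟩ := exists_l2norm_le hq0 hq1 hf hc hM hfA i
  obtain ⟨B', hB'⟩ := exists_l2norm_le hq0 hq1 hf hc hM hfA j
  refine (hc i j h).congr_dist ?_
  refine squeeze_zero (fun k => dist_nonneg) (fun k => ?_)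
    (tendsto_one_div_mul (B := (n i).factorial * (B' + 1 + B)))
  rw [Real.dist_eq, ← qInner_stepFun (hM k)]
  refine (abs_qInner_sub_le hq0 hq1 (hf i k) (memLp_stepFun (hM k) _)
    (memLp_comp_cast h (hf j k)) (memLp_stepFun (hM k) _)).trans ?_
  rw [l2norm_comp_cast_sub h (f j k)]
  have h1 := hfA i k
  have h2 := hfA j k
  have h3 : l2norm (orthant (n i)) (fun t => f j k (t ∘ Fin.cast h.symm)) ≤ B' + 1 := by
    have e1 := l2norm_le_of_sub (memLp_comp_cast h (hf j k))
      (memLp_stepFun (hM k) (symTensor (A k j) (n i)))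
    have e2 : l2norm (orthant (n i)) (stepFun (M k) (symTensor (A k j) (n i))) ≤ B' := by
      rw [h]; exact (hB' k).2
    rw [l2norm_comp_cast_sub h (f j k)] at e1
    have e3 : 1 / ((k : ℝ) + 1) ≤ 1 :=
      (div_le_one (by positivity)).2 (by linarith [Nat.cast_nonneg (α := ℝ) k])
    linarith
  have hk : 0 ≤ 1 / ((k : ℝ) + 1) := by positivity
  calc _ ≤ ((n i).factorial : ℝ) * (1 / ((k : ℝ) + 1) * (B' + 1) + B * (1 / ((k : ℝ) + 1))) := by
        refine mul_le_mul_of_nonneg_left (add_le_add ?_ ?_) (Nat.cast_nonneg _)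
        · exact mul_le_mul h1 h3 (l2norm_nonneg _) hk
        · exact mul_le_mul (hB k).2 h2 (l2norm_nonneg _) ((l2norm_nonneg _).trans (hB k).1)
    _ = _ := by ring

/-- The contraction is quadratic and continuous, so on bounded sequences it moves by at most a
constant times the approximation error. On step functions its squared norm is exactly `contrSq`. -/
lemma tendsto_contraction_iff (hq0 : 0 ≤ q) (hq1 : q ≤ 1)
    (hf : ∀ i k, MemLp (f i k) 2 (orthant (n i)))
    (hc : ∀ i j, ∀ h : n i = n j,
      Tendsto (fun k => qInner q (f i k) (fun t => f j k (t ∘ Fin.cast h.symm)))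
        atTop (𝓝 (c i j))) (hM : ∀ k, 0 < M k)
    (hfA : ∀ i k, l2norm (orthant (n i))
      (fun t => f i k t - stepFun (M k) (symTensor (A k i) (n i)) t) ≤ 1 / ((k : ℝ) + 1))
    (i : Fin d) {p : ℕ} (hp : p ≤ n i) :
    Tendsto (fun k => eLpNorm (contraction p hp hp (f i k) (f i k)) 2
      (orthant ((n i - p) + (n i - p)))) atTop (𝓝 0) ↔
    Tendsto (fun k => contrSq (A k i) p (n i - p)) atTop (𝓝 0) := by
  obtain ⟨B, hB⟩ := exists_l2norm_le hq0 hq1 hf hc hM hfA i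
  have hmem : ∀ k, MemLp (contraction p hp hp (f i k) (f i k)) 2 (orthant ((n i - p) + (n i - p))) :=
    fun k => memLp_contraction hp hp (hf i k) (hf i k)
  let g : ℕ → (Fin (n i) → ℝ) → ℝ := fun k => stepFun (M k) (symTensor (A k i) (n i))
  have hg : ∀ k, MemLp (g k) 2 (orthant (n i)) := fun k => memLp_stepFun (hM k) _
  have hmem' : ∀ k, MemLp (contraction p hp hp (g k) (g k)) 2 (orthant ((n i - p) + (n i - p))) :=
    fun k => memLp_contraction hp hp (hg k) (hg k)
  have e1 : Tendsto (fun k => eLpNorm (contraction p hp hp (f i k) (f i k)) 2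
      (orthant ((n i - p) + (n i - p)))) atTop (𝓝 0) ↔
      Tendsto (fun k => l2norm (orthant ((n i - p) + (n i - p)))
        (contraction p hp hp (f i k) (f i k))) atTop (𝓝 0) := by
    unfold l2norm
    rw [← ENNReal.tendsto_toReal_iff (fun k => (hmem k).2.ne) ENNReal.zero_ne_top,
      ENNReal.toReal_zero]
  have e2 : Tendsto (fun k => contrSq (A k i) p (n i - p)) atTop (𝓝 0) ↔
      Tendsto (fun k => l2norm (orthant ((n i - p) + (n i - p)))
        (contraction p hp hp (g k) (g k))) atTop (𝓝 0) := by
    simp_rw [← fun k => l2norm_contraction_stepFun_sq (hM k) hp (A k i)]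
    constructor
    · intro h
      have := (Real.continuous_sqrt.tendsto _).comp h
      rw [Real.sqrt_zero] at this
      exact this.congr fun k => Real.sqrt_sq (l2norm_nonneg _)
    · intro h
      have := h.pow 2
      rwa [zero_pow two_ne_zero] at this
  rw [e1, e2]
  have hdist : Tendsto (fun k => dist
      (l2norm (orthant ((n i - p) + (n i - p))) (contraction p hp hp (f i k) (f i k)))
      (l2norm (orthant ((n i - p) + (n i - p))) (contraction p hp hp (g k) (g k)))) atTop (𝓝 0) := by
    refine squeeze_zero (fun k => dist_nonneg) (fun k => ?_) (tendsto_one_div_mul (B := B + B))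
    rw [Real.dist_eq]
    have h1 := l2norm_le_of_sub (hmem k) (hmem' k)
    have h2 := l2norm_le_of_sub (hmem' k) (hmem k)
    rw [l2norm_sub_comm] at h2
    have h3 := l2norm_contraction_sub_le hp (hf i k) (hg k)
    have h4 : l2norm (orthant (n i)) (fun t => f i k t - g k t) *
        (l2norm (orthant (n i)) (f i k) + l2norm (orthant (n i)) (g k)) ≤
        1 / ((k : ℝ) + 1) * (B + B) :=
      mul_le_mul (hfA i k) (add_le_add (hB k).1 (hB k).2)
        (add_nonneg (l2norm_nonneg _) (l2norm_nonneg _)) (by positivity)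
    rw [abs_le]
    constructor <;> linarith
  exact ⟨fun h => h.congr_dist hdist,
    fun h => h.congr_dist (by simpa only [dist_comm] using hdist)⟩

end Approximation

/-! ### Products of asymptotically equal bounded sequences -/

section Products

lemma tendsto_prod_sub {R : Type*} [NormedRing R] {r : ℕ} {U V : Fin r → ℕ → R}
    (hUV : ∀ l, Tendsto (fun k => U l k - V l k) atTop (𝓝 0))
    (hV : ∀ l, ∃ B, ∀ k, ‖V l k‖ ≤ B) :
    Tendsto (fun k => (List.ofFn fun l => U l k).prod - (List.ofFn fun l => V l k).prod)
      atTop (𝓝 0) ∧ ∃ B, ∀ k, ‖(List.ofFn fun l => V l k).prod‖ ≤ B := by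
  induction r with
  | zero => exact ⟨by simp, ‖(1 : R)‖, fun k => by simp⟩
  | succ r ih =>
    obtain ⟨h1, B, hB⟩ := ih (fun l => hUV l.succ) (fun l => hV l.succ)
    obtain ⟨B0, hB0⟩ := hV 0
    simp only [List.ofFn_succ, List.prod_cons]
    refine ⟨?_, B0 * B, fun k => (norm_mul_le _ _).trans
      (mul_le_mul (hB0 k) (hB k) (norm_nonneg _) ((norm_nonneg _).trans (hB0 k)))⟩
    -- The expansion `uu' - vv' = (u-v)(u'-v') + (u-v)v' + v(u'-v')` uses bounds on the sequences
    -- `V` only.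
    have h2 : ∀ k, U 0 k * (List.ofFn fun l : Fin r => U l.succ k).prod -
        V 0 k * (List.ofFn fun l : Fin r => V l.succ k).prod =
        (U 0 k - V 0 k) * ((List.ofFn fun l : Fin r => U l.succ k).prod -
          (List.ofFn fun l : Fin r => V l.succ k).prod) +
        (U 0 k - V 0 k) * (List.ofFn fun l : Fin r => V l.succ k).prod +
        V 0 k * ((List.ofFn fun l : Fin r => U l.succ k).prod -
          (List.ofFn fun l : Fin r => V l.succ k).prod) := fun k => by noncomm_ring
    simp_rw [h2]
    have t1 := (hUV 0).mul h1
    rw [mul_zero] at t1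
    have t2 : Tendsto (fun k => (U 0 k - V 0 k) *
        (List.ofFn fun l : Fin r => V l.succ k).prod) atTop (𝓝 0) := by
      refine squeeze_zero_norm (fun k => (norm_mul_le _ _).trans
        (mul_le_mul_of_nonneg_left (hB k) (norm_nonneg _))) ?_
      simpa using (hUV 0).norm.mul_const B
    have t3 : Tendsto (fun k => V 0 k * ((List.ofFn fun l : Fin r => U l.succ k).prod -
        (List.ofFn fun l : Fin r => V l.succ k).prod)) atTop (𝓝 0) := by
      refine squeeze_zero_norm (fun k => (norm_mul_le _ _).trans
        (mul_le_mul_of_nonneg_right (hB0 k) (norm_nonneg _))) ?_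
      simpa using h1.norm.const_mul B0
    simpa using (t1.add t2).add t3

end Products

/-! ### Transfer of moments to tensors -/

section Transfer

variable {H : Type*} [NormedAddCommGroup H] [InnerProductSpace ℂ H] [CompleteSpace H]
  {W : WStarProbabilitySpace H} {q : ℝ} {X : ℝ≥0 → W.Elem}
  {d : ℕ} {n : Fin d → ℕ} {f : (i : Fin d) → ℕ → (Fin (n i) → ℝ) → ℝ}
  {c : Fin d → Fin d → ℝ} {M : ℕ → ℕ} {A : ∀ k, Fin d → Multiset (Fin (M k * M k)) → ℝ}

lemma isSelfAdjoint_of_tendsto {R : Type*} [NormedRing R] [StarRing R] [NormedStarGroup R]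
    {T : ℕ → R} {Y : R} (hT : ∀ k, IsSelfAdjoint (T k)) (h : Tendsto T atTop (𝓝 Y)) :
    IsSelfAdjoint Y :=
  tendsto_nhds_unique (h.star.congr fun k => (hT k).star_eq) h

lemma IsQBrownianMotion.multipleIntegral_isSelfAdjoint (hX : IsQBrownianMotion W q X)
    (hq0 : 0 ≤ q) (hq1 : q ≤ 1) {n : ℕ} {f : (Fin n → ℝ) → ℝ} (hf : MemLp f 2 (orthant n))
    (hsymm : IsSymmetricKernel f) : IsSelfAdjoint (multipleIntegral X f) := by
  obtain ⟨M, A, hM, hA, hfA, -⟩ := exists_approximation (d := 1) (n := fun _ => n)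
    (f := fun _ _ => f) (fun _ _ => hf) (fun _ _ => hsymm)
  refine isSelfAdjoint_of_tendsto (T := fun k => tensorIntegral (gridFamily X (M k) (M k * M k))
    (symTensor (A k 0) n)) (fun k => tensorIntegral_isSelfAdjoint
      (gridFamily_isSelfAdjoint hX _ _) _ _) ?_
  rw [tendsto_iff_norm_sub_tendsto_zero]
  refine squeeze_zero (fun k => norm_nonneg _) (fun k => ?_)
    (tendsto_one_div_mul (B := ‖X 1‖ ^ n))
  rw [norm_sub_rev, mul_comm (1 / ((k : ℝ) + 1))]
  exact ((hX.exists_multipleIntegral hq0 hq1 hf hsymm).2 (hM k)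
    (isOffDiag_symTensor (hA k 0) n)).trans
    (mul_le_mul_of_nonneg_left (hfA 0 k) (pow_nonneg (norm_nonneg _) _))

lemma IsQBrownianMotion.tendsto_multipleIntegral_sub (hX : IsQBrownianMotion W q X)
    (hq0 : 0 ≤ q) (hq1 : q ≤ 1) (hf : ∀ i k, MemLp (f i k) 2 (orthant (n i)))
    (hsymm : ∀ i k, IsSymmetricKernel (f i k)) (hM : ∀ k, 0 < M k)
    (hA : ∀ k i s, A k i s ≠ 0 → s.Nodup)
    (hfA : ∀ i k, l2norm (orthant (n i))
      (fun t => f i k t - stepFun (M k) (symTensor (A k i) (n i)) t) ≤ 1 / ((k : ℝ) + 1))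
    (i : Fin d) :
    Tendsto (fun k => multipleIntegral X (f i k) -
      tensorIntegral (gridFamily X (M k) (M k * M k)) (symTensor (A k i) (n i))) atTop (𝓝 0) := by
  refine squeeze_zero_norm (fun k => ?_) (tendsto_one_div_mul (B := ‖X 1‖ ^ n i))
  rw [mul_comm (1 / ((k : ℝ) + 1))]
  exact ((hX.exists_multipleIntegral hq0 hq1 (hf i k) (hsymm i k)).2 (hM k)
    (isOffDiag_symTensor (hA k i) (n i))).trans
    (mul_le_mul_of_nonneg_left (hfA i k) (pow_nonneg (norm_nonneg _) _))

lemma IsQBrownianMotion.exists_norm_tensorIntegral_le (hX : IsQBrownianMotion W q X)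
    (hq0 : 0 ≤ q) (hM : ∀ k, 0 < M k) (hA : ∀ k i s, A k i s ≠ 0 → s.Nodup) {i : Fin d} {v : ℝ}
    (hv : Tendsto (fun k => tensorInner q (symTensor (A k i) (n i)) (symTensor (A k i) (n i)))
      atTop (𝓝 v)) :
    ∃ B, ∀ k, ‖tensorIntegral (gridFamily X (M k) (M k * M k)) (symTensor (A k i) (n i))‖ ≤ B := by
  obtain ⟨C, hC⟩ := hv.bddAbove_range
  refine ⟨‖X 1‖ ^ n i * Real.sqrt C, fun k => ?_⟩
  refine (hX.norm_tensorIntegral_le hq0 (hM k) (Nat.mul_pos (hM k) (hM k)) (hA k i) (n i)).trans ?_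
  exact mul_le_mul_of_nonneg_left (Real.sqrt_le_sqrt
    ((nrmSq_le_tensorInner hq0 _ _).trans (hC (Set.mem_range_self k))))
    (pow_nonneg (norm_nonneg _) _)

/-- The joint moments of the integrals and of their approximations have the same limits. -/
lemma IsQBrownianMotion.tendsto_trace_sub (hX : IsQBrownianMotion W q X)
    (hq0 : 0 ≤ q) (hq1 : q ≤ 1) (hf : ∀ i k, MemLp (f i k) 2 (orthant (n i)))
    (hsymm : ∀ i k, IsSymmetricKernel (f i k)) (hM : ∀ k, 0 < M k)
    (hA : ∀ k i s, A k i s ≠ 0 → s.Nodup)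
    (hfA : ∀ i k, l2norm (orthant (n i))
      (fun t => f i k t - stepFun (M k) (symTensor (A k i) (n i)) t) ≤ 1 / ((k : ℝ) + 1))
    (hv : ∀ i, Tendsto (fun k => tensorInner q (symTensor (A k i) (n i)) (symTensor (A k i) (n i)))
      atTop (𝓝 (c i i))) {r : ℕ} (i : Fin r → Fin d) :
    Tendsto (fun k => W.trace (List.ofFn fun l => multipleIntegral X (f (i l) k)).prod -
      (jointMoment q n (A k) i : ℂ)) atTop (𝓝 0) := by
  obtain ⟨h, -⟩ := tendsto_prod_sub (U := fun l k => multipleIntegral X (f (i l) k))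
    (V := fun l k => tensorIntegral (gridFamily X (M k) (M k * M k))
      (symTensor (A k (i l)) (n (i l))))
    (fun l => hX.tendsto_multipleIntegral_sub hq0 hq1 hf hsymm hM hA hfA (i l))
    (fun l => hX.exists_norm_tensorIntegral_le hq0 hM hA (hv (i l)))
  refine squeeze_zero_norm (fun k => ?_) (tendsto_zero_iff_norm_tendsto_zero.1 h)
  rw [← hX.trace_tensors (hM k), ← map_sub]
  exact W.isFaithfulState.norm_le _

end Transfer

/-! ### Existence of the limit law -/

section Laws

variable {H : Type*} [NormedAddCommGroup H] [InnerProductSpace ℂ H] [CompleteSpace H]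
  {W : WStarProbabilitySpace H}

lemma colouredMoment_const (q v : ℝ) (N r : ℕ) :
    colouredMoment q (fun _ : Fin r => N) (fun _ _ => v) =
      v ^ (r / 2) * ∑ π : Pairing r, (q ^ N ^ 2) ^ π.cr := colouredSum_const q v N

lemma tendsto_norm_bound {R : Type*} [SeminormedAddCommGroup R] {U V : ℕ → R}
    (hUV : Tendsto (fun k => U k - V k) atTop (𝓝 0)) (hV : ∃ B, ∀ k, ‖V k‖ ≤ B) :
    ∃ B, ∀ k, ‖U k‖ ≤ B := by
  obtain ⟨B, hB⟩ := hV
  obtain ⟨C, hC⟩ := hUV.norm.bddAbove_range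
  refine ⟨C + B, fun k => ?_⟩
  calc ‖U k‖ = ‖(U k - V k) + V k‖ := by rw [sub_add_cancel]
    _ ≤ ‖U k - V k‖ + ‖V k‖ := norm_add_le _ _
    _ ≤ C + B := add_le_add (hC (Set.mem_range_self k)) (hB k)

/-- A bounded sequence of self-adjoint elements with `q`-Gaussian limit moments converges in
law. -/
lemma WStarProbabilitySpace.exists_isQGaussian (W : WStarProbabilitySpace H) {Y : ℕ → W.Elem}
    (hY : ∀ k, IsSelfAdjoint (Y k)) {B : ℝ} (hB : ∀ k, ‖Y k‖ ≤ B) {Q v : ℝ}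
    (hm : ∀ r, 1 ≤ r → Tendsto (fun k => W.trace (Y k ^ r)) atTop
      (𝓝 ((v ^ (r / 2) * ∑ π : Pairing r, Q ^ π.cr : ℝ) : ℂ))) :
    ∃ ν : Measure ℝ, IsQGaussian Q v ν ∧ ConvergesInLaw W Y ν := by
  -- Convergence is assumed for `1 ≤ r`; the moment of order zero must be supplied to obtain a
  -- probability measure.
  have hzero : v ^ (0 / 2) * ∑ π : Pairing 0, Q ^ π.cr = 1 := by
    have hu : (Finset.univ : Finset (Pairing 0)).card = 1 := by decide +kernel
    have hcr : ∀ π : Pairing 0, π.cr = 0 := by decide +kernel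
    simp [hcr, hu]
  obtain ⟨ν, hν, hsupp, hmom⟩ := W.isFaithfulState.exists_measure_of_tendsto_moments hY hB
    (m := fun r => v ^ (r / 2) * ∑ π : Pairing r, Q ^ π.cr) (by
      intro r
      rcases Nat.eq_zero_or_pos r with rfl | hr
      · simp only [pow_zero, W.trace_one, Complex.one_re]
        rw [show v ^ (0 / 2) * ∑ π : Pairing 0, Q ^ π.cr = 1 from hzero]
        exact tendsto_const_nhds
      · exact (Complex.continuous_re.tendsto _).comp (hm r hr))
  refine ⟨ν, ⟨hν, ⟨B, hsupp⟩, fun k => ?_, fun k => ?_⟩, fun r hr => ?_⟩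
  · have := isEmpty_pairing_odd k
    rw [hmom, Finset.univ_eq_empty, Finset.sum_empty, mul_zero]
  · rw [hmom, Nat.mul_div_cancel_left k two_pos]
  · rw [hmom]; exact hm r hr

end Laws

end QChaos

end

/-! ### The equivalence -/

theorem theorem3p1 {H : Type*} [NormedAddCommGroup H] [InnerProductSpace ℂ H] [CompleteSpace H]
    (W : QChaos.WStarProbabilitySpace H) (q : ℝ) (hq0 : 0 ≤ q) (hq1 : q < 1)
    (X : ℝ≥0 → W.Elem) (hX : QChaos.IsQBrownianMotion W q X)
    (d : ℕ) (n : Fin d → ℕ) (hn : ∀ i, 1 ≤ n i)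
    (f : (i : Fin d) → ℕ → (Fin (n i) → ℝ) → ℝ)
    (hf : ∀ i k, MemLp (f i k) 2 (QChaos.orthant (n i)))
    (hsymm : ∀ i k, QChaos.IsSymmetricKernel (f i k))
    (c : Fin d → Fin d → ℝ)
    (hc : ∀ i j, ∀ h : n i = n j,
      Tendsto (fun k => QChaos.qInner q (f i k) (fun t => f j k (t ∘ Fin.cast h.symm)))
        atTop (𝓝 (c i j))) :
    (∀ i k, QChaos.IsMultipleIntegral X (f i k) (QChaos.multipleIntegral X (f i k))) ∧
    List.TFAE [
      (∀ i, Tendsto (fun k => W.trace (QChaos.multipleIntegral X (f i k) ^ 4)) atTop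
        (𝓝 (((2 + q ^ (n i ^ 2)) * c i i ^ 2 : ℝ) : ℂ))),
      (∀ i, ∀ p, 1 ≤ p → ∀ hp : p < n i,
        Tendsto (fun k => eLpNorm (QChaos.contraction p hp.le hp.le (f i k) (f i k)) 2
          (QChaos.orthant ((n i - p) + (n i - p)))) atTop (𝓝 0)),
      (∀ i, ∃ ν : Measure ℝ, QChaos.IsQGaussian (q ^ (n i ^ 2)) (c i i) ν ∧
        QChaos.ConvergesInLaw W (fun k => QChaos.multipleIntegral X (f i k)) ν),
      (∀ r, 1 ≤ r → ∀ i : Fin r → Fin d,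
        Tendsto
          (fun k => W.trace (List.ofFn fun l => QChaos.multipleIntegral X (f (i l) k)).prod) atTop
          (𝓝 ((QChaos.colouredMoment q (fun l => n (i l)) (fun l m => c (i l) (i m)) : ℝ) : ℂ)))
    ] := by
  have hq1' := hq1.le
  obtain ⟨M, A, hM, hA, hfA, hdiag⟩ := QChaos.exists_approximation hf hsymm
  have hinner := fun i j h => QChaos.tendsto_tensorInner hq0 hq1' hf hc hM hfA i j h
  have hcontr := fun i p (hp : p ≤ n i) =>
    QChaos.tendsto_contraction_iff hq0 hq1' hf hc hM hfA i hp
  have htrace : ∀ {r : ℕ} (i : Fin r → Fin d), Tendsto (fun k =>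
      W.trace (List.ofFn fun l => QChaos.multipleIntegral X (f (i l) k)).prod -
        (QChaos.jointMoment q n (A k) i : ℂ)) atTop (𝓝 0) := fun i =>
    hX.tendsto_trace_sub hq0 hq1' hf hsymm hM hA hfA (fun i => hinner i i rfl) i
  have hpow : ∀ i k r, W.trace (QChaos.multipleIntegral X (f i k) ^ r) =
      W.trace (List.ofFn fun _ : Fin r => QChaos.multipleIntegral X (f i k)).prod := fun i k r => by
    rw [List.ofFn_const, List.prod_replicate]
  refine ⟨fun i k => (hX.exists_multipleIntegral hq0 hq1' (hf i k) (hsymm i k)).1, ?_⟩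
  tfae_have 2 → 4 := by
    intro h r _ i
    have : ∀ k, Nonempty (Fin (M k * M k)) := fun k =>
      ⟨⟨0, Nat.mul_pos (hM k) (hM k)⟩⟩
    have h1 := QChaos.tendsto_jointMoment hq0 hn A hA hinner
      (fun i p hp1 hp2 => (hcontr i p hp2.le).1 (h i p hp1 hp2)) i
    have h2 := (htrace i).add ((Complex.continuous_ofReal.tendsto _).comp h1)
    rw [zero_add] at h2
    exact h2.congr fun k => sub_add_cancel _ _
  tfae_have 4 → 3 := by
    intro h i
    -- The existence of a compactly supported limit law needs a uniform operator norm bound, which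
    -- the approximating tensors provide.
    obtain ⟨B, hB⟩ := QChaos.tendsto_norm_bound
      (hX.tendsto_multipleIntegral_sub hq0 hq1' hf hsymm hM hA hfA i)
      (hX.exists_norm_tensorIntegral_le hq0 hM hA (hinner i i rfl))
    refine W.exists_isQGaussian
      (fun k => hX.multipleIntegral_isSelfAdjoint hq0 hq1' (hf i k) (hsymm i k)) hB
      fun r hr => ?_
    rw [← QChaos.colouredMoment_const]
    simp_rw [hpow]
    -- A constant word turns the joint moments into the moments of one sequence.
    exact h r hr fun _ => i
  tfae_have 3 → 1 := by
    intro h i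
    obtain ⟨ν, hν, hlaw⟩ := h i
    have h1 := hlaw 4 (by norm_num)
    rw [hν.even_moments 2, QChaos.sum_pairing_four, mul_comm] at h1
    exact h1
  tfae_have 1 → 2 := by
    intro h i p hp1 hp
    rw [hcontr i p hp.le]
    obtain ⟨δ, hδ, K, hK⟩ := hX.exists_contrSq_le hq0 hq1' hp1 hp
    have h1 := htrace fun _ : Fin 4 => i
    have h2 : Tendsto (fun k => QChaos.jointMoment q n (A k) fun _ : Fin 4 => i) atTop
        (𝓝 ((2 + q ^ (n i ^ 2)) * c i i ^ 2)) := by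
      have h3 := (Complex.continuous_re.tendsto _).comp ((h i).sub h1)
      rw [sub_zero, Complex.ofReal_re] at h3
      refine h3.congr fun k => ?_
      rw [Function.comp_apply, hpow, sub_sub_cancel, Complex.ofReal_re]
    have h4 : Tendsto (fun k => QChaos.diagMass (QChaos.symTensor (A k i) (n i))) atTop (𝓝 0) :=
      squeeze_zero (fun k => QChaos.diagMass_nonneg _) (hdiag i)
        tendsto_one_div_add_atTop_nhds_zero_nat
    -- The excess of the fourth moment over `2 + q ^ n²` times the squared variance tends to zero,
    -- and so does the diagonal mass; together they dominate `δ` times the contraction.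
    have h5 := ((h2.sub (((hinner i i rfl).pow 2).const_mul (2 + q ^ (n i ^ 2)))).add
      (h4.const_mul K)).const_mul δ⁻¹
    rw [sub_self, mul_zero, add_zero, mul_zero] at h5
    refine squeeze_zero (fun k => QChaos.contrSq_nonneg _ _ _) (fun k => ?_) h5
    rw [← div_eq_inv_mul, le_div_iff₀' hδ]
    have h6 := hK (hM k) (A k i) (hA k i)
    have h7 := hX.trace_tensors (hM k) n (A k) fun _ : Fin 4 => i
    rw [List.ofFn_const, List.prod_replicate] at h7
    rw [h7, Complex.ofReal_re] at h6
    exact h6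
  tfae_finish
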